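/- Let $L>0$ and $0\le s\le \tfrac12$. All functions are real valued; $\mathbb T=\mathbb R/L\mathbb Z$ carries the normalized Lebesgue measure, $\xi_k=2\pi k/L$ for $k\in\mathbb Z$, $\langle x\rangle=(1+x^2)^{1/2}$, $\hat f_k$ denotes the $k$-th Fourier coefficient of $f$, and $\|f\|_{H^s}=\big(\sum_k\langle \xi_k\rangle^{2s}|\hat f_k|^2\big)^{1/2}$. Consider the periodic Drinfeld–Sokolov–Wilson system $$u_t+(uv)_x+u_{xxx}=0,\qquad v_t+uu_x=0,\qquad u|_{t=0}=u_0\in H^s(\mathbb T),\quad v|_{t=0}=v_0\in L^2(\mathbb T).$$ For an interval $[0,T]$, a solution on $[0,T]$ is a pair $(u,v)\in C([0,T];H^s)\times C([0,T];L^2)$ with $(u,v)(0)=(u_0,v_0)$ that satisfies the equations in the sense of distributions, that is, for every smooth $L$-periodic $\varphi$ and every $t\in[0,T]$, $$\int_0^L u(t)\varphi\,dx=\int_0^L u_0\varphi\,dx+\int_0^t\!\int_0^L (uv\,\varphi'+u\,\varphi''')\,dx\,dr,\qquad \int_0^L v(t)\varphi\,dx=\int_0^L v_0\varphi\,dx+\int_0^t\!\int_0^L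 \tfrac12u^2\varphi'\,dx\,dr .$$ For $g\in\mathbb R$ let $Y_g$ be the space of pairs $(u,v)$ of functions on $\mathbb R\times\mathbb T$ whose space-time Fourier transforms $\widetilde u(\tau,k),\widetilde v(\tau,k)$ satisfy $$\|(u,v)\|_{Y_g}=\|\langle \xi_k\rangle^s\langle\tau-\xi_k^3+g\xi_k\rangle^{1/2}\widetilde u\|_{\ell^2_kL^2_\tau}+\|\langle \xi_k\rangle^s\widetilde u\|_{\ell^2_kL^1_\tau}+\|\langle\tau\rangle^{1/2}\widetilde v\|_{\ell^2_kL^2_\tau}+\|\widetilde v\|_{\ell^2_kL^1_\tau}<\infty$$ (equivalently: $u(t,x+gt)$ belongs to $X^{s,1/2}\cap H^s_xL^1_\tau$ and $v$ to $H^{1/2}_tL^2_x\cap L^2_xL^1_\tau$, where $X^{s,b}$ is the KdV Bourgain space with weight $\langle\xi_k\rangle^s\langle\tau-\xi_k^3\rangle^b$). For a set of times $I\subseteq\mathbb R$ let $Y_g(I)$ be the space of restrictions to $I$ of the elements of $Y_g$, with the infimum of the norms of the extensions as norm. Then: 1. $Y_g(I)\hookrightarrow C(I;H^s)\times C(I;L^2)$,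 with an embedding constant independent of $g$ and $I$. 2. For every $R\ge 0$ there is $T=T(R)>0$ (depending also on the fixed $L$ and $s$, but on nothing else) such that for all $(u_0,v_0)\in H^s\times L^2$ with $\|u_0\|_{H^s}+\|v_0\|_{L^2}\le R$ there is a solution $(u,v)\in C([0,T];H^s)\times C([0,T];L^2)$ on $[0,T]$ that belongs to $Y_g([0,T])$, where $g$ is the mean value of $v_0$ over $\mathbb T$, and it is the only solution on $[0,T]$ with these data in $Y_g([0,T])$. 3. For every $R\ge0$, with $T=T(R)$, the solution map $(u_0,v_0)\mapsto(u,v)$ is continuous from $\{(u_0,v_0):\|u_0\|_{H^s}+\|v_0\|_{L^2}\le R\}$, with the topology of $H^s\times L^2$, to $C([0,T];H^s)\times C([0,T];L^2)$. -/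

import Mathlib

open MeasureTheory Set Filter Topology
open scoped ENNReal NNReal

noncomputable section

namespace DSW

/-- Real-valued square integrable functions on the circle of length `L`, with respect to the
normalized Lebesgue measure. -/
abbrev L2 (L : ℝ) [Fact (0 < L)] : Type :=
  Lp ℝ 2 (AddCircle.haarAddCircle : Measure (AddCircle L))

/-- The wave number `2πk/L` of the `k`-th Fourier mode on the circle of length `L`. -/
def freq (L : ℝ) (k : ℤ) : ℝ := 2 * Real.pi * k / L

/-- The bracket `⟨x⟩ = (1 + x²)^{1/2}`. -/
def bracket (x : ℝ) : ℝ := Real.sqrt (1 + x ^ 2)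

/-- The `k`-th Fourier coefficient of a real-valued function. -/
def coeff {L : ℝ} [Fact (0 < L)] (f : L2 L) (k : ℤ) : ℂ :=
  fourierCoeff (fun x : AddCircle L => ((f x : ℝ) : ℂ)) k

/-- The mean value over one period. -/
def mean {L : ℝ} [Fact (0 < L)] (f : L2 L) : ℝ :=
  ∫ x, f x ∂(AddCircle.haarAddCircle : Measure (AddCircle L))

/-- The `H^s` norm (`s ≥ 0`) of an `L²` function; it is `∞` exactly if the function is not in
`H^s`. -/
def sobNorm {L : ℝ} [Fact (0 < L)] (s : ℝ) (f : L2 L) : ℝ≥0∞ :=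
  (∑' k : ℤ, (ENNReal.ofReal (bracket (freq L k) ^ s) * ‖coeff f k‖ₑ) ^ 2) ^ (1 / 2 : ℝ)

/-- `u ∈ C⁰(I; H^s)`. -/
def SobContinuousOn {L : ℝ} [Fact (0 < L)] (s : ℝ) (u : ℝ → L2 L) (I : Set ℝ) : Prop :=
  ∀ t ∈ I, sobNorm s (u t) < ⊤ ∧
    Tendsto (fun r => sobNorm s (u r - u t)) (𝓝[I] t) (𝓝 0)

/-- The norm `‖⟨2πk/L⟩^s ⟨τ - w(k)⟩^b a(k, τ)‖` in `ℓ²_k L²_τ`, for a function `a` on the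
Fourier side. -/
def bourgainNorm (L : ℝ) (w : ℤ → ℝ) (s b : ℝ) (a : ℤ → ℝ → ℂ) : ℝ≥0∞ :=
  (∑' k : ℤ, ∫⁻ τ : ℝ,
    (ENNReal.ofReal (bracket (freq L k) ^ s * bracket (τ - w k) ^ b) * ‖a k τ‖ₑ) ^ 2)
      ^ (1 / 2 : ℝ)

/-- The norm `‖⟨2πk/L⟩^s a(k, τ)‖` in `ℓ²_k L¹_τ`, for a function `a` on the Fourier side. -/
def sobL1Norm (L : ℝ) (s : ℝ) (a : ℤ → ℝ → ℂ) : ℝ≥0∞ :=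
  (∑' k : ℤ, (∫⁻ τ : ℝ, ENNReal.ofReal (bracket (freq L k) ^ s) * ‖a k τ‖ₑ) ^ 2)
    ^ (1 / 2 : ℝ)

/-- `a` is the space-time Fourier transform of a function on `ℝ × 𝕋` that agrees with `u` at all
times in `I`; the integral converges absolutely as soon as `sobL1Norm L s a` is finite. -/
def Represents {L : ℝ} [Fact (0 < L)] (I : Set ℝ) (u : ℝ → L2 L) (a : ℤ → ℝ → ℂ) : Prop :=
  (∀ k, AEStronglyMeasurable (a k) volume) ∧
    ∀ t ∈ I, ∀ k, coeff (u t) k = ∫ τ : ℝ, Complex.exp (Complex.I * τ * t) * a k τ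

/-- The dispersion relation of `u_t + g u_x + u_xxx = 0`: the waves `exp (i(ξx + ωt))` with
`ω = ξ³ - gξ`. For `g = 0` this is the one of the linear KdV equation. -/
def dispersion (L g : ℝ) (k : ℤ) : ℝ := freq L k ^ 3 - g * freq L k

/-- The norm of the restriction to the set of times `I` of the space
`Y = (X^{s,1/2} ∩ H^s_x L¹_τ) × (H_t^{1/2} L²_x ∩ L²_x L¹_τ)`: the infimum of the norms of all
extensions to `ℝ × 𝕋`. It is `∞` exactly if `(u, v)` is not in that space. The space `X^{s,1/2}`
is the one adapted to `∂_t + g ∂_x + ∂_x³`; equivalently, `u(t, x + gt)` lies in the KdV space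
`X^{s,1/2}` with weight `⟨τ - ξ³⟩`. -/
def YNorm {L : ℝ} [Fact (0 < L)] (s g : ℝ) (I : Set ℝ) (u v : ℝ → L2 L) : ℝ≥0∞ :=
  ⨅ (a : ℤ → ℝ → ℂ) (b : ℤ → ℝ → ℂ) (_ : Represents I u a) (_ : Represents I v b),
    bourgainNorm L (dispersion L g) s (1 / 2) a + sobL1Norm L s a
      + bourgainNorm L (fun _ => 0) 0 (1 / 2) b + sobL1Norm L 0 b

/-- `(u, v) ∈ C⁰([0,T]; H^s) × C⁰([0,T]; L²)` is a solution on `[0,T]`, with initial data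
`(u₀, v₀)`, of `u_t + (uv)_x + u_xxx = 0`, `v_t + u u_x = 0` in the sense of distributions: the
equations are tested against smooth `L`-periodic functions `φ` and integrated in time. -/
structure IsSolution {L : ℝ} [Fact (0 < L)] (s T : ℝ) (u₀ v₀ : L2 L) (u v : ℝ → L2 L) :
    Prop where
  cont_u : SobContinuousOn s u (Icc 0 T)
  cont_v : ContinuousOn v (Icc 0 T)
  init_u : u 0 = u₀
  init_v : v 0 = v₀
  eq_u : ∀ φ : ℝ → ℂ, ContDiff ℝ ((⊤ : ℕ∞) : WithTop ℕ∞) φ → Function.Periodic φ L → ∀ t ∈ Icc 0 T,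
    ∫ x in (0 : ℝ)..L, u t (x : AddCircle L) • φ x =
      (∫ x in (0 : ℝ)..L, u₀ (x : AddCircle L) • φ x) +
        ∫ r in (0 : ℝ)..t, ∫ x in (0 : ℝ)..L,
          ((u r (x : AddCircle L) * v r (x : AddCircle L)) • deriv φ x
            + u r (x : AddCircle L) • iteratedDeriv 3 φ x)
  eq_v : ∀ φ : ℝ → ℂ, ContDiff ℝ ((⊤ : ℕ∞) : WithTop ℕ∞) φ → Function.Periodic φ L → ∀ t ∈ Icc 0 T,
    ∫ x in (0 : ℝ)..L, v t (x : AddCircle L) • φ x =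
      (∫ x in (0 : ℝ)..L, v₀ (x : AddCircle L) • φ x) +
        ∫ r in (0 : ℝ)..t, ∫ x in (0 : ℝ)..L,
          (u r (x : AddCircle L) ^ 2 / 2) • deriv φ x

end DSW

end

noncomputable section

namespace DSW

/-! ### The bracket and its powers -/

/-! The mean g of v is conserved, so the resonant part g·u_x of (uv)_x can be moved into the linear
part. This produces the dispersion relation Ω(ξ) = ξ³ - gξ, and the nonlinearity that remains
contains no zero mode of v. Rescale [0, T] to [0, 1], weight the coefficients of u by ⟨ξ⟩^s and
strip off the oscillation e^{iΩt}. Both unknowns then live in one space `ZS`, normed on the Fourier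
side by ℓ²H^{1/2} ∩ ℓ²L¹ in time, and the system reads z = l + B(z, z). The components of B are
operators `bilin m φ`: truncated Duhamel integrals of Σ m(k, k₁) e^{-iφ(k, k₁)t} p(k₁) q(k - k₁).

Everything rests on the resonance function. With ξ = ξ₁ + ξ₂ the phases factor as φ₁ = T(ξ - ξ₁)(ξ²
+ ξξ₁ + ξ₁² - g) and φ₂ = -Tξ(ξ₁² - ξ₁ξ₂ + ξ₂² - g). Nonzero frequencies have modulus at least 2π/L,
and s ≤ 1/2, so the derivative together with the Sobolev weights costs no more than ⟨φ⟩^{1/2}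
(`multiplier_le₁`, `multiplier_le₂`). The relation φ = σ₁ + σ₂ - σ between the modulations lets one
of the three weights ⟨·⟩^{1/2} pay for that. The two other weights, integrated over the modulations,
leave ⟨y + φ⟩^{-3/5} (`lintegral_jb_conv_le`). With one of the three frequencies held fixed, φ is a
quadratic or cubic polynomial of the free one, so the lattice sum of this quantity is bounded
uniformly in y (`cubic_gap`, `quad_gap`, `tsum_jb_le_of_gap`). In rescaled time the sums are O(T ·
T^{-3/5}) = O(T^{2/5}), which makes B small for short times (`exists_admissible`, `zn_bilin_le`).
The ℓ²L¹ component compensates for the endpoint exponent 1/2: it gives continuity in time and closes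
the Duhamel estimate.

Existence is the contraction principle for a quadratic equation (`BddBiadditive.exists_eq_add`). The
fixed point is real because its reflection solves the same equation (`sub_refl_eq_zero`).
`Window.fourierSol` and `FourierSol.isSolution` lead back to the weak form of the system.

For uniqueness among solutions of arbitrary size in Y, [0, T] is cut into short windows.
Localization to a window is bounded uniformly in its length (`zn_locP_le`), whereas the norm of B
tends to zero with the length, so the contraction applies on every window (`tp_eq_of_duhamel`,
`solution_unique`).

For continuity, data with different means have different phases. The operator B with phases
depending on g is shown to be only strongly continuous in g (`ZS.tendsto_bilin`), and the free
evolutions with two drifts are compared by dominated convergence (`tendsto_driftGap`). Hence δ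
depends on the data at which continuity is tested, and no modulus of continuity results
(`DuhamelSol.exists_delta`). -/

lemma one_le_bracket (x : ℝ) : 1 ≤ bracket x := by
  unfold bracket
  rw [Real.one_le_sqrt]
  nlinarith [sq_nonneg x]

lemma bracket_pos (x : ℝ) : 0 < bracket x := lt_of_lt_of_le one_pos (one_le_bracket x)

lemma bracket_sq (x : ℝ) : bracket x ^ 2 = 1 + x ^ 2 := by
  unfold bracket
  rw [Real.sq_sqrt]
  positivity

@[simp] lemma bracket_neg (x : ℝ) : bracket (-x) = bracket x := by simp [bracket]

lemma continuous_bracket : Continuous bracket := by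
  unfold bracket
  fun_prop

lemma abs_le_bracket (x : ℝ) : |x| ≤ bracket x := by
  refine abs_le_of_sq_le_sq ?_ (bracket_pos x).le
  rw [bracket_sq]
  linarith

lemma bracket_le_one_add_abs (x : ℝ) : bracket x ≤ 1 + |x| := by
  refine le_of_sq_le_sq ?_ (by positivity)
  rw [bracket_sq]
  nlinarith [abs_nonneg x, sq_abs x]

lemma bracket_le_bracket {x y : ℝ} (h : |x| ≤ |y|) : bracket x ≤ bracket y := by
  unfold bracket
  apply Real.sqrt_le_sqrt
  have := sq_le_sq.2 h
  linarith

lemma bracket_add_le (x y : ℝ) : bracket (x + y) ≤ bracket x + bracket y := by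
  refine le_of_sq_le_sq ?_ (by linarith [bracket_pos x, bracket_pos y])
  have h1 := abs_le_bracket x
  have h2 := abs_le_bracket y
  have h3 : x * y ≤ bracket x * bracket y := by
    calc x * y ≤ |x * y| := le_abs_self _
      _ = |x| * |y| := abs_mul _ _
      _ ≤ _ := mul_le_mul h1 h2 (abs_nonneg _) (bracket_pos x).le
  have := bracket_sq (x + y)
  have := bracket_sq x
  have := bracket_sq y
  nlinarith

lemma bracket_add_le_mul (x y : ℝ) : bracket (x + y) ≤ 2 * (bracket x * bracket y) := by
  have := bracket_add_le x y
  have h1 := one_le_bracket x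
  have h2 := one_le_bracket y
  nlinarith

lemma bracket_mul_le {c : ℝ} (x : ℝ) (hc : 1 ≤ c) : bracket (c * x) ≤ c * bracket x := by
  refine le_of_sq_le_sq ?_ (mul_nonneg (by linarith) (bracket_pos x).le)
  rw [mul_pow, bracket_sq, bracket_sq]
  nlinarith [sq_nonneg x]

/-- The power `⟨x⟩ʳ` as an extended nonnegative real. -/
def jb (x r : ℝ) : ℝ≥0∞ := ENNReal.ofReal (bracket x ^ r)

lemma jb_mul (x r r' : ℝ) : jb x r * jb x r' = jb x (r + r') := by
  unfold jb
  rw [← ENNReal.ofReal_mul (Real.rpow_nonneg (bracket_pos x).le _),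
    Real.rpow_add (bracket_pos x)]

@[simp] lemma jb_zero (x : ℝ) : jb x 0 = 1 := by simp [jb]

@[simp] lemma jb_neg (x r : ℝ) : jb (-x) r = jb x r := by simp [jb]

lemma jb_pow_two (x r : ℝ) : jb x r ^ 2 = jb x (2 * r) := by
  rw [sq, jb_mul, two_mul]

@[simp] lemma jb_ne_top (x r : ℝ) : jb x r ≠ ⊤ := ENNReal.ofReal_ne_top

lemma jb_mono (x : ℝ) {r r' : ℝ} (h : r ≤ r') : jb x r ≤ jb x r' :=
  ENNReal.ofReal_le_ofReal (Real.rpow_le_rpow_of_exponent_le (one_le_bracket x) h)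

lemma jb_le_one (x : ℝ) {r : ℝ} (h : r ≤ 0) : jb x r ≤ 1 := by
  simpa using jb_mono x h

lemma one_le_jb (x : ℝ) {r : ℝ} (h : 0 ≤ r) : 1 ≤ jb x r := by
  simpa using jb_mono x h

@[fun_prop] lemma measurable_jb (r : ℝ) : Measurable fun x => jb x r := by
  unfold jb
  have := continuous_bracket.measurable
  fun_prop

@[fun_prop] lemma Measurable.jb {α : Type*} [MeasurableSpace α] {f : α → ℝ} (hf : Measurable f)
    (r : ℝ) : Measurable fun x => DSW.jb (f x) r := (measurable_jb r).comp hf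

lemma jb_add_le (x y : ℝ) {r : ℝ} (h0 : 0 ≤ r) (h1 : r ≤ 1) : jb (x + y) r ≤ jb x r + jb y r := by
  unfold jb
  rw [← ENNReal.ofReal_add (Real.rpow_nonneg (bracket_pos x).le _)
    (Real.rpow_nonneg (bracket_pos y).le _)]
  apply ENNReal.ofReal_le_ofReal
  exact (Real.rpow_le_rpow (bracket_pos _).le (bracket_add_le x y) h0).trans
    (Real.rpow_add_le_add_rpow (bracket_pos x).le (bracket_pos y).le h0 h1)

/-- Replacing the larger bracket by the smaller one only increases negative powers. The sum on the
right spares the user the case distinction. -/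
lemma jb_neg_mul_neg_le (x y : ℝ) {r r' : ℝ} (h : 0 ≤ r) (h' : 0 ≤ r') :
    jb x (-r) * jb y (-r') ≤ jb x (-(r + r')) + jb y (-(r + r')) := by
  have aux : ∀ {x y : ℝ} (t : ℝ), 0 ≤ t → bracket x ≤ bracket y → jb y (-t) ≤ jb x (-t) := by
    intro x y t ht hxy
    apply ENNReal.ofReal_le_ofReal
    exact Real.rpow_le_rpow_of_nonpos (bracket_pos x) hxy (by linarith)
  rcases le_total (bracket x) (bracket y) with hxy | hxy
  · refine le_add_right ?_
    calc jb x (-r) * jb y (-r') ≤ jb x (-r) * jb x (-r') := by gcongr; exact aux _ h' hxy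
      _ = _ := by rw [jb_mul]; ring_nf
  · refine le_add_left ?_
    calc jb x (-r) * jb y (-r') ≤ jb y (-r) * jb y (-r') := by gcongr; exact aux _ h hxy
      _ = _ := by rw [jb_mul]; ring_nf

lemma jb_add_le_mul (x y : ℝ) {r : ℝ} (h0 : 0 ≤ r) (h1 : r ≤ 1) :
    jb (x + y) r ≤ 2 * (jb x r * jb y r) := by
  refine (jb_add_le x y h0 h1).trans ?_
  rw [two_mul]
  gcongr
  · exact le_mul_of_one_le_right' (one_le_jb y h0)
  · exact le_mul_of_one_le_left' (one_le_jb x h0)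

lemma lintegral_jb_lt_top {r : ℝ} (h : 1 < r) : ∫⁻ x : ℝ, jb x (-r) < ⊤ := by
  have := (integrable_rpow_neg_one_add_norm_sq (E := ℝ) (μ := volume) (r := r)
    (by simpa using h)).lintegral_lt_top
  refine lt_of_le_of_lt (lintegral_mono fun x => ?_) this
  unfold jb bracket
  apply ENNReal.ofReal_le_ofReal
  rw [Real.sqrt_eq_rpow, ← Real.rpow_mul (by positivity)]
  apply le_of_eq
  simp
  ring_nf

/-- The constant `∫ ⟨x⟩^{-6/5} dx`. -/
def jbMass : ℝ≥0∞ := ∫⁻ x : ℝ, jb x (-(6 / 5))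

lemma jbMass_lt_top : jbMass < ⊤ := lintegral_jb_lt_top (by norm_num)

lemma lintegral_sub_left_jb (y r : ℝ) : ∫⁻ x : ℝ, jb (y - x) r = ∫⁻ x : ℝ, jb x r :=
  lintegral_sub_left_eq_self (fun x => jb x r) y

/-- Distribute ⟨y⟩^{3/5} ≤ ⟨x⟩^{3/5} + ⟨y - x⟩^{3/5}: in each term the exponents 3/10 and 9/10
remain, with integrable total 6/5. The exponent 3/5 exceeds 1/2, which is what a lattice sum over a
quadratic phase needs. -/
lemma lintegral_jb_conv_le (y : ℝ) :
    ∫⁻ x : ℝ, jb x (-(9 / 10)) * jb (y - x) (-(9 / 10)) ≤ 4 * jbMass * jb y (-(3 / 5)) := by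
  have key : ∀ x : ℝ, jb x (-(9 / 10)) * jb (y - x) (-(9 / 10)) ≤
      jb y (-(3 / 5)) * (2 * (jb x (-(6 / 5)) + jb (y - x) (-(6 / 5)))) := by
    intro x
    have h1 : jb y (3 / 5) ≤ jb x (3 / 5) + jb (y - x) (3 / 5) := by
      have := jb_add_le x (y - x) (r := 3 / 5) (by norm_num) (by norm_num)
      simpa using this
    have h2 : jb x (3 / 5) * (jb x (-(9 / 10)) * jb (y - x) (-(9 / 10))) ≤
        jb x (-(6 / 5)) + jb (y - x) (-(6 / 5)) := by
      rw [← mul_assoc, jb_mul]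
      have := jb_neg_mul_neg_le x (y - x) (r := 3 / 10) (r' := 9 / 10) (by norm_num) (by norm_num)
      convert this using 2 <;> norm_num
    have h3 : jb (y - x) (3 / 5) * (jb x (-(9 / 10)) * jb (y - x) (-(9 / 10))) ≤
        jb x (-(6 / 5)) + jb (y - x) (-(6 / 5)) := by
      rw [mul_left_comm, jb_mul]
      have := jb_neg_mul_neg_le x (y - x) (r := 9 / 10) (r' := 3 / 10) (by norm_num) (by norm_num)
      convert this using 2 <;> norm_num
    calc jb x (-(9 / 10)) * jb (y - x) (-(9 / 10))
        = jb y (-(3 / 5)) * (jb y (3 / 5) * (jb x (-(9 / 10)) * jb (y - x) (-(9 / 10)))) := by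
          rw [← mul_assoc, jb_mul]; simp
      _ ≤ jb y (-(3 / 5)) * ((jb x (3 / 5) + jb (y - x) (3 / 5)) *
            (jb x (-(9 / 10)) * jb (y - x) (-(9 / 10)))) := by gcongr
      _ ≤ _ := by
          refine mul_le_mul_right ?_ _
          rw [add_mul, two_mul]
          exact add_le_add h2 h3
  calc ∫⁻ x : ℝ, jb x (-(9 / 10)) * jb (y - x) (-(9 / 10))
      ≤ ∫⁻ x : ℝ, jb y (-(3 / 5)) * (2 * (jb x (-(6 / 5)) + jb (y - x) (-(6 / 5)))) :=
        lintegral_mono key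
    _ = jb y (-(3 / 5)) * (2 * (jbMass + jbMass)) := by
        rw [lintegral_const_mul _ (by fun_prop), lintegral_const_mul _ (by fun_prop),
          lintegral_add_left (by fun_prop), lintegral_sub_left_jb]
        rfl
    _ = _ := by ring

/-! ### Cauchy–Schwarz and duality for extended nonnegative functions -/

section CauchySchwarz

variable {α β : Type*} [MeasurableSpace α] [MeasurableSpace β]

lemma sq_lintegral_mul_le {μ : Measure α} {f g : α → ℝ≥0∞} (hf : AEMeasurable f μ)
    (hg : AEMeasurable g μ) :
    (∫⁻ x, f x * g x ∂μ) ^ 2 ≤ (∫⁻ x, f x ^ 2 ∂μ) * ∫⁻ x, g x ^ 2 ∂μ := by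
  have := ENNReal.lintegral_mul_le_Lp_mul_Lq μ Real.HolderConjugate.two_two hf hg
  simp only [Pi.mul_apply, ENNReal.rpow_ofNat] at this
  calc (∫⁻ x, f x * g x ∂μ) ^ 2
      ≤ ((∫⁻ x, f x ^ 2 ∂μ) ^ (1 / 2 : ℝ) * (∫⁻ x, g x ^ 2 ∂μ) ^ (1 / 2 : ℝ)) ^ 2 := by gcongr
    _ = _ := by
      rw [mul_pow, ← ENNReal.rpow_natCast, ← ENNReal.rpow_natCast, ← ENNReal.rpow_mul,
        ← ENNReal.rpow_mul]
      norm_num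

/-- Cauchy–Schwarz with a weight `w` that is square integrable in the second variable. -/
lemma lintegral_sq_lintegral_mul_le {μ : Measure α} {ν : Measure β} [SFinite ν]
    {w R : α → β → ℝ≥0∞} (hw : Measurable (Function.uncurry w))
    (hR : Measurable (Function.uncurry R)) {K : ℝ≥0∞} (hK : ∀ a, ∫⁻ b, w a b ^ 2 ∂ν ≤ K) :
    ∫⁻ a, (∫⁻ b, w a b * R a b ∂ν) ^ 2 ∂μ ≤ K * ∫⁻ a, ∫⁻ b, R a b ^ 2 ∂ν ∂μ := by
  have hR2 : Measurable fun a => ∫⁻ b, R a b ^ 2 ∂ν :=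
    Measurable.lintegral_prod_right' (f := fun p : α × β => R p.1 p.2 ^ 2) (hR.pow_const 2)
  rw [← lintegral_const_mul _ hR2]
  refine lintegral_mono fun a => ?_
  refine (sq_lintegral_mul_le (hw.comp measurable_prodMk_left).aemeasurable
    (hR.comp measurable_prodMk_left).aemeasurable).trans ?_
  exact mul_le_mul_left (hK a) _

/-- The dual characterization of the `L²` norm. -/
lemma lintegral_sq_le_of_forall_dual {μ : Measure α} [SigmaFinite μ] {f : α → ℝ≥0∞}
    (hf : Measurable f) {K : ℝ≥0∞}
    (h : ∀ c : α → ℝ≥0∞, Measurable c → (∫⁻ x, f x * c x ∂μ) ^ 2 ≤ K * ∫⁻ x, c x ^ 2 ∂μ) :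
    ∫⁻ x, f x ^ 2 ∂μ ≤ K := by
  -- The test functions are truncations of f itself, in height and in support, so that their square
  -- integrals are finite and can be cancelled from both sides.
  let c : ℕ → α → ℝ≥0∞ := fun n => (spanningSets μ n).indicator fun x => min (f x) n
  have hc : ∀ n, Measurable (c n) := fun n =>
    (hf.min measurable_const).indicator (measurableSet_spanningSets μ n)
  have hmono : Monotone c := by
    intro n m hnm x
    simp only [c]
    refine (indicator_le_indicator_of_subset (monotone_spanningSets μ hnm)
      (fun _ => zero_le) x).trans ?_
    apply indicator_le_indicator
    gcongr
  have hle : ∀ n x, c n x ≤ f x := by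
    intro n x
    simp only [c]
    exact indicator_le' (fun x _ => min_le_left _ _) (fun _ _ => zero_le) x
  have hsup : ∀ x, ⨆ n, c n x ^ 2 = f x ^ 2 := by
    intro x
    apply iSup_eq_of_tendsto (fun n m hnm => by gcongr; exact hmono hnm x)
    have h1 : Tendsto (fun n : ℕ => c n x) atTop (𝓝 (f x)) := by
      have h2 : Tendsto (fun n : ℕ => min (f x) (n : ℝ≥0∞)) atTop (𝓝 (min (f x) ⊤)) :=
        tendsto_const_nhds.min ENNReal.tendsto_nat_nhds_top
      rw [min_top_right] at h2
      refine h2.congr' ?_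
      have hx : x ∈ ⋃ n, spanningSets μ n := by rw [iUnion_spanningSets]; trivial
      obtain ⟨N, hN⟩ := mem_iUnion.1 hx
      filter_upwards [eventually_ge_atTop N] with n hn
      simp only [c]
      rw [indicator_of_mem (monotone_spanningSets μ hn hN)]
    exact ENNReal.Tendsto.pow h1
  have hfin : ∀ n, ∫⁻ x, c n x ^ 2 ∂μ ≠ ⊤ := by
    intro n
    have : ∫⁻ x, c n x ^ 2 ∂μ ≤ ∫⁻ x, (spanningSets μ n).indicator (fun _ => (n : ℝ≥0∞) ^ 2) x ∂μ := by
      refine lintegral_mono fun x => ?_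
      by_cases hx : x ∈ spanningSets μ n
      · simp only [c, indicator_of_mem hx]
        gcongr
        exact min_le_right _ _
      · simp [c, indicator_of_notMem hx]
    refine ne_top_of_le_ne_top ?_ this
    rw [lintegral_indicator (measurableSet_spanningSets μ n), lintegral_const]
    refine ENNReal.mul_ne_top (by finiteness) ?_
    simpa using (measure_spanningSets_lt_top μ n).ne
  calc ∫⁻ x, f x ^ 2 ∂μ = ∫⁻ x, ⨆ n, c n x ^ 2 ∂μ := by simp_rw [hsup]
    _ = ⨆ n, ∫⁻ x, c n x ^ 2 ∂μ := lintegral_iSup (fun n => (hc n).pow_const 2)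
        (fun n m hnm x => by gcongr; exact hmono hnm x)
    _ ≤ K := by
      refine iSup_le fun n => ?_
      by_cases h0 : ∫⁻ x, c n x ^ 2 ∂μ = 0
      · rw [h0]; exact zero_le
      have h1 : (∫⁻ x, c n x ^ 2 ∂μ) ^ 2 ≤ K * ∫⁻ x, c n x ^ 2 ∂μ := by
        refine le_trans ?_ (h (c n) (hc n))
        gcongr with x
        rw [sq]
        gcongr
        exact hle n x
      rw [sq] at h1
      exact (ENNReal.mul_le_mul_iff_left h0 (hfin n)).1 h1

end CauchySchwarz

/-! ### Bilinear estimates for nonnegative functions on the Fourier side -/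

/-- The Haar measure of `ℤ × ℝ`. -/
abbrev haarZR : Measure (ℤ × ℝ) := (Measure.count : Measure ℤ).prod volume

lemma lintegral_haarZR {f : ℤ × ℝ → ℝ≥0∞} (hf : Measurable f) :
    ∫⁻ x, f x ∂haarZR = ∑' k : ℤ, ∫⁻ σ : ℝ, f (k, σ) := by
  rw [lintegral_prod _ hf.aemeasurable, lintegral_count]

lemma measurable_uncurry_of_forall {β γ : Type*} [MeasurableSpace β] [MeasurableSpace γ]
    {f : ℤ → β → γ} (hf : ∀ k, Measurable (f k)) : Measurable fun x : ℤ × β => f x.1 x.2 :=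
  measurable_from_prod_countable_right hf

/-- The shift of σ may depend on k. This is what allows changes of variables that involve the phase.
-/
lemma lintegral_shift {f : ℤ × ℝ → ℝ≥0∞} (hf : Measurable f) (n : ℤ) (c : ℤ → ℝ) :
    ∫⁻ x : ℤ × ℝ, f (x.1 + n, x.2 + c x.1) ∂haarZR = ∫⁻ x, f x ∂haarZR := by
  have hc : Measurable c := measurable_of_countable c
  rw [lintegral_haarZR hf, lintegral_haarZR (by fun_prop)]
  rw [← (Equiv.addRight n).tsum_eq (fun k : ℤ => ∫⁻ σ : ℝ, f (k, σ))]
  refine tsum_congr fun k => ?_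
  exact lintegral_add_right_eq_self (fun σ => f (k + n, σ)) (c k)

/-- The weighted sums over the interacting frequencies `k = k₁ + k₂` that control a bilinear
operator with multiplier `ψ⟨φ⟩^{1/2}` and phase `φ`. -/
structure SumBound (ψ : ℤ → ℤ → ℝ≥0∞) (φ : ℤ → ℤ → ℝ) (S : ℝ≥0∞) : Prop where
  out : ∀ k y, ∑' k₁, ψ k k₁ ^ 2 * jb (y + φ k k₁) (-(3 / 5)) ≤ S
  fst : ∀ k₁ y, ∑' k, ψ k k₁ ^ 2 * jb (y + φ k k₁) (-(3 / 5)) ≤ S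
  snd : ∀ k₂ y, ∑' k₁, ψ (k₁ + k₂) k₁ ^ 2 * jb (y + φ (k₁ + k₂) k₁) (-(3 / 5)) ≤ S

section Bilinear

variable {ψ : ℤ → ℤ → ℝ≥0∞} {φ : ℤ → ℤ → ℝ} {S : ℝ≥0∞}

/-- The frequencies of the second factor, given those of the output and of the first factor. -/
def sndFreq (φ : ℤ → ℤ → ℝ) (x y : ℤ × ℝ) : ℤ × ℝ := (x.1 - y.1, x.2 - y.2 + φ x.1 y.1)

@[fun_prop] lemma measurable_sndFreq {α : Type*} [MeasurableSpace α] {a b : α → ℤ × ℝ}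
    (ha : Measurable a) (hb : Measurable b) : Measurable fun x => sndFreq φ (a x) (b x) := by
  unfold sndFreq
  fun_prop

lemma lintegral_sndFreq {f : ℤ × ℝ → ℝ≥0∞} (hf : Measurable f) (y : ℤ × ℝ) :
    ∫⁻ x, f (sndFreq φ x y) ∂haarZR = ∫⁻ x, f x ∂haarZR := by
  rw [← lintegral_shift hf (-y.1) (fun k => - y.2 + φ k y.1)]
  simp only [sndFreq, sub_eq_add_neg, add_assoc]

/-- The bilinear operator with multiplier `ψ` and phase `φ` on nonnegative functions. -/
def posBilin (φ : ℤ → ℤ → ℝ) (ψ : ℤ → ℤ → ℝ≥0∞) (p q : ℤ × ℝ → ℝ≥0∞) (x : ℤ × ℝ) : ℝ≥0∞ :=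
  ∫⁻ y, ψ x.1 y.1 * (p y * q (sndFreq φ x y)) ∂haarZR

@[fun_prop] lemma measurable_posBilin {p q : ℤ × ℝ → ℝ≥0∞} (hp : Measurable p)
    (hq : Measurable q) : Measurable (posBilin φ ψ p q) := by
  unfold posBilin
  apply Measurable.lintegral_prod_right'
    (f := fun z : (ℤ × ℝ) × (ℤ × ℝ) => ψ z.1.1 z.2.1 * (p z.2 * q (sndFreq φ z.1 z.2)))
  fun_prop

/-- A little decay is given away so that all weights take the form treated by
`lintegral_jb_conv_le`. The slack is used on the output side, where only ⟨σ⟩^{-9/20} is spent. -/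
lemma jb_half_sq (x : ℝ) : jb x (-(1 / 2)) ^ 2 ≤ jb x (-(9 / 10)) := by
  rw [jb_pow_two]
  exact jb_mono x (by norm_num)

lemma jb_ninetwentieth_sq (x : ℝ) : jb x (-(9 / 20)) ^ 2 = jb x (-(9 / 10)) := by
  rw [jb_pow_two]
  norm_num

/-- The weight in the bilinear estimates, summed over one of the frequencies. -/
lemma lintegral_weight_le {χ : ℤ → ℝ≥0∞} {c : ℤ → ℝ} {w : ℤ × ℝ → ℝ≥0∞} (hw : Measurable w)
    (y : ℝ)
    (h : ∀ x, w x ^ 2 ≤ χ x.1 ^ 2 * (jb x.2 (-(9 / 10)) * jb (y + c x.1 - x.2) (-(9 / 10))))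
    (hS : ∑' k, χ k ^ 2 * jb (y + c k) (-(3 / 5)) ≤ S) :
    ∫⁻ x, w x ^ 2 ∂haarZR ≤ 4 * jbMass * S := by
  rw [lintegral_haarZR (by fun_prop)]
  calc ∑' k : ℤ, ∫⁻ σ : ℝ, w (k, σ) ^ 2
      ≤ ∑' k : ℤ, ∫⁻ σ : ℝ, χ k ^ 2 * (jb σ (-(9 / 10)) * jb (y + c k - σ) (-(9 / 10))) :=
        ENNReal.tsum_le_tsum fun k => lintegral_mono fun σ => h (k, σ)
    _ ≤ ∑' k : ℤ, 4 * jbMass * (χ k ^ 2 * jb (y + c k) (-(3 / 5))) := by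
        refine ENNReal.tsum_le_tsum fun k => ?_
        rw [lintegral_const_mul _ (by fun_prop), mul_left_comm]
        exact mul_le_mul_right (lintegral_jb_conv_le _) _
    _ ≤ _ := by
        rw [ENNReal.tsum_mul_left]
        exact mul_le_mul_right hS _

/-- The case in which the output modulation pays for the phase: both inputs keep their weights, and
Cauchy–Schwarz at fixed output uses the sum `SumBound.out`. -/
lemma posBilin_out_le (hS : SumBound ψ φ S) {P Q : ℤ × ℝ → ℝ≥0∞} (hP : Measurable P)
    (hQ : Measurable Q) :
    ∫⁻ x, posBilin φ ψ (fun y => jb y.2 (-(1 / 2)) * P y) (fun z => jb z.2 (-(1 / 2)) * Q z) x ^ 2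
      ∂haarZR ≤ 4 * jbMass * S * ((∫⁻ x, P x ^ 2 ∂haarZR) * ∫⁻ x, Q x ^ 2 ∂haarZR) := by
  let w : ℤ × ℝ → ℤ × ℝ → ℝ≥0∞ := fun x y =>
    ψ x.1 y.1 * (jb y.2 (-(1 / 2)) * jb (sndFreq φ x y).2 (-(1 / 2)))
  let R : ℤ × ℝ → ℤ × ℝ → ℝ≥0∞ := fun x y => P y * Q (sndFreq φ x y)
  have h := lintegral_sq_lintegral_mul_le (μ := haarZR) (ν := haarZR) (w := w) (R := R)
    (by unfold w Function.uncurry; fun_prop) (by unfold R Function.uncurry; fun_prop)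
    (K := 4 * jbMass * S) (by
      intro x
      apply lintegral_weight_le (χ := fun k => ψ x.1 k) (c := fun k => φ x.1 k) (y := x.2)
        (by unfold w; fun_prop) _ (hS.out x.1 x.2)
      intro y
      simp only [w, mul_pow]
      gcongr
      · exact jb_half_sq _
      · rw [jb_pow_two]
        simp only [sndFreq]
        rw [show x.2 - y.2 + φ x.1 y.1 = x.2 + φ x.1 y.1 - y.2 by ring]
        exact jb_mono _ (by norm_num))
  calc _ = ∫⁻ x, (∫⁻ y, w x y * R x y ∂haarZR) ^ 2 ∂haarZR := by
        simp only [posBilin, w, R]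
        congr! 5
        ring
    _ ≤ _ := h
    _ = _ := by
        congr 1
        rw [lintegral_lintegral_swap (by unfold R Function.uncurry; fun_prop)]
        simp only [R, mul_pow]
        have : ∀ y, ∫⁻ x, P y ^ 2 * Q (sndFreq φ x y) ^ 2 ∂haarZR
            = P y ^ 2 * ∫⁻ x, Q x ^ 2 ∂haarZR := by
          intro y
          rw [lintegral_const_mul _ (by fun_prop)]
          rw [lintegral_sndFreq (f := fun z => Q z ^ 2) (by fun_prop)]
        simp_rw [this]
        rw [lintegral_mul_const _ (by fun_prop)]

/-- The case in which the first factor pays, so that P carries no weight. By duality this is a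
trilinear form in P, Q and c; Cauchy–Schwarz at fixed frequencies of P uses the sum `SumBound.fst`.
-/
lemma posBilin_fst_le (hS : SumBound ψ φ S) {P Q : ℤ × ℝ → ℝ≥0∞} (hP : Measurable P)
    (hQ : Measurable Q) :
    ∫⁻ x, (jb x.2 (-(9 / 20)) * posBilin φ ψ P (fun z => jb z.2 (-(1 / 2)) * Q z) x) ^ 2
      ∂haarZR ≤ 4 * jbMass * S * ((∫⁻ x, P x ^ 2 ∂haarZR) * ∫⁻ x, Q x ^ 2 ∂haarZR) := by
  apply lintegral_sq_le_of_forall_dual (by fun_prop)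
  intro c hc
  let w : ℤ × ℝ → ℤ × ℝ → ℝ≥0∞ := fun y x =>
    ψ x.1 y.1 * (jb x.2 (-(9 / 20)) * jb (sndFreq φ x y).2 (-(1 / 2)))
  let R : ℤ × ℝ → ℤ × ℝ → ℝ≥0∞ := fun y x => c x * Q (sndFreq φ x y)
  have h := lintegral_sq_lintegral_mul_le (μ := haarZR) (ν := haarZR) (w := w) (R := R)
    (by unfold w Function.uncurry; fun_prop) (by unfold R Function.uncurry; fun_prop)
    (K := 4 * jbMass * S) (by
      intro y
      apply lintegral_weight_le (χ := fun k => ψ k y.1) (c := fun k => - φ k y.1) (y := y.2)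
        (by unfold w; fun_prop)
      · intro x
        simp only [w, mul_pow]
        gcongr
        · exact (jb_ninetwentieth_sq _).le
        · rw [jb_pow_two]
          simp only [sndFreq]
          rw [← jb_neg (y.2 + -φ x.1 y.1 - x.2),
            show -(y.2 + -φ x.1 y.1 - x.2) = x.2 - y.2 + φ x.1 y.1 by ring]
          exact jb_mono _ (by norm_num)
      · refine le_trans (le_of_eq ?_) (hS.fst y.1 (-y.2))
        congr! 3 with k
        rw [← jb_neg]
        congr 1
        ring)
  have e1 : ∫⁻ x, (jb x.2 (-(9 / 20)) * posBilin φ ψ P (fun z => jb z.2 (-(1 / 2)) * Q z) x) * c x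
      ∂haarZR = ∫⁻ y, P y * ∫⁻ x, w y x * R y x ∂haarZR ∂haarZR := by
    have : ∀ x, (jb x.2 (-(9 / 20)) * posBilin φ ψ P (fun z => jb z.2 (-(1 / 2)) * Q z) x) * c x
        = ∫⁻ y, P y * (w y x * R y x) ∂haarZR := by
      intro x
      unfold posBilin
      rw [← lintegral_const_mul _ (by fun_prop), ← lintegral_mul_const _ (by fun_prop)]
      congr! 2 with y
      simp only [w, R]
      ring
    simp_rw [this]
    rw [lintegral_lintegral_swap (by unfold w R Function.uncurry; fun_prop)]
    congr! 2 with y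
    rw [lintegral_const_mul _ (by unfold w R; fun_prop)]
  rw [e1]
  refine (sq_lintegral_mul_le (by fun_prop) ?_).trans ?_
  · refine Measurable.aemeasurable (Measurable.lintegral_prod_right'
      (f := fun z : (ℤ × ℝ) × (ℤ × ℝ) => w z.1 z.2 * R z.1 z.2) ?_)
    unfold w R
    fun_prop
  refine (mul_le_mul_right h _).trans (le_of_eq ?_)
  have e2 : ∫⁻ y, ∫⁻ x, R y x ^ 2 ∂haarZR ∂haarZR
      = (∫⁻ x, c x ^ 2 ∂haarZR) * ∫⁻ x, Q x ^ 2 ∂haarZR := by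
    simp only [R, mul_pow]
    have : ∀ x, ∫⁻ y, c x ^ 2 * Q (sndFreq φ x y) ^ 2 ∂haarZR
        = c x ^ 2 * ∫⁻ x, Q x ^ 2 ∂haarZR := by
      intro x
      rw [lintegral_const_mul _ (by fun_prop)]
      congr 1
      rw [lintegral_haarZR (by fun_prop), lintegral_haarZR (by fun_prop)]
      rw [← (Equiv.subLeft x.1).tsum_eq (fun k : ℤ => ∫⁻ σ : ℝ, Q (k, σ) ^ 2)]
      refine tsum_congr fun k => ?_
      simp only [sndFreq, Equiv.subLeft_apply]
      rw [← lintegral_sub_left_eq_self (fun σ => Q (x.1 - k, σ) ^ 2) (x.2 + φ x.1 k)]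
      congr! 4 with σ
      ring_nf
    rw [lintegral_lintegral_swap (by unfold Function.uncurry; fun_prop)]
    simp_rw [this]
    rw [lintegral_mul_const _ (by fun_prop)]
  rw [e2]
  ring

/-- The output frequencies, given those of the two factors. -/
def outFreq (φ : ℤ → ℤ → ℝ) (y z : ℤ × ℝ) : ℤ × ℝ := (y.1 + z.1, y.2 + z.2 - φ (y.1 + z.1) y.1)

@[fun_prop] lemma measurable_outFreq {α : Type*} [MeasurableSpace α] {a b : α → ℤ × ℝ}
    (ha : Measurable a) (hb : Measurable b) : Measurable fun x => outFreq φ (a x) (b x) := by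
  unfold outFreq
  fun_prop

lemma lintegral_outFreq {f : ℤ × ℝ → ℝ≥0∞} (hf : Measurable f) (y : ℤ × ℝ) :
    ∫⁻ z, f (outFreq φ y z) ∂haarZR = ∫⁻ x, f x ∂haarZR := by
  rw [← lintegral_shift hf y.1 (fun k => y.2 - φ (y.1 + k) y.1)]
  simp only [outFreq]
  refine lintegral_congr fun z => congrArg f (Prod.ext ?_ ?_)
  · simp only
    ring
  · simp only
    ring

lemma sndFreq_outFreq (y z : ℤ × ℝ) : sndFreq φ (outFreq φ y z) y = z := by
  simp only [sndFreq, outFreq]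
  ext
  · simp
  · simp only
    ring

/-- The same duality with the second factor paying. The output variable is first traded for the
frequencies of Q through `outFreq`, so that Cauchy–Schwarz can be applied with those held fixed. -/
lemma posBilin_snd_le (hS : SumBound ψ φ S) {P Q : ℤ × ℝ → ℝ≥0∞} (hP : Measurable P)
    (hQ : Measurable Q) :
    ∫⁻ x, (jb x.2 (-(9 / 20)) * posBilin φ ψ (fun z => jb z.2 (-(1 / 2)) * P z) Q x) ^ 2
      ∂haarZR ≤ 4 * jbMass * S * ((∫⁻ x, P x ^ 2 ∂haarZR) * ∫⁻ x, Q x ^ 2 ∂haarZR) := by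
  apply lintegral_sq_le_of_forall_dual (by fun_prop)
  intro c hc
  let w : ℤ × ℝ → ℤ × ℝ → ℝ≥0∞ := fun z y =>
    ψ (y.1 + z.1) y.1 * (jb y.2 (-(1 / 2)) * jb (outFreq φ y z).2 (-(9 / 20)))
  let R : ℤ × ℝ → ℤ × ℝ → ℝ≥0∞ := fun z y => c (outFreq φ y z) * P y
  have h := lintegral_sq_lintegral_mul_le (μ := haarZR) (ν := haarZR) (w := w) (R := R)
    (by unfold w Function.uncurry; fun_prop) (by unfold R Function.uncurry; fun_prop)
    (K := 4 * jbMass * S) (by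
      intro z
      apply lintegral_weight_le (χ := fun k => ψ (k + z.1) k)
        (c := fun k => φ (k + z.1) k) (y := - z.2) (by unfold w; fun_prop) _ (hS.snd z.1 (- z.2))
      intro y
      simp only [w, mul_pow]
      gcongr
      · exact jb_half_sq _
      · rw [jb_ninetwentieth_sq]
        simp only [outFreq]
        rw [← jb_neg]
        apply le_of_eq
        congr 1
        ring)
  have e1 : ∫⁻ x, (jb x.2 (-(9 / 20)) * posBilin φ ψ (fun z => jb z.2 (-(1 / 2)) * P z) Q x) * c x
      ∂haarZR = ∫⁻ z, Q z * ∫⁻ y, w z y * R z y ∂haarZR ∂haarZR := by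
    have : ∀ x, (jb x.2 (-(9 / 20)) * posBilin φ ψ (fun z => jb z.2 (-(1 / 2)) * P z) Q x) * c x
        = ∫⁻ y, ψ x.1 y.1 * (jb y.2 (-(1 / 2)) * jb x.2 (-(9 / 20))) *
            (c x * P y) * Q (sndFreq φ x y) ∂haarZR := by
      intro x
      unfold posBilin
      rw [← lintegral_const_mul _ (by fun_prop), ← lintegral_mul_const _ (by fun_prop)]
      congr! 2 with y
      ring
    simp_rw [this]
    rw [lintegral_lintegral_swap (by unfold Function.uncurry; fun_prop)]
    have : ∀ y, ∫⁻ x, ψ x.1 y.1 * (jb y.2 (-(1 / 2)) * jb x.2 (-(9 / 20))) *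
            (c x * P y) * Q (sndFreq φ x y) ∂haarZR
        = ∫⁻ z, Q z * (w z y * R z y) ∂haarZR := by
      intro y
      rw [← lintegral_outFreq (φ := φ) (by fun_prop) y]
      congr! 2 with z
      rw [sndFreq_outFreq]
      simp only [w, R, outFreq]
      ring
    simp_rw [this]
    rw [lintegral_lintegral_swap (by unfold w R Function.uncurry; fun_prop)]
    congr! 2 with z
    rw [lintegral_const_mul _ (by unfold w R; fun_prop)]
  rw [e1]
  refine (sq_lintegral_mul_le (by fun_prop) ?_).trans ?_
  · refine Measurable.aemeasurable (Measurable.lintegral_prod_right'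
      (f := fun z : (ℤ × ℝ) × (ℤ × ℝ) => w z.1 z.2 * R z.1 z.2) ?_)
    unfold w R
    fun_prop
  refine (mul_le_mul_right h _).trans (le_of_eq ?_)
  have e2 : ∫⁻ z, ∫⁻ y, R z y ^ 2 ∂haarZR ∂haarZR
      = (∫⁻ x, c x ^ 2 ∂haarZR) * ∫⁻ x, P x ^ 2 ∂haarZR := by
    simp only [R, mul_pow]
    have : ∀ y, ∫⁻ z, c (outFreq φ y z) ^ 2 * P y ^ 2 ∂haarZR
        = (∫⁻ x, c x ^ 2 ∂haarZR) * P y ^ 2 := by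
      intro y
      rw [lintegral_mul_const _ (by fun_prop), lintegral_outFreq (f := fun z => c z ^ 2)
        (by fun_prop)]
    rw [lintegral_lintegral_swap (by unfold Function.uncurry; fun_prop)]
    simp_rw [this]
    rw [lintegral_const_mul _ (by fun_prop)]
  rw [e2]
  ring

lemma add_sq_le_two_mul (a b : ℝ≥0∞) : (a + b) ^ 2 ≤ 2 * (a ^ 2 + b ^ 2) := by
  have h := ENNReal.rpow_add_le_mul_rpow_add_rpow a b (p := 2) (by norm_num)
  norm_num at h
  exact h

lemma add_add_sq_le (a b c : ℝ≥0∞) : (a + b + c) ^ 2 ≤ 4 * (a ^ 2 + b ^ 2 + c ^ 2) := by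
  calc (a + b + c) ^ 2 ≤ 2 * ((a + b) ^ 2 + c ^ 2) := add_sq_le_two_mul _ _
    _ ≤ 2 * (2 * (a ^ 2 + b ^ 2) + 2 * c ^ 2) := by
        gcongr
        · exact add_sq_le_two_mul _ _
        · exact le_mul_of_one_le_left' (by norm_num)
    _ = _ := by ring

/-- The resonance identity `φ = σ₁ + σ₂ - σ` in the form of an inequality between weights. -/
lemma jb_phase_le (x y : ℤ × ℝ) : jb (φ x.1 y.1) (1 / 2) ≤
    jb x.2 (1 / 2) + jb y.2 (1 / 2) + jb (sndFreq φ x y).2 (1 / 2) := by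
  have e : φ x.1 y.1 = -x.2 + y.2 + (sndFreq φ x y).2 := by
    simp only [sndFreq]
    ring
  rw [e]
  refine (jb_add_le _ _ (by norm_num) (by norm_num)).trans ?_
  gcongr
  refine (jb_add_le _ _ (by norm_num) (by norm_num)).trans ?_
  rw [jb_neg]

/-- If the output weight dominates, then ⟨φ⟩ ≤ 4⟨σ⟩ and the factor ⟨σ⟩⁻¹ turns ⟨φ⟩^{1/2} into
4⟨φ⟩^{-1/2}, a bound free of all modulations. Otherwise the inputs pay for the phase. -/
lemma jb_neg_one_mul_phase_le (x y : ℤ × ℝ) : jb x.2 (-1) * jb (φ x.1 y.1) (1 / 2) ≤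
    4 * jb (φ x.1 y.1) (-(1 / 2)) +
      2 * (jb x.2 (-1) * (jb y.2 (1 / 2) + jb (sndFreq φ x y).2 (1 / 2))) := by
  have h := jb_phase_le (φ := φ) x y
  rcases le_total (jb x.2 (1 / 2)) (jb y.2 (1 / 2) + jb (sndFreq φ x y).2 (1 / 2)) with h1 | h1
  · refine le_add_left ?_
    rw [mul_left_comm]
    refine mul_le_mul_right (h.trans ?_) _
    rw [add_assoc, two_mul]
    gcongr
  · refine le_add_right ?_
    have h2 : jb (φ x.1 y.1) (1 / 2) ≤ 2 * jb x.2 (1 / 2) := by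
      refine h.trans ?_
      rw [add_assoc, two_mul]
      gcongr
    have h3 : jb (φ x.1 y.1) 1 ≤ 4 * jb x.2 1 := by
      have := pow_le_pow_left' h2 2
      rw [mul_pow, jb_pow_two, jb_pow_two] at this
      norm_num at this
      exact this
    calc jb x.2 (-1) * jb (φ x.1 y.1) (1 / 2)
        = jb x.2 (-1) * (jb (φ x.1 y.1) 1 * jb (φ x.1 y.1) (-(1 / 2))) := by
          rw [jb_mul]; norm_num
      _ ≤ jb x.2 (-1) * (4 * jb x.2 1 * jb (φ x.1 y.1) (-(1 / 2))) := by gcongr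
      _ = 4 * (jb x.2 (-1) * jb x.2 1) * jb (φ x.1 y.1) (-(1 / 2)) := by ring
      _ = _ := by rw [jb_mul]; norm_num

/-- The first of the two estimates of the bilinear operator: the `X^{0,-1/2}` norm. -/
lemma posBilin_sq_le (hS : SumBound ψ φ S) {p q : ℤ × ℝ → ℝ≥0∞} (hp : Measurable p)
    (hq : Measurable q) :
    ∫⁻ x, jb x.2 (-1) * posBilin φ (fun k k₁ => ψ k k₁ * jb (φ k k₁) (1 / 2)) p q x ^ 2 ∂haarZR ≤
      48 * jbMass * S * ((∫⁻ x, jb x.2 1 * p x ^ 2 ∂haarZR) * ∫⁻ x, jb x.2 1 * q x ^ 2 ∂haarZR) := by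
  let P : ℤ × ℝ → ℝ≥0∞ := fun y => jb y.2 (1 / 2) * p y
  let Q : ℤ × ℝ → ℝ≥0∞ := fun y => jb y.2 (1 / 2) * q y
  have hP : Measurable P := by unfold P; fun_prop
  have hQ : Measurable Q := by unfold Q; fun_prop
  have hp' : p = fun y => jb y.2 (-(1 / 2)) * P y := by
    ext y; simp only [P]; rw [← mul_assoc, jb_mul]; simp
  have hq' : q = fun y => jb y.2 (-(1 / 2)) * Q y := by
    ext y; simp only [Q]; rw [← mul_assoc, jb_mul]; simp
  have hP2 : ∫⁻ x, jb x.2 1 * p x ^ 2 ∂haarZR = ∫⁻ x, P x ^ 2 ∂haarZR := by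
    simp only [P, mul_pow, jb_pow_two]; norm_num
  have hQ2 : ∫⁻ x, jb x.2 1 * q x ^ 2 ∂haarZR = ∫⁻ x, Q x ^ 2 ∂haarZR := by
    simp only [Q, mul_pow, jb_pow_two]; norm_num
  rw [hP2, hQ2]
  set I0 := posBilin φ ψ p q
  set I1 := posBilin φ ψ P q
  set I2 := posBilin φ ψ p Q
  have hI0 : Measurable I0 := measurable_posBilin hp hq
  have hI1 : Measurable I1 := measurable_posBilin hP hq
  have hI2 : Measurable I2 := measurable_posBilin hp hQ
  -- The resonance inequality splits the operator into three, one for each modulation that pays.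
  have key : ∀ x, posBilin φ (fun k k₁ => ψ k k₁ * jb (φ k k₁) (1 / 2)) p q x ≤
      jb x.2 (1 / 2) * I0 x + I1 x + I2 x := by
    intro x
    simp only [I0, I1, I2, posBilin]
    rw [← lintegral_const_mul _ (by fun_prop), ← lintegral_add_left (by fun_prop),
      ← lintegral_add_left (by fun_prop)]
    refine lintegral_mono fun y => ?_
    calc ψ x.1 y.1 * jb (φ x.1 y.1) (1 / 2) * (p y * q (sndFreq φ x y))
        ≤ ψ x.1 y.1 * (jb x.2 (1 / 2) + jb y.2 (1 / 2) + jb (sndFreq φ x y).2 (1 / 2)) *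
          (p y * q (sndFreq φ x y)) := by gcongr; exact jb_phase_le x y
      _ = _ := by simp only [P, Q]; ring
  have key2 : ∀ x, jb x.2 (-1) *
      posBilin φ (fun k k₁ => ψ k k₁ * jb (φ k k₁) (1 / 2)) p q x ^ 2 ≤
      4 * (I0 x ^ 2 + (jb x.2 (-(9 / 20)) * I1 x) ^ 2 + (jb x.2 (-(9 / 20)) * I2 x) ^ 2) := by
    intro x
    have e : jb x.2 (-1) = jb x.2 (-(1 / 2)) ^ 2 := by rw [jb_pow_two]; norm_num
    calc _ = (jb x.2 (-(1 / 2)) *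
            posBilin φ (fun k k₁ => ψ k k₁ * jb (φ k k₁) (1 / 2)) p q x) ^ 2 := by rw [e]; ring
      _ ≤ (jb x.2 (-(1 / 2)) * (jb x.2 (1 / 2) * I0 x + I1 x + I2 x)) ^ 2 := by
          gcongr; exact key x
      _ = (I0 x + jb x.2 (-(1 / 2)) * I1 x + jb x.2 (-(1 / 2)) * I2 x) ^ 2 := by
          rw [mul_add, mul_add, ← mul_assoc, jb_mul]; simp
      _ ≤ (I0 x + jb x.2 (-(9 / 20)) * I1 x + jb x.2 (-(9 / 20)) * I2 x) ^ 2 := by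
          gcongr <;> exact jb_mono _ (by norm_num)
      _ ≤ _ := add_add_sq_le _ _ _
  refine (lintegral_mono key2).trans ?_
  rw [lintegral_const_mul _ (by fun_prop), lintegral_add_left (by fun_prop),
    lintegral_add_left (by fun_prop)]
  have b0 := posBilin_out_le hS hP hQ
  have b1 := posBilin_fst_le hS hP hQ
  have b2 := posBilin_snd_le hS hP hQ
  rw [← hp', ← hq'] at b0
  rw [← hq'] at b1
  rw [← hp'] at b2
  calc _ ≤ 4 * (_ + _ + _) := mul_le_mul_right (add_le_add (add_le_add b0 b1) b2) 4
    _ = _ := by ring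

/-- Write ⟨σ⟩⁻¹ = ⟨σ⟩^{-11/20}⟨σ⟩^{-9/20}, the first factor being square integrable. This is why the
estimates with a paying input spend only 9/20 of the output weight: with 1/2 the remaining factor
would miss L² logarithmically. -/
lemma sq_lintegral_weight_le {I : ℤ × ℝ → ℝ≥0∞} (hI : Measurable I) :
    ∑' k : ℤ, (∫⁻ σ : ℝ, jb σ (-1) * I (k, σ)) ^ 2 ≤
      (∫⁻ σ : ℝ, jb σ (-(11 / 10))) * ∫⁻ x, (jb x.2 (-(9 / 20)) * I x) ^ 2 ∂haarZR := by
  rw [lintegral_haarZR (by fun_prop), ← ENNReal.tsum_mul_left]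
  refine ENNReal.tsum_le_tsum fun k => ?_
  have := sq_lintegral_mul_le (μ := volume) (f := fun σ : ℝ => jb σ (-(11 / 20)))
    (g := fun σ => jb σ (-(9 / 20)) * I (k, σ)) (by fun_prop) (by fun_prop)
  simp only [jb_pow_two, ← mul_assoc, jb_mul] at this
  norm_num at this ⊢
  exact this

/-- The contribution of the region where the modulation of the output dominates. -/
lemma posBilin_phase_le (hS : SumBound ψ φ S) {p q : ℤ × ℝ → ℝ≥0∞} (hp : Measurable p)
    (hq : Measurable q) :
    ∑' k : ℤ, (∫⁻ σ : ℝ, posBilin φ (fun k k₁ => ψ k k₁ * jb (φ k k₁) (-(1 / 2))) p q (k, σ)) ^ 2 ≤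
      S * ((∑' k : ℤ, (∫⁻ σ : ℝ, p (k, σ)) ^ 2) * ∑' k : ℤ, (∫⁻ σ : ℝ, q (k, σ)) ^ 2) := by
  -- No modulation weight is left, so integrating out σ decouples the factors. What remains is a
  -- discrete convolution of the L¹ norms.
  have e : ∀ k : ℤ, ∫⁻ σ : ℝ, posBilin φ (fun k k₁ => ψ k k₁ * jb (φ k k₁) (-(1 / 2))) p q (k, σ) =
      ∑' k₁ : ℤ, (ψ k k₁ * jb (φ k k₁) (-(1 / 2))) *
        ((∫⁻ σ : ℝ, p (k₁, σ)) * ∫⁻ σ : ℝ, q (k - k₁, σ)) := by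
    intro k
    unfold posBilin
    rw [lintegral_lintegral_swap (by unfold Function.uncurry; fun_prop),
      lintegral_haarZR (by
        apply Measurable.lintegral_prod_right' (f := fun z : (ℤ × ℝ) × ℝ =>
          ψ k z.1.1 * jb (φ k z.1.1) (-(1 / 2)) * (p z.1 * q (sndFreq φ (k, z.2) z.1)))
        fun_prop)]
    refine tsum_congr fun k₁ => ?_
    have : ∀ σ₁ : ℝ, ∫⁻ σ : ℝ, ψ k k₁ * jb (φ k k₁) (-(1 / 2)) *
        (p (k₁, σ₁) * q (sndFreq φ (k, σ) (k₁, σ₁))) = ψ k k₁ * jb (φ k k₁) (-(1 / 2)) *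
        (p (k₁, σ₁) * ∫⁻ σ : ℝ, q (k - k₁, σ)) := by
      intro σ₁
      rw [lintegral_const_mul _ (by fun_prop), lintegral_const_mul _ (by fun_prop)]
      congr 2
      simp only [sndFreq]
      rw [← lintegral_add_right_eq_self (fun σ => q (k - k₁, σ)) (-σ₁ + φ k k₁)]
      congr! 3 with σ
      ring_nf
    simp_rw [this]
    rw [lintegral_const_mul _ (by fun_prop), lintegral_mul_const _ (by fun_prop)]
  simp_rw [e]
  set a : ℤ → ℝ≥0∞ := fun k => ∫⁻ σ : ℝ, p (k, σ)
  set b : ℤ → ℝ≥0∞ := fun k => ∫⁻ σ : ℝ, q (k, σ)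
  have h1 : ∀ k : ℤ, (∑' k₁ : ℤ, ψ k k₁ * jb (φ k k₁) (-(1 / 2)) * (a k₁ * b (k - k₁))) ^ 2 ≤
      S * ∑' k₁ : ℤ, a k₁ ^ 2 * b (k - k₁) ^ 2 := by
    intro k
    have h2 := sq_lintegral_mul_le (μ := (Measure.count : Measure ℤ))
      (f := fun k₁ => ψ k k₁ * jb (φ k k₁) (-(1 / 2))) (g := fun k₁ => a k₁ * b (k - k₁))
      (measurable_of_countable _).aemeasurable (measurable_of_countable _).aemeasurable
    simp only [lintegral_count, mul_pow] at h2
    refine h2.trans (mul_le_mul_left ?_ _)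
    refine le_trans (ENNReal.tsum_le_tsum fun k₁ => ?_) (hS.out k 0)
    rw [jb_pow_two, zero_add]
    gcongr
    exact jb_mono _ (by norm_num)
  refine (ENNReal.tsum_le_tsum h1).trans ?_
  rw [ENNReal.tsum_mul_left, ENNReal.tsum_comm]
  refine mul_le_mul_right (le_of_eq ?_) _
  rw [← ENNReal.tsum_mul_right]
  refine tsum_congr fun k₁ => ?_
  rw [ENNReal.tsum_mul_left]
  congr 1
  exact (Equiv.subRight k₁).tsum_eq (fun k => b k ^ 2)

/-- The second of the two estimates of the bilinear operator: the `ℓ² L¹` norm with weight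
`⟨σ⟩⁻¹`. -/
lemma sq_lintegral_posBilin_le (hS : SumBound ψ φ S) {p q : ℤ × ℝ → ℝ≥0∞} (hp : Measurable p)
    (hq : Measurable q) :
    ∑' k : ℤ, (∫⁻ σ : ℝ, jb σ (-1) *
        posBilin φ (fun k k₁ => ψ k k₁ * jb (φ k k₁) (1 / 2)) p q (k, σ)) ^ 2 ≤
      64 * S * ((∑' k : ℤ, (∫⁻ σ : ℝ, p (k, σ)) ^ 2) * ∑' k : ℤ, (∫⁻ σ : ℝ, q (k, σ)) ^ 2) +
      128 * (∫⁻ σ : ℝ, jb σ (-(11 / 10))) * jbMass * S *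
        ((∫⁻ x, jb x.2 1 * p x ^ 2 ∂haarZR) * ∫⁻ x, jb x.2 1 * q x ^ 2 ∂haarZR) := by
  let P : ℤ × ℝ → ℝ≥0∞ := fun y => jb y.2 (1 / 2) * p y
  let Q : ℤ × ℝ → ℝ≥0∞ := fun y => jb y.2 (1 / 2) * q y
  have hP : Measurable P := by unfold P; fun_prop
  have hQ : Measurable Q := by unfold Q; fun_prop
  have hp' : p = fun y => jb y.2 (-(1 / 2)) * P y := by
    ext y; simp only [P]; rw [← mul_assoc, jb_mul]; simp
  have hq' : q = fun y => jb y.2 (-(1 / 2)) * Q y := by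
    ext y; simp only [Q]; rw [← mul_assoc, jb_mul]; simp
  have hP2 : ∫⁻ x, jb x.2 1 * p x ^ 2 ∂haarZR = ∫⁻ x, P x ^ 2 ∂haarZR := by
    simp only [P, mul_pow, jb_pow_two]; norm_num
  have hQ2 : ∫⁻ x, jb x.2 1 * q x ^ 2 ∂haarZR = ∫⁻ x, Q x ^ 2 ∂haarZR := by
    simp only [Q, mul_pow, jb_pow_two]; norm_num
  rw [hP2, hQ2]
  set I0 := posBilin φ (fun k k₁ => ψ k k₁ * jb (φ k k₁) (-(1 / 2))) p q
  set I1 := posBilin φ ψ P q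
  set I2 := posBilin φ ψ p Q
  have hI0 : Measurable I0 := measurable_posBilin hp hq
  have hI1 : Measurable I1 := measurable_posBilin hP hq
  have hI2 : Measurable I2 := measurable_posBilin hp hQ
  have key : ∀ x : ℤ × ℝ, jb x.2 (-1) *
      posBilin φ (fun k k₁ => ψ k k₁ * jb (φ k k₁) (1 / 2)) p q x ≤
      4 * I0 x + 2 * (jb x.2 (-1) * I1 x) + 2 * (jb x.2 (-1) * I2 x) := by
    intro x
    simp only [I0, I1, I2, posBilin]
    rw [← lintegral_const_mul _ (by fun_prop), ← lintegral_const_mul _ (by fun_prop),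
      ← lintegral_const_mul _ (by fun_prop), ← lintegral_const_mul _ (by fun_prop),
      ← lintegral_const_mul _ (by fun_prop), ← lintegral_const_mul _ (by fun_prop),
      ← lintegral_add_left (by fun_prop), ← lintegral_add_left (by fun_prop)]
    refine lintegral_mono fun y => ?_
    calc jb x.2 (-1) * (ψ x.1 y.1 * jb (φ x.1 y.1) (1 / 2) * (p y * q (sndFreq φ x y)))
        = (jb x.2 (-1) * jb (φ x.1 y.1) (1 / 2)) *
            (ψ x.1 y.1 * (p y * q (sndFreq φ x y))) := by ring
      _ ≤ (4 * jb (φ x.1 y.1) (-(1 / 2)) +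
          2 * (jb x.2 (-1) * (jb y.2 (1 / 2) + jb (sndFreq φ x y).2 (1 / 2)))) *
            (ψ x.1 y.1 * (p y * q (sndFreq φ x y))) := by
          gcongr; exact jb_neg_one_mul_phase_le x y
      _ = _ := by simp only [P, Q]; ring
  have key2 : ∀ k : ℤ, (∫⁻ σ : ℝ, jb σ (-1) *
        posBilin φ (fun k k₁ => ψ k k₁ * jb (φ k k₁) (1 / 2)) p q (k, σ)) ^ 2 ≤
      64 * (∫⁻ σ : ℝ, I0 (k, σ)) ^ 2 + 16 * (∫⁻ σ : ℝ, jb σ (-1) * I1 (k, σ)) ^ 2 +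
        16 * (∫⁻ σ : ℝ, jb σ (-1) * I2 (k, σ)) ^ 2 := by
    intro k
    calc _ ≤ (∫⁻ σ : ℝ, (4 * I0 (k, σ) + 2 * (jb σ (-1) * I1 (k, σ)) +
            2 * (jb σ (-1) * I2 (k, σ)))) ^ 2 := by
          gcongr with σ; exact key (k, σ)
      _ = (4 * (∫⁻ σ : ℝ, I0 (k, σ)) + 2 * (∫⁻ σ : ℝ, jb σ (-1) * I1 (k, σ)) +
            2 * (∫⁻ σ : ℝ, jb σ (-1) * I2 (k, σ))) ^ 2 := by
          rw [lintegral_add_left (by fun_prop), lintegral_add_left (by fun_prop),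
            lintegral_const_mul _ (by fun_prop), lintegral_const_mul _ (by fun_prop),
            lintegral_const_mul _ (by fun_prop)]
      _ ≤ _ := add_add_sq_le _ _ _
      _ = _ := by ring
  refine (ENNReal.tsum_le_tsum key2).trans ?_
  rw [ENNReal.tsum_add, ENNReal.tsum_add, ENNReal.tsum_mul_left, ENNReal.tsum_mul_left,
    ENNReal.tsum_mul_left]
  have b0 := posBilin_phase_le hS hp hq
  have b1 := posBilin_fst_le hS hP hQ
  have b2 := posBilin_snd_le hS hP hQ
  rw [← hq'] at b1
  rw [← hp'] at b2
  have c1 := (sq_lintegral_weight_le hI1).trans (mul_le_mul_right b1 _)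
  have c2 := (sq_lintegral_weight_le hI2).trans (mul_le_mul_right b2 _)
  calc _ ≤ 64 * _ + 16 * _ + 16 * _ :=
        add_le_add (add_le_add (mul_le_mul_right b0 _) (mul_le_mul_right c1 _))
          (mul_le_mul_right c2 _)
    _ = _ := by ring

end Bilinear

/-! ### Oscillating exponentials and a cutoff in time -/

/-- The unimodular number `e^{ix}`. -/
def ee (x : ℝ) : ℂ := Complex.exp (Complex.I * x)

lemma exp_eq_ee (τ t : ℝ) : Complex.exp (Complex.I * τ * t) = ee (τ * t) := by
  unfold ee
  push_cast
  ring_nf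

lemma ee_add (x y : ℝ) : ee (x + y) = ee x * ee y := by
  unfold ee
  rw [← Complex.exp_add]
  push_cast
  ring_nf

@[simp] lemma ee_zero : ee 0 = 1 := by simp [ee]

@[simp] lemma norm_ee (x : ℝ) : ‖ee x‖ = 1 := by
  unfold ee
  rw [mul_comm, Complex.norm_exp_ofReal_mul_I]

@[simp] lemma enorm_ee (x : ℝ) : ‖ee x‖ₑ = 1 := by
  rw [← ofReal_norm, norm_ee]
  simp

lemma conj_ee (x : ℝ) : (starRingEnd ℂ) (ee x) = ee (-x) := by
  unfold ee
  rw [← Complex.exp_conj]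
  simp

lemma ee_neg_mul_ee (x : ℝ) : ee (-x) * ee x = 1 := by
  rw [← ee_add]
  simp

@[fun_prop] lemma continuous_ee : Continuous ee := by
  unfold ee
  fun_prop

@[fun_prop] lemma measurable_ee : Measurable ee := continuous_ee.measurable

lemma hasDerivAt_ee (x : ℝ) : HasDerivAt ee (Complex.I * ee x) x := by
  unfold ee
  have h : HasDerivAt (fun y : ℝ => Complex.I * (y : ℂ)) (Complex.I * 1) x :=
    (Complex.ofRealCLM.hasDerivAt (x := x)).const_mul Complex.I
  convert h.cexp using 1
  ring

lemma hasDerivAt_ee_mul (c t : ℝ) :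
    HasDerivAt (fun t => ee (c * t)) (Complex.I * c * ee (c * t)) t := by
  have h := (hasDerivAt_ee (c * t)).scomp t ((hasDerivAt_id t).const_mul c)
  refine HasDerivAt.congr_deriv (f := fun t => ee (c * t)) h ?_
  rw [Complex.real_smul]
  push_cast
  ring

open FourierTransform in
/-- The function whose inverse Fourier integral `∫ e^{iτt} · dτ` is `f`. -/
def fourierDensity (f : SchwartzMap ℝ ℂ) (τ : ℝ) : ℂ :=
  ((2 * Real.pi)⁻¹ : ℝ) * (𝓕 f) (τ / (2 * Real.pi))

lemma integral_ee_mul_fourierDensity (f : SchwartzMap ℝ ℂ) (t : ℝ) :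
    ∫ τ, ee (τ * t) * fourierDensity f τ = f t := by
  open FourierTransform in
  have h : (𝓕⁻ (𝓕 (f : ℝ → ℂ))) t = f t := by
    rw [f.continuous.fourierInv_fourier_eq f.integrable]
    rw [← SchwartzMap.fourier_coe]
    exact SchwartzMap.integrable _
  rw [← h, Real.fourierInv_eq']
  have h2 := Measure.integral_comp_div
    (fun v : ℝ => ((2 * Real.pi)⁻¹ : ℝ) * (ee (2 * Real.pi * v * t) *
      (FourierTransform.fourier f) v)) (2 * Real.pi)
  have hpi : (2 * Real.pi) ≠ 0 := by positivity
  calc _ = ∫ τ : ℝ, ((2 * Real.pi)⁻¹ : ℝ) * (ee (2 * Real.pi * (τ / (2 * Real.pi)) * t) *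
      (FourierTransform.fourier f) (τ / (2 * Real.pi))) := by
        refine integral_congr_ae (Eventually.of_forall fun τ => ?_)
        simp only [fourierDensity]
        rw [mul_div_cancel₀ _ hpi]
        ring
    _ = _ := h2
    _ = _ := by
        rw [integral_const_mul, abs_of_pos (by positivity), Complex.real_smul, ← mul_assoc,
          ← Complex.ofReal_mul, mul_inv_cancel₀ hpi, Complex.ofReal_one, one_mul]
        refine integral_congr_ae (Eventually.of_forall fun τ => ?_)
        simp only [ee, SchwartzMap.fourier_coe, smul_eq_mul, RCLike.inner_apply, conj_trivial]
        congr 2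
        push_cast
        ring

lemma exists_norm_fourierDensity_le (f : SchwartzMap ℝ ℂ) :
    ∃ C : ℝ, ∀ τ, ‖fourierDensity f τ‖ ≤ C * bracket τ ^ (-2 : ℝ) := by
  obtain ⟨C0, hC0, h0⟩ := (FourierTransform.fourier f).decay 0 0
  obtain ⟨C2, hC2, h2⟩ := (FourierTransform.fourier f).decay 2 0
  refine ⟨C0 + (2 * Real.pi) ^ 2 * C2, fun τ => ?_⟩
  have hpi : (2 * Real.pi) ≠ 0 := by positivity
  have h0' := h0 (τ / (2 * Real.pi))
  have h2' := h2 (τ / (2 * Real.pi))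
  simp only [pow_zero, norm_iteratedFDeriv_zero, one_mul, Real.norm_eq_abs, sq_abs] at h0' h2'
  set a := ‖(FourierTransform.fourier f) (τ / (2 * Real.pi))‖
  have hn : ‖fourierDensity f τ‖ ≤ a := by
    unfold fourierDensity
    rw [norm_mul]
    refine mul_le_of_le_one_left (norm_nonneg _) ?_
    rw [Complex.norm_real, Real.norm_eq_abs, abs_of_pos (by positivity)]
    exact inv_le_one_of_one_le₀ (by linarith [Real.pi_gt_three])
  rw [Real.rpow_neg (bracket_pos τ).le, Real.rpow_ofNat, ← div_eq_mul_inv, bracket_sq,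
    le_div_iff₀ (by positivity)]
  have : τ ^ 2 * a ≤ (2 * Real.pi) ^ 2 * C2 := by
    have : τ ^ 2 * a = (2 * Real.pi) ^ 2 * ((τ / (2 * Real.pi)) ^ 2 * a) := by
      field_simp
    rw [this]
    gcongr
  nlinarith [sq_nonneg τ]

lemma fourierDensity_neg {f : SchwartzMap ℝ ℂ} (hf : ∀ t, (starRingEnd ℂ) (f t) = f t) (τ : ℝ) :
    fourierDensity f (-τ) = (starRingEnd ℂ) (fourierDensity f τ) := by
  unfold fourierDensity
  rw [map_mul, Complex.conj_ofReal, SchwartzMap.fourier_coe, Real.fourier_eq', Real.fourier_eq',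
    ← integral_conj]
  congr 2
  ext v
  simp only [smul_eq_mul, map_mul, hf, ← Complex.exp_conj]
  simp
  ring_nf
  simp

lemma continuous_fourierDensity (f : SchwartzMap ℝ ℂ) : Continuous (fourierDensity f) := by
  unfold fourierDensity
  have := (FourierTransform.fourier f).continuous
  fun_prop

lemma hasDerivAt_fourierDensity {f f₁ : SchwartzMap ℝ ℂ} (h : ∀ t, f₁ t = t * f t) (τ : ℝ) :
    HasDerivAt (fourierDensity f) (-Complex.I * fourierDensity f₁ τ) τ := by
  have h1 := Real.hasDerivAt_fourier f.integrable (by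
    have : (fun x : ℝ => x • f x) = f₁ := by
      ext x
      rw [h, Complex.real_smul]
    rw [this]
    exact f₁.integrable) (τ / (2 * Real.pi))
  have e : FourierTransform.fourier (fun x : ℝ => (-2 * ↑Real.pi * Complex.I * ↑x) • f x)
      (τ / (2 * Real.pi)) = -2 * Real.pi * Complex.I *
        FourierTransform.fourier f₁ (τ / (2 * Real.pi)) := by
    rw [SchwartzMap.fourier_coe, Real.fourier_eq', Real.fourier_eq', ← integral_const_mul]
    congr 1
    ext v
    rw [h]
    simp only [smul_eq_mul]
    ring
  rw [e] at h1
  have h2 := (h1.scomp τ ((hasDerivAt_id τ).div_const (2 * Real.pi))).const_mul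
    (((2 * Real.pi)⁻¹ : ℝ) : ℂ)
  unfold fourierDensity
  rw [SchwartzMap.fourier_coe f]
  refine HasDerivAt.congr_deriv
    (f := fun τ => ((2 * Real.pi)⁻¹ : ℝ) * FourierTransform.fourier (⇑f) (τ / (2 * Real.pi))) h2 ?_
  have hpi : (Real.pi : ℂ) ≠ 0 := by exact_mod_cast Real.pi_ne_zero
  rw [Complex.real_smul]
  push_cast
  field_simp

/-- A pair of functions whose inverse Fourier integrals are `η(t)` and `tη(t)` with a cutoff `η`
that is `1` on `[0, 1]`. -/
structure IsCutoff (κ lam : ℝ → ℂ) (C : ℝ) : Prop where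
  cont : Continuous κ
  cont' : Continuous lam
  deriv : ∀ τ, HasDerivAt κ (-Complex.I * lam τ) τ
  decay : ∀ τ, ‖κ τ‖ ≤ C * bracket τ ^ (-2 : ℝ)
  decay' : ∀ τ, ‖lam τ‖ ≤ C * bracket τ ^ (-2 : ℝ)
  inv : ∀ t ∈ Icc (0 : ℝ) 1, ∫ τ, ee (τ * t) * κ τ = 1
  inv' : ∀ t ∈ Icc (0 : ℝ) 1, ∫ τ, ee (τ * t) * lam τ = t
  refl : ∀ τ, κ (-τ) = (starRingEnd ℂ) (κ τ)
  refl' : ∀ τ, lam (-τ) = (starRingEnd ℂ) (lam τ)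

lemma exists_isCutoff : ∃ (κ lam : ℝ → ℂ) (C : ℝ), IsCutoff κ lam C := by
  -- The bump is real, which gives the conjugation symmetry of both transforms, and it equals 1 on
  -- the ball of radius 1.
  let η : ContDiffBump (0 : ℝ) := ⟨1, 2, one_pos, one_lt_two⟩
  have hη : ∀ t ∈ Icc (0 : ℝ) 1, η t = 1 := by
    intro t ht
    apply η.one_of_mem_closedBall
    rw [mem_closedBall_zero_iff, Real.norm_eq_abs, abs_of_nonneg ht.1]
    exact ht.2
  have hs : HasCompactSupport (fun t => (η t : ℂ)) :=
    η.hasCompactSupport.comp_left (g := fun x : ℝ => (x : ℂ)) (by simp)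
  have hd : ContDiff ℝ ((⊤ : ℕ∞) : WithTop ℕ∞) (fun t => (η t : ℂ)) :=
    Complex.ofRealCLM.contDiff.comp η.contDiff
  have hs' : HasCompactSupport (fun t : ℝ => (t : ℂ) * (η t : ℂ)) := hs.mul_left
  have hd' : ContDiff ℝ ((⊤ : ℕ∞) : WithTop ℕ∞) (fun t : ℝ => (t : ℂ) * (η t : ℂ)) :=
    Complex.ofRealCLM.contDiff.mul hd
  let f := hs.toSchwartzMap hd
  let f₁ := hs'.toSchwartzMap hd'
  have hf : ∀ t, f t = η t := fun t => rfl
  have hf₁ : ∀ t, f₁ t = t * η t := fun t => rfl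
  obtain ⟨C, hC⟩ := exists_norm_fourierDensity_le f
  obtain ⟨C', hC'⟩ := exists_norm_fourierDensity_le f₁
  have hb : ∀ τ, 0 ≤ bracket τ ^ (-2 : ℝ) := fun τ => Real.rpow_nonneg (bracket_pos τ).le _
  refine ⟨fourierDensity f, fourierDensity f₁, max C C', continuous_fourierDensity f,
    continuous_fourierDensity f₁, hasDerivAt_fourierDensity (fun t => by rw [hf, hf₁]),
    fun τ => (hC τ).trans (mul_le_mul_of_nonneg_right (le_max_left _ _) (hb τ)),
    fun τ => (hC' τ).trans (mul_le_mul_of_nonneg_right (le_max_right _ _) (hb τ)), ?_, ?_,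
    fourierDensity_neg (by simp [hf]), fourierDensity_neg (by simp [hf₁])⟩
  · intro t ht
    rw [integral_ee_mul_fourierDensity, hf, hη t ht, Complex.ofReal_one]
  · intro t ht
    rw [integral_ee_mul_fourierDensity, hf₁, hη t ht, Complex.ofReal_one, mul_one]

/-! ### The kernel of the truncated Duhamel integral -/

/-- The Fourier transform of a fixed cutoff in time. -/
def cutK : ℝ → ℂ := exists_isCutoff.choose

/-- The Fourier transform of `t` times the cutoff. -/
def cutL : ℝ → ℂ := exists_isCutoff.choose_spec.choose

/-- A constant in the decay estimates of `cutK` and `cutL`. -/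
def cutC : ℝ := exists_isCutoff.choose_spec.choose_spec.choose

lemma isCutoff : IsCutoff cutK cutL cutC :=
  exists_isCutoff.choose_spec.choose_spec.choose_spec

@[fun_prop] lemma continuous_cutK : Continuous cutK := isCutoff.cont

@[fun_prop] lemma continuous_cutL : Continuous cutL := isCutoff.cont'

@[fun_prop] lemma measurable_cutK : Measurable cutK := continuous_cutK.measurable

@[fun_prop] lemma measurable_cutL : Measurable cutL := continuous_cutL.measurable

lemma cutC_nonneg : 0 ≤ cutC := by
  have := isCutoff.decay 0
  have h1 : bracket 0 = 1 := by simp [bracket]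
  rw [h1, Real.one_rpow, mul_one] at this
  exact (norm_nonneg _).trans this

lemma enorm_le_jb_of_norm_le {z : ℂ} {C x r : ℝ} (hC : 0 ≤ C) (h : ‖z‖ ≤ C * bracket x ^ r) :
    ‖z‖ₑ ≤ ENNReal.ofReal C * jb x r := by
  rw [← ofReal_norm, jb, ← ENNReal.ofReal_mul hC]
  exact ENNReal.ofReal_le_ofReal h

lemma enorm_cutK_le (τ : ℝ) : ‖cutK τ‖ₑ ≤ ENNReal.ofReal cutC * jb τ (-2) :=
  enorm_le_jb_of_norm_le cutC_nonneg (isCutoff.decay τ)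

lemma integrable_of_enorm_le_jb {f : ℝ → ℂ} (hf : Measurable f) {C : ℝ≥0∞} (hC : C ≠ ⊤) {r : ℝ}
    (hr : 1 < r) (h : ∀ τ, ‖f τ‖ₑ ≤ C * jb τ (-r)) : Integrable f := by
  refine ⟨hf.aestronglyMeasurable, ?_⟩
  refine lt_of_le_of_lt (lintegral_mono h) ?_
  rw [lintegral_const_mul _ (by fun_prop)]
  exact ENNReal.mul_lt_top hC.lt_top (lintegral_jb_lt_top hr)

lemma integrable_cutK : Integrable cutK :=
  integrable_of_enorm_le_jb (by fun_prop) ENNReal.ofReal_ne_top one_lt_two enorm_cutK_le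

/-- The Fourier transform of `η(t) ∫₀ᵗ e^{iσr} dr` with the cutoff `η`. -/
def kerK (τ σ : ℝ) : ℂ :=
  -- The value at σ = 0 is the limit of the quotient, because the derivative of `cutK` is -i times
  -- `cutL`.
  if σ = 0 then cutL τ else (cutK (τ - σ) - cutK τ) / (Complex.I * σ)

lemma measurable_kerK : Measurable (Function.uncurry kerK) := by
  unfold kerK Function.uncurry
  refine Measurable.ite (measurableSet_eq_fun measurable_snd measurable_const) ?_ ?_ <;> fun_prop

@[fun_prop] lemma Measurable.kerK {α : Type*} [MeasurableSpace α] {f g : α → ℝ}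
    (hf : Measurable f) (hg : Measurable g) : Measurable fun x => DSW.kerK (f x) (g x) :=
  measurable_kerK.comp (hf.prodMk hg)

lemma kerK_neg (τ σ : ℝ) : kerK (-τ) (-σ) = (starRingEnd ℂ) (kerK τ σ) := by
  unfold kerK
  by_cases h : σ = 0
  · simp [h, isCutoff.refl']
  · simp only [neg_eq_zero, h, if_false]
    rw [show -τ - -σ = -(τ - σ) by ring, isCutoff.refl, isCutoff.refl]
    simp

/-- The mean value inequality on the unit ball around τ, on which ⟨·⟩^{-2} is comparable to its
value at the centre. -/
lemma norm_cutK_sub_le {τ σ : ℝ} (h : |σ| ≤ 1) :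
    ‖cutK (τ - σ) - cutK τ‖ ≤ 16 * cutC * bracket τ ^ (-2 : ℝ) * |σ| := by
  have h1 := Convex.norm_image_sub_le_of_norm_hasDerivWithin_le (𝕜 := ℝ)
    (f := cutK) (f' := fun τ => -Complex.I * cutL τ) (s := Metric.closedBall τ 1)
    (x := τ) (y := τ - σ) (C := 16 * cutC * bracket τ ^ (-2 : ℝ))
    (fun x _ => (isCutoff.deriv x).hasDerivWithinAt) ?_ (convex_closedBall τ 1)
    (Metric.mem_closedBall_self zero_le_one) (by simpa [Real.dist_eq] using h)
  · simpa using h1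
  · intro x hx
    rw [Metric.mem_closedBall, Real.dist_eq] at hx
    rw [norm_mul, norm_neg, Complex.norm_I, one_mul]
    refine (isCutoff.decay' x).trans ?_
    have h2 : bracket τ ≤ 4 * bracket x := by
      have h3 := bracket_add_le x (τ - x)
      have h4 := bracket_le_one_add_abs (τ - x)
      rw [abs_sub_comm] at hx
      have h5 := one_le_bracket x
      rw [add_sub_cancel] at h3
      linarith
    have h3 : bracket x ^ (-2 : ℝ) ≤ 16 * bracket τ ^ (-2 : ℝ) := by
      rw [Real.rpow_neg (bracket_pos x).le, Real.rpow_neg (bracket_pos τ).le, Real.rpow_ofNat,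
        Real.rpow_ofNat, ← div_eq_mul_inv, le_div_iff₀ (pow_pos (bracket_pos τ) 2),
        inv_mul_le_iff₀ (pow_pos (bracket_pos x) 2)]
      nlinarith [bracket_pos τ, bracket_pos x]
    calc cutC * bracket x ^ (-2 : ℝ) ≤ cutC * (16 * bracket τ ^ (-2 : ℝ)) := by
          gcongr; exact cutC_nonneg
      _ = _ := by ring

/-- For |σ| ≤ 1 the difference of the two values of `cutK` cancels the singularity 1/σ. For |σ| > 1
there is nothing to cancel, and 1/|σ| is comparable to ⟨σ⟩⁻¹. -/
lemma norm_kerK_le (τ σ : ℝ) : ‖kerK τ σ‖ ≤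
    (32 * cutC) * (bracket σ ^ (-1 : ℝ) * (bracket (τ - σ) ^ (-2 : ℝ) + bracket τ ^ (-2 : ℝ))) := by
  have hC := cutC_nonneg
  have hb : ∀ τ, 0 ≤ bracket τ ^ (-2 : ℝ) := fun τ => Real.rpow_nonneg (bracket_pos τ).le _
  have ht := hb τ
  have hts := hb (τ - σ)
  rw [Real.rpow_neg_one]
  by_cases h1 : |σ| ≤ 1
  · have h2 : (1 : ℝ) / 2 ≤ (bracket σ)⁻¹ := by
      rw [one_div]
      exact inv_anti₀ (bracket_pos σ) ((bracket_le_one_add_abs σ).trans (by linarith))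
    have h3 : ‖kerK τ σ‖ ≤ 16 * cutC * bracket τ ^ (-2 : ℝ) := by
      unfold kerK
      split_ifs with h
      · refine (isCutoff.decay' τ).trans ?_
        nlinarith [mul_nonneg hC ht]
      · rw [norm_div, norm_mul, Complex.norm_I, one_mul, Complex.norm_real, Real.norm_eq_abs,
          div_le_iff₀ (abs_pos.2 h)]
        exact norm_cutK_sub_le h1
    calc ‖kerK τ σ‖ ≤ 16 * cutC * bracket τ ^ (-2 : ℝ) := h3
      _ = (32 * cutC) * (1 / 2 * bracket τ ^ (-2 : ℝ)) := by ring
      _ ≤ _ := by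
        gcongr
        linarith
  · push Not at h1
    have h0 : σ ≠ 0 := by rintro rfl; norm_num at h1
    have h2 : bracket σ ≤ 2 * |σ| := (bracket_le_one_add_abs σ).trans (by linarith)
    have h3 : |σ|⁻¹ ≤ 2 * (bracket σ)⁻¹ := by
      rw [inv_le_iff_one_le_mul₀ (by positivity)]
      have := bracket_pos σ
      field_simp
      linarith
    unfold kerK
    rw [if_neg h0, norm_div, norm_mul, Complex.norm_I, one_mul, Complex.norm_real,
      Real.norm_eq_abs]
    calc ‖cutK (τ - σ) - cutK τ‖ / |σ|
        ≤ (cutC * bracket (τ - σ) ^ (-2 : ℝ) + cutC * bracket τ ^ (-2 : ℝ)) * (2 * (bracket σ)⁻¹) := by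
          rw [div_eq_mul_inv]
          gcongr
          exact (norm_sub_le _ _).trans (add_le_add (isCutoff.decay _) (isCutoff.decay _))
      _ = (2 * cutC) * ((bracket σ)⁻¹ * (bracket (τ - σ) ^ (-2 : ℝ) + bracket τ ^ (-2 : ℝ))) := by
          ring
      _ ≤ _ := by
          have := (inv_pos.2 (bracket_pos σ)).le
          gcongr
          norm_num

/-- The constant in the kernel estimate. -/
def kerC : ℝ≥0∞ := ENNReal.ofReal (32 * cutC)

lemma kerC_ne_top : kerC ≠ ⊤ := ENNReal.ofReal_ne_top

lemma enorm_kerK_le (τ σ : ℝ) :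
    ‖kerK τ σ‖ₑ ≤ kerC * (jb σ (-1) * (jb (τ - σ) (-2) + jb τ (-2))) := by
  have hC := cutC_nonneg
  have hb : ∀ (τ r : ℝ), 0 ≤ bracket τ ^ r := fun τ r => Real.rpow_nonneg (bracket_pos τ).le _
  unfold kerC jb
  rw [← ENNReal.ofReal_add (hb _ _) (hb _ _), ← ENNReal.ofReal_mul (hb _ _),
    ← ENNReal.ofReal_mul (by positivity), ← ofReal_norm]
  exact ENNReal.ofReal_le_ofReal (norm_kerK_le τ σ)

lemma enorm_kerK_le_const (τ σ : ℝ) : ‖kerK τ σ‖ₑ ≤ 2 * kerC := by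
  refine (enorm_kerK_le τ σ).trans ?_
  rw [mul_comm]
  refine mul_le_mul_left ?_ _
  calc jb σ (-1) * (jb (τ - σ) (-2) + jb τ (-2)) ≤ 1 * (1 + 1) := by
        gcongr <;> exact jb_le_one _ (by norm_num)
    _ = 2 := by norm_num

lemma norm_kerK_le_const (τ σ : ℝ) : ‖kerK τ σ‖ ≤ (2 * kerC).toReal := by
  rw [← toReal_enorm]
  exact ENNReal.toReal_mono (ENNReal.mul_ne_top (by norm_num) kerC_ne_top)
    (enorm_kerK_le_const τ σ)

lemma lintegral_enorm_kerK_le (σ : ℝ) :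
    ∫⁻ τ, ‖kerK τ σ‖ₑ ≤ kerC * (2 * ∫⁻ τ : ℝ, jb τ (-2)) := by
  calc ∫⁻ τ, ‖kerK τ σ‖ₑ ≤ ∫⁻ τ, kerC * (jb (τ - σ) (-2) + jb τ (-2)) := by
        refine lintegral_mono fun τ => (enorm_kerK_le τ σ).trans ?_
        gcongr
        exact mul_le_of_le_one_left' (jb_le_one _ (by norm_num))
    _ = _ := by
        rw [lintegral_const_mul _ (by fun_prop), lintegral_add_left (by fun_prop),
          lintegral_sub_right_eq_self (fun τ => jb τ (-2)), two_mul]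

/-- On [0, 1] the cutoff is 1, so `cutK` inverts to 1 and its translate by σ inverts to e^{iσt}. The
quotient is therefore the primitive of the exponential. -/
lemma integral_ee_mul_kerK {t : ℝ} (ht : t ∈ Icc (0 : ℝ) 1) (σ : ℝ) :
    ∫ τ, ee (τ * t) * kerK τ σ = ∫ r in (0 : ℝ)..t, ee (σ * r) := by
  unfold kerK
  by_cases h : σ = 0
  · simp only [h, if_true, zero_mul, ee_zero, intervalIntegral.integral_const, sub_zero]
    rw [isCutoff.inv' t ht]
    simp
  · simp only [h, if_false]
    have hInt : ∀ c : ℝ, Integrable fun τ : ℝ => ee (τ * t) * cutK (τ - c) := by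
      intro c
      refine Integrable.bdd_mul (c := 1) (integrable_cutK.comp_sub_right c) ?_ ?_
      · exact (Measurable.aestronglyMeasurable (by fun_prop))
      · simp
    have e1 : ∫ τ, ee (τ * t) * cutK (τ - σ) = ee (σ * t) := by
      have := integral_sub_right_eq_self (fun τ => ee ((τ + σ) * t) * cutK τ) (μ := volume) σ
      simp only [sub_add_cancel] at this
      rw [this]
      have : ∀ τ, ee ((τ + σ) * t) * cutK τ = ee (σ * t) * (ee (τ * t) * cutK τ) := by
        intro τ
        rw [add_mul, ee_add]
        ring
      simp_rw [this]
      rw [integral_const_mul, isCutoff.inv t ht, mul_one]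
    have e2 : ∫ τ, ee (τ * t) * ((cutK (τ - σ) - cutK τ) / (Complex.I * σ)) =
        (ee (σ * t) - 1) / (Complex.I * σ) := by
      have : ∀ τ, ee (τ * t) * ((cutK (τ - σ) - cutK τ) / (Complex.I * σ)) =
          (ee (τ * t) * cutK (τ - σ) - ee (τ * t) * cutK τ) / (Complex.I * σ) := by
        intro τ; ring
      simp_rw [this]
      rw [integral_div, integral_sub (hInt σ) (by simpa using hInt 0), e1, isCutoff.inv t ht]
    rw [e2]
    have hσ : (Complex.I * σ : ℂ) ≠ 0 := by simp [h]
    have e3 : ∫ r in (0 : ℝ)..t, Complex.I * σ * ee (σ * r) = ee (σ * t) - ee (σ * 0) :=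
      intervalIntegral.integral_eq_sub_of_hasDerivAt (fun r _ => hasDerivAt_ee_mul σ r)
        (Continuous.intervalIntegrable (by fun_prop) _ _)
    rw [intervalIntegral.integral_const_mul] at e3
    rw [mul_zero, ee_zero] at e3
    rw [div_eq_iff hσ, ← e3, mul_comm]

lemma continuousAt_kerK (τ : ℝ) {σ : ℝ} (h : σ ≠ 0) : ContinuousAt (kerK τ) σ := by
  have h1 : ContinuousAt (fun σ : ℝ => (cutK (τ - σ) - cutK τ) / (Complex.I * σ)) σ := by
    refine ContinuousAt.div (by fun_prop) (by fun_prop) (by simp [h])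
  refine h1.congr ?_
  filter_upwards [isOpen_ne.mem_nhds h] with x hx
  unfold kerK
  rw [if_neg hx]

/-! ### Linear estimates -/

/-- The integral operator with the majorant of `kerK` as kernel. -/
def posDuhamel (G : ℝ → ℝ≥0∞) (τ : ℝ) : ℝ≥0∞ :=
  ∫⁻ σ, jb σ (-1) * (jb (τ - σ) (-2) + jb τ (-2)) * G σ

lemma lintegral_posDuhamel_le {G : ℝ → ℝ≥0∞} (hG : Measurable G) :
    ∫⁻ τ, posDuhamel G τ ≤ 2 * (∫⁻ τ : ℝ, jb τ (-2)) * ∫⁻ σ, jb σ (-1) * G σ := by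
  unfold posDuhamel
  rw [lintegral_lintegral_swap (by unfold Function.uncurry; fun_prop),
    ← lintegral_const_mul _ (by fun_prop)]
  apply le_of_eq
  refine lintegral_congr fun σ => ?_
  have : ∀ τ, jb σ (-1) * (jb (τ - σ) (-2) + jb τ (-2)) * G σ =
      (jb σ (-1) * G σ) * (jb (τ - σ) (-2) + jb τ (-2)) := fun τ => by ring
  simp_rw [this]
  rw [lintegral_const_mul _ (by fun_prop), lintegral_add_left (by fun_prop),
    lintegral_sub_right_eq_self (fun τ => jb τ (-2))]
  ring

/-- Young's inequality `‖w * H‖₂ ≤ ‖w‖₁ ‖H‖₂`, squared. -/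
lemma lintegral_sq_conv_le {w H : ℝ → ℝ≥0∞} (hw : Measurable w) (hH : Measurable H) :
    ∫⁻ τ, (∫⁻ σ, w (τ - σ) * H σ) ^ 2 ≤ (∫⁻ τ, w τ) ^ 2 * ∫⁻ σ, H σ ^ 2 := by
  have h1 : ∀ τ, (∫⁻ σ, w (τ - σ) * H σ) ^ 2 ≤
      (∫⁻ τ, w τ) * ∫⁻ σ, w (τ - σ) * H σ ^ 2 := by
    intro τ
    -- One half of w goes to each factor of Cauchy–Schwarz.
    have h2 := sq_lintegral_mul_le (μ := volume) (f := fun σ => w (τ - σ) ^ (1 / 2 : ℝ))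
      (g := fun σ => w (τ - σ) ^ (1 / 2 : ℝ) * H σ) (by fun_prop) (by fun_prop)
    have e : ∀ x : ℝ≥0∞, (x ^ (1 / 2 : ℝ)) ^ 2 = x := by
      intro x
      rw [← ENNReal.rpow_natCast, ← ENNReal.rpow_mul]
      norm_num
    simp only [← mul_assoc, ← sq, mul_pow, e] at h2
    rwa [lintegral_sub_left_eq_self (fun σ => w σ)] at h2
  refine (lintegral_mono h1).trans (le_of_eq ?_)
  have hm : Measurable fun τ => ∫⁻ σ, w (τ - σ) * H σ ^ 2 :=
    Measurable.lintegral_prod_right' (f := fun z : ℝ × ℝ => w (z.1 - z.2) * H z.2 ^ 2)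
      (by fun_prop)
  rw [lintegral_const_mul _ hm, lintegral_lintegral_swap (by unfold Function.uncurry; fun_prop)]
  have : ∀ σ, ∫⁻ τ, w (τ - σ) * H σ ^ 2 = (∫⁻ τ, w τ) * H σ ^ 2 := by
    intro σ
    rw [lintegral_mul_const _ (by fun_prop), lintegral_sub_right_eq_self (fun τ => w τ)]
  simp_rw [this]
  rw [lintegral_const_mul _ (by fun_prop), sq, mul_assoc]

/-- The kernel has two parts. The one with ⟨τ - σ⟩^{-2} is a convolution: ⟨τ⟩^{1/2} ≤ 2⟨τ -
σ⟩^{1/2}⟨σ⟩^{1/2}, then Young's inequality. The one with ⟨τ⟩^{-2} has rank one and sees G only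
through ∫⟨σ⟩⁻¹G, which is why the L¹ estimate is needed even for the H^{1/2} norm. -/
lemma lintegral_sq_posDuhamel_le {G : ℝ → ℝ≥0∞} (hG : Measurable G) :
    ∫⁻ τ, jb τ 1 * posDuhamel G τ ^ 2 ≤
      8 * (∫⁻ τ : ℝ, jb τ (-(3 / 2))) ^ 2 * (∫⁻ σ, jb σ (-1) * G σ ^ 2) +
      2 * (∫⁻ τ : ℝ, jb τ (-3)) * (∫⁻ σ, jb σ (-1) * G σ) ^ 2 := by
  set A := ∫⁻ σ, jb σ (-1) * G σ
  set B : ℝ → ℝ≥0∞ := fun τ => ∫⁻ σ, jb (τ - σ) (-(3 / 2)) * (jb σ (-(1 / 2)) * G σ)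
  have hB : Measurable B :=
    Measurable.lintegral_prod_right'
      (f := fun z : ℝ × ℝ => jb (z.1 - z.2) (-(3 / 2)) * (jb z.2 (-(1 / 2)) * G z.2))
      (by fun_prop)
  have h1 : ∀ τ, jb τ (1 / 2) * posDuhamel G τ ≤ 2 * B τ + jb τ (-(3 / 2)) * A := by
    intro τ
    unfold posDuhamel
    simp only [B, A]
    rw [← lintegral_const_mul _ (by fun_prop), ← lintegral_const_mul _ (by fun_prop),
      ← lintegral_const_mul _ (by fun_prop), ← lintegral_add_left (by fun_prop)]
    refine lintegral_mono fun σ => ?_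
    have h2 : jb τ (1 / 2) ≤ 2 * (jb (τ - σ) (1 / 2) * jb σ (1 / 2)) := by
      have := jb_add_le_mul (τ - σ) σ (r := 1 / 2) (by norm_num) (by norm_num)
      simpa using this
    calc jb τ (1 / 2) * (jb σ (-1) * (jb (τ - σ) (-2) + jb τ (-2)) * G σ)
        = jb τ (1 / 2) * (jb σ (-1) * jb (τ - σ) (-2) * G σ) +
            (jb τ (1 / 2) * jb τ (-2)) * (jb σ (-1) * G σ) := by ring
      _ ≤ 2 * (jb (τ - σ) (1 / 2) * jb σ (1 / 2)) * (jb σ (-1) * jb (τ - σ) (-2) * G σ) +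
            (jb τ (1 / 2) * jb τ (-2)) * (jb σ (-1) * G σ) := by gcongr
      _ = 2 * ((jb (τ - σ) (1 / 2) * jb (τ - σ) (-2)) * ((jb σ (1 / 2) * jb σ (-1)) * G σ)) +
            (jb τ (1 / 2) * jb τ (-2)) * (jb σ (-1) * G σ) := by ring
      _ = _ := by simp only [jb_mul]; norm_num
  have h3 : ∀ τ, jb τ 1 * posDuhamel G τ ^ 2 ≤ 8 * B τ ^ 2 + 2 * (jb τ (-3) * A ^ 2) := by
    intro τ
    calc jb τ 1 * posDuhamel G τ ^ 2 = (jb τ (1 / 2) * posDuhamel G τ) ^ 2 := by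
          rw [mul_pow, jb_pow_two]; norm_num
      _ ≤ (2 * B τ + jb τ (-(3 / 2)) * A) ^ 2 := by gcongr; exact h1 τ
      _ ≤ 2 * ((2 * B τ) ^ 2 + (jb τ (-(3 / 2)) * A) ^ 2) := add_sq_le_two_mul _ _
      _ = _ := by rw [mul_pow, mul_pow, jb_pow_two]; norm_num; ring
  refine (lintegral_mono h3).trans ?_
  rw [lintegral_add_left (by fun_prop), lintegral_const_mul _ (by fun_prop),
    lintegral_const_mul _ (by fun_prop), lintegral_mul_const _ (by fun_prop)]
  have h4 := lintegral_sq_conv_le (w := fun τ => jb τ (-(3 / 2)))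
    (H := fun σ => jb σ (-(1 / 2)) * G σ) (by fun_prop) (by fun_prop)
  have h5 : ∀ σ, (jb σ (-(1 / 2)) * G σ) ^ 2 = jb σ (-1) * G σ ^ 2 := by
    intro σ
    rw [mul_pow, jb_pow_two]
    norm_num
  simp_rw [h5] at h4
  calc _ ≤ 8 * _ + _ := add_le_add_left (mul_le_mul_right h4 8) _
    _ = _ := by ring

/-! ### The norm on the Fourier side and the bilinear Duhamel operator -/

/-- The square of the norm of `ℓ² H^{1/2}` on the Fourier side. -/
def sqX2 (p : ℤ → ℝ → ℂ) : ℝ≥0∞ := ∑' k : ℤ, ∫⁻ σ : ℝ, jb σ 1 * ‖p k σ‖ₑ ^ 2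

/-- The square of the norm of `ℓ² L¹`. -/
def sqX1 (p : ℤ → ℝ → ℂ) : ℝ≥0∞ := ∑' k : ℤ, (∫⁻ σ : ℝ, ‖p k σ‖ₑ) ^ 2

/-- The norm of `ℓ² H^{1/2} ∩ ℓ² L¹` on the Fourier side. -/
def zn (p : ℤ → ℝ → ℂ) : ℝ≥0∞ := sqX2 p ^ (1 / 2 : ℝ) + sqX1 p ^ (1 / 2 : ℝ)

lemma rpow_half_sq (x : ℝ≥0∞) : (x ^ (1 / 2 : ℝ)) ^ 2 = x := by
  rw [← ENNReal.rpow_natCast, ← ENNReal.rpow_mul]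
  norm_num

lemma sq_rpow_half (x : ℝ≥0∞) : (x ^ 2) ^ (1 / 2 : ℝ) = x := by
  rw [← ENNReal.rpow_natCast, ← ENNReal.rpow_mul]
  norm_num

lemma rpow_half_le_iff {x y : ℝ≥0∞} : x ^ (1 / 2 : ℝ) ≤ y ↔ x ≤ y ^ 2 := by
  constructor
  · intro h
    rw [← rpow_half_sq x]
    gcongr
  · intro h
    rw [← sq_rpow_half y]
    gcongr

lemma rpow_half_lt_top {x : ℝ≥0∞} : x ^ (1 / 2 : ℝ) < ⊤ ↔ x < ⊤ := by
  rw [ENNReal.rpow_lt_top_iff_of_pos (by norm_num)]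

lemma sqX1_le_zn_sq (p : ℤ → ℝ → ℂ) : sqX1 p ≤ zn p ^ 2 :=
  rpow_half_le_iff.1 (le_add_left le_rfl)

lemma sqX2_le_zn_sq (p : ℤ → ℝ → ℂ) : sqX2 p ≤ zn p ^ 2 :=
  rpow_half_le_iff.1 (le_add_right le_rfl)

lemma zn_le_of_sq_le {p : ℤ → ℝ → ℂ} {A : ℝ≥0∞} (h2 : sqX2 p ≤ A ^ 2) (h1 : sqX1 p ≤ A ^ 2) :
    zn p ≤ 2 * A := by
  rw [two_mul]
  exact add_le_add (rpow_half_le_iff.2 h2) (rpow_half_le_iff.2 h1)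

lemma zn_lt_top_iff {p : ℤ → ℝ → ℂ} : zn p < ⊤ ↔ sqX2 p < ⊤ ∧ sqX1 p < ⊤ := by
  rw [zn, ENNReal.add_lt_top, rpow_half_lt_top, rpow_half_lt_top]

lemma lintegral_enorm_lt_top {p : ℤ → ℝ → ℂ} (h : sqX1 p < ⊤) (k : ℤ) :
    ∫⁻ σ, ‖p k σ‖ₑ < ⊤ := by
  have h1 : (∫⁻ σ, ‖p k σ‖ₑ) ^ 2 ≤ sqX1 p := ENNReal.le_tsum (f := fun k => (∫⁻ σ, ‖p k σ‖ₑ) ^ 2) k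
  have h2 := lt_of_le_of_lt h1 h
  by_contra h3
  rw [not_lt, top_le_iff] at h3
  rw [h3] at h2
  simp at h2

lemma integrable_of_sqX1 {p : ℤ → ℝ → ℂ} (hp : ∀ k, Measurable (p k)) (h : sqX1 p < ⊤) (k : ℤ) :
    Integrable (p k) :=
  ⟨(hp k).aestronglyMeasurable, lintegral_enorm_lt_top h k⟩

lemma sq_tsum_mul_le (a b : ℤ → ℝ≥0∞) :
    (∑' k, a k * b k) ^ 2 ≤ (∑' k, a k ^ 2) * ∑' k, b k ^ 2 := by
  have h := sq_lintegral_mul_le (μ := (Measure.count : Measure ℤ)) (f := a) (g := b)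
    (measurable_of_countable _).aemeasurable (measurable_of_countable _).aemeasurable
  simpa only [lintegral_count] using h

lemma tsum_conv_sq_le (a b : ℤ → ℝ≥0∞) (k : ℤ) :
    (∑' k₁, a k₁ * b (k - k₁)) ^ 2 ≤ (∑' k, a k ^ 2) * ∑' k, b k ^ 2 := by
  refine (sq_tsum_mul_le a fun k₁ => b (k - k₁)).trans (le_of_eq ?_)
  congr 1
  exact (Equiv.subLeft k).tsum_eq (fun k => b k ^ 2)

/-- The measure on the frequencies `(k₁, σ₁, σ₂)` of the two factors of a product. -/
abbrev haarZRR : Measure (ℤ × ℝ × ℝ) := (Measure.count : Measure ℤ).prod volume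

/-- The product of two factors at the output frequency `k`. -/
def tensor (p q : ℤ → ℝ → ℂ) (k : ℤ) (y : ℤ × ℝ × ℝ) : ℂ := p y.1 y.2.1 * q (k - y.1) y.2.2

lemma measurable_tensor {p q : ℤ → ℝ → ℂ} (hp : ∀ k, Measurable (p k))
    (hq : ∀ k, Measurable (q k)) (k : ℤ) : Measurable (tensor p q k) := by
  unfold tensor
  refine measurable_from_prod_countable_right fun k₁ => ?_
  exact ((hp k₁).comp measurable_fst).mul ((hq (k - k₁)).comp measurable_snd)

lemma lintegral_haarZRR {f : ℤ × ℝ × ℝ → ℝ≥0∞} (hf : Measurable f) :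
    ∫⁻ y, f y ∂haarZRR = ∑' k : ℤ, ∫⁻ σ : ℝ, ∫⁻ σ' : ℝ, f (k, σ, σ') := by
  rw [lintegral_prod _ hf.aemeasurable, lintegral_count]
  refine tsum_congr fun k => ?_
  rw [Measure.volume_eq_prod, lintegral_prod _ (by fun_prop)]

lemma lintegral_enorm_tensor {p q : ℤ → ℝ → ℂ} (hp : ∀ k, Measurable (p k))
    (hq : ∀ k, Measurable (q k)) (k : ℤ) :
    ∫⁻ y, ‖tensor p q k y‖ₑ ∂haarZRR =
      ∑' k₁, (∫⁻ σ, ‖p k₁ σ‖ₑ) * ∫⁻ σ, ‖q (k - k₁) σ‖ₑ := by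
  have := measurable_tensor hp hq k
  rw [lintegral_haarZRR (by fun_prop)]
  refine tsum_congr fun k₁ => ?_
  have := hp k₁
  have := hq (k - k₁)
  simp only [tensor, enorm_mul]
  have : ∀ σ, ∫⁻ σ', ‖p k₁ σ‖ₑ * ‖q (k - k₁) σ'‖ₑ = ‖p k₁ σ‖ₑ * ∫⁻ σ', ‖q (k - k₁) σ'‖ₑ :=
    fun σ => lintegral_const_mul _ (by fun_prop)
  simp_rw [this]
  rw [lintegral_mul_const _ (by fun_prop)]

lemma integrable_tensor {p q : ℤ → ℝ → ℂ} (hp : ∀ k, Measurable (p k))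
    (hq : ∀ k, Measurable (q k)) (h1 : sqX1 p < ⊤) (h2 : sqX1 q < ⊤) (k : ℤ) :
    Integrable (tensor p q k) haarZRR := by
  refine ⟨(measurable_tensor hp hq k).aestronglyMeasurable, ?_⟩
  unfold HasFiniteIntegral
  rw [lintegral_enorm_tensor hp hq]
  have h3 := tsum_conv_sq_le (fun k => ∫⁻ σ, ‖p k σ‖ₑ) (fun k => ∫⁻ σ, ‖q k σ‖ₑ) k
  have h4 : (∑' k₁, (∫⁻ σ, ‖p k₁ σ‖ₑ) * ∫⁻ σ, ‖q (k - k₁) σ‖ₑ) ^ 2 < ⊤ :=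
    lt_of_le_of_lt h3 (ENNReal.mul_lt_top h1 h2)
  by_contra h5
  rw [not_lt, top_le_iff] at h5
  rw [h5] at h4
  simp at h4

/-- A multiplier and a phase for which the bilinear Duhamel operator is bounded. -/
structure Admissible (m : ℤ → ℤ → ℂ) (φ : ℤ → ℤ → ℝ) (S : ℝ≥0∞) : Prop where
  bound : SumBound (fun k k₁ => ‖m k k₁‖ₑ * jb (φ k k₁) (-(1 / 2))) φ S
  bdd : ∀ k, ∃ M : ℝ, ∀ k₁, ‖m k k₁‖ ≤ M

/-- The bilinear Duhamel operator with multiplier `m` and phase `φ`, on the Fourier side. -/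
def bilin (m : ℤ → ℤ → ℂ) (φ : ℤ → ℤ → ℝ) (p q : ℤ → ℝ → ℂ) (k : ℤ) (τ : ℝ) : ℂ :=
  ∫ y, (m k y.1 * kerK τ (y.2.1 + y.2.2 - φ k y.1)) * tensor p q k y ∂haarZRR

section Bilin

variable {m : ℤ → ℤ → ℂ} {φ : ℤ → ℤ → ℝ} {S : ℝ≥0∞} {p q : ℤ → ℝ → ℂ}

lemma integrable_bilin (hm : ∀ k, ∃ M : ℝ, ∀ k₁, ‖m k k₁‖ ≤ M) (hp : ∀ k, Measurable (p k))
    (hq : ∀ k, Measurable (q k)) (h1 : sqX1 p < ⊤) (h2 : sqX1 q < ⊤) (k : ℤ) (τ : ℝ) :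
    Integrable (fun y : ℤ × ℝ × ℝ =>
      (m k y.1 * kerK τ (y.2.1 + y.2.2 - φ k y.1)) * tensor p q k y) haarZRR := by
  obtain ⟨M, hM⟩ := hm k
  refine Integrable.bdd_mul (c := M * (2 * kerC).toReal) (integrable_tensor hp hq h1 h2 k) ?_ ?_
  · exact Measurable.aestronglyMeasurable (by fun_prop)
  · refine Eventually.of_forall fun y => ?_
    rw [norm_mul]
    exact mul_le_mul (hM _) (norm_kerK_le_const _ _) (norm_nonneg _)
      ((norm_nonneg _).trans (hM 0))

lemma measurable_bilin (hp : ∀ k, Measurable (p k)) (hq : ∀ k, Measurable (q k)) (k : ℤ) :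
    Measurable (bilin m φ p q k) := by
  have := measurable_tensor hp hq k
  refine (StronglyMeasurable.integral_prod_right (ν := haarZRR) (f := fun (τ : ℝ) (y : ℤ × ℝ × ℝ) =>
    (m k y.1 * kerK τ (y.2.1 + y.2.2 - φ k y.1)) * tensor p q k y) ?_).measurable
  refine Measurable.stronglyMeasurable ?_
  unfold Function.uncurry
  fun_prop

/-- The kernel depends on the input modulations only through σ = σ₁ + σ₂ - φ. Substituting σ for σ₂
factors the operator into a product on the Fourier side followed by the linear Duhamel kernel. -/
lemma enorm_bilin_le (hp : ∀ k, Measurable (p k)) (hq : ∀ k, Measurable (q k)) (k : ℤ) (τ : ℝ) :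
    ‖bilin m φ p q k τ‖ₑ ≤ ∫⁻ σ, ‖kerK τ σ‖ₑ * posBilin φ (fun k k₁ => ‖m k k₁‖ₑ)
      (fun x => ‖p x.1 x.2‖ₑ) (fun x => ‖q x.1 x.2‖ₑ) (k, σ) := by
  have ht := measurable_tensor hp hq k
  have hp' := measurable_uncurry_of_forall hp
  have hq' := measurable_uncurry_of_forall hq
  refine (enorm_integral_le_lintegral_enorm _).trans (le_of_eq ?_)
  rw [lintegral_haarZRR (by fun_prop)]
  have e : ∀ σ, ‖kerK τ σ‖ₑ * posBilin φ (fun k k₁ => ‖m k k₁‖ₑ)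
      (fun x => ‖p x.1 x.2‖ₑ) (fun x => ‖q x.1 x.2‖ₑ) (k, σ) =
      ∫⁻ y : ℤ × ℝ, ‖kerK τ σ‖ₑ * (‖m k y.1‖ₑ * (‖p y.1 y.2‖ₑ *
        ‖q (sndFreq φ (k, σ) y).1 (sndFreq φ (k, σ) y).2‖ₑ)) ∂haarZR := by
    intro σ
    unfold posBilin
    rw [lintegral_const_mul _ (by fun_prop)]
  simp_rw [e]
  have hmeas : Measurable (fun z : ℝ × (ℤ × ℝ) => ‖kerK τ z.1‖ₑ * (‖m k z.2.1‖ₑ * (‖p z.2.1 z.2.2‖ₑ *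
        ‖q (sndFreq φ (k, z.1) z.2).1 (sndFreq φ (k, z.1) z.2).2‖ₑ))) := by
    have h1 : Measurable fun z : ℝ × (ℤ × ℝ) =>
        q (sndFreq φ (k, z.1) z.2).1 (sndFreq φ (k, z.1) z.2).2 :=
      hq'.comp (g := fun x : ℤ × ℝ => q x.1 x.2) (by fun_prop)
    have h2 : Measurable fun z : ℝ × (ℤ × ℝ) => p z.2.1 z.2.2 := hp'.comp measurable_snd
    fun_prop
  have hmeas2 : Measurable fun y : ℤ × ℝ => ∫⁻ x : ℝ, ‖kerK τ x‖ₑ * (‖m k y.1‖ₑ * (‖p y.1 y.2‖ₑ *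
        ‖q (sndFreq φ (k, x) y).1 (sndFreq φ (k, x) y).2‖ₑ)) :=
    Measurable.lintegral_prod_right' (hmeas.comp measurable_swap)
  rw [lintegral_lintegral_swap hmeas.aemeasurable, lintegral_haarZR hmeas2]
  refine tsum_congr fun k₁ => lintegral_congr fun σ₁ => ?_
  rw [← lintegral_add_right_eq_self _ (φ k k₁ - σ₁)]
  refine lintegral_congr fun σ₂ => ?_
  simp only [tensor, enorm_mul, sndFreq]
  rw [show σ₁ + (σ₂ + (φ k k₁ - σ₁)) - φ k k₁ = σ₂ by ring,
    show σ₂ + (φ k k₁ - σ₁) = σ₂ - σ₁ + φ k k₁ by ring]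
  ring

lemma enorm_bilin_le_posDuhamel (hp : ∀ k, Measurable (p k)) (hq : ∀ k, Measurable (q k)) (k : ℤ)
    (τ : ℝ) : ‖bilin m φ p q k τ‖ₑ ≤ kerC * posDuhamel (fun σ => posBilin φ (fun k k₁ => ‖m k k₁‖ₑ)
      (fun x => ‖p x.1 x.2‖ₑ) (fun x => ‖q x.1 x.2‖ₑ) (k, σ)) τ := by
  have hp' := measurable_uncurry_of_forall hp
  have hq' := measurable_uncurry_of_forall hq
  refine (enorm_bilin_le hp hq k τ).trans ?_
  unfold posDuhamel
  rw [← lintegral_const_mul _ (by fun_prop)]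
  refine lintegral_mono fun σ => ?_
  rw [← mul_assoc]
  gcongr
  exact enorm_kerK_le τ σ

/-- The constant in the bilinear estimate. -/
def bilinC : ℝ≥0∞ :=
  kerC ^ 2 * (8 * (∫⁻ τ : ℝ, jb τ (-(3 / 2))) ^ 2 * (48 * jbMass) +
    (2 * (∫⁻ τ : ℝ, jb τ (-3)) + (2 * (∫⁻ τ : ℝ, jb τ (-2))) ^ 2) *
      (64 + 128 * (∫⁻ σ : ℝ, jb σ (-(11 / 10))) * jbMass))

lemma bilinC_ne_top : bilinC ≠ ⊤ := by
  have h1 := (lintegral_jb_lt_top (r := 3 / 2) (by norm_num)).ne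
  have h2 := (lintegral_jb_lt_top (r := 3) (by norm_num)).ne
  have h3 := (lintegral_jb_lt_top (r := 2) (by norm_num)).ne
  have h4 := (lintegral_jb_lt_top (r := 11 / 10) (by norm_num)).ne
  have h5 := jbMass_lt_top.ne
  have h6 := kerC_ne_top
  unfold bilinC
  finiteness

/-- Since |m| = ψ⟨φ⟩^{1/2} with ψ = |m|⟨φ⟩^{-1/2}, the two estimates for `posBilin` control the
product in exactly the two norms that the linear Duhamel estimates take as input. -/
lemma sq_bilin_le (hS : Admissible m φ S) (hp : ∀ k, Measurable (p k))
    (hq : ∀ k, Measurable (q k)) :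
    sqX2 (bilin m φ p q) ≤ bilinC * S * (sqX2 p * sqX2 q + sqX1 p * sqX1 q) ∧
    sqX1 (bilin m φ p q) ≤ bilinC * S * (sqX2 p * sqX2 q + sqX1 p * sqX1 q) := by
  have hp' := measurable_uncurry_of_forall hp
  have hq' := measurable_uncurry_of_forall hq
  set P : ℤ × ℝ → ℝ≥0∞ := fun x => ‖p x.1 x.2‖ₑ
  set Q : ℤ × ℝ → ℝ≥0∞ := fun x => ‖q x.1 x.2‖ₑ
  have hP : Measurable P := by unfold P; fun_prop
  have hQ : Measurable Q := by unfold Q; fun_prop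
  set G := posBilin φ (fun k k₁ => ‖m k k₁‖ₑ) P Q
  have hG : Measurable G := measurable_posBilin hP hQ
  have hψ : (fun k k₁ => ‖m k k₁‖ₑ * jb (φ k k₁) (-(1 / 2)) * jb (φ k k₁) (1 / 2)) =
      fun k k₁ => ‖m k k₁‖ₑ := by
    ext k k₁
    rw [mul_assoc, jb_mul]
    simp
  have g2 := posBilin_sq_le hS.bound hP hQ
  have g1 := sq_lintegral_posBilin_le hS.bound hP hQ
  rw [hψ] at g1 g2
  have eP : ∫⁻ x, jb x.2 1 * P x ^ 2 ∂haarZR = sqX2 p := lintegral_haarZR (by fun_prop)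
  have eQ : ∫⁻ x, jb x.2 1 * Q x ^ 2 ∂haarZR = sqX2 q := lintegral_haarZR (by fun_prop)
  have eP1 : ∑' k : ℤ, (∫⁻ σ : ℝ, P (k, σ)) ^ 2 = sqX1 p := rfl
  have eQ1 : ∑' k : ℤ, (∫⁻ σ : ℝ, Q (k, σ)) ^ 2 = sqX1 q := rfl
  rw [eP, eQ, lintegral_haarZR (by fun_prop)] at g2
  rw [eP, eQ, eP1, eQ1] at g1
  set X := sqX2 p * sqX2 q
  set Y := sqX1 p * sqX1 q
  set G2 := ∑' k : ℤ, ∫⁻ σ : ℝ, jb σ (-1) * G (k, σ) ^ 2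
  set G1 := ∑' k : ℤ, (∫⁻ σ : ℝ, jb σ (-1) * G (k, σ)) ^ 2
  set J1 := ∫⁻ σ : ℝ, jb σ (-(11 / 10))
  have g2' : G2 ≤ 48 * jbMass * (S * (X + Y)) := by
    refine g2.trans ?_
    rw [mul_assoc]
    gcongr
    exact le_self_add
  have g1' : G1 ≤ (64 + 128 * J1 * jbMass) * (S * (X + Y)) := by
    refine g1.trans ?_
    calc 64 * S * Y + 128 * J1 * jbMass * S * X
        ≤ 64 * S * (X + Y) + 128 * J1 * jbMass * S * (X + Y) := by
          gcongr
          · exact le_add_self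
          · exact le_self_add
      _ = _ := by ring
  have hle := enorm_bilin_le_posDuhamel (m := m) (φ := φ) hp hq
  constructor
  · calc sqX2 (bilin m φ p q)
        ≤ ∑' k : ℤ, ∫⁻ τ : ℝ, kerC ^ 2 * (jb τ 1 * posDuhamel (fun σ => G (k, σ)) τ ^ 2) := by
          refine ENNReal.tsum_le_tsum fun k => lintegral_mono fun τ => ?_
          calc jb τ 1 * ‖bilin m φ p q k τ‖ₑ ^ 2
              ≤ jb τ 1 * (kerC * posDuhamel (fun σ => G (k, σ)) τ) ^ 2 := by
                gcongr; exact hle k τ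
            _ = _ := by ring
      _ ≤ ∑' k : ℤ, kerC ^ 2 * (8 * (∫⁻ τ : ℝ, jb τ (-(3 / 2))) ^ 2 *
            (∫⁻ σ, jb σ (-1) * G (k, σ) ^ 2) +
            2 * (∫⁻ τ : ℝ, jb τ (-3)) * (∫⁻ σ, jb σ (-1) * G (k, σ)) ^ 2) := by
          refine ENNReal.tsum_le_tsum fun k => ?_
          rw [lintegral_const_mul' _ _ (ENNReal.pow_ne_top kerC_ne_top)]
          gcongr
          exact lintegral_sq_posDuhamel_le (by fun_prop)
      _ = kerC ^ 2 * (8 * (∫⁻ τ : ℝ, jb τ (-(3 / 2))) ^ 2 * G2 +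
            2 * (∫⁻ τ : ℝ, jb τ (-3)) * G1) := by
          rw [ENNReal.tsum_mul_left, ENNReal.tsum_add, ENNReal.tsum_mul_left,
            ENNReal.tsum_mul_left]
      _ ≤ kerC ^ 2 * (8 * (∫⁻ τ : ℝ, jb τ (-(3 / 2))) ^ 2 * (48 * jbMass * (S * (X + Y))) +
            (2 * (∫⁻ τ : ℝ, jb τ (-3)) + (2 * (∫⁻ τ : ℝ, jb τ (-2))) ^ 2) *
              ((64 + 128 * J1 * jbMass) * (S * (X + Y)))) := by
          gcongr
          exact le_self_add
      _ = _ := by unfold bilinC; ring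
  · calc sqX1 (bilin m φ p q)
        ≤ ∑' k : ℤ, (kerC * ∫⁻ τ : ℝ, posDuhamel (fun σ => G (k, σ)) τ) ^ 2 := by
          refine ENNReal.tsum_le_tsum fun k => ?_
          rw [← lintegral_const_mul' _ _ kerC_ne_top]
          gcongr with τ
          exact hle k τ
      _ ≤ ∑' k : ℤ, (kerC * (2 * (∫⁻ τ : ℝ, jb τ (-2)) * ∫⁻ σ, jb σ (-1) * G (k, σ))) ^ 2 := by
          refine ENNReal.tsum_le_tsum fun k => ?_
          gcongr
          exact lintegral_posDuhamel_le (by fun_prop)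
      _ = kerC ^ 2 * ((2 * (∫⁻ τ : ℝ, jb τ (-2))) ^ 2 * G1) := by
          rw [← ENNReal.tsum_mul_left, ← ENNReal.tsum_mul_left]
          refine tsum_congr fun k => ?_
          ring
      _ ≤ kerC ^ 2 * (8 * (∫⁻ τ : ℝ, jb τ (-(3 / 2))) ^ 2 * (48 * jbMass * (S * (X + Y))) +
            (2 * (∫⁻ τ : ℝ, jb τ (-3)) + (2 * (∫⁻ τ : ℝ, jb τ (-2))) ^ 2) *
              ((64 + 128 * J1 * jbMass) * (S * (X + Y)))) := by
          gcongr
          refine le_add_left ?_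
          gcongr
          exact le_add_self
      _ = _ := by unfold bilinC; ring

/-- The bilinear estimate. -/
theorem zn_bilin_le (hS : Admissible m φ S) (hp : ∀ k, Measurable (p k))
    (hq : ∀ k, Measurable (q k)) :
    zn (bilin m φ p q) ≤ 2 * ((bilinC * S) ^ (1 / 2 : ℝ) * (zn p * zn q)) := by
  have h : sqX2 p * sqX2 q + sqX1 p * sqX1 q ≤ (zn p * zn q) ^ 2 := by
    set a := sqX2 p ^ (1 / 2 : ℝ)
    set b := sqX2 q ^ (1 / 2 : ℝ)
    set c := sqX1 p ^ (1 / 2 : ℝ)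
    set d := sqX1 q ^ (1 / 2 : ℝ)
    have ha : sqX2 p = a ^ 2 := (rpow_half_sq _).symm
    have hb : sqX2 q = b ^ 2 := (rpow_half_sq _).symm
    have hc : sqX1 p = c ^ 2 := (rpow_half_sq _).symm
    have hd : sqX1 q = d ^ 2 := (rpow_half_sq _).symm
    have e : (zn p * zn q) ^ 2 = ((a + c) * (b + d)) ^ 2 := rfl
    rw [e, ha, hb, hc, hd]
    calc a ^ 2 * b ^ 2 + c ^ 2 * d ^ 2 ≤ (a * b + c * d) ^ 2 := by
          have : (a * b + c * d) ^ 2 = a ^ 2 * b ^ 2 + c ^ 2 * d ^ 2 + 2 * (a * b * c * d) := by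
            ring
          rw [this]
          exact le_self_add
      _ ≤ _ := by
          gcongr
          have : (a + c) * (b + d) = a * b + c * d + (a * d + c * b) := by ring
          rw [this]
          exact le_self_add
  obtain ⟨h2, h1⟩ := sq_bilin_le hS hp hq
  have e : bilinC * S * (zn p * zn q) ^ 2 = ((bilinC * S) ^ (1 / 2 : ℝ) * (zn p * zn q)) ^ 2 := by
    rw [mul_pow _ (zn p * zn q), rpow_half_sq]
  apply zn_le_of_sq_le
  · rw [← e]
    exact h2.trans (mul_le_mul_right h _)
  · rw [← e]
    exact h1.trans (mul_le_mul_right h _)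

end Bilin

/-! ### Minkowski's inequality and completeness -/

section L2

variable {α : Type*} [MeasurableSpace α]

/-- The `L²` norm of an extended nonnegative function. -/
def l2n (μ : Measure α) (F : α → ℝ≥0∞) : ℝ≥0∞ := (∫⁻ x, F x ^ 2 ∂μ) ^ (1 / 2 : ℝ)

lemma l2n_mono {μ : Measure α} {F G : α → ℝ≥0∞} (h : ∀ x, F x ≤ G x) : l2n μ F ≤ l2n μ G := by
  unfold l2n
  gcongr with x
  exact h x

lemma l2n_add_le {μ : Measure α} {F G : α → ℝ≥0∞} (hF : Measurable F) (hG : Measurable G) :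
    l2n μ (fun x => F x + G x) ≤ l2n μ F + l2n μ G := by
  have := ENNReal.lintegral_Lp_add_le (μ := μ) hF.aemeasurable hG.aemeasurable
    (p := 2) (by norm_num)
  simpa [l2n] using this

lemma l2n_sum_le {μ : Measure α} {F : ℕ → α → ℝ≥0∞} (hF : ∀ n, Measurable (F n)) (N : ℕ) :
    l2n μ (fun x => ∑ n ∈ Finset.range N, F n x) ≤ ∑ n ∈ Finset.range N, l2n μ (F n) := by
  induction N with
  | zero => simp [l2n]
  | succ N ih =>
    simp only [Finset.sum_range_succ]
    refine (l2n_add_le (by fun_prop) (hF N)).trans ?_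
    gcongr

lemma l2n_tsum_le {μ : Measure α} {F : ℕ → α → ℝ≥0∞} (hF : ∀ n, Measurable (F n)) :
    l2n μ (fun x => ∑' n, F n x) ≤ ∑' n, l2n μ (F n) := by
  have hmono : Monotone fun (N : ℕ) (x : α) => ∑ n ∈ Finset.range N, F n x := by
    intro N M h x
    exact Finset.sum_le_sum_of_subset (Finset.range_mono h)
  have h1 : ∀ x, (∑' n, F n x) ^ 2 = ⨆ N : ℕ, (∑ n ∈ Finset.range N, F n x) ^ 2 := by
    intro x
    symm
    apply iSup_eq_of_tendsto (fun N M h => pow_le_pow_left' (hmono h x) 2)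
    exact ENNReal.Tendsto.pow (ENNReal.tendsto_nat_tsum _)
  unfold l2n
  rw [rpow_half_le_iff]
  simp_rw [h1]
  rw [lintegral_iSup (fun N => (Finset.measurable_fun_sum _ fun n _ => hF n).pow_const 2)
    (fun N M h x => pow_le_pow_left' (hmono h x) 2)]
  refine iSup_le fun N => ?_
  rw [← rpow_half_le_iff]
  exact (l2n_sum_le hF N).trans (ENNReal.sum_le_tsum _)

end L2

/-- The norm of `ℓ² H^{1/2} ∩ ℓ² L¹` for nonnegative functions. -/
def znE (F : ℤ → ℝ → ℝ≥0∞) : ℝ≥0∞ :=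
  l2n haarZR (fun x => jb x.2 (1 / 2) * F x.1 x.2) +
    l2n (Measure.count : Measure ℤ) (fun k => ∫⁻ σ, F k σ)

lemma zn_eq_znE {p : ℤ → ℝ → ℂ} (hp : ∀ k, Measurable (p k)) :
    zn p = znE fun k σ => ‖p k σ‖ₑ := by
  have hp' := measurable_uncurry_of_forall hp
  unfold zn znE l2n
  congr 2
  · rw [lintegral_haarZR (by fun_prop)]
    unfold sqX2
    simp only [mul_pow, jb_pow_two]
    norm_num
  · rw [lintegral_count]
    rfl

lemma znE_mono {F G : ℤ → ℝ → ℝ≥0∞} (h : ∀ k σ, F k σ ≤ G k σ) : znE F ≤ znE G := by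
  unfold znE
  refine add_le_add (l2n_mono fun x => ?_) (l2n_mono fun k => lintegral_mono fun σ => h k σ)
  gcongr
  exact h _ _

lemma znE_tsum_le {F : ℕ → ℤ → ℝ → ℝ≥0∞} (hF : ∀ n k, Measurable (F n k)) :
    znE (fun k σ => ∑' n, F n k σ) ≤ ∑' n, znE (F n) := by
  have hF' := fun n => measurable_uncurry_of_forall (hF n)
  unfold znE
  rw [ENNReal.tsum_add]
  refine add_le_add ?_ ?_
  · simp_rw [← ENNReal.tsum_mul_left]
    exact l2n_tsum_le fun n => by fun_prop
  · have : ∀ k, ∫⁻ σ, ∑' n, F n k σ = ∑' n, ∫⁻ σ, F n k σ := fun k =>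
      lintegral_tsum fun n => (hF n k).aemeasurable
    simp_rw [this]
    exact l2n_tsum_le fun n => measurable_of_countable _

lemma znE_add_le {F G : ℤ → ℝ → ℝ≥0∞} (hF : ∀ k, Measurable (F k)) (hG : ∀ k, Measurable (G k)) :
    znE (fun k σ => F k σ + G k σ) ≤ znE F + znE G := by
  have hF' := measurable_uncurry_of_forall hF
  have hG' := measurable_uncurry_of_forall hG
  unfold znE
  rw [add_add_add_comm]
  refine add_le_add ?_ ?_
  · simp_rw [mul_add]
    exact l2n_add_le (by fun_prop) (by fun_prop)
  · have : ∀ k, ∫⁻ σ, F k σ + G k σ = (∫⁻ σ, F k σ) + ∫⁻ σ, G k σ := fun k =>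
      lintegral_add_left (hF k) _
    simp_rw [this]
    exact l2n_add_le (measurable_of_countable _) (measurable_of_countable _)

lemma zn_add_le {p q : ℤ → ℝ → ℂ} (hp : ∀ k, Measurable (p k)) (hq : ∀ k, Measurable (q k)) :
    zn (p + q) ≤ zn p + zn q := by
  have hpq : ∀ k, Measurable ((p + q) k) := fun k => (hp k).add (hq k)
  rw [zn_eq_znE hp, zn_eq_znE hq, zn_eq_znE hpq]
  refine (znE_mono fun k σ => enorm_add_le _ _).trans ?_
  exact znE_add_le (fun k => (hp k).enorm) (fun k => (hq k).enorm)

lemma zn_zero : zn 0 = 0 := by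
  simp [zn, sqX1, sqX2]

lemma zn_neg (p : ℤ → ℝ → ℂ) : zn (-p) = zn p := by
  simp [zn, sqX1, sqX2]

/-- The space of measurable functions on the Fourier side with finite norm. -/
@[ext] structure ZS where
  /-- The function. -/
  val : ℤ → ℝ → ℂ
  meas : ∀ k, Measurable (val k)
  lt_top : zn val < ⊤

instance : Zero ZS := ⟨⟨0, fun _ => measurable_const, by rw [zn_zero]; exact ENNReal.zero_lt_top⟩⟩

instance : Add ZS := ⟨fun p q => ⟨p.1 + q.1, fun k => (p.2 k).add (q.2 k),
  lt_of_le_of_lt (zn_add_le p.2 q.2) (ENNReal.add_lt_top.2 ⟨p.3, q.3⟩)⟩⟩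

instance : Neg ZS := ⟨fun p => ⟨-p.1, fun k => (p.2 k).neg, by rw [zn_neg]; exact p.3⟩⟩

@[simp] lemma ZS.coe_add (p q : ZS) : (p + q).1 = p.1 + q.1 := rfl

@[simp] lemma ZS.coe_zero : (0 : ZS).1 = 0 := rfl

@[simp] lemma ZS.coe_neg (p : ZS) : (-p).1 = -p.1 := rfl

instance : AddCommGroup ZS :=
  { AddGroup.ofLeftAxioms (G := ZS) (fun p q r => ZS.ext (by simp [add_assoc]))
      (fun p => ZS.ext (by simp)) (fun p => ZS.ext (by simp)) with
    add_comm := fun p q => ZS.ext (by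
      rw [ZS.coe_add, ZS.coe_add]
      exact add_comm _ _) }

@[simp] lemma ZS.coe_sub (p q : ZS) : (p - q).1 = p.1 - q.1 := by
  rw [sub_eq_add_neg, sub_eq_add_neg]
  rfl

lemma ZS.sqX1_lt_top (p : ZS) : sqX1 p.1 < ⊤ := (zn_lt_top_iff.1 p.lt_top).2

/-- Functions equal almost everywhere are not identified, so this is only a seminorm. Equations in
`ZS` are accordingly stated later as the vanishing of the norm of a difference. -/
instance : SeminormedAddCommGroup ZS :=
  AddGroupSeminorm.toSeminormedAddCommGroup
    { toFun := fun p => (zn p.1).toReal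
      map_zero' := by
        rw [ZS.coe_zero, zn_zero, ENNReal.toReal_zero]
      add_le' := fun p q => by
        rw [← ENNReal.toReal_add p.lt_top.ne q.lt_top.ne, ZS.coe_add]
        exact ENNReal.toReal_mono (ENNReal.add_lt_top.2 ⟨p.lt_top, q.lt_top⟩).ne
          (zn_add_le p.meas q.meas)
      neg' := fun p => by
        rw [ZS.coe_neg, zn_neg] }

lemma ZS.norm_def (p : ZS) : ‖p‖ = (zn p.1).toReal := rfl

lemma ZS.zn_eq (p : ZS) : zn p.1 = ENNReal.ofReal ‖p‖ := by
  rw [ZS.norm_def, ENNReal.ofReal_toReal p.lt_top.ne]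

/-- A seminormed group is complete if every absolutely convergent series converges. -/
lemma completeSpace_of_summable_imp_tendsto {E : Type*} [SeminormedAddCommGroup E]
    (h : ∀ u : ℕ → E, Summable (fun n => ‖u n‖) →
      ∃ a, Tendsto (fun n => ∑ i ∈ Finset.range n, u i) atTop (𝓝 a)) : CompleteSpace E := by
  apply Metric.complete_of_cauchySeq_tendsto
  intro u hu
  obtain ⟨f, hf₁, hf₂⟩ := Metric.exists_subseq_summable_dist_of_cauchySeq u hu
  simp only [dist_eq_norm] at hf₂
  obtain ⟨a, ha⟩ := h (fun n => u (f (n + 1)) - u (f n)) hf₂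
  refine ⟨a + u (f 0), tendsto_nhds_of_cauchySeq_of_subseq hu hf₁.tendsto_atTop ?_⟩
  refine (ha.add_const (u (f 0))).congr fun n => ?_
  rw [Finset.sum_range_sub (fun n => u (f n)) n]
  simp

/-- The Riesz–Fischer argument: an absolutely convergent series is summed pointwise where the moduli
are summable, and the tails are controlled by the countable triangle inequality `znE_tsum_le`. -/
instance : CompleteSpace ZS := by
  apply completeSpace_of_summable_imp_tendsto
  intro u hu
  set F : ℕ → ℤ → ℝ → ℝ≥0∞ := fun n k σ => ‖(u n).1 k σ‖ₑ
  have hF : ∀ n k, Measurable (F n k) := fun n k => ((u n).meas k).enorm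
  have hsum : ∑' n, znE (F n) ≠ ⊤ := by
    have : ∀ n, znE (F n) = ENNReal.ofReal ‖u n‖ := fun n => by
      rw [← ZS.zn_eq, zn_eq_znE (u n).meas]
    simp_rw [this]
    exact hu.tsum_ofReal_ne_top
  set A : ℤ → Set ℝ := fun k => {σ | ∑' n, F n k σ < ⊤}
  have hA : ∀ k, MeasurableSet (A k) := fun k =>
    measurableSet_lt (Measurable.tsum fun n => hF n k) measurable_const
  set l : ℤ → ℝ → ℂ := fun k => (A k).indicator fun σ => ∑' n, (u n).1 k σ
  have hsummable : ∀ k, ∀ σ ∈ A k, Summable fun n => (u n).1 k σ := by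
    intro k σ hσ
    apply Summable.of_nnnorm
    exact ENNReal.tsum_coe_ne_top_iff_summable.1 hσ.ne
  have hl : ∀ k, Measurable (l k) := by
    intro k
    refine measurable_of_tendsto_metrizable
      (f := fun N => (A k).indicator fun σ => ∑ n ∈ Finset.range N, (u n).1 k σ) ?_ ?_
    · intro N
      have := fun n => (u n).meas k
      exact Measurable.indicator (by fun_prop) (hA k)
    · rw [tendsto_pi_nhds]
      intro σ
      by_cases hσ : σ ∈ A k
      · simp only [l, indicator_of_mem hσ]
        exact (hsummable k σ hσ).hasSum.tendsto_sum_nat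
      · simp only [l, indicator_of_notMem hσ]
        exact tendsto_const_nhds
  have hcoe : ∀ (N k) (σ : ℝ), (∑ n ∈ Finset.range N, u n : ZS).1 k σ =
      ∑ n ∈ Finset.range N, (u n).1 k σ := by
    intro N k σ
    induction N with
    | zero => simp
    | succ N ih =>
      rw [Finset.sum_range_succ, Finset.sum_range_succ, ZS.coe_add, ← ih]
      rfl
  have htail : ∀ (N k σ), ‖l k σ - (∑ n ∈ Finset.range N, u n : ZS).1 k σ‖ₑ ≤
      ∑' n, F (n + N) k σ := by
    intro N k σ
    rw [hcoe]
    by_cases hσ : σ ∈ A k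
    · simp only [l, indicator_of_mem hσ]
      rw [← (hsummable k σ hσ).sum_add_tsum_nat_add N, add_sub_cancel_left]
      exact enorm_tsum_le_tsum_enorm
    -- Where the series of moduli diverges every tail is infinite, so the value 0 chosen there needs
    -- no justification.
    · have h1 : ∑' n, F n k σ = ⊤ := by
        simpa [A] using hσ
      have h2 : ∑' n, F (n + N) k σ = ⊤ := by
        by_contra h
        apply h1.not_lt
        rw [← ENNReal.summable.sum_add_tsum_nat_add' (k := N)]
        refine ENNReal.add_lt_top.2 ⟨?_, Ne.lt_top h⟩
        exact ENNReal.sum_lt_top.2 fun n _ => enorm_lt_top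
      rw [h2]
      exact le_top
  have hdiff : ∀ N, zn (l - (∑ n ∈ Finset.range N, u n : ZS).1) ≤ ∑' n, znE (F (n + N)) := by
    intro N
    have hm : ∀ k, Measurable ((l - (∑ n ∈ Finset.range N, u n : ZS).1) k) := fun k =>
      (hl k).sub (ZS.meas _ k)
    rw [zn_eq_znE hm]
    exact (znE_mono (htail N)).trans (znE_tsum_le fun n k => hF (n + N) k)
  have hlmem : zn l < ⊤ := by
    have h0 := hdiff 0
    simp only [Finset.range_zero, Finset.sum_empty, add_zero] at h0
    have : l - (0 : ZS).1 = l := by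
      rw [ZS.coe_zero, sub_zero]
    rw [this] at h0
    exact lt_of_le_of_lt h0 hsum.lt_top
  refine ⟨⟨l, hl, hlmem⟩, ?_⟩
  rw [tendsto_iff_norm_sub_tendsto_zero]
  have h1 : Tendsto (fun N => (∑' n, znE (F (n + N))).toReal) atTop (𝓝 0) := by
    have := (ENNReal.tendsto_toReal ENNReal.zero_ne_top).comp
      (ENNReal.tendsto_sum_nat_add _ hsum)
    rw [ENNReal.toReal_zero] at this
    exact this
  refine squeeze_zero (fun N => norm_nonneg _) (fun N => ?_) h1
  rw [norm_sub_rev, ZS.norm_def, ZS.coe_sub]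
  refine ENNReal.toReal_mono ?_ (hdiff N)
  refine ne_top_of_le_ne_top hsum ?_
  rw [← (ENNReal.summable (f := fun n => znE (F (n + N)))).sum_add_tsum_nat_add' (f := fun n => znE (F n))]
  exact le_add_self

/-! ### Algebraic properties of the bilinear Duhamel operator -/

section Algebra

variable {m : ℤ → ℤ → ℂ} {φ : ℤ → ℤ → ℝ}

lemma bilin_sub_left (hm : ∀ k, ∃ M : ℝ, ∀ k₁, ‖m k k₁‖ ≤ M) (p p' q : ZS) :
    bilin m φ (p - p').1 q.1 = bilin m φ p.1 q.1 - bilin m φ p'.1 q.1 := by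
  ext k τ
  simp only [Pi.sub_apply, bilin]
  rw [← integral_sub (integrable_bilin hm p.meas q.meas p.sqX1_lt_top q.sqX1_lt_top k τ)
    (integrable_bilin hm p'.meas q.meas p'.sqX1_lt_top q.sqX1_lt_top k τ)]
  congr 1
  ext y
  simp only [tensor, ZS.coe_sub, Pi.sub_apply]
  ring

lemma bilin_sub_right (hm : ∀ k, ∃ M : ℝ, ∀ k₁, ‖m k k₁‖ ≤ M) (p q q' : ZS) :
    bilin m φ p.1 (q - q').1 = bilin m φ p.1 q.1 - bilin m φ p.1 q'.1 := by
  ext k τ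
  simp only [Pi.sub_apply, bilin]
  rw [← integral_sub (integrable_bilin hm p.meas q.meas p.sqX1_lt_top q.sqX1_lt_top k τ)
    (integrable_bilin hm p.meas q'.meas p.sqX1_lt_top q'.sqX1_lt_top k τ)]
  congr 1
  ext y
  simp only [tensor, ZS.coe_sub, Pi.sub_apply]
  ring

/-- The reflection on the Fourier side that fixes the transforms of real functions. -/
def refl (p : ℤ → ℝ → ℂ) (k : ℤ) (σ : ℝ) : ℂ := (starRingEnd ℂ) (p (-k) (-σ))

lemma integral_haarZRR_neg (f : ℤ × ℝ × ℝ → ℂ) :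
    ∫ y, f (-y) ∂haarZRR = ∫ y, f y ∂haarZRR := by
  have h1 : MeasurePreserving (Neg.neg : ℤ → ℤ) Measure.count Measure.count := by
    refine ⟨measurable_of_countable _, ?_⟩
    ext s hs
    rw [Measure.map_apply (measurable_of_countable _) hs]
    simp only [neg_preimage]
    have h := Measure.count_injective_image (s := s) (neg_injective (G := ℤ))
    rwa [image_neg_eq_neg] at h
  have h2 : MeasurePreserving (Neg.neg : ℝ × ℝ → ℝ × ℝ) volume volume :=
    Measure.measurePreserving_neg volume
  have h3 : MeasurePreserving (fun y : ℤ × ℝ × ℝ => -y) haarZRR haarZRR := h1.prod h2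
  exact h3.integral_comp (MeasurableEquiv.neg (ℤ × ℝ × ℝ)).measurableEmbedding f

/-- Change the sign of all frequencies of integration. The hypotheses say that m and φ come from a
real operator; this is the source of the real-valuedness of the solution. -/
lemma bilin_refl (hm : ∀ k k₁, m (-k) (-k₁) = (starRingEnd ℂ) (m k k₁))
    (hφ : ∀ k k₁, φ (-k) (-k₁) = -φ k k₁) (p q : ℤ → ℝ → ℂ) :
    bilin m φ (refl p) (refl q) = refl (bilin m φ p q) := by
  ext k τ
  simp only [bilin, refl]
  rw [← integral_conj, ← integral_haarZRR_neg]
  congr 1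
  ext y
  simp only [tensor, map_mul, Prod.fst_neg, Prod.snd_neg]
  have e1 := hm k (-y.1)
  have e2 := hφ k (-y.1)
  rw [neg_neg] at e1 e2
  rw [e1, e2, ← kerK_neg]
  simp only [Complex.conj_conj, neg_neg]
  congr 2
  · congr 2
    ring
  · simp [refl]
  · simp only [refl, neg_neg]
    ring_nf

lemma sqX2_refl (p : ℤ → ℝ → ℂ) : sqX2 (refl p) = sqX2 p := by
  unfold sqX2
  rw [← (Equiv.neg ℤ).tsum_eq]
  refine tsum_congr fun k => ?_
  rw [← lintegral_neg_eq_self]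
  simp [refl]

lemma sqX1_refl (p : ℤ → ℝ → ℂ) : sqX1 (refl p) = sqX1 p := by
  unfold sqX1
  rw [← (Equiv.neg ℤ).tsum_eq]
  refine tsum_congr fun k => ?_
  rw [← lintegral_neg_eq_self]
  simp [refl]

/-- The reflection on the space `ZS`. -/
def ZS.refl (p : ZS) : ZS where
  val := DSW.refl p.1
  meas := fun k => by
    have := p.meas (-k)
    unfold DSW.refl
    have h : Measurable (starRingEnd ℂ) := Complex.continuous_conj.measurable
    exact h.comp (this.comp measurable_neg)
  lt_top := by
    have := p.lt_top
    unfold zn at this ⊢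
    rwa [sqX2_refl, sqX1_refl]

lemma ZS.norm_refl (p : ZS) : ‖p.refl‖ = ‖p‖ := by
  rw [ZS.norm_def, ZS.norm_def]
  simp only [ZS.refl, zn, sqX2_refl, sqX1_refl]

end Algebra

/-! ### The time side -/

/-- The function of time with Fourier transform `p`. -/
def tp (p : ℤ → ℝ → ℂ) (k : ℤ) (t : ℝ) : ℂ := ∫ σ, ee (σ * t) * p k σ

lemma enorm_tp_le (p : ℤ → ℝ → ℂ) (k : ℤ) (t : ℝ) : ‖tp p k t‖ₑ ≤ ∫⁻ σ, ‖p k σ‖ₑ := by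
  refine (enorm_integral_le_lintegral_enorm _).trans (le_of_eq ?_)
  simp [enorm_mul]

lemma tsum_enorm_tp_sq_le (p : ℤ → ℝ → ℂ) (t : ℝ) : ∑' k, ‖tp p k t‖ₑ ^ 2 ≤ sqX1 p := by
  unfold sqX1
  gcongr with k
  exact enorm_tp_le p k t

lemma integrable_ee_mul {f : ℝ → ℂ} (hf : Integrable f) (t : ℝ) :
    Integrable fun σ => ee (σ * t) * f σ :=
  Integrable.bdd_mul (c := 1) hf (Measurable.aestronglyMeasurable (by fun_prop)) (by simp)

lemma ZS.integrable (p : ZS) (k : ℤ) : Integrable (p.1 k) :=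
  integrable_of_sqX1 p.meas p.sqX1_lt_top k

lemma tp_sub (p q : ZS) (k : ℤ) (t : ℝ) : tp (p - q).1 k t = tp p.1 k t - tp q.1 k t := by
  unfold tp
  rw [← integral_sub (integrable_ee_mul (p.integrable k) t) (integrable_ee_mul (q.integrable k) t)]
  congr 1
  ext σ
  simp only [ZS.coe_sub, Pi.sub_apply]
  ring

lemma tp_add (p q : ZS) (k : ℤ) (t : ℝ) : tp (p + q).1 k t = tp p.1 k t + tp q.1 k t := by
  unfold tp
  rw [← integral_add (integrable_ee_mul (p.integrable k) t) (integrable_ee_mul (q.integrable k) t)]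
  congr 1
  ext σ
  simp only [ZS.coe_add, Pi.add_apply]
  ring

lemma tp_refl (p : ℤ → ℝ → ℂ) (k : ℤ) (t : ℝ) :
    tp (refl p) k t = (starRingEnd ℂ) (tp p (-k) t) := by
  unfold tp refl
  rw [← integral_conj, ← integral_neg_eq_self]
  congr 1
  ext σ
  rw [map_mul, conj_ee]
  ring_nf

lemma continuous_tp (p : ZS) (k : ℤ) : Continuous (tp p.1 k) := by
  unfold tp
  have := p.meas k
  refine continuous_of_dominated (bound := fun σ => ‖p.1 k σ‖) ?_ ?_ (p.integrable k).norm ?_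
  · intro t
    exact Measurable.aestronglyMeasurable (by fun_prop)
  · intro t
    simp
  · refine Eventually.of_forall fun σ => ?_
    fun_prop

lemma tp_eq_of_norm_sub_eq_zero {p q : ZS} (h : ‖p - q‖ = 0) (k : ℤ) (t : ℝ) :
    tp p.1 k t = tp q.1 k t := by
  have h1 : sqX1 (p - q).1 = 0 := by
    have h2 := sqX1_le_zn_sq (p - q).1
    rw [ZS.zn_eq, h] at h2
    simpa using h2
  have h2 := tsum_enorm_tp_sq_le (p - q).1 t
  rw [h1, nonpos_iff_eq_zero, ENNReal.tsum_eq_zero] at h2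
  have h3 := h2 k
  rw [tp_sub] at h3
  simpa [sub_eq_zero] using h3

section TimeSide

variable {m : ℤ → ℤ → ℂ} {φ : ℤ → ℤ → ℝ}

lemma integral_haarZRR_tensor (hm : ∀ k, ∃ M : ℝ, ∀ k₁, ‖m k k₁‖ ≤ M) (p q : ZS) (k : ℤ) (r : ℝ) :
    ∫ y, (m k y.1 * ee ((y.2.1 + y.2.2 - φ k y.1) * r)) * tensor p.1 q.1 k y ∂haarZRR =
      ∑' k₁, m k k₁ * ee (-φ k k₁ * r) * (tp p.1 k₁ r * tp q.1 (k - k₁) r) := by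
  obtain ⟨M, hM⟩ := hm k
  have hi : Integrable (fun y : ℤ × ℝ × ℝ =>
      (m k y.1 * ee ((y.2.1 + y.2.2 - φ k y.1) * r)) * tensor p.1 q.1 k y) haarZRR := by
    refine Integrable.bdd_mul (c := M)
      (integrable_tensor p.meas q.meas p.sqX1_lt_top q.sqX1_lt_top k) ?_ ?_
    · exact Measurable.aestronglyMeasurable (by fun_prop)
    · refine Eventually.of_forall fun y => ?_
      rw [norm_mul, norm_ee, mul_one]
      exact hM _
  rw [integral_prod _ hi, integral_countable hi.integral_prod_left]
  refine tsum_congr fun k₁ => ?_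
  have : (Measure.count : Measure ℤ).real {k₁} = 1 := by simp [Measure.real]
  rw [this, one_smul]
  unfold tp
  rw [← integral_prod_mul, ← integral_const_mul]
  congr 1
  ext y
  simp only [tensor]
  rw [show (y.1 + y.2 - φ k k₁) * r = -φ k k₁ * r + (y.1 * r + y.2 * r) by ring, ee_add, ee_add]
  ring

/-- The link between the Fourier side and the equation: after Fubini the kernel inverts to ∫₀ᵗ
e^{iσr} dr. In particular, on [0, 1] the operator depends only on the values of its arguments at
times in [0, 1]. -/
lemma tp_bilin (hm : ∀ k, ∃ M : ℝ, ∀ k₁, ‖m k k₁‖ ≤ M) (p q : ZS) (k : ℤ) {t : ℝ}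
    (ht : t ∈ Icc (0 : ℝ) 1) :
    tp (bilin m φ p.1 q.1) k t = ∫ r in (0 : ℝ)..t,
      ∑' k₁, m k k₁ * ee (-φ k k₁ * r) * (tp p.1 k₁ r * tp q.1 (k - k₁) r) := by
  obtain ⟨M, hM⟩ := hm k
  have hT := integrable_tensor p.meas q.meas p.sqX1_lt_top q.sqX1_lt_top k
  have hTm := measurable_tensor p.meas q.meas k
  simp_rw [← integral_haarZRR_tensor hm p q k]
  rw [intervalIntegral_integral_swap]
  · unfold tp bilin
    simp_rw [← integral_const_mul]
    rw [integral_integral_swap]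
    · congr 1
      ext y
      have e1 : ∀ τ : ℝ, ee (τ * t) * (m k y.1 * kerK τ (y.2.1 + y.2.2 - φ k y.1) *
          tensor p.1 q.1 k y) = (m k y.1 * tensor p.1 q.1 k y) *
            (ee (τ * t) * kerK τ (y.2.1 + y.2.2 - φ k y.1)) := fun τ => by ring
      have e2 : ∀ r : ℝ, m k y.1 * ee ((y.2.1 + y.2.2 - φ k y.1) * r) * tensor p.1 q.1 k y =
          (m k y.1 * tensor p.1 q.1 k y) * ee ((y.2.1 + y.2.2 - φ k y.1) * r) := fun r => by ring
      simp_rw [e1, e2]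
      rw [integral_const_mul, integral_ee_mul_kerK ht, intervalIntegral.integral_const_mul]
    · refine ⟨Measurable.aestronglyMeasurable (by unfold Function.uncurry; fun_prop), ?_⟩
      unfold HasFiniteIntegral
      rw [lintegral_prod_symm' _ (by unfold Function.uncurry; fun_prop)]
      calc ∫⁻ y, ∫⁻ τ, ‖Function.uncurry (fun (τ : ℝ) (y : ℤ × ℝ × ℝ) => ee (τ * t) *
            (m k y.1 * kerK τ (y.2.1 + y.2.2 - φ k y.1) * tensor p.1 q.1 k y)) (τ, y)‖ₑ ∂volume ∂haarZRR
          ≤ ∫⁻ y, (ENNReal.ofReal M * (kerC * (2 * ∫⁻ τ : ℝ, jb τ (-2)))) *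
              ‖tensor p.1 q.1 k y‖ₑ ∂haarZRR := by
            refine lintegral_mono fun y => ?_
            simp only [Function.uncurry, enorm_mul, enorm_ee, one_mul]
            rw [lintegral_mul_const _ (by fun_prop), lintegral_const_mul _ (by fun_prop)]
            gcongr
            · rw [← ofReal_norm]
              exact ENNReal.ofReal_le_ofReal (hM _)
            · exact lintegral_enorm_kerK_le _
        _ < ⊤ := by
            rw [lintegral_const_mul _ (by fun_prop)]
            refine ENNReal.mul_lt_top ?_ hT.2
            have h1 := kerC_ne_top
            have h2 := (lintegral_jb_lt_top (r := 2) (by norm_num)).ne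
            finiteness
  · have h1 : Integrable (fun z : ℝ × (ℤ × ℝ × ℝ) => tensor p.1 q.1 k z.2)
        ((volume.restrict (Set.uIoc 0 t)).prod haarZRR) := by
      have := Integrable.mul_prod (μ := volume.restrict (Set.uIoc 0 t)) (ν := haarZRR)
        (f := fun _ => (1 : ℂ)) (g := tensor p.1 q.1 k)
        ((continuous_const (y := (1 : ℂ))).intervalIntegrable 0 t).def' hT
      simpa using this
    refine Integrable.bdd_mul (c := M) h1 ?_ ?_
    · exact Measurable.aestronglyMeasurable (by fun_prop)
    · refine Eventually.of_forall fun y => ?_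
      rw [norm_mul, norm_ee, mul_one]
      exact hM _

end TimeSide

/-! ### Lattice sums -/

lemma freq_sub (L : ℝ) (k k₁ : ℤ) : freq L (k - k₁) = freq L k - freq L k₁ := by
  unfold freq
  push_cast
  ring

lemma freq_add (L : ℝ) (k k₁ : ℤ) : freq L (k + k₁) = freq L k + freq L k₁ := by
  unfold freq
  push_cast
  ring

@[simp] lemma freq_neg (L : ℝ) (k : ℤ) : freq L (-k) = -freq L k := by
  unfold freq
  push_cast
  ring

@[simp] lemma freq_zero (L : ℝ) : freq L 0 = 0 := by simp [freq]

lemma freq_eq_mul (L : ℝ) (k : ℤ) : freq L k = 2 * Real.pi / L * k := by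
  unfold freq
  ring

lemma le_abs_freq {L : ℝ} (hL : 0 < L) {k : ℤ} (hk : k ≠ 0) : 2 * Real.pi / L ≤ |freq L k| := by
  have hc : 0 < 2 * Real.pi / L := by positivity
  rw [freq_eq_mul, abs_mul, abs_of_pos hc]
  have : (1 : ℝ) ≤ |(k : ℝ)| := by exact_mod_cast Int.one_le_abs hk
  nlinarith

lemma summable_bracket_freq {L : ℝ} (hL : 0 < L) :
    Summable fun k : ℤ => bracket (freq L k) ^ (-(6 / 5) : ℝ) := by
  have hc : 0 < 2 * Real.pi / L := by positivity
  have h1 : Summable fun k : ℤ => (2 * Real.pi / L) ^ (-(6 / 5) : ℝ) * |(k : ℝ)| ^ (-(6 / 5) : ℝ) :=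
    (Real.summable_abs_int_rpow (by norm_num)).mul_left _
  refine Summable.of_norm_bounded_eventually h1 ?_
  rw [Filter.eventually_cofinite]
  refine (finite_singleton (0 : ℤ)).subset ?_
  intro k hk
  by_contra hk0
  apply hk
  have hk1 : (k : ℝ) ≠ 0 := by exact_mod_cast hk0
  rw [Real.norm_of_nonneg (Real.rpow_nonneg (bracket_pos _).le _),
    ← Real.mul_rpow hc.le (abs_nonneg _)]
  apply Real.rpow_le_rpow_of_nonpos (mul_pos hc (abs_pos.2 hk1)) _ (by norm_num)
  have := abs_le_bracket (freq L k)
  rwa [freq_eq_mul, abs_mul, abs_of_pos hc, ← freq_eq_mul] at this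

/-- Uniformity in d: translating the lattice reduces the shift to at most one lattice spacing, and
such a shift changes brackets only by a bounded factor. -/
lemma tsum_jb_freq_add_le {L : ℝ} (hL : 0 < L) :
    ∃ C : ℝ≥0, ∀ d : ℝ, ∑' k : ℤ, jb (freq L k + d) (-(6 / 5)) ≤ C := by
  have hc : 0 < 2 * Real.pi / L := by positivity
  have hfin : ∑' k : ℤ, jb (freq L k) (-(6 / 5)) ≠ ⊤ :=
    (summable_bracket_freq hL).tsum_ofReal_ne_top
  set c := 2 * Real.pi / L
  set B := ENNReal.ofReal ((2 * bracket c) ^ (6 / 5 : ℝ)) * ∑' k : ℤ, jb (freq L k) (-(6 / 5))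
  have hB : B ≠ ⊤ := ENNReal.mul_ne_top ENNReal.ofReal_ne_top hfin
  refine ⟨B.toNNReal, fun d => ?_⟩
  rw [ENNReal.coe_toNNReal hB]
  set n := ⌊d / c⌋
  set θ := d - c * n
  have hθ : |θ| ≤ |c| := by
    have h1 : (n : ℝ) ≤ d / c := Int.floor_le _
    have h2 : d / c < n + 1 := Int.lt_floor_add_one _
    rw [le_div_iff₀ hc] at h1
    rw [div_lt_iff₀ hc] at h2
    rw [abs_of_pos hc, abs_of_nonneg] <;> simp only [θ] <;> nlinarith
  calc ∑' k : ℤ, jb (freq L k + d) (-(6 / 5)) = ∑' k : ℤ, jb (freq L k + θ) (-(6 / 5)) := by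
        rw [← (Equiv.addRight n).tsum_eq (fun k : ℤ => jb (freq L k + θ) (-(6 / 5)))]
        refine tsum_congr fun k => ?_
        simp only [Equiv.coe_addRight, θ]
        congr 1
        rw [freq_eq_mul, freq_eq_mul]
        push_cast
        ring
    _ ≤ ∑' k : ℤ, ENNReal.ofReal ((2 * bracket c) ^ (6 / 5 : ℝ)) * jb (freq L k) (-(6 / 5)) := by
        refine ENNReal.tsum_le_tsum fun k => ?_
        unfold jb
        have hbc := bracket_pos c
        rw [← ENNReal.ofReal_mul (by positivity)]
        apply ENNReal.ofReal_le_ofReal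
        have h1 : bracket (freq L k) ≤ 2 * bracket c * bracket (freq L k + θ) := by
          have h2 := bracket_add_le_mul (freq L k + θ) (-θ)
          rw [add_neg_cancel_right, bracket_neg] at h2
          have h3 := bracket_le_bracket hθ
          have h4 := bracket_pos (freq L k + θ)
          nlinarith
        have h2 : (2 * bracket c * bracket (freq L k + θ)) ^ (-(6 / 5) : ℝ) ≤
            bracket (freq L k) ^ (-(6 / 5) : ℝ) :=
          Real.rpow_le_rpow_of_nonpos (bracket_pos _) h1 (by norm_num)
        rw [Real.mul_rpow (by positivity) (bracket_pos _).le] at h2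
        have h3 : (2 * bracket c) ^ (6 / 5 : ℝ) * (2 * bracket c) ^ (-(6 / 5) : ℝ) = 1 := by
          rw [← Real.rpow_add (by positivity)]
          norm_num
        calc bracket (freq L k + θ) ^ (-(6 / 5) : ℝ)
            = (2 * bracket c) ^ (6 / 5 : ℝ) * ((2 * bracket c) ^ (-(6 / 5) : ℝ) *
                bracket (freq L k + θ) ^ (-(6 / 5) : ℝ)) := by rw [← mul_assoc, h3, one_mul]
          _ ≤ _ := by gcongr
    _ = B := by rw [ENNReal.tsum_mul_left]

/-- A lattice sum over a phase that grows at least quadratically away from at most two points. -/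
lemma tsum_jb_le_of_gap {L : ℝ} (hL : 0 < L) : ∃ C : ℝ≥0, ∀ (a : ℤ → ℝ) (B d₁ d₂ : ℝ), 0 < B →
    (∀ k, bracket (freq L k + d₁) ^ 2 ≤ B * bracket (a k) ∨
      bracket (freq L k + d₂) ^ 2 ≤ B * bracket (a k)) →
    ∑' k : ℤ, jb (a k) (-(3 / 5)) ≤ ENNReal.ofReal (B ^ (3 / 5 : ℝ)) * C := by
  obtain ⟨C, hC⟩ := tsum_jb_freq_add_le hL
  refine ⟨2 * C, fun a B d₁ d₂ hB h => ?_⟩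
  -- Quadratic growth doubles the exponent 3/5 to 6/5 > 1, at the price of the factor B^{3/5}.
  have aux : ∀ x y : ℝ, bracket x ^ 2 ≤ B * bracket y →
      jb y (-(3 / 5)) ≤ ENNReal.ofReal (B ^ (3 / 5 : ℝ)) * jb x (-(6 / 5)) := by
    intro x y hxy
    unfold jb
    rw [← ENNReal.ofReal_mul (by positivity)]
    apply ENNReal.ofReal_le_ofReal
    have h1 : (B * bracket y) ^ (-(3 / 5) : ℝ) ≤ (bracket x ^ 2) ^ (-(3 / 5) : ℝ) :=
      Real.rpow_le_rpow_of_nonpos (pow_pos (bracket_pos x) 2) hxy (by norm_num)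
    rw [← Real.rpow_natCast, ← Real.rpow_mul (bracket_pos x).le,
      Real.mul_rpow hB.le (bracket_pos y).le] at h1
    have h3 : B ^ (3 / 5 : ℝ) * B ^ (-(3 / 5) : ℝ) = 1 := by
      rw [← Real.rpow_add hB]
      norm_num
    calc bracket y ^ (-(3 / 5) : ℝ)
        = B ^ (3 / 5 : ℝ) * (B ^ (-(3 / 5) : ℝ) * bracket y ^ (-(3 / 5) : ℝ)) := by
          rw [← mul_assoc, h3, one_mul]
      _ ≤ B ^ (3 / 5 : ℝ) * bracket x ^ (((2 : ℕ) : ℝ) * (-(3 / 5))) := by gcongr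
      _ = _ := by norm_num
  calc ∑' k : ℤ, jb (a k) (-(3 / 5))
      ≤ ∑' k : ℤ, ENNReal.ofReal (B ^ (3 / 5 : ℝ)) *
          (jb (freq L k + d₁) (-(6 / 5)) + jb (freq L k + d₂) (-(6 / 5))) := by
        refine ENNReal.tsum_le_tsum fun k => ?_
        rcases h k with h1 | h1
        · exact (aux _ _ h1).trans (mul_le_mul_right le_self_add _)
        · exact (aux _ _ h1).trans (mul_le_mul_right le_add_self _)
    _ ≤ _ := by
        rw [ENNReal.tsum_mul_left, ENNReal.tsum_add]
        refine mul_le_mul_right ?_ _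
        push_cast
        rw [two_mul]
        exact add_le_add (hC _) (hC _)

/-! ### The phases -/

/-- The dispersion relation as a function of the wave number. -/
def Om (g x : ℝ) : ℝ := x ^ 3 - g * x

lemma dispersion_eq (L g : ℝ) (k : ℤ) : dispersion L g k = Om g (freq L k) := rfl

lemma Om_neg (g x : ℝ) : Om g (-x) = -Om g x := by
  unfold Om
  ring

lemma exists_Om_eq (g w : ℝ) : ∃ z, Om g z = w := by
  set M := 1 + |g| + |w|
  have hg := abs_nonneg g
  have hw := abs_nonneg w
  have hM : 1 ≤ M := by simp only [M]; linarith
  have hbig : |w| ≤ Om g M := by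
    unfold Om
    have h1 : g * M ≤ |g| * M := mul_le_mul_of_nonneg_right (le_abs_self g) (by linarith)
    have h2 : M ^ 2 ≤ M ^ 3 := pow_le_pow_right₀ hM (by norm_num)
    have h3 : M * (1 + |w|) = M ^ 2 - |g| * M := by simp only [M]; ring
    nlinarith
  have hc : ContinuousOn (Om g) (Icc (-M) M) := by unfold Om; fun_prop
  have h := intermediate_value_Icc (by linarith : -M ≤ M) hc
  have hmem : w ∈ Icc (Om g (-M)) (Om g M) := by
    rw [Om_neg]
    exact ⟨by linarith [neg_abs_le w], (le_abs_self w).trans hbig⟩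
  obtain ⟨z, -, hz⟩ := h hmem
  exact ⟨z, hz⟩

lemma mul_bracket_le_bracket_mul {T : ℝ} (hT : 0 < T) (hT1 : T ≤ 1) (x : ℝ) :
    T * bracket x ≤ bracket (T * x) := by
  refine le_of_sq_le_sq ?_ (bracket_pos _).le
  rw [mul_pow, bracket_sq, bracket_sq]
  nlinarith

/-- Let z be a real zero of x ↦ y + T·Ω(x). Then Ω(x) - Ω(z) = (x - z)(x² + xz + z² - g), and the
second factor is at least (x - z)²/4 - R. Far from z the growth is cubic, more than required, and
near z the constant absorbs everything. One centre is enough even if the cubic has three real zeros.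
-/
lemma cubic_gap {R g T : ℝ} (hg : |g| ≤ R) (hT : 0 < T) (hT1 : T ≤ 1) (y : ℝ) :
    ∃ d, ∀ x, bracket (x + d) ^ 2 ≤ (10 + 8 * R) / T * bracket (y + T * Om g x) := by
  obtain ⟨z, hz⟩ := exists_Om_eq g (-y / T)
  have hR : 0 ≤ R := (abs_nonneg g).trans hg
  refine ⟨-z, fun x => ?_⟩
  have e : y + T * Om g x = T * (Om g x - Om g z) := by
    rw [hz]
    field_simp
    ring
  rw [e]
  have h1 := mul_bracket_le_bracket_mul hT hT1 (Om g x - Om g z)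
  set Δ := Om g x - Om g z
  suffices h : bracket (x + -z) ^ 2 ≤ (10 + 8 * R) * bracket Δ by
    refine h.trans ?_
    rw [div_mul_eq_mul_div, le_div_iff₀ hT]
    nlinarith
  rw [bracket_sq]
  have hb := one_le_bracket Δ
  have hb2 := abs_le_bracket Δ
  set D := |x + -z|
  have hD : (x + -z) ^ 2 = D ^ 2 := (sq_abs _).symm
  have hD0 : 0 ≤ D := abs_nonneg _
  rw [hD]
  by_cases h : 8 * R < D ^ 2 ∧ 1 < D
  · have h2 : D * (D ^ 2 / 4 - R) ≤ |Δ| := by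
      have e2 : Δ = (x + -z) * (x ^ 2 + x * z + z ^ 2 - g) := by
        simp only [Δ, Om]
        ring
      rw [e2, abs_mul]
      refine mul_le_mul_of_nonneg_left ?_ hD0
      refine le_trans ?_ (le_abs_self _)
      have := (le_abs_self g).trans hg
      nlinarith [sq_nonneg (x + z)]
    nlinarith [h.1, h.2]
  · rw [not_and_or, not_lt, not_lt] at h
    rcases h with h | h <;> nlinarith

/-- The difference of two cubics shifted by ξ is quadratic. Completing the square at X = x + ξ/2
gives 3Tξ(X² - Y), whose leading coefficient is bounded below because |ξ| ≥ c. The distance to the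
nearer of ±√Y then controls the value. -/
lemma quad_gap {c g T ξ : ℝ} (hc : 0 < c) (hξ : c ≤ |ξ|) (hT : 0 < T) (hT1 : T ≤ 1) (y : ℝ) :
    ∃ d₁ d₂, ∀ x,
      bracket (x + d₁) ^ 2 ≤ (1 + 1 / (3 * c)) / T * bracket (y + T * (Om g (x + ξ) - Om g x)) ∨
      bracket (x + d₂) ^ 2 ≤ (1 + 1 / (3 * c)) / T * bracket (y + T * (Om g (x + ξ) - Om g x)) := by
  have hξ0 : ξ ≠ 0 := by
    rintro rfl
    simp at hξ
    linarith
  set Y := -(y + T * ξ * (ξ ^ 2 / 4 - g)) / (3 * T * ξ)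
  -- If Y is negative there is no real zero, and the vertex X = 0 serves as centre.
  set z := √(max Y 0)
  have hz : 0 ≤ z := Real.sqrt_nonneg _
  refine ⟨ξ / 2 - z, ξ / 2 + z, fun x => ?_⟩
  set X := x + ξ / 2
  have e : y + T * (Om g (x + ξ) - Om g x) = 3 * T * ξ * (X ^ 2 - Y) := by
    simp only [Y, X, Om]
    field_simp
    ring
  rw [e]
  have h1 : (|X| - z) ^ 2 ≤ |X ^ 2 - Y| := by
    rcases le_total Y 0 with hY | hY
    · have : z = 0 := by simp only [z]; rw [max_eq_right hY, Real.sqrt_zero]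
      rw [this, sub_zero, sq_abs]
      exact le_trans (by linarith) (le_abs_self _)
    · have hz2 : z ^ 2 = Y := by simp only [z]; rw [max_eq_left hY, Real.sq_sqrt hY]
      rw [← hz2, ← sq_abs X, sq_sub_sq, abs_mul, ← sq_abs (|X| - z), sq, mul_comm]
      refine mul_le_mul_of_nonneg_right ?_ (abs_nonneg _)
      rw [abs_of_nonneg (by positivity : 0 ≤ |X| + z)]
      rw [abs_le]
      constructor <;> linarith [abs_nonneg X]
  set a := 3 * T * ξ * (X ^ 2 - Y)
  have h2 : 3 * T * c * (|X| - z) ^ 2 ≤ |a| := by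
    have : |a| = 3 * T * |ξ| * |X ^ 2 - Y| := by
      simp only [a]
      rw [abs_mul, abs_mul, abs_of_pos (by positivity : 0 < 3 * T)]
    rw [this]
    have h0 : 0 ≤ 3 * T * |ξ| := by positivity
    calc 3 * T * c * (|X| - z) ^ 2 ≤ 3 * T * |ξ| * (|X| - z) ^ 2 := by gcongr
      _ ≤ _ := mul_le_mul_of_nonneg_left h1 h0
  have h3 : 1 + (|X| - z) ^ 2 ≤ (1 + 1 / (3 * c)) / T * bracket a := by
    have hb := one_le_bracket a
    have hb2 := abs_le_bracket a
    have h4 : (|X| - z) ^ 2 ≤ bracket a / (3 * T * c) := by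
      rw [le_div_iff₀ (by positivity)]
      linarith
    have h5 : 1 ≤ bracket a / T := by
      rw [le_div_iff₀ hT]
      linarith
    have e3 : (1 + 1 / (3 * c)) / T * bracket a = bracket a / T + bracket a / (3 * T * c) := by
      field_simp
    rw [e3]
    linarith
  rcases le_total 0 X with hX | hX
  · left
    rw [abs_of_nonneg hX] at h3
    rw [bracket_sq]
    convert h3 using 3
    simp only [X]
    ring
  · right
    rw [abs_of_nonpos hX] at h3
    rw [bracket_sq]
    have : (x + (ξ / 2 + z)) ^ 2 = (-X - z) ^ 2 := by simp only [X]; ring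
    rw [this]
    exact h3

/-! ### The multipliers -/

/-- This is where s ≤ 1/2 enters: the squared quotient of the weights is (⟨x⟩/⟨y⟩)^{2s} with 2s ≤ 1,
so it costs at most one power of ⟨x - y⟩. -/
lemma rpow_quotient_le {s x y : ℝ} (hs₀ : 0 ≤ s) (hs₁ : s ≤ 1 / 2) :
    (bracket x ^ s * bracket y ^ (-s)) ^ 2 ≤ 1 + 2 * bracket (x - y) := by
  have hx := bracket_pos x
  have hy := bracket_pos y
  have e : (bracket x ^ s * bracket y ^ (-s)) ^ 2 = (bracket x / bracket y) ^ (2 * s) := by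
    rw [Real.rpow_neg hy.le, ← div_eq_mul_inv, ← Real.div_rpow hx.le hy.le, ← Real.rpow_natCast,
      ← Real.rpow_mul (by positivity)]
    congr 1
    push_cast
    ring
  rw [e]
  have h1 : bracket x / bracket y ≤ 2 * bracket (x - y) := by
    rw [div_le_iff₀ hy]
    have := bracket_add_le_mul (x - y) y
    rw [sub_add_cancel] at this
    linarith
  rcases le_total (bracket x / bracket y) 1 with h | h
  · have h2 : (bracket x / bracket y) ^ (2 * s) ≤ 1 :=
      Real.rpow_le_one (by positivity) h (by linarith)
    linarith [bracket_pos (x - y)]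
  · have h2 : (bracket x / bracket y) ^ (2 * s) ≤ (bracket x / bracket y) ^ (1 : ℝ) :=
      Real.rpow_le_rpow_of_exponent_le h (by linarith)
    rw [Real.rpow_one] at h2
    linarith

/-- Put Q = x² + xy + y², so that the phase is (x - y)(Q - g). The squared multiplier is at most a
constant times x²|x - y|, the size of the phase once Q dominates g. If Q < 2R all frequencies are
bounded. The lower bound on |x - y| reflects the removal of the mean of v. -/
lemma multiplier_le₁ {c R : ℝ} (hc : 0 < c) (hR : 0 ≤ R) : ∃ C : ℝ, 0 < C ∧ ∀ s g x y : ℝ, 0 ≤ s →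
    s ≤ 1 / 2 → |g| ≤ R → c ≤ |x - y| →
    (x * (bracket x ^ s * bracket y ^ (-s))) ^ 2 ≤ C * bracket (Om g x - Om g y) := by
  refine ⟨(3 / c + 2) * (3 + 3 * R * (1 + 8 * R)), by positivity, fun s g x y hs₀ hs₁ hg hxy => ?_⟩
  have h1 := rpow_quotient_le (x := x) (y := y) hs₀ hs₁
  have h2 : 1 + 2 * bracket (x - y) ≤ (3 / c + 2) * |x - y| := by
    have h3 := bracket_le_one_add_abs (x - y)
    have h4 : 1 ≤ |x - y| / c := by rw [le_div_iff₀ hc]; linarith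
    have e : (3 / c + 2) * |x - y| = 3 * (|x - y| / c) + 2 * |x - y| := by ring
    rw [e]
    linarith
  have h3 : x ^ 2 * |x - y| ≤ (3 + 3 * R * (1 + 8 * R)) * bracket (Om g x - Om g y) := by
    set Q := x ^ 2 + x * y + y ^ 2
    have hQ1 : 3 / 4 * x ^ 2 ≤ Q := by simp only [Q]; nlinarith [sq_nonneg (x / 2 + y)]
    have hQ2 : |x - y| ^ 2 / 4 ≤ Q := by
      rw [sq_abs]; simp only [Q]; nlinarith [sq_nonneg (x + y)]
    have e : Om g x - Om g y = (x - y) * (Q - g) := by simp only [Om, Q]; ring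
    have hb := one_le_bracket (Om g x - Om g y)
    have hb2 := abs_le_bracket (Om g x - Om g y)
    have hga := (le_abs_self g).trans hg
    have hRR : 0 ≤ 3 * R * (1 + 8 * R) := by positivity
    by_cases h : 2 * R ≤ Q
    · have h4 : |x - y| * (Q / 2) ≤ |Om g x - Om g y| := by
        rw [e, abs_mul]
        refine mul_le_mul_of_nonneg_left ?_ (abs_nonneg _)
        exact le_trans (by linarith) (le_abs_self _)
      have h5 : x ^ 2 * |x - y| ≤ 8 / 3 * |Om g x - Om g y| := by
        have := mul_le_mul_of_nonneg_left hQ1 (abs_nonneg (x - y))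
        nlinarith
      nlinarith
    · push Not at h
      have h4 : |x - y| ≤ 1 + 8 * R := by nlinarith [abs_nonneg (x - y)]
      have h5 : x ^ 2 ≤ 3 * R := by linarith
      have h6 : x ^ 2 * |x - y| ≤ 3 * R * (1 + 8 * R) :=
        mul_le_mul h5 h4 (abs_nonneg _) (by positivity)
      nlinarith
  calc (x * (bracket x ^ s * bracket y ^ (-s))) ^ 2
      = x ^ 2 * (bracket x ^ s * bracket y ^ (-s)) ^ 2 := by ring
    _ ≤ x ^ 2 * ((3 / c + 2) * |x - y|) := by gcongr; exact h1.trans h2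
    _ = (3 / c + 2) * (x ^ 2 * |x - y|) := by ring
    _ ≤ _ := by rw [mul_assoc]; gcongr

/-- The phase is x(Q - g) up to sign, with Q = y² - y(x - y) + (x - y)² ≥ x²/4, and |x| ≥ c, so it
dominates x² unless Q is bounded by 2R. The Sobolev weights are merely bounded by 1. -/
lemma multiplier_le₂ {c R : ℝ} (hc : 0 < c) (hR : 0 ≤ R) : ∃ C : ℝ, 0 < C ∧ ∀ s g x y : ℝ, 0 ≤ s →
    |g| ≤ R → c ≤ |x| →
    (x * (bracket y ^ (-s) * bracket (x - y) ^ (-s))) ^ 2 ≤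
      C * bracket (-(Om g y + Om g (x - y))) := by
  refine ⟨8 / c + 8 * R, by positivity, fun s g x y hs₀ hg hx => ?_⟩
  rw [bracket_neg]
  have h0 : ∀ z : ℝ, bracket z ^ (-s) ≤ 1 := fun z =>
    Real.rpow_le_one_of_one_le_of_nonpos (one_le_bracket z) (by linarith)
  have h0' : ∀ z : ℝ, 0 ≤ bracket z ^ (-s) := fun z => Real.rpow_nonneg (bracket_pos z).le _
  have h1 : (bracket y ^ (-s) * bracket (x - y) ^ (-s)) ^ 2 ≤ 1 :=
    pow_le_one₀ (mul_nonneg (h0' _) (h0' _)) (mul_le_one₀ (h0 _) (h0' _) (h0 _))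
  have h2 : (x * (bracket y ^ (-s) * bracket (x - y) ^ (-s))) ^ 2 ≤ x ^ 2 := by
    rw [mul_pow]
    exact mul_le_of_le_one_right (sq_nonneg x) h1
  refine h2.trans ?_
  set Q := y ^ 2 - y * (x - y) + (x - y) ^ 2
  have hQ : x ^ 2 / 4 ≤ Q := by simp only [Q]; nlinarith [sq_nonneg (x - 2 * y)]
  have e : Om g y + Om g (x - y) = x * (Q - g) := by simp only [Om, Q]; ring
  have hb := one_le_bracket (Om g y + Om g (x - y))
  have hb2 := abs_le_bracket (Om g y + Om g (x - y))
  have hga := (le_abs_self g).trans hg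
  by_cases h : 2 * R ≤ Q
  · have h4 : c * (x ^ 2 / 8) ≤ |Om g y + Om g (x - y)| := by
      rw [e, abs_mul]
      refine mul_le_mul hx ?_ (by positivity) (abs_nonneg _)
      exact le_trans (by linarith) (le_abs_self _)
    have h5 : x ^ 2 ≤ 8 / c * |Om g y + Om g (x - y)| := by
      rw [div_mul_eq_mul_div, le_div_iff₀ hc]
      linarith
    have h6 : 8 / c * |Om g y + Om g (x - y)| ≤ 8 / c * bracket (Om g y + Om g (x - y)) := by
      gcongr
    nlinarith
  · push Not at h
    have : 0 ≤ 8 / c * bracket (Om g y + Om g (x - y)) := by positivity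
    nlinarith

/-! ### The two nonlinear terms of the system -/

/-- The multiplier of the nonlinear term in the equation for `u`. -/
def mul₁ (L s T : ℝ) (k k₁ : ℤ) : ℂ :=
  -- For k₁ = k the factor v contributes its zero mode g. This term is part of the dispersion
  -- relation.
  if k₁ = k then 0 else
    -Complex.I * ((T * (freq L k * (bracket (freq L k) ^ s * bracket (freq L k₁) ^ (-s))) : ℝ) : ℂ)

/-- The phase of the nonlinear term in the equation for `u`. -/
def ph₁ (L T g : ℝ) (k k₁ : ℤ) : ℝ := T * (Om g (freq L k) - Om g (freq L k₁))

/-- The multiplier of the nonlinear term in the equation for `v`. -/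
def mul₂ (L s T : ℝ) (k k₁ : ℤ) : ℂ :=
  -(Complex.I / 2) * ((T * (freq L k *
    (bracket (freq L k₁) ^ (-s) * bracket (freq L (k - k₁)) ^ (-s))) : ℝ) : ℂ)

/-- The phase of the nonlinear term in the equation for `v`. -/
def ph₂ (L T g : ℝ) (k k₁ : ℤ) : ℝ := T * -(Om g (freq L k₁) + Om g (freq L (k - k₁)))

/-- Rescaling time puts a factor T into both the multiplier and the phase. Since ⟨Tx⟩ ≥ T⟨x⟩, one
power of T survives. -/
lemma weight_sq_le {T C x : ℝ} {z : ℂ} (hT : 0 < T) (hT1 : T ≤ 1) (hC : 0 ≤ C)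
    (h : ‖z‖ ^ 2 ≤ T ^ 2 * (C * bracket x)) :
    (‖z‖ₑ * jb (T * x) (-(1 / 2))) ^ 2 ≤ ENNReal.ofReal (C * T) := by
  rw [mul_pow, jb_pow_two, ← ofReal_norm, jb, ← ENNReal.ofReal_pow (norm_nonneg _),
    ← ENNReal.ofReal_mul (by positivity)]
  apply ENNReal.ofReal_le_ofReal
  have h1 := mul_bracket_le_bracket_mul hT hT1 x
  have h2 := bracket_pos (T * x)
  rw [show (2 : ℝ) * -(1 / 2) = -1 by norm_num, Real.rpow_neg_one, ← div_eq_mul_inv,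
    div_le_iff₀ h2]
  calc ‖z‖ ^ 2 ≤ T ^ 2 * (C * bracket x) := h
    _ = C * T * (T * bracket x) := by ring
    _ ≤ _ := by gcongr

/-- The power T of the multiplier outweighs the loss T^{-3/5} of the lattice sum. The net factor
T^{2/5} is the source of smallness for short times. -/
lemma ofReal_mul_le {C T B : ℝ} {C' : ℝ≥0} (hT : 0 < T) (hC : 0 ≤ C) (hB : 0 < B) :
    ENNReal.ofReal (C * T) * (ENNReal.ofReal ((B / T) ^ (3 / 5 : ℝ)) * C') =
      ENNReal.ofReal (C * B ^ (3 / 5 : ℝ) * C' * T ^ (2 / 5 : ℝ)) := by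
  have e : (C' : ℝ≥0∞) = ENNReal.ofReal C' := by simp
  rw [e, ← ENNReal.ofReal_mul (by positivity), ← ENNReal.ofReal_mul (by positivity)]
  congr 1
  rw [Real.div_rpow hB.le hT.le]
  have h1 : T = T ^ (3 / 5 : ℝ) * T ^ (2 / 5 : ℝ) := by
    rw [← Real.rpow_add hT]
    norm_num
  have h2 : T ^ (3 / 5 : ℝ) ≠ 0 := (Real.rpow_pos_of_pos hT _).ne'
  nth_rewrite 1 [h1]
  field_simp

/-- One of the sums that make a multiplier and a phase admissible. -/
lemma tsum_weight_le {L : ℝ} {C' : ℝ≥0}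
    (hgap : ∀ (a : ℤ → ℝ) (B d₁ d₂ : ℝ), 0 < B →
      (∀ k, bracket (freq L k + d₁) ^ 2 ≤ B * bracket (a k) ∨
        bracket (freq L k + d₂) ^ 2 ≤ B * bracket (a k)) →
      ∑' k : ℤ, jb (a k) (-(3 / 5)) ≤ ENNReal.ofReal (B ^ (3 / 5 : ℝ)) * C')
    {T C B : ℝ} (hT : 0 < T) (hC : 0 ≤ C) (hB : 0 < B) {w : ℤ → ℝ≥0∞} {a : ℤ → ℝ}
    (hw : ∀ k, w k ^ 2 ≤ ENNReal.ofReal (C * T))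
    (ha : ∃ d₁ d₂ : ℝ, ∀ k, bracket (freq L k + d₁) ^ 2 ≤ B / T * bracket (a k) ∨
        bracket (freq L k + d₂) ^ 2 ≤ B / T * bracket (a k)) :
    ∑' k, w k ^ 2 * jb (a k) (-(3 / 5)) ≤
      ENNReal.ofReal (C * B ^ (3 / 5 : ℝ) * C' * T ^ (2 / 5 : ℝ)) := by
  obtain ⟨d₁, d₂, h⟩ := ha
  rw [← ofReal_mul_le hT hC hB]
  calc ∑' k, w k ^ 2 * jb (a k) (-(3 / 5))
      ≤ ∑' k, ENNReal.ofReal (C * T) * jb (a k) (-(3 / 5)) := by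
        gcongr with k
        exact hw k
    _ ≤ _ := by
        rw [ENNReal.tsum_mul_left]
        gcongr
        exact hgap a (B / T) d₁ d₂ (by positivity) h

/-- Six sums, each over one frequency with another held fixed. If just one of the arguments of Ω in
the phase varies, the phase is cubic in it. If both vary, with fixed difference for the first phase
or fixed sum for the second, it is quadratic, and the fixed frequency must not be zero; when it is
zero, the multiplier vanishes. The constant depends on g only through the bound R. -/
lemma exists_admissible {L : ℝ} (hL : 0 < L) {s : ℝ} (hs₀ : 0 ≤ s) (hs₁ : s ≤ 1 / 2) {R : ℝ}
    (hR : 0 ≤ R) : ∃ K : ℝ, 0 ≤ K ∧ ∀ T g : ℝ, 0 < T → T ≤ 1 → |g| ≤ R →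
      Admissible (mul₁ L s T) (ph₁ L T g) (ENNReal.ofReal (K * T ^ (2 / 5 : ℝ))) ∧
      Admissible (mul₂ L s T) (ph₂ L T g) (ENNReal.ofReal (K * T ^ (2 / 5 : ℝ))) := by
  set c := 2 * Real.pi / L
  have hc : 0 < c := by positivity
  obtain ⟨C', hgap⟩ := tsum_jb_le_of_gap hL
  obtain ⟨C₁, hC₁, h₁⟩ := multiplier_le₁ hc hR
  obtain ⟨C₂, hC₂, h₂⟩ := multiplier_le₂ hc hR
  set B := (10 + 8 * R) + (1 + 1 / (3 * c))
  set C := C₁ + C₂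
  have hB : 0 < B := by positivity
  have hC : 0 ≤ C := by positivity
  refine ⟨C * B ^ (3 / 5 : ℝ) * C', by positivity, fun T g hT hT1 hg => ?_⟩
  have hcub : ∀ y x₀ : ℝ, ∃ d₁ d₂ : ℝ, ∀ k : ℤ,
      bracket (freq L k + d₁) ^ 2 ≤ B / T * bracket (y + T * Om g (freq L k + x₀)) ∨
      bracket (freq L k + d₂) ^ 2 ≤ B / T * bracket (y + T * Om g (freq L k + x₀)) := by
    intro y x₀
    obtain ⟨d, hd⟩ := cubic_gap hg hT hT1 y
    -- The cubic has a single centre; the second one is a dummy.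
    refine ⟨x₀ + d, 0, fun k => Or.inl ?_⟩
    rw [← add_assoc]
    refine (hd _).trans ?_
    have := (bracket_pos (y + T * Om g (freq L k + x₀))).le
    gcongr
    simp only [B]
    have : 0 < 1 / (3 * c) := by positivity
    linarith
  have hquad : ∀ y x₀ ξ : ℝ, c ≤ |ξ| → ∃ d₁ d₂ : ℝ, ∀ k : ℤ,
      bracket (freq L k + d₁) ^ 2 ≤
        B / T * bracket (y + T * (Om g (freq L k + x₀ + ξ) - Om g (freq L k + x₀))) ∨
      bracket (freq L k + d₂) ^ 2 ≤
        B / T * bracket (y + T * (Om g (freq L k + x₀ + ξ) - Om g (freq L k + x₀))) := by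
    intro y x₀ ξ hξ
    obtain ⟨d₁, d₂, hd⟩ := quad_gap (g := g) hc hξ hT hT1 y
    refine ⟨x₀ + d₁, x₀ + d₂, fun k => ?_⟩
    rw [← add_assoc, ← add_assoc]
    have hle : (1 + 1 / (3 * c)) / T ≤ B / T := by
      gcongr
      simp only [B]
      linarith
    have hb := (bracket_pos (y + T * (Om g (freq L k + x₀ + ξ) - Om g (freq L k + x₀)))).le
    refine (hd (freq L k + x₀)).imp ?_ ?_ <;>
    · intro h
      exact h.trans (mul_le_mul_of_nonneg_right hle hb)
  have hw₁ : ∀ k k₁, (‖mul₁ L s T k k₁‖ₑ * jb (ph₁ L T g k k₁) (-(1 / 2))) ^ 2 ≤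
      ENNReal.ofReal (C * T) := by
    intro k k₁
    apply weight_sq_le hT hT1 hC
    unfold mul₁
    split_ifs with h
    · have hb := (bracket_pos (Om g (freq L k) - Om g (freq L k₁))).le
      have := mul_nonneg (sq_nonneg T) (mul_nonneg hC hb)
      simpa using this
    · rw [norm_mul, norm_neg, Complex.norm_I, one_mul, Complex.norm_real, Real.norm_eq_abs, sq_abs,
        mul_pow]
      gcongr
      refine (h₁ s g _ _ hs₀ hs₁ hg ?_).trans ?_
      · rw [← freq_sub]
        exact le_abs_freq hL (sub_ne_zero.2 (Ne.symm h))
      · have := (bracket_pos (Om g (freq L k) - Om g (freq L k₁))).le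
        gcongr
        simp only [C]
        linarith
  have hw₂ : ∀ k k₁, (‖mul₂ L s T k k₁‖ₑ * jb (ph₂ L T g k k₁) (-(1 / 2))) ^ 2 ≤
      ENNReal.ofReal (C * T) := by
    intro k k₁
    apply weight_sq_le hT hT1 hC
    have hb := (bracket_pos (-(Om g (freq L k₁) + Om g (freq L (k - k₁))))).le
    by_cases hk : k = 0
    · simp only [mul₂, hk, freq_zero, zero_mul, mul_zero, Complex.ofReal_zero, norm_zero]
      subst hk
      have := mul_nonneg (sq_nonneg T) (mul_nonneg hC hb)
      simpa using this
    · unfold mul₂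
      rw [norm_mul, norm_neg, norm_div, Complex.norm_I, Complex.norm_real, Real.norm_eq_abs,
        mul_pow, sq_abs, mul_pow]
      have h3 := h₂ s g (freq L k) (freq L k₁) hs₀ hg (le_abs_freq hL hk)
      rw [← freq_sub] at h3
      have h4 : (1 / ‖(2 : ℂ)‖) ^ 2 ≤ 1 := by norm_num
      calc _ ≤ 1 * (T ^ 2 * (freq L k * (bracket (freq L k₁) ^ (-s) *
            bracket (freq L (k - k₁)) ^ (-s))) ^ 2) := by gcongr
        _ ≤ _ := by
          rw [one_mul]
          gcongr
          refine h3.trans ?_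
          gcongr
          simp only [C]
          linarith
  constructor
  · constructor
    · constructor
      · intro k y
        refine tsum_weight_le hgap hT hC hB (hw₁ k) ?_
        obtain ⟨d₁, d₂, h⟩ := hcub (-(y + T * Om g (freq L k))) 0
        refine ⟨d₁, d₂, fun k₁ => ?_⟩
        have := h k₁
        rw [← bracket_neg (_ + _ * _), add_zero] at this
        convert this using 4 <;> · unfold ph₁; ring
      · intro k₁ y
        refine tsum_weight_le hgap hT hC hB (fun k => hw₁ k k₁) ?_
        obtain ⟨d₁, d₂, h⟩ := hcub (y - T * Om g (freq L k₁)) 0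
        refine ⟨d₁, d₂, fun k => ?_⟩
        have := h k
        rw [add_zero] at this
        convert this using 4 <;> · unfold ph₁; ring
      · intro k₂ y
        -- The phase φ₁ vanishes identically for k₂ = 0, but so does the multiplier, since the mean
        -- of v was removed.
        by_cases hk : k₂ = 0
        · subst hk
          simp [mul₁]
        refine tsum_weight_le hgap hT hC hB (fun k₁ => hw₁ (k₁ + k₂) k₁) ?_
        obtain ⟨d₁, d₂, h⟩ := hquad y 0 (freq L k₂) (le_abs_freq hL hk)
        refine ⟨d₁, d₂, fun k₁ => ?_⟩
        have := h k₁
        rw [add_zero] at this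
        simp only [ph₁, freq_add]
        exact this
    · intro k
      refine ⟨T * (|freq L k| * bracket (freq L k) ^ s), fun k₁ => ?_⟩
      have hb := bracket_pos (freq L k)
      unfold mul₁
      split_ifs
      · rw [norm_zero]
        positivity
      · rw [norm_mul, norm_neg, Complex.norm_I, one_mul, Complex.norm_real, Real.norm_eq_abs,
          abs_mul, abs_mul, abs_of_pos hT]
        gcongr
        rw [abs_of_nonneg (mul_nonneg (Real.rpow_nonneg hb.le _)
          (Real.rpow_nonneg (bracket_pos _).le _))]
        exact mul_le_of_le_one_right (Real.rpow_nonneg hb.le _)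
          (Real.rpow_le_one_of_one_le_of_nonpos (one_le_bracket _) (by linarith))
  · constructor
    · constructor
      · intro k y
        -- At k = 0 the derivative in front of u² kills the multiplier.
        by_cases hk : k = 0
        · subst hk
          simp [mul₂]
        refine tsum_weight_le hgap hT hC hB (hw₂ k) ?_
        obtain ⟨d₁, d₂, h⟩ := hquad (-y) (-freq L k) (freq L k) (le_abs_freq hL hk)
        refine ⟨d₁, d₂, fun k₁ => ?_⟩
        have h' := h k₁
        -- Because Ω is odd, the sum of its values at ξ₁ and ξ - ξ₁ is a difference of values at two
        -- points whose distance is the fixed ξ.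
        have e : y + ph₂ L T g k k₁ = -(-y + T * (Om g (freq L k₁ + -freq L k + freq L k) -
            Om g (freq L k₁ + -freq L k))) := by
          have e' : Om g (freq L k₁ + -freq L k) = -Om g (freq L k - freq L k₁) := by
            rw [← Om_neg]
            congr 1
            ring
          unfold ph₂
          rw [neg_add_cancel_right, freq_sub, e']
          ring
        rw [e, bracket_neg]
        exact h'
      · intro k₁ y
        refine tsum_weight_le hgap hT hC hB (fun k => hw₂ k k₁) ?_
        obtain ⟨d₁, d₂, h⟩ := hcub (-(y - T * Om g (freq L k₁))) (-freq L k₁)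
        refine ⟨d₁, d₂, fun k => ?_⟩
        have := h k
        rw [← bracket_neg (_ + _ * _), ← sub_eq_add_neg, ← freq_sub] at this
        convert this using 4 <;> · unfold ph₂; ring
      · intro k₂ y
        refine tsum_weight_le hgap hT hC hB (fun k₁ => hw₂ (k₁ + k₂) k₁) ?_
        obtain ⟨d₁, d₂, h⟩ := hcub (-(y - T * Om g (freq L k₂))) 0
        refine ⟨d₁, d₂, fun k₁ => ?_⟩
        have := h k₁
        rw [← bracket_neg (_ + _ * _), add_zero] at this
        convert this using 4 <;>
        · unfold ph₂
          rw [show k₁ + k₂ - k₁ = k₂ by ring]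
          ring
    · intro k
      refine ⟨T * |freq L k|, fun k₁ => ?_⟩
      unfold mul₂
      have hx : ∀ x, 0 ≤ bracket x ^ (-s) := fun x => Real.rpow_nonneg (bracket_pos x).le _
      have hx1 : ∀ x, bracket x ^ (-s) ≤ 1 := fun x =>
        Real.rpow_le_one_of_one_le_of_nonpos (one_le_bracket _) (by linarith)
      rw [norm_mul, norm_neg, norm_div, Complex.norm_I, Complex.norm_real, Real.norm_eq_abs,
          abs_mul, abs_mul, abs_of_pos hT, abs_of_nonneg (mul_nonneg (hx _) (hx _))]
      have h4 : (1 / ‖(2 : ℂ)‖) ≤ 1 := by norm_num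
      have h5 : bracket (freq L k₁) ^ (-s) * bracket (freq L (k - k₁)) ^ (-s) ≤ 1 :=
        mul_le_one₀ (hx1 _) (hx _) (hx1 _)
      have h6 := mul_nonneg (hx (freq L k₁)) (hx (freq L (k - k₁)))
      calc _ ≤ 1 * (T * (|freq L k| * 1)) := by
            refine mul_le_mul h4 ?_ (by positivity) zero_le_one
            gcongr
        _ = _ := by ring

/-! ### Quadratic equations in complete seminormed groups -/

section FixedPoint

variable {E : Type*} [SeminormedAddCommGroup E]

/-- A bounded biadditive map. -/
structure BddBiadditive (B : E → E → E) (κ : ℝ) : Prop where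
  sub_left : ∀ z z' w, B (z - z') w = B z w - B z' w
  sub_right : ∀ z w w', B z (w - w') = B z w - B z w'
  bound : ∀ z w, ‖B z w‖ ≤ κ * (‖z‖ * ‖w‖)

variable {B : E → E → E} {κ ρ : ℝ}

lemma BddBiadditive.norm_sub_le (hB : BddBiadditive B κ) (hκ : 0 ≤ κ) (hρ : 4 * (κ * ρ) ≤ 1)
    {z z' : E} (hz : ‖z‖ ≤ ρ) (hz' : ‖z'‖ ≤ ρ) : ‖B z z - B z' z'‖ ≤ 1 / 2 * ‖z - z'‖ := by
  have e : B z z - B z' z' = B (z - z') z + B z' (z - z') := by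
    rw [hB.sub_left, hB.sub_right]
    abel
  have hn := norm_nonneg (z - z')
  calc ‖B z z - B z' z'‖ ≤ ‖B (z - z') z‖ + ‖B z' (z - z')‖ := e ▸ norm_add_le _ _
    _ ≤ κ * (‖z - z'‖ * ‖z‖) + κ * (‖z'‖ * ‖z - z'‖) :=
        add_le_add (hB.bound _ _) (hB.bound _ _)
    _ ≤ κ * (‖z - z'‖ * ρ) + κ * (ρ * ‖z - z'‖) := by gcongr
    _ = 2 * (κ * ρ) * ‖z - z'‖ := by ring
    _ ≤ _ := by gcongr; linarith

/-- Picard iteration from 0 in the ball of radius ρ, with Lipschitz constant 1/2. The norm is only a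
seminorm, so the limit is a fixed point up to an element of norm zero. -/
lemma BddBiadditive.exists_eq_add [CompleteSpace E] (hB : BddBiadditive B κ) (hκ : 0 ≤ κ)
    (hρ : 4 * (κ * ρ) ≤ 1) {l : E} (hl : ‖l‖ ≤ ρ / 2) :
    ∃ z, ‖z‖ ≤ ρ ∧ ‖z - (l + B z z)‖ = 0 := by
  have hρ0 : 0 ≤ ρ := by linarith [norm_nonneg l]
  let Φ : E → E := fun z => l + B z z
  have hΦ : ∀ z, ‖z‖ ≤ ρ → ‖Φ z‖ ≤ ρ := by
    intro z hz
    calc ‖Φ z‖ ≤ ‖l‖ + ‖B z z‖ := norm_add_le _ _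
      _ ≤ ρ / 2 + κ * (ρ * ρ) := by
          gcongr
          exact (hB.bound z z).trans (by gcongr)
      _ ≤ ρ := by nlinarith
  have hlip : ∀ z z', ‖z‖ ≤ ρ → ‖z'‖ ≤ ρ → ‖Φ z - Φ z'‖ ≤ 1 / 2 * ‖z - z'‖ := by
    intro z z' hz hz'
    have := hB.norm_sub_le hκ hρ hz hz'
    simpa [Φ] using this
  let u : ℕ → E := fun n => Φ^[n] 0
  have hu : ∀ n, u (n + 1) = Φ (u n) := fun n => Function.iterate_succ_apply' Φ n 0
  have hball : ∀ n, ‖u n‖ ≤ ρ := by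
    intro n
    induction n with
    | zero => simpa [u] using hρ0
    | succ n ih => rw [hu]; exact hΦ _ ih
  have hstep : ∀ n, dist (u n) (u (n + 1)) ≤ dist (u 0) (u 1) * (1 / 2) ^ n := by
    intro n
    induction n with
    | zero => simp
    | succ n ih =>
      rw [dist_eq_norm, hu n, hu (n + 1)]
      have h := hlip _ _ (hball n) (hball (n + 1))
      rw [← dist_eq_norm (u n)] at h
      calc _ ≤ _ := h
        _ ≤ 1 / 2 * (dist (u 0) (u 1) * (1 / 2) ^ n) := by gcongr
        _ = _ := by ring
  have hcau : CauchySeq u := cauchySeq_of_le_geometric (1 / 2) _ (by norm_num) hstep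
  obtain ⟨z, hz⟩ := cauchySeq_tendsto_of_complete hcau
  have hzρ : ‖z‖ ≤ ρ := le_of_tendsto hz.norm (Eventually.of_forall hball)
  refine ⟨z, hzρ, ?_⟩
  have h1 : Tendsto (fun n => ‖u (n + 1) - z‖ + 1 / 2 * ‖u n - z‖) atTop (𝓝 0) := by
    have h2 := tendsto_iff_norm_sub_tendsto_zero.1 hz
    have h3 := h2.comp (tendsto_add_atTop_nat 1)
    have h4 := h3.add (h2.const_mul (1 / 2))
    rw [mul_zero, add_zero] at h4
    exact h4
  refine le_antisymm (ge_of_tendsto h1 (Eventually.of_forall fun n => ?_)) (norm_nonneg _)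
  have h4 := hlip _ _ (hball n) hzρ
  rw [← hu] at h4
  calc ‖z - Φ z‖ = ‖(z - u (n + 1)) + (u (n + 1) - Φ z)‖ := by congr 1; abel
    _ ≤ ‖z - u (n + 1)‖ + ‖u (n + 1) - Φ z‖ := norm_add_le _ _
    _ ≤ _ := by
        rw [norm_sub_rev z]
        gcongr

/-- Stability of the fixed point under changes of both l and B. Only B' needs a bound, and B' - B is
measured only at the one point z; strong convergence of the operators is therefore enough. With
equal operators and data it is uniqueness in the ball. -/
lemma BddBiadditive.norm_sub_le_of_eq_add {B' : E → E → E} (hB : BddBiadditive B' κ) (hκ : 0 ≤ κ)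
    (hρ : 4 * (κ * ρ) ≤ 1) {l l' z z' : E} (hz : ‖z‖ ≤ ρ) (hz' : ‖z'‖ ≤ ρ)
    (h : ‖z - (l + B z z)‖ = 0) (h' : ‖z' - (l' + B' z' z')‖ = 0) :
    ‖z' - z‖ ≤ 2 * (‖l' - l‖ + ‖B' z z - B z z‖) := by
  have e : z' - z = (z' - (l' + B' z' z')) + (l' - l) + (B' z' z' - B' z z) +
      (B' z z - B z z) + -(z - (l + B z z)) := by abel
  have h1 := hB.norm_sub_le hκ hρ hz' hz
  have h2 : ‖z' - z‖ ≤ ‖z' - (l' + B' z' z')‖ + ‖l' - l‖ + ‖B' z' z' - B' z z‖ +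
      ‖B' z z - B z z‖ + ‖-(z - (l + B z z))‖ := by
    conv_lhs => rw [e]
    refine (norm_add_le _ _).trans ?_
    gcongr
    refine (norm_add_le _ _).trans ?_
    gcongr
    refine (norm_add_le _ _).trans ?_
    gcongr
    exact norm_add_le _ _
  rw [norm_neg, h, h'] at h2
  linarith

end FixedPoint

/-! ### The bilinear operators on the space `ZS` -/

open Classical in
/-- The bilinear Duhamel operator on the space `ZS`. -/
def ZS.bilin (m : ℤ → ℤ → ℂ) (φ : ℤ → ℤ → ℝ) (p q : ZS) : ZS :=
  -- For admissible m and φ the norm is always finite, so the default value 0 does not occur.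
  if h : zn (DSW.bilin m φ p.1 q.1) < ⊤ then
    ⟨DSW.bilin m φ p.1 q.1, measurable_bilin p.meas q.meas, h⟩ else 0

section

variable {m : ℤ → ℤ → ℂ} {φ : ℤ → ℤ → ℝ} {S : ℝ}

/-- The norm of the bilinear Duhamel operator. -/
def bilinNorm (S : ℝ) : ℝ := 2 * ((bilinC.toReal * S) ^ (1 / 2 : ℝ))

lemma zn_bilin_le_ofReal (hS : 0 ≤ S) (h : Admissible m φ (ENNReal.ofReal S)) (p q : ZS) :
    zn (DSW.bilin m φ p.1 q.1) ≤ ENNReal.ofReal (bilinNorm S * (‖p‖ * ‖q‖)) := by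
  refine (zn_bilin_le h p.meas q.meas).trans (le_of_eq ?_)
  have hC : bilinC = ENNReal.ofReal bilinC.toReal := (ENNReal.ofReal_toReal bilinC_ne_top).symm
  rw [ZS.zn_eq, ZS.zn_eq, bilinNorm, hC, ENNReal.toReal_ofReal ENNReal.toReal_nonneg,
    ← ENNReal.ofReal_mul ENNReal.toReal_nonneg, ← ENNReal.ofReal_mul (norm_nonneg _),
    ENNReal.ofReal_rpow_of_nonneg (by positivity) (by norm_num),
    ← ENNReal.ofReal_mul (by positivity), mul_assoc, ENNReal.ofReal_mul (p := 2) (by norm_num)]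
  simp

lemma ZS.coe_bilin (hS : 0 ≤ S) (h : Admissible m φ (ENNReal.ofReal S)) (p q : ZS) :
    (ZS.bilin m φ p q).1 = DSW.bilin m φ p.1 q.1 := by
  rw [ZS.bilin, dif_pos (lt_of_le_of_lt (zn_bilin_le_ofReal hS h p q) ENNReal.ofReal_lt_top)]

lemma bilinNorm_nonneg (hS : 0 ≤ S) : 0 ≤ bilinNorm S := by
  unfold bilinNorm
  positivity

lemma ZS.norm_bilin_le (hS : 0 ≤ S) (h : Admissible m φ (ENNReal.ofReal S)) (p q : ZS) :
    ‖ZS.bilin m φ p q‖ ≤ bilinNorm S * (‖p‖ * ‖q‖) := by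
  have := bilinNorm_nonneg hS
  rw [ZS.norm_def, ZS.coe_bilin hS h]
  exact ENNReal.toReal_le_of_le_ofReal (by positivity) (zn_bilin_le_ofReal hS h p q)

lemma ZS.bilin_sub_left (hS : 0 ≤ S) (h : Admissible m φ (ENNReal.ofReal S)) (p p' q : ZS) :
    ZS.bilin m φ (p - p') q = ZS.bilin m φ p q - ZS.bilin m φ p' q := by
  ext1
  rw [ZS.coe_sub, ZS.coe_bilin hS h, ZS.coe_bilin hS h, ZS.coe_bilin hS h,
    DSW.bilin_sub_left h.bdd]

lemma ZS.bilin_sub_right (hS : 0 ≤ S) (h : Admissible m φ (ENNReal.ofReal S)) (p q q' : ZS) :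
    ZS.bilin m φ p (q - q') = ZS.bilin m φ p q - ZS.bilin m φ p q' := by
  ext1
  rw [ZS.coe_sub, ZS.coe_bilin hS h, ZS.coe_bilin hS h, ZS.coe_bilin hS h,
    DSW.bilin_sub_right h.bdd]

end

/-- The quadratic part of the Duhamel formula for the system. -/
def sysB (m₁ m₂ : ℤ → ℤ → ℂ) (φ₁ φ₂ : ℤ → ℤ → ℝ) (z w : ZS × ZS) : ZS × ZS :=
  (ZS.bilin m₁ φ₁ z.1 w.2, ZS.bilin m₂ φ₂ z.1 w.1)

lemma bddBiadditive_sysB {m₁ m₂ : ℤ → ℤ → ℂ} {φ₁ φ₂ : ℤ → ℤ → ℝ} {S : ℝ} (hS : 0 ≤ S)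
    (h₁ : Admissible m₁ φ₁ (ENNReal.ofReal S)) (h₂ : Admissible m₂ φ₂ (ENNReal.ofReal S)) :
    BddBiadditive (sysB m₁ m₂ φ₁ φ₂) (bilinNorm S) where
  sub_left z z' w := by
    ext1
    · exact ZS.bilin_sub_left hS h₁ _ _ _
    · exact ZS.bilin_sub_left hS h₂ _ _ _
  sub_right z w w' := by
    ext1
    · exact ZS.bilin_sub_right hS h₁ _ _ _
    · exact ZS.bilin_sub_right hS h₂ _ _ _
  bound z w := by
    have := bilinNorm_nonneg hS
    refine norm_prod_le_iff.2 ⟨(ZS.norm_bilin_le hS h₁ _ _).trans ?_,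
      (ZS.norm_bilin_le hS h₂ _ _).trans ?_⟩
    · gcongr
      · exact norm_fst_le z
      · exact norm_snd_le w
    · gcongr
      · exact norm_fst_le z
      · exact norm_fst_le w

/-! ### The linear part of the Duhamel formula -/

/-- The transform of the constant function of time with value `c`, cut off in time. -/
def linP (c : ℤ → ℂ) (k : ℤ) (σ : ℝ) : ℂ := c k * cutK σ

/-- The square of the `ℓ²` norm of a sequence. -/
def sql2 (c : ℤ → ℂ) : ℝ≥0∞ := ∑' k, ‖c k‖ₑ ^ 2

/-- The constant in the bound of the linear part. -/
def linC : ℝ≥0∞ := (∫⁻ σ, jb σ 1 * ‖cutK σ‖ₑ ^ 2) ^ (1 / 2 : ℝ) + ∫⁻ σ, ‖cutK σ‖ₑ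

lemma linC_ne_top : linC ≠ ⊤ := by
  have h1 : ∫⁻ σ, jb σ 1 * ‖cutK σ‖ₑ ^ 2 < ⊤ := by
    calc ∫⁻ σ, jb σ 1 * ‖cutK σ‖ₑ ^ 2
        ≤ ∫⁻ σ, ENNReal.ofReal cutC ^ 2 * jb σ (-3) := by
          refine lintegral_mono fun σ => ?_
          calc jb σ 1 * ‖cutK σ‖ₑ ^ 2 ≤ jb σ 1 * (ENNReal.ofReal cutC * jb σ (-2)) ^ 2 := by
                gcongr
                exact enorm_cutK_le σ
            _ = ENNReal.ofReal cutC ^ 2 * (jb σ 1 * jb σ (-2) ^ 2) := by ring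
            _ = _ := by
                rw [jb_pow_two, jb_mul]
                norm_num
      _ < ⊤ := by
          rw [lintegral_const_mul _ (by fun_prop)]
          exact ENNReal.mul_lt_top (by finiteness) (lintegral_jb_lt_top (by norm_num))
  have h2 : ∫⁻ σ, ‖cutK σ‖ₑ < ⊤ := integrable_cutK.2
  exact (ENNReal.add_lt_top.2 ⟨rpow_half_lt_top.2 h1, h2⟩).ne

lemma zn_linP (c : ℤ → ℂ) : zn (linP c) = linC * sql2 c ^ (1 / 2 : ℝ) := by
  have h1 : sqX1 (linP c) = (∫⁻ σ, ‖cutK σ‖ₑ) ^ 2 * sql2 c := by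
    unfold sqX1 linP sql2
    rw [← ENNReal.tsum_mul_left]
    refine tsum_congr fun k => ?_
    simp only [enorm_mul]
    rw [lintegral_const_mul _ (by fun_prop)]
    ring
  have h2 : sqX2 (linP c) = (∫⁻ σ, jb σ 1 * ‖cutK σ‖ₑ ^ 2) * sql2 c := by
    unfold sqX2 linP sql2
    rw [← ENNReal.tsum_mul_left]
    refine tsum_congr fun k => ?_
    rw [← lintegral_mul_const _ (by fun_prop)]
    congr 1
    ext σ
    rw [enorm_mul]
    ring
  rw [zn, h1, h2, ENNReal.mul_rpow_of_nonneg _ _ (by norm_num),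
    ENNReal.mul_rpow_of_nonneg _ _ (by norm_num), sq_rpow_half, linC, add_mul]

open Classical in
/-- The linear part of the Duhamel formula, as an element of `ZS`. -/
def ZS.lin (c : ℤ → ℂ) : ZS :=
  if h : sql2 c < ⊤ then
    ⟨linP c, fun k => by unfold linP; fun_prop, by
      rw [zn_linP]
      exact ENNReal.mul_lt_top linC_ne_top.lt_top (rpow_half_lt_top.2 h)⟩ else 0

lemma ZS.coe_lin {c : ℤ → ℂ} (h : sql2 c < ⊤) : (ZS.lin c).1 = linP c := by
  rw [ZS.lin, dif_pos h]

lemma ZS.norm_lin {c : ℤ → ℂ} (h : sql2 c < ⊤) :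
    ‖ZS.lin c‖ = linC.toReal * (sql2 c ^ (1 / 2 : ℝ)).toReal := by
  rw [ZS.norm_def, ZS.coe_lin h, zn_linP, ENNReal.toReal_mul]

lemma sql2_sub_lt_top {c c' : ℤ → ℂ} (h : sql2 c < ⊤) (h' : sql2 c' < ⊤) : sql2 (c - c') < ⊤ := by
  calc sql2 (c - c') ≤ ∑' k, 2 * (‖c k‖ₑ ^ 2 + ‖c' k‖ₑ ^ 2) := by
        unfold sql2
        gcongr with k
        refine le_trans ?_ (add_sq_le_two_mul _ _)
        gcongr
        exact enorm_sub_le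
    _ < ⊤ := by
        rw [ENNReal.tsum_mul_left, ENNReal.tsum_add]
        exact ENNReal.mul_lt_top (by norm_num) (ENNReal.add_lt_top.2 ⟨h, h'⟩)

lemma ZS.lin_sub {c c' : ℤ → ℂ} (h : sql2 c < ⊤) (h' : sql2 c' < ⊤) :
    ZS.lin c - ZS.lin c' = ZS.lin (c - c') := by
  ext1
  rw [ZS.coe_sub, ZS.coe_lin h, ZS.coe_lin h', ZS.coe_lin (sql2_sub_lt_top h h')]
  ext k σ
  simp only [linP, Pi.sub_apply]
  ring

lemma tp_lin {c : ℤ → ℂ} (h : sql2 c < ⊤) (k : ℤ) {t : ℝ} (ht : t ∈ Icc (0 : ℝ) 1) :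
    tp (ZS.lin c).1 k t = c k := by
  rw [ZS.coe_lin h]
  unfold tp linP
  have : ∀ σ : ℝ, ee (σ * t) * (c k * cutK σ) = c k * (ee (σ * t) * cutK σ) := fun σ => by ring
  simp_rw [this]
  rw [integral_const_mul, isCutoff.inv t ht, mul_one]

/-! ### Continuous dependence of the bilinear operator on the phase -/

/-- The set of frequencies of size at most `N`. -/
def lowSet (N : ℕ) : Set (ℤ × ℝ) := {x | |(x.1 : ℝ)| ≤ N ∧ |x.2| ≤ N}

lemma measurableSet_lowSet (N : ℕ) : MeasurableSet (lowSet N) := by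
  have h1 : Measurable fun x : ℤ × ℝ => |(x.1 : ℝ)| := by fun_prop
  have h2 : Measurable fun x : ℤ × ℝ => |x.2| := by fun_prop
  exact (measurableSet_le h1 measurable_const).inter (measurableSet_le h2 measurable_const)

/-- The restriction to frequencies of size at most `N`. -/
def lowP (N : ℕ) (p : ℤ → ℝ → ℂ) (k : ℤ) (σ : ℝ) : ℂ :=
  (lowSet N).indicator (fun x : ℤ × ℝ => p x.1 x.2) (k, σ)

lemma measurable_lowP {p : ℤ → ℝ → ℂ} (hp : ∀ k, Measurable (p k)) (N : ℕ) (k : ℤ) :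
    Measurable (lowP N p k) := by
  have h := (measurable_uncurry_of_forall hp).indicator (measurableSet_lowSet N)
  exact h.comp (by fun_prop : Measurable fun σ : ℝ => (k, σ))

lemma enorm_lowP_le (N : ℕ) (p : ℤ → ℝ → ℂ) (k : ℤ) (σ : ℝ) : ‖lowP N p k σ‖ₑ ≤ ‖p k σ‖ₑ := by
  unfold lowP
  by_cases h : (k, σ) ∈ lowSet N
  · rw [indicator_of_mem h]
  · rw [indicator_of_notMem h]
    simp

lemma enorm_sub_lowP_le (N : ℕ) (p : ℤ → ℝ → ℂ) (k : ℤ) (σ : ℝ) :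
    ‖p k σ - lowP N p k σ‖ₑ ≤ ‖p k σ‖ₑ := by
  unfold lowP
  by_cases h : (k, σ) ∈ lowSet N
  · rw [indicator_of_mem h]
    simp
  · rw [indicator_of_notMem h]
    simp

lemma zn_le_of_enorm_le {p q : ℤ → ℝ → ℂ} (h : ∀ k σ, ‖p k σ‖ₑ ≤ ‖q k σ‖ₑ) : zn p ≤ zn q := by
  unfold zn sqX2 sqX1
  gcongr with k σ k σ
  · exact h _ _
  · exact h _ _

/-- The restriction to frequencies of size at most `N` in the space `ZS`. -/
def ZS.low (N : ℕ) (p : ZS) : ZS where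
  val := lowP N p.1
  meas := measurable_lowP p.meas N
  lt_top := lt_of_le_of_lt (zn_le_of_enorm_le (enorm_lowP_le N p.1)) p.lt_top

lemma ZS.norm_low_le (N : ℕ) (p : ZS) : ‖ZS.low N p‖ ≤ ‖p‖ := by
  rw [ZS.norm_def, ZS.norm_def]
  exact ENNReal.toReal_mono p.lt_top.ne (zn_le_of_enorm_le (enorm_lowP_le N p.1))

lemma eventually_lowP_eq (p : ℤ → ℝ → ℂ) (k : ℤ) (σ : ℝ) :
    ∀ᶠ N : ℕ in atTop, lowP N p k σ = p k σ := by
  obtain ⟨N₁, h₁⟩ := exists_nat_ge |(k : ℝ)|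
  obtain ⟨N₂, h₂⟩ := exists_nat_ge |σ|
  filter_upwards [eventually_ge_atTop N₁, eventually_ge_atTop N₂] with N hN₁ hN₂
  have h : (k, σ) ∈ lowSet N :=
    ⟨h₁.trans (by exact_mod_cast hN₁), h₂.trans (by exact_mod_cast hN₂)⟩
  unfold lowP
  rw [indicator_of_mem h]

lemma tendsto_zn_of_tendsto_sq {ι : Type*} {l : Filter ι} {p : ι → ℤ → ℝ → ℂ}
    (h2 : Tendsto (fun i => sqX2 (p i)) l (𝓝 0)) (h1 : Tendsto (fun i => sqX1 (p i)) l (𝓝 0)) :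
    Tendsto (fun i => zn (p i)) l (𝓝 0) := by
  unfold zn
  have e : (0 : ℝ≥0∞) = 0 ^ (1 / 2 : ℝ) + 0 ^ (1 / 2 : ℝ) := by
    rw [ENNReal.zero_rpow_of_pos (by norm_num), add_zero]
  rw [e]
  exact (h2.ennrpow_const _).add (h1.ennrpow_const _)

lemma ZS.tendsto_norm_of_tendsto_zn {ι : Type*} {l : Filter ι} {p : ι → ZS}
    (h : Tendsto (fun i => zn (p i).1) l (𝓝 0)) : Tendsto (fun i => ‖p i‖) l (𝓝 0) := by
  have := (ENNReal.tendsto_toReal ENNReal.zero_ne_top).comp h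
  rwa [ENNReal.toReal_zero] at this

lemma tendsto_tsum_of_dominated {ι : Type*} {l : Filter ι} [l.IsCountablyGenerated]
    {F : ι → ℤ → ℝ≥0∞} {G : ℤ → ℝ≥0∞} (h1 : ∀ᶠ i in l, ∀ k, F i k ≤ G k)
    (h2 : ∑' k, G k < ⊤) (h3 : ∀ k, Tendsto (fun i => F i k) l (𝓝 0)) :
    Tendsto (fun i => ∑' k, F i k) l (𝓝 0) := by
  have := tendsto_lintegral_filter_of_dominated_convergence (μ := (Measure.count : Measure ℤ))
    (F := F) (f := fun _ => 0) (l := l) G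
    (Eventually.of_forall fun i => measurable_of_countable _)
    (h1.mono fun i hi => Eventually.of_forall hi) (by rw [lintegral_count]; exact h2.ne)
    (Eventually.of_forall h3)
  simpa [lintegral_count] using this

/-- Dominated convergence in the norm `zn`. -/
lemma tendsto_zn_of_dominated {ι : Type*} {l : Filter ι} [l.IsCountablyGenerated]
    {p : ι → ℤ → ℝ → ℂ} {G : ℤ → ℝ → ℝ≥0∞} (hp : ∀ i k, Measurable (p i k))
    (hq2 : ∑' k : ℤ, ∫⁻ σ : ℝ, jb σ 1 * G k σ ^ 2 < ⊤) (hq1 : ∑' k : ℤ, (∫⁻ σ : ℝ, G k σ) ^ 2 < ⊤)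
    (hle : ∀ᶠ i in l, ∀ k σ, ‖p i k σ‖ₑ ≤ G k σ)
    (hlim : ∀ k, ∀ᵐ σ : ℝ, Tendsto (fun i => p i k σ) l (𝓝 0)) :
    Tendsto (fun i => zn (p i)) l (𝓝 0) := by
  apply tendsto_zn_of_tendsto_sq
  · refine tendsto_tsum_of_dominated (G := fun k => ∫⁻ σ : ℝ, jb σ 1 * G k σ ^ 2) ?_ hq2 ?_
    · filter_upwards [hle] with i hi k
      gcongr with σ
      exact hi k σ
    · intro k
      have hk : ∫⁻ σ : ℝ, jb σ 1 * G k σ ^ 2 ≠ ⊤ := ENNReal.ne_top_of_tsum_ne_top hq2.ne k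
      have := tendsto_lintegral_filter_of_dominated_convergence (μ := (volume : Measure ℝ))
        (F := fun i σ => jb σ 1 * ‖p i k σ‖ₑ ^ 2) (f := fun _ => 0) (l := l)
        (fun σ => jb σ 1 * G k σ ^ 2)
        (Eventually.of_forall fun i => by have := hp i k; fun_prop)
        (hle.mono fun i hi => Eventually.of_forall fun σ => by gcongr; exact hi k σ) hk
        ((hlim k).mono fun σ hσ => by
          have h := ENNReal.Tendsto.const_mul (a := jb σ 1)
            (ENNReal.Tendsto.pow (n := 2) hσ.enorm) (Or.inr (jb_ne_top _ _))
          simpa using h)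
      simpa using this
  · refine tendsto_tsum_of_dominated (G := fun k => (∫⁻ σ : ℝ, G k σ) ^ 2) ?_ hq1 ?_
    · filter_upwards [hle] with i hi k
      gcongr with σ
      exact hi k σ
    · intro k
      have := tendsto_lintegral_filter_of_dominated_convergence (μ := (volume : Measure ℝ))
        (F := fun i σ => ‖p i k σ‖ₑ) (f := fun _ => 0) (l := l)
        (fun σ => G k σ)
        (Eventually.of_forall fun i => by have := hp i k; fun_prop)
        (hle.mono fun i hi => Eventually.of_forall fun σ => hi k σ)
        (by simpa using ENNReal.ne_top_of_tsum_ne_top hq1.ne k)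
        ((hlim k).mono fun σ hσ => by simpa using hσ.enorm)
      have := ENNReal.Tendsto.pow (n := 2) this
      simpa using this

lemma ZS.tendsto_low (p : ZS) : Tendsto (fun N => ‖p - ZS.low N p‖) atTop (𝓝 0) := by
  apply ZS.tendsto_norm_of_tendsto_zn
  refine tendsto_zn_of_dominated (fun i k => (p - ZS.low i p).meas k) (zn_lt_top_iff.1 p.lt_top).1
    p.sqX1_lt_top (Eventually.of_forall fun N k σ => ?_) ?_
  · rw [ZS.coe_sub]
    exact enorm_sub_lowP_le N p.1 k σ
  · intro k
    refine Eventually.of_forall fun σ => tendsto_const_nhds.congr' ?_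
    filter_upwards [eventually_lowP_eq p.1 k σ] with N hN
    rw [ZS.coe_sub]
    change 0 = p.1 k σ - lowP N p.1 k σ
    rw [hN, sub_self]

/-- For σ in a bounded set the shift in ⟨τ - σ⟩^{-2} costs only a constant. The result is a majorant
in τ that does not depend on σ. -/
lemma enorm_kerK_le_of_abs_le {M : ℝ} {σ : ℝ} (h : |σ| ≤ M) (τ : ℝ) :
    ‖kerK τ σ‖ₑ ≤ kerC * (ENNReal.ofReal (16 * bracket M ^ 2)) * jb τ (-2) := by
  refine (enorm_kerK_le τ σ).trans ?_
  rw [mul_assoc]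
  refine mul_le_mul_right ?_ _
  have h1 : jb σ (-1) ≤ 1 := jb_le_one _ (by norm_num)
  refine (mul_le_of_le_one_left' h1).trans ?_
  have hM : bracket σ ≤ bracket M := bracket_le_bracket (h.trans (le_abs_self _))
  have h2 : bracket τ ≤ 2 * (bracket (τ - σ) * bracket M) := by
    calc bracket τ = bracket ((τ - σ) + σ) := by ring_nf
      _ ≤ 2 * (bracket (τ - σ) * bracket σ) := bracket_add_le_mul _ _
      _ ≤ _ := by
          have := (bracket_pos (τ - σ)).le
          gcongr
  unfold jb
  have b1 := bracket_pos τ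
  have b2 := bracket_pos (τ - σ)
  have b3 := one_le_bracket M
  rw [← ENNReal.ofReal_mul (by positivity), ← ENNReal.ofReal_add (by positivity) (by positivity)]
  apply ENNReal.ofReal_le_ofReal
  have e : ∀ x : ℝ, x ^ (-2 : ℝ) = (x ^ 2)⁻¹ := fun x => by
    rw [show (-2 : ℝ) = ((-2 : ℤ) : ℝ) by norm_num, Real.rpow_intCast]
    rfl
  rw [e, e]
  have h3 : (bracket (τ - σ) ^ 2)⁻¹ ≤ 4 * bracket M ^ 2 * (bracket τ ^ 2)⁻¹ := by
    rw [← div_eq_mul_inv, inv_eq_one_div, div_le_div_iff₀ (by positivity) (by positivity)]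
    calc 1 * bracket τ ^ 2 ≤ (2 * (bracket (τ - σ) * bracket M)) ^ 2 := by rw [one_mul]; gcongr
      _ = _ := by ring
  have h4 : (bracket τ ^ 2)⁻¹ ≤ bracket M ^ 2 * (bracket τ ^ 2)⁻¹ := by
    apply le_mul_of_one_le_left (by positivity)
    exact one_le_pow₀ b3
  have h5 : 0 ≤ bracket M ^ 2 * (bracket τ ^ 2)⁻¹ := by positivity
  linarith

lemma tensor_low_ne_zero {p q : ℤ → ℝ → ℂ} {N : ℕ} {k : ℤ} {y : ℤ × ℝ × ℝ}
    (h : tensor (lowP N p) (lowP N q) k y ≠ 0) :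
    |(k : ℝ)| ≤ 2 * N ∧ |(y.1 : ℝ)| ≤ N ∧ |y.2.1| ≤ N ∧ |y.2.2| ≤ N := by
  unfold tensor lowP at h
  have h1 := mem_of_indicator_ne_zero (left_ne_zero_of_mul h)
  have h2 := mem_of_indicator_ne_zero (right_ne_zero_of_mul h)
  obtain ⟨a, b⟩ := h1
  obtain ⟨c, d⟩ := h2
  simp only at a b c d
  refine ⟨?_, a, b, d⟩
  calc |(k : ℝ)| = |((k - y.1 : ℤ) : ℝ) + y.1| := by push_cast; ring_nf
    _ ≤ _ := (abs_add_le _ _).trans (by linarith)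

section Phase

variable {ι : Type*} {l : Filter ι} [l.IsCountablyGenerated] {m : ℤ → ℤ → ℂ}
  {φ : ι → ℤ → ℤ → ℝ} {φ₀ : ℤ → ℤ → ℝ}

lemma enorm_bilin_low_le {φ : ℤ → ℤ → ℝ} (p q : ZS) (N : ℕ) {k : ℤ} {A M : ℝ}
    (hA : ∀ k₁, ‖m k k₁‖ ≤ A) (hM : ∀ k₁ : ℤ, |(k₁ : ℝ)| ≤ N → |φ k k₁| ≤ M) (τ : ℝ) :
    ‖bilin m φ (ZS.low N p).1 (ZS.low N q).1 k τ‖ₑ ≤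
      (ENNReal.ofReal A * (kerC * ENNReal.ofReal (16 * bracket (2 * N + M) ^ 2)) *
        ∫⁻ y, ‖tensor (ZS.low N p).1 (ZS.low N q).1 k y‖ₑ ∂haarZRR) * jb τ (-2) := by
  have hT := measurable_tensor (ZS.low N p).meas (ZS.low N q).meas k
  refine (enorm_integral_le_lintegral_enorm _).trans ?_
  rw [mul_right_comm, ← lintegral_const_mul _ (by fun_prop)]
  refine lintegral_mono fun y => ?_
  by_cases h : tensor (ZS.low N p).1 (ZS.low N q).1 k y = 0
  · simp [h]
  obtain ⟨-, h1, h2, h3⟩ := tensor_low_ne_zero h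
  rw [enorm_mul, enorm_mul, mul_assoc (ENNReal.ofReal A)]
  gcongr
  · rw [← ofReal_norm]
    exact ENNReal.ofReal_le_ofReal (hA _)
  · apply enorm_kerK_le_of_abs_le
    have h4 := hM _ h1
    rw [abs_le] at h2 h3 h4 ⊢
    constructor <;> linarith

/-- For every k this is the complement of a line in the plane. Continuity of the kernel in σ is thus
needed only away from σ = 0. -/
lemma ae_add_sub_ne (c : ℤ → ℝ) : ∀ᵐ y : ℤ × ℝ × ℝ ∂haarZRR, y.2.1 + y.2.2 - c y.1 ≠ 0 := by
  have hmeas : MeasurableSet {y : ℤ × ℝ × ℝ | y.2.1 + y.2.2 - c y.1 ≠ 0} :=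
    (measurableSet_eq_fun (by fun_prop) measurable_const).compl
  rw [Measure.ae_prod_iff_ae_ae hmeas]
  refine Eventually.of_forall fun k => ?_
  have hmeas' : MeasurableSet {y : ℝ × ℝ | y.1 + y.2 - c k ≠ 0} :=
    (measurableSet_eq_fun (by fun_prop) measurable_const).compl
  rw [Measure.volume_eq_prod]
  refine (Measure.ae_prod_iff_ae_ae hmeas').2 (Eventually.of_forall fun σ => ?_)
  have : ∀ᵐ σ' : ℝ, σ' ≠ c k - σ := by
    simp [ae_iff]
  filter_upwards [this] with σ' h h'
  apply h
  linarith

lemma tendsto_bilin_apply (hm : ∀ k, ∃ M : ℝ, ∀ k₁, ‖m k k₁‖ ≤ M) (p q : ZS)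
    (hφ : ∀ k k₁, Tendsto (fun i => φ i k k₁) l (𝓝 (φ₀ k k₁))) (k : ℤ) (τ : ℝ) :
    Tendsto (fun i => bilin m (φ i) p.1 q.1 k τ) l (𝓝 (bilin m φ₀ p.1 q.1 k τ)) := by
  have hT := integrable_tensor p.meas q.meas p.sqX1_lt_top q.sqX1_lt_top k
  have hTm := measurable_tensor p.meas q.meas k
  obtain ⟨M, hM⟩ := hm k
  unfold bilin
  refine tendsto_integral_filter_of_dominated_convergence
    (fun y => M * (2 * kerC).toReal * ‖tensor p.1 q.1 k y‖) ?_ ?_ (hT.norm.const_mul _) ?_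
  · refine Eventually.of_forall fun i => ?_
    exact Measurable.aestronglyMeasurable (by fun_prop)
  · refine Eventually.of_forall fun i => Eventually.of_forall fun y => ?_
    rw [norm_mul, norm_mul]
    gcongr
    · exact (norm_nonneg _).trans (hM 0)
    · exact hM _
    · exact norm_kerK_le_const _ _
  · filter_upwards [ae_add_sub_ne (φ₀ k)] with y hy
    refine Tendsto.mul_const _ (Tendsto.const_mul _ ?_)
    exact (continuousAt_kerK τ hy).tendsto.comp (tendsto_const_nhds.sub (hφ k y.1))

/-- For truncated factors only finitely many output frequencies and bounded modulations contribute,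
so pointwise convergence of the phases suffices for dominated convergence in the full norm. -/
lemma tendsto_bilin_low (hm : ∀ k, ∃ M : ℝ, ∀ k₁, ‖m k k₁‖ ≤ M) (p q : ZS) (N : ℕ)
    (hφ : ∀ k k₁, Tendsto (fun i => φ i k k₁) l (𝓝 (φ₀ k k₁))) :
    Tendsto (fun i => zn (bilin m (φ i) (ZS.low N p).1 (ZS.low N q).1 -
      bilin m φ₀ (ZS.low N p).1 (ZS.low N q).1)) l (𝓝 0) := by
  choose A hA using hm
  set s : Finset ℤ := Finset.Icc (-(2 * N)) (2 * N)
  have hs : ∀ k : ℤ, |(k : ℝ)| ≤ 2 * N → k ∈ s := by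
    intro k hk
    rw [abs_le] at hk
    rw [Finset.mem_Icc]
    constructor
    · exact_mod_cast hk.1
    · exact_mod_cast hk.2
  -- Finitely many limit phases are bounded by M, hence the nearby phases on the same finite set are
  -- eventually bounded by M + 1.
  obtain ⟨M, hM⟩ : ∃ M : ℝ, ∀ k ∈ s, ∀ k₁ ∈ s, |φ₀ k k₁| ≤ M := by
    obtain ⟨M, hM⟩ := ((s ×ˢ s).image fun x => |φ₀ x.1 x.2|).bddAbove
    refine ⟨M, fun k hk k₁ hk₁ => hM ?_⟩
    simp only [Finset.coe_image]
    exact ⟨(k, k₁), Finset.mem_coe.2 (Finset.mk_mem_product hk hk₁), rfl⟩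
  have hev : ∀ᶠ i in l, ∀ k ∈ s, ∀ k₁ ∈ s, |φ i k k₁| ≤ M + 1 := by
    rw [Finset.eventually_all]
    intro k hk
    rw [Finset.eventually_all]
    intro k₁ hk₁
    exact ((hφ k k₁).abs.eventually (gt_mem_nhds
      ((hM k hk k₁ hk₁).trans_lt (lt_add_one M)))).mono fun i hi => hi.le
  have hT := fun k => measurable_tensor (ZS.low N p).meas (ZS.low N q).meas k
  set D : ℤ → ℝ≥0∞ := fun k =>
    ENNReal.ofReal (A k) * (kerC * ENNReal.ofReal (16 * bracket (2 * N + (M + 1)) ^ 2)) *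
        ∫⁻ y, ‖tensor (ZS.low N p).1 (ZS.low N q).1 k y‖ₑ ∂haarZRR
  have hD : ∀ k, D k ≠ ⊤ := by
    intro k
    have h1 := (integrable_tensor (ZS.low N p).meas (ZS.low N q).meas (ZS.low N p).sqX1_lt_top
      (ZS.low N q).sqX1_lt_top k).2
    have h2 := kerC_ne_top
    exact ENNReal.mul_ne_top (by finiteness) (ne_of_lt h1)
  have hzero : ∀ k ∉ s, ∀ φ τ, bilin m φ (ZS.low N p).1 (ZS.low N q).1 k τ = 0 := by
    intro k hk φ τ
    unfold bilin
    have : ∀ y, tensor (ZS.low N p).1 (ZS.low N q).1 k y = 0 := by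
      intro y
      by_contra h
      exact hk (hs k (tensor_low_ne_zero h).1)
    simp [this]
  have hk₁ : ∀ k₁ : ℤ, |(k₁ : ℝ)| ≤ N → k₁ ∈ s := fun k₁ h => hs k₁ (by
    have : (0 : ℝ) ≤ N := Nat.cast_nonneg N
    linarith)
  have hJ : ∫⁻ τ : ℝ, jb τ (-2) < ⊤ := lintegral_jb_lt_top (by norm_num)
  refine tendsto_zn_of_dominated (G := fun k τ => if k ∈ s then (D k + D k) * jb τ (-2) else 0)
    ?_ ?_ ?_ ?_ ?_
  · intro i k
    exact (measurable_bilin (ZS.low N p).meas (ZS.low N q).meas k).sub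
      (measurable_bilin (ZS.low N p).meas (ZS.low N q).meas k)
  · rw [tsum_eq_sum (s := s) (fun k hk => by simp [hk])]
    refine ENNReal.sum_lt_top.2 fun k hk => ?_
    simp only [hk, if_true]
    have e : ∀ τ : ℝ, jb τ 1 * ((D k + D k) * jb τ (-2)) ^ 2 = (D k + D k) ^ 2 * jb τ (-3) := by
      intro τ
      rw [mul_pow, mul_left_comm, jb_pow_two, jb_mul]
      norm_num
    simp_rw [e]
    rw [lintegral_const_mul _ (by fun_prop)]
    have := hD k
    exact ENNReal.mul_lt_top (by finiteness) (lintegral_jb_lt_top (by norm_num))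
  · rw [tsum_eq_sum (s := s) (fun k hk => by simp [hk])]
    refine ENNReal.sum_lt_top.2 fun k hk => ?_
    simp only [hk, if_true]
    rw [lintegral_const_mul _ (by fun_prop)]
    have := hD k
    have := hJ.ne
    finiteness
  · filter_upwards [hev] with i hi k τ
    by_cases hk : k ∈ s
    · simp only [hk, if_true, Pi.sub_apply]
      refine enorm_sub_le.trans ?_
      rw [add_mul]
      refine add_le_add (enorm_bilin_low_le p q N (hA k) (fun k₁ h => hi k hk k₁ (hk₁ k₁ h)) τ)
        (enorm_bilin_low_le p q N (hA k) (fun k₁ h => ?_) τ)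
      exact (hM k hk k₁ (hk₁ k₁ h)).trans (lt_add_one M).le
    · simp [hk, hzero k hk]
  · intro k
    refine Eventually.of_forall fun τ => ?_
    have := (tendsto_bilin_apply (fun k => ⟨A k, hA k⟩) (ZS.low N p) (ZS.low N q) hφ k τ).sub_const
      (bilin m φ₀ (ZS.low N p).1 (ZS.low N q).1 k τ)
    rw [sub_self] at this
    exact this

/-- A density argument: truncated factors converge by `tendsto_bilin_low`, and the truncation error
is small uniformly in i because all operators share one bound. The arguments p and q are fixed; no
convergence in operator norm is claimed. -/
lemma ZS.tendsto_bilin {S : ℝ} (hS : 0 ≤ S)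
    (h : ∀ᶠ i in l, Admissible m (φ i) (ENNReal.ofReal S))
    (h₀ : Admissible m φ₀ (ENNReal.ofReal S)) (p q : ZS)
    (hφ : ∀ k k₁, Tendsto (fun i => φ i k k₁) l (𝓝 (φ₀ k k₁))) :
    Tendsto (fun i => ‖ZS.bilin m (φ i) p q - ZS.bilin m φ₀ p q‖) l (𝓝 0) := by
  have hκ := bilinNorm_nonneg hS
  set κ := bilinNorm S
  have hdiff : ∀ {ψ : ℤ → ℤ → ℝ}, Admissible m ψ (ENNReal.ofReal S) → ∀ N : ℕ,
      ‖ZS.bilin m ψ p q - ZS.bilin m ψ (p.low N) (q.low N)‖ ≤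
        κ * (‖p - p.low N‖ * ‖q‖ + ‖p‖ * ‖q - q.low N‖) := by
    intro ψ hψ N
    have e : ZS.bilin m ψ p q - ZS.bilin m ψ (p.low N) (q.low N) =
        ZS.bilin m ψ (p - p.low N) q + ZS.bilin m ψ (p.low N) (q - q.low N) := by
      rw [ZS.bilin_sub_left hS hψ, ZS.bilin_sub_right hS hψ]
      abel
    rw [e, mul_add]
    refine (norm_add_le _ _).trans (add_le_add (ZS.norm_bilin_le hS hψ _ _)
      ((ZS.norm_bilin_le hS hψ _ _).trans ?_))
    gcongr
    exact ZS.norm_low_le N p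
  have hlim : Tendsto (fun N : ℕ => κ * (‖p - p.low N‖ * ‖q‖ + ‖p‖ * ‖q - q.low N‖)) atTop
      (𝓝 0) := by
    have := ((p.tendsto_low.mul_const ‖q‖).add (q.tendsto_low.const_mul ‖p‖)).const_mul κ
    simpa using this
  rw [Metric.tendsto_nhds]
  intro ε hε
  obtain ⟨N, hN⟩ := (hlim.eventually (gt_mem_nhds (show (0 : ℝ) < ε / 3 by positivity))).exists
  have hlow : Tendsto (fun i => (zn (DSW.bilin m (φ i) (ZS.low N p).1 (ZS.low N q).1 -
      DSW.bilin m φ₀ (ZS.low N p).1 (ZS.low N q).1)).toReal) l (𝓝 0) := by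
    have := (ENNReal.tendsto_toReal ENNReal.zero_ne_top).comp
      (tendsto_bilin_low h₀.bdd p q N hφ)
    rwa [ENNReal.toReal_zero] at this
  filter_upwards [h, hlow.eventually (gt_mem_nhds (show (0 : ℝ) < ε / 3 by positivity))]
    with i hi hi'
  rw [dist_zero_right, norm_norm]
  have e : ZS.bilin m (φ i) p q - ZS.bilin m φ₀ p q =
      (ZS.bilin m (φ i) p q - ZS.bilin m (φ i) (p.low N) (q.low N)) +
      (ZS.bilin m (φ i) (p.low N) (q.low N) - ZS.bilin m φ₀ (p.low N) (q.low N)) -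
      (ZS.bilin m φ₀ p q - ZS.bilin m φ₀ (p.low N) (q.low N)) := by abel
  have e2 : ‖ZS.bilin m (φ i) (p.low N) (q.low N) - ZS.bilin m φ₀ (p.low N) (q.low N)‖ < ε / 3 := by
    rw [ZS.norm_def, ZS.coe_sub, ZS.coe_bilin hS hi, ZS.coe_bilin hS h₀]
    exact hi'
  have h1 := hdiff hi N
  have h2 := hdiff h₀ N
  calc _ ≤ _ := by rw [e]; exact norm_sub_le _ _
    _ ≤ _ := add_le_add_left (norm_add_le _ _) _
    _ < ε := by linarith

end Phase

/-! ### Rescaling and localization in time -/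

lemma lintegral_comp_mul_left {a : ℝ} (ha : 0 < a) {f : ℝ → ℝ≥0∞} (hf : Measurable f) :
    ∫⁻ x, f (a * x) = ENNReal.ofReal a⁻¹ * ∫⁻ x, f x := by
  have h := Real.map_volume_mul_left ha.ne'
  rw [← lintegral_map hf (by fun_prop), h, lintegral_smul_measure, abs_of_pos (inv_pos.2 ha)]
  rfl

lemma jb_one_div_le {T : ℝ} (hT : 0 < T) (hT1 : T ≤ 1) (σ : ℝ) :
    jb (σ / T) 1 ≤ ENNReal.ofReal T⁻¹ * jb σ 1 := by
  unfold jb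
  rw [← ENNReal.ofReal_mul (by positivity), Real.rpow_one, Real.rpow_one]
  apply ENNReal.ofReal_le_ofReal
  have := bracket_mul_le σ ((one_le_inv₀ hT).2 hT1)
  rwa [div_eq_inv_mul]

/-- Dilation on the Fourier side. -/
def dilP (T : ℝ) (p : ℤ → ℝ → ℂ) (k : ℤ) (σ : ℝ) : ℂ := T * p k (T * σ)

lemma tp_dilP {T : ℝ} (hT : 0 < T) (p : ℤ → ℝ → ℂ) (k : ℤ) (t : ℝ) :
    tp (dilP T p) k t = tp p k (t / T) := by
  unfold tp dilP
  have h := Measure.integral_comp_mul_left (fun x => ee (x * (t / T)) * p k x) T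
  have e : ∀ σ : ℝ, ee (σ * t) * (T * p k (T * σ)) =
      T * (ee (T * σ * (t / T)) * p k (T * σ)) := fun σ => by
    rw [show T * σ * (t / T) = σ * t by field_simp]
    ring
  simp_rw [e]
  rw [integral_const_mul, h, abs_of_pos (inv_pos.2 hT), Complex.real_smul, ← mul_assoc,
    ← Complex.ofReal_mul, mul_inv_cancel₀ hT.ne', Complex.ofReal_one, one_mul]

/-- Dilation on the space `ZS`. -/
def ZS.dil {T : ℝ} (hT : 0 < T) (hT1 : T ≤ 1) (p : ZS) : ZS where
  val := dilP T p.1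
  meas := fun k => by
    have := p.meas k
    unfold dilP
    fun_prop
  lt_top := by
    have hm := p.meas
    have hTT : ENNReal.ofReal T * ENNReal.ofReal T⁻¹ = 1 := by
      rw [← ENNReal.ofReal_mul hT.le, mul_inv_cancel₀ hT.ne', ENNReal.ofReal_one]
    have hnorm : ‖(T : ℂ)‖ₑ = ENNReal.ofReal T := by
      rw [← ofReal_norm, Complex.norm_real, Real.norm_of_nonneg hT.le]
    rw [zn_lt_top_iff]
    constructor
    · refine lt_of_le_of_lt ?_ (zn_lt_top_iff.1 p.lt_top).1
      unfold sqX2 dilP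
      refine ENNReal.tsum_le_tsum fun k => ?_
      have e : ∀ σ : ℝ, jb σ 1 * ‖(T : ℂ) * p.1 k (T * σ)‖ₑ ^ 2 =
          ENNReal.ofReal T ^ 2 * (jb (T * σ / T) 1 * ‖p.1 k (T * σ)‖ₑ ^ 2) := fun σ => by
        rw [enorm_mul, hnorm, mul_div_cancel_left₀ _ hT.ne']
        ring
      simp_rw [e]
      rw [lintegral_const_mul _ (by fun_prop),
        lintegral_comp_mul_left hT (f := fun x => jb (x / T) 1 * ‖p.1 k x‖ₑ ^ 2) (by fun_prop)]
      calc ENNReal.ofReal T ^ 2 * (ENNReal.ofReal T⁻¹ * ∫⁻ x, jb (x / T) 1 * ‖p.1 k x‖ₑ ^ 2)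
          ≤ ENNReal.ofReal T ^ 2 * (ENNReal.ofReal T⁻¹ * ∫⁻ x, ENNReal.ofReal T⁻¹ *
              (jb x 1 * ‖p.1 k x‖ₑ ^ 2)) := by
            refine mul_le_mul_right (mul_le_mul_right (lintegral_mono fun x => ?_) _) _
            rw [← mul_assoc]
            exact mul_le_mul_left (jb_one_div_le hT hT1 x) _
        _ = (ENNReal.ofReal T * ENNReal.ofReal T⁻¹) ^ 2 * ∫⁻ x, jb x 1 * ‖p.1 k x‖ₑ ^ 2 := by
            rw [lintegral_const_mul _ (by fun_prop)]
            ring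
        _ = _ := by rw [hTT, one_pow, one_mul]
    · refine lt_of_le_of_lt (le_of_eq ?_) p.sqX1_lt_top
      unfold sqX1 dilP
      refine tsum_congr fun k => ?_
      simp only [enorm_mul, hnorm]
      rw [lintegral_const_mul _ (by fun_prop),
        lintegral_comp_mul_left hT (f := fun x => ‖p.1 k x‖ₑ) (by fun_prop), ← mul_assoc, hTT,
        one_mul]

lemma tp_dil {T : ℝ} (hT : 0 < T) (hT1 : T ≤ 1) (p : ZS) (k : ℤ) (t : ℝ) :
    tp (p.dil hT hT1).1 k t = tp p.1 k (t / T) := tp_dilP hT p.1 k t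

/-- Young's inequality with w in L² and H in L¹. The dilation acts only on the variable in which H
is integrated, so the bound is uniform in δ. -/
lemma lintegral_sq_conv_le' {w H : ℝ → ℝ≥0∞} (hw : Measurable w) (hH : Measurable H) (δ : ℝ) :
    ∫⁻ τ, (∫⁻ σ, w (τ - δ * σ) * H σ) ^ 2 ≤ (∫⁻ τ, w τ ^ 2) * (∫⁻ σ, H σ) ^ 2 := by
  have h1 : ∀ τ, (∫⁻ σ, w (τ - δ * σ) * H σ) ^ 2 ≤
      (∫⁻ σ, H σ) * ∫⁻ σ, w (τ - δ * σ) ^ 2 * H σ := by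
    intro τ
    have h2 := sq_lintegral_mul_le (μ := volume) (f := fun σ => H σ ^ (1 / 2 : ℝ))
      (g := fun σ => H σ ^ (1 / 2 : ℝ) * w (τ - δ * σ)) (by fun_prop) (by fun_prop)
    simp only [← mul_assoc, ← sq, mul_pow, rpow_half_sq] at h2
    simpa only [mul_comm] using h2
  refine (lintegral_mono h1).trans (le_of_eq ?_)
  have hm : Measurable fun τ => ∫⁻ σ, w (τ - δ * σ) ^ 2 * H σ :=
    Measurable.lintegral_prod_right' (f := fun z : ℝ × ℝ => w (z.1 - δ * z.2) ^ 2 * H z.2)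
      (by fun_prop)
  rw [lintegral_const_mul _ hm, lintegral_lintegral_swap (by unfold Function.uncurry; fun_prop)]
  have : ∀ σ, ∫⁻ τ, w (τ - δ * σ) ^ 2 * H σ = (∫⁻ τ, w τ ^ 2) * H σ := by
    intro σ
    rw [lintegral_mul_const _ (by fun_prop), lintegral_sub_right_eq_self (fun τ => w τ ^ 2)]
  simp_rw [this]
  rw [lintegral_const_mul _ (by fun_prop)]
  ring

/-- With the exponents exchanged, the dilation by δ costs 1/δ. The factor δ on the left is supplied
later by the weight ⟨δσ'⟩^{1/2}. -/
lemma lintegral_sq_conv_scaled_le {w H : ℝ → ℝ≥0∞} (hw : Measurable w) (hH : Measurable H) {δ : ℝ}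
    (hδ : 0 < δ) :
    ENNReal.ofReal δ * ∫⁻ τ, (∫⁻ σ, w (τ - δ * σ) * H σ) ^ 2 ≤
      (∫⁻ τ, w τ) ^ 2 * ∫⁻ σ, H σ ^ 2 := by
  have hδδ : ENNReal.ofReal δ * ENNReal.ofReal δ⁻¹ = 1 := by
    rw [← ENNReal.ofReal_mul hδ.le, mul_inv_cancel₀ hδ.ne', ENNReal.ofReal_one]
  have h1 : ∀ τ, ∫⁻ σ, w (τ - δ * σ) * H σ =
      ENNReal.ofReal δ⁻¹ * ∫⁻ σ, w (τ - σ) * H (σ / δ) := by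
    intro τ
    rw [← lintegral_comp_mul_left hδ (by fun_prop)]
    simp only [mul_div_cancel_left₀ _ hδ.ne']
  have h2 := lintegral_sq_conv_le hw (H := fun σ => H (σ / δ)) (by fun_prop)
  have h3 : ∫⁻ σ, H (σ / δ) ^ 2 = ENNReal.ofReal δ * ∫⁻ σ, H σ ^ 2 := by
    have := lintegral_comp_mul_left (inv_pos.2 hδ) (f := fun x => H x ^ 2) (by fun_prop)
    rw [inv_inv] at this
    simp only [div_eq_inv_mul]
    exact this
  have hm : Measurable fun τ => (∫⁻ σ, w (τ - σ) * H (σ / δ)) :=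
    Measurable.lintegral_prod_right' (f := fun z : ℝ × ℝ => w (z.1 - z.2) * H (z.2 / δ))
      (by fun_prop)
  simp_rw [h1, mul_pow]
  rw [lintegral_const_mul _ (by fun_prop)]
  rw [h3] at h2
  calc _ ≤ ENNReal.ofReal δ * (ENNReal.ofReal δ⁻¹ ^ 2 *
        ((∫⁻ τ, w τ) ^ 2 * (ENNReal.ofReal δ * ∫⁻ σ, H σ ^ 2))) := by gcongr
    _ = (ENNReal.ofReal δ * ENNReal.ofReal δ⁻¹) ^ 2 * ((∫⁻ τ, w τ) ^ 2 * ∫⁻ σ, H σ ^ 2) := by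
        ring
    _ = _ := by rw [hδδ, one_pow, one_mul]

/-- From ⟨δσ'⟩ ≤ 1 + δ⟨σ'⟩. The summand 1 is absorbed by the weight at σ - δσ', and the other one
retains the gain δ^{1/2}. -/
lemma jb_half_le_of_scale {δ : ℝ} (hδ : 0 < δ) (σ σ' : ℝ) : jb σ (1 / 2) ≤
    2 * jb (σ - δ * σ') (1 / 2) + ENNReal.ofReal δ ^ (1 / 2 : ℝ) * jb σ' (1 / 2) := by
  have h1 : jb σ (1 / 2) ≤ jb (σ - δ * σ') (1 / 2) + jb (δ * σ') (1 / 2) := by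
    have := jb_add_le (σ - δ * σ') (δ * σ') (r := 1 / 2) (by norm_num) (by norm_num)
    rwa [sub_add_cancel] at this
  have h2 : jb (δ * σ') (1 / 2) ≤ 1 + ENNReal.ofReal δ ^ (1 / 2 : ℝ) * jb σ' (1 / 2) := by
    have e : ∀ x, jb x (1 / 2) = ENNReal.ofReal (bracket x) ^ (1 / 2 : ℝ) := fun x => by
      rw [jb, ENNReal.ofReal_rpow_of_nonneg (bracket_pos _).le (by norm_num)]
    rw [e, e, ← ENNReal.mul_rpow_of_nonneg _ _ (by norm_num), ← ENNReal.ofReal_mul hδ.le]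
    have h3 : bracket (δ * σ') ≤ 1 + δ * bracket σ' := by
      refine (bracket_le_one_add_abs _).trans ?_
      rw [abs_mul, abs_of_pos hδ]
      gcongr
      exact abs_le_bracket _
    have hb := (bracket_pos σ').le
    calc ENNReal.ofReal (bracket (δ * σ')) ^ (1 / 2 : ℝ)
        ≤ (1 + ENNReal.ofReal (δ * bracket σ')) ^ (1 / 2 : ℝ) := by
          gcongr
          rw [← ENNReal.ofReal_one, ← ENNReal.ofReal_add zero_le_one (by positivity)]
          exact ENNReal.ofReal_le_ofReal h3
      _ ≤ 1 ^ (1 / 2 : ℝ) + ENNReal.ofReal (δ * bracket σ') ^ (1 / 2 : ℝ) :=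
          ENNReal.rpow_add_le_add_rpow _ _ (by norm_num) (by norm_num)
      _ = _ := by rw [ENNReal.one_rpow]
  calc _ ≤ _ := h1
    _ ≤ jb (σ - δ * σ') (1 / 2) + (jb (σ - δ * σ') (1 / 2) +
          ENNReal.ofReal δ ^ (1 / 2 : ℝ) * jb σ' (1 / 2)) := by
        gcongr
        refine h2.trans ?_
        gcongr
        exact one_le_jb _ (by norm_num)
    _ = _ := by ring

/-- The transform of the restriction of a function to the time interval `[t₀, t₀ + δ]`, which is
rescaled to `[0, 1]` and then extended. -/
def locP (δ t₀ : ℝ) (p : ℤ → ℝ → ℂ) (k : ℤ) (σ : ℝ) : ℂ :=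
  ∫ σ', cutK (σ - δ * σ') * (ee (σ' * t₀) * p k σ')

section

variable {δ t₀ : ℝ}

lemma measurable_locP {p : ℤ → ℝ → ℂ} (hp : ∀ k, Measurable (p k)) (k : ℤ) :
    Measurable (locP δ t₀ p k) := by
  have := hp k
  refine StronglyMeasurable.measurable ?_
  exact StronglyMeasurable.integral_prod_right'
    (f := fun z : ℝ × ℝ => cutK (z.1 - δ * z.2) * (ee (z.2 * t₀) * p k z.2))
    (Measurable.stronglyMeasurable (by fun_prop))

lemma enorm_locP_le (p : ℤ → ℝ → ℂ) (k : ℤ) (σ : ℝ) :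
    ‖locP δ t₀ p k σ‖ₑ ≤ ∫⁻ σ', ‖cutK (σ - δ * σ')‖ₑ * ‖p k σ'‖ₑ := by
  refine (enorm_integral_le_lintegral_enorm _).trans (le_of_eq ?_)
  simp [enorm_mul]

lemma sqX1_locP_le {p : ℤ → ℝ → ℂ} (hp : ∀ k, Measurable (p k)) :
    sqX1 (locP δ t₀ p) ≤ (∫⁻ σ, ‖cutK σ‖ₑ) ^ 2 * sqX1 p := by
  unfold sqX1
  rw [← ENNReal.tsum_mul_left]
  gcongr with k
  rw [← mul_pow]
  gcongr
  have := hp k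
  calc ∫⁻ σ, ‖locP δ t₀ p k σ‖ₑ ≤ ∫⁻ σ, ∫⁻ σ', ‖cutK (σ - δ * σ')‖ₑ * ‖p k σ'‖ₑ :=
        lintegral_mono fun σ => enorm_locP_le p k σ
    _ = ∫⁻ σ', ∫⁻ σ, ‖cutK (σ - δ * σ')‖ₑ * ‖p k σ'‖ₑ :=
        lintegral_lintegral_swap (by unfold Function.uncurry; fun_prop)
    _ = ∫⁻ σ', (∫⁻ σ, ‖cutK σ‖ₑ) * ‖p k σ'‖ₑ := by
        congr 1
        ext σ'
        rw [lintegral_mul_const _ (by fun_prop),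
          lintegral_sub_right_eq_self (fun σ => ‖cutK σ‖ₑ)]
    _ = _ := lintegral_const_mul _ (by fun_prop)

/-- The bound does not depend on δ or t₀, as needed for uniqueness on short windows. The H^{1/2}
part is scale invariant at high modulation; the weight that remains of order one is charged to the
L¹ norm of p. -/
lemma sqX2_locP_le (hδ : 0 < δ) {p : ℤ → ℝ → ℂ} (hp : ∀ k, Measurable (p k)) :
    sqX2 (locP δ t₀ p) ≤ 8 * (∫⁻ σ, jb σ 1 * ‖cutK σ‖ₑ ^ 2) * sqX1 p +
      2 * (∫⁻ σ, ‖cutK σ‖ₑ) ^ 2 * sqX2 p := by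
  unfold sqX1 sqX2
  rw [← ENNReal.tsum_mul_left, ← ENNReal.tsum_mul_left, ← ENNReal.tsum_add]
  gcongr with k
  have hpk := hp k
  set w : ℝ → ℝ≥0∞ := fun σ => jb σ (1 / 2) * ‖cutK σ‖ₑ
  have hw : Measurable w := by fun_prop
  have hjb : ∀ σ, jb σ (1 / 2) ^ 2 = jb σ 1 := fun σ => by
    rw [jb_pow_two]
    norm_num
  have hm1 : Measurable fun σ => ∫⁻ σ', w (σ - δ * σ') * ‖p k σ'‖ₑ :=
    Measurable.lintegral_prod_right' (f := fun z : ℝ × ℝ => w (z.1 - δ * z.2) * ‖p k z.2‖ₑ)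
      (by fun_prop)
  have hm2 : Measurable fun σ =>
      ∫⁻ σ', ‖cutK (σ - δ * σ')‖ₑ * (jb σ' (1 / 2) * ‖p k σ'‖ₑ) :=
    Measurable.lintegral_prod_right'
      (f := fun z : ℝ × ℝ => ‖cutK (z.1 - δ * z.2)‖ₑ * (jb z.2 (1 / 2) * ‖p k z.2‖ₑ))
      (by fun_prop)
  have h1 : ∀ σ, jb σ (1 / 2) * ‖locP δ t₀ p k σ‖ₑ ≤
      2 * (∫⁻ σ', w (σ - δ * σ') * ‖p k σ'‖ₑ) + ENNReal.ofReal δ ^ (1 / 2 : ℝ) *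
        ∫⁻ σ', ‖cutK (σ - δ * σ')‖ₑ * (jb σ' (1 / 2) * ‖p k σ'‖ₑ) := by
    intro σ
    calc jb σ (1 / 2) * ‖locP δ t₀ p k σ‖ₑ
        ≤ jb σ (1 / 2) * ∫⁻ σ', ‖cutK (σ - δ * σ')‖ₑ * ‖p k σ'‖ₑ := by
          gcongr
          exact enorm_locP_le p k σ
      _ = ∫⁻ σ', jb σ (1 / 2) * (‖cutK (σ - δ * σ')‖ₑ * ‖p k σ'‖ₑ) :=
          (lintegral_const_mul _ (by fun_prop)).symm
      _ ≤ ∫⁻ σ', (2 * (w (σ - δ * σ') * ‖p k σ'‖ₑ) + ENNReal.ofReal δ ^ (1 / 2 : ℝ) *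
            (‖cutK (σ - δ * σ')‖ₑ * (jb σ' (1 / 2) * ‖p k σ'‖ₑ))) := by
          refine lintegral_mono fun σ' => ?_
          calc jb σ (1 / 2) * (‖cutK (σ - δ * σ')‖ₑ * ‖p k σ'‖ₑ)
              ≤ (2 * jb (σ - δ * σ') (1 / 2) + ENNReal.ofReal δ ^ (1 / 2 : ℝ) * jb σ' (1 / 2)) *
                  (‖cutK (σ - δ * σ')‖ₑ * ‖p k σ'‖ₑ) := by
                gcongr
                exact jb_half_le_of_scale hδ σ σ'
            _ = _ := by
                simp only [w]
                ring
      _ = _ := by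
          rw [lintegral_add_left (by fun_prop), lintegral_const_mul _ (by fun_prop),
            lintegral_const_mul _ (by fun_prop)]
  calc ∫⁻ σ, jb σ 1 * ‖locP δ t₀ p k σ‖ₑ ^ 2
      ≤ ∫⁻ σ, 2 * ((2 * ∫⁻ σ', w (σ - δ * σ') * ‖p k σ'‖ₑ) ^ 2 +
          (ENNReal.ofReal δ ^ (1 / 2 : ℝ) *
            ∫⁻ σ', ‖cutK (σ - δ * σ')‖ₑ * (jb σ' (1 / 2) * ‖p k σ'‖ₑ)) ^ 2) := by
        refine lintegral_mono fun σ => ?_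
        rw [← hjb, ← mul_pow]
        refine le_trans ?_ (add_sq_le_two_mul _ _)
        gcongr
        exact h1 σ
    _ = 8 * (∫⁻ σ, (∫⁻ σ', w (σ - δ * σ') * ‖p k σ'‖ₑ) ^ 2) + 2 * (ENNReal.ofReal δ *
          ∫⁻ σ, (∫⁻ σ', ‖cutK (σ - δ * σ')‖ₑ * (jb σ' (1 / 2) * ‖p k σ'‖ₑ)) ^ 2) := by
        simp_rw [mul_pow, rpow_half_sq]
        rw [lintegral_const_mul _ (by fun_prop), lintegral_add_left (by fun_prop),
          lintegral_const_mul _ (by fun_prop), lintegral_const_mul _ (by fun_prop)]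
        ring
    _ ≤ 8 * ((∫⁻ σ, w σ ^ 2) * (∫⁻ σ, ‖p k σ‖ₑ) ^ 2) + 2 * ((∫⁻ σ, ‖cutK σ‖ₑ) ^ 2 *
          ∫⁻ σ, (jb σ (1 / 2) * ‖p k σ‖ₑ) ^ 2) := by
        refine add_le_add (mul_le_mul_right (lintegral_sq_conv_le' hw (by fun_prop) δ) _)
          (mul_le_mul_right ?_ _)
        exact lintegral_sq_conv_scaled_le (w := fun σ => ‖cutK σ‖ₑ)
          (H := fun σ => jb σ (1 / 2) * ‖p k σ‖ₑ) (by fun_prop) (by fun_prop) hδ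
    _ = _ := by
        simp only [w, mul_pow, hjb]
        ring

/-- The constant in the bound of the localization in time. -/
def locC : ℝ≥0∞ := 10 * linC ^ 2

lemma zn_locP_le (hδ : 0 < δ) {p : ℤ → ℝ → ℂ} (hp : ∀ k, Measurable (p k)) :
    zn (locP δ t₀ p) ≤ 2 * (locC ^ (1 / 2 : ℝ) * zn p) := by
  have h1 : ∫⁻ σ, ‖cutK σ‖ₑ ≤ linC := le_add_self
  have h2 : ∫⁻ σ, jb σ 1 * ‖cutK σ‖ₑ ^ 2 ≤ linC ^ 2 := rpow_half_le_iff.1 le_self_add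
  have h3 := sqX1_le_zn_sq p
  have h4 := sqX2_le_zn_sq p
  have e : (locC ^ (1 / 2 : ℝ) * zn p) ^ 2 = 10 * linC ^ 2 * zn p ^ 2 := by
    rw [mul_pow, rpow_half_sq, locC]
  apply zn_le_of_sq_le
  · rw [e]
    calc _ ≤ _ := sqX2_locP_le hδ hp
      _ ≤ 8 * linC ^ 2 * zn p ^ 2 + 2 * linC ^ 2 * zn p ^ 2 := by gcongr
      _ = _ := by ring
  · rw [e]
    calc _ ≤ _ := sqX1_locP_le hp
      _ ≤ 1 * linC ^ 2 * zn p ^ 2 := by rw [one_mul]; gcongr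
      _ ≤ _ := by gcongr; norm_num

/-- Localization in time on the space `ZS`. -/
def ZS.loc (hδ : 0 < δ) (t₀ : ℝ) (p : ZS) : ZS where
  val := locP δ t₀ p.1
  meas := measurable_locP p.meas
  lt_top := by
    refine lt_of_le_of_lt (zn_locP_le hδ p.meas) ?_
    have h1 := linC_ne_top
    have h2 := p.lt_top.ne
    have h3 : locC ^ (1 / 2 : ℝ) < ⊤ := rpow_half_lt_top.2 (by unfold locC; finiteness)
    have h4 := h3.ne
    finiteness

lemma ZS.norm_loc_le (hδ : 0 < δ) (t₀ : ℝ) (p : ZS) :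
    ‖p.loc hδ t₀‖ ≤ 2 * (locC ^ (1 / 2 : ℝ)).toReal * ‖p‖ := by
  have h1 := linC_ne_top
  have h2 := p.lt_top.ne
  have h3 : locC ^ (1 / 2 : ℝ) < ⊤ := rpow_half_lt_top.2 (by unfold locC; finiteness)
  have h4 := h3.ne
  have := ENNReal.toReal_mono (by finiteness) (zn_locP_le (t₀ := t₀) hδ p.meas)
  rw [ENNReal.toReal_mul, ENNReal.toReal_mul, ← mul_assoc] at this
  exact this

/-- A wave e^{iσ't} becomes e^{iσ't₀}e^{iδσ't} in window time; multiplying it by the cutoff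
translates `cutK` by δσ'. On [0, 1] the cutoff is 1. -/
lemma tp_loc (hδ : 0 < δ) (t₀ : ℝ) (p : ZS) (k : ℤ) {t : ℝ} (ht : t ∈ Icc (0 : ℝ) 1) :
    tp (p.loc hδ t₀).1 k t = tp p.1 k (t₀ + δ * t) := by
  have hpk := p.meas k
  change tp (locP δ t₀ p.1) k t = _
  unfold tp locP
  simp_rw [← integral_const_mul]
  rw [integral_integral_swap]
  · congr 1
    ext σ'
    have e : ∀ σ : ℝ, ee (σ * t) * (cutK (σ - δ * σ') * (ee (σ' * t₀) * p.1 k σ')) =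
        (ee (σ' * (t₀ + δ * t)) * p.1 k σ') *
          (ee ((σ - δ * σ') * t) * cutK (σ - δ * σ')) := by
      intro σ
      rw [show σ * t = (σ - δ * σ') * t + δ * σ' * t by ring,
        show σ' * (t₀ + δ * t) = σ' * t₀ + δ * σ' * t by ring, ee_add, ee_add]
      ring
    simp_rw [e]
    rw [integral_const_mul, integral_sub_right_eq_self (fun σ => ee (σ * t) * cutK σ),
      isCutoff.inv t ht, mul_one]
  · refine ⟨Measurable.aestronglyMeasurable (by unfold Function.uncurry; fun_prop), ?_⟩
    unfold HasFiniteIntegral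
    rw [lintegral_prod_symm' _ (by unfold Function.uncurry; fun_prop)]
    have e : ∀ σ', ∫⁻ σ : ℝ, ‖Function.uncurry (fun σ σ' : ℝ => ee (σ * t) *
        (cutK (σ - δ * σ') * (ee (σ' * t₀) * p.1 k σ'))) (σ, σ')‖ₑ =
          (∫⁻ σ, ‖cutK σ‖ₑ) * ‖p.1 k σ'‖ₑ := by
      intro σ'
      simp only [Function.uncurry, enorm_mul, enorm_ee, one_mul]
      rw [lintegral_mul_const _ (by fun_prop), lintegral_sub_right_eq_self (fun σ => ‖cutK σ‖ₑ)]
    simp_rw [e]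
    rw [lintegral_const_mul _ (by fun_prop)]
    exact ENNReal.mul_lt_top integrable_cutK.2 (p.integrable k).2

end

/-! ### Fourier series of real square integrable functions -/

section Circle

variable {L : ℝ} [Fact (0 < L)]

local notation "haarL" => (AddCircle.haarAddCircle : Measure (AddCircle L))

lemma le_of_sq_le {x y : ℝ≥0∞} (h : x ^ 2 ≤ y ^ 2) : x ≤ y := by
  rw [← sq_rpow_half x, ← sq_rpow_half y]
  gcongr

lemma integrable_L2 (f : L2 L) : Integrable f haarL :=
  (Lp.memLp f).integrable one_le_two

lemma integrable_L2_ofReal (f : L2 L) : Integrable (fun x => ((f x : ℝ) : ℂ)) haarL :=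
  (integrable_L2 f).ofReal

/-- The complexification of a real square integrable function. -/
def cx (f : L2 L) : Lp ℂ 2 haarL := Complex.ofRealCLM.compLp f

lemma coeFn_cx (f : L2 L) : ∀ᵐ x ∂haarL, cx f x = ((f x : ℝ) : ℂ) :=
  Complex.ofRealCLM.coeFn_compLp f

lemma enorm_cx (f : L2 L) : ‖cx f‖ₑ = ‖f‖ₑ := by
  rw [Lp.enorm_def, Lp.enorm_def]
  refine eLpNorm_congr_norm_ae ?_
  filter_upwards [coeFn_cx f] with x hx
  rw [hx, Complex.norm_real]

lemma coeff_eq_repr (f : L2 L) (k : ℤ) : coeff f k = fourierBasis.repr (cx f) k := by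
  rw [fourierBasis_repr]
  exact congrFun (fourierCoeff_congr_ae ((coeFn_cx f).mono fun x hx => hx.symm)) k

lemma coeff_sub (f g : L2 L) (k : ℤ) : coeff (f - g) k = coeff f k - coeff g k := by
  unfold coeff fourierCoeff
  rw [← integral_sub ((integrable_L2_ofReal f).fourier_smul _)
    ((integrable_L2_ofReal g).fourier_smul _)]
  refine integral_congr_ae ?_
  filter_upwards [Lp.coeFn_sub f g] with x hx
  rw [hx, ← smul_sub]
  simp

lemma coeff_neg_eq_conj (f : L2 L) (k : ℤ) : coeff f (-k) = (starRingEnd ℂ) (coeff f k) := by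
  unfold coeff fourierCoeff
  rw [← integral_conj]
  congr 1
  ext x
  rw [smul_eq_mul, smul_eq_mul, map_mul, ← fourier_neg, Complex.conj_ofReal]

lemma enorm_sq_eq_tsum (F : Lp ℂ 2 haarL) :
    ‖F‖ₑ ^ 2 = ∑' k, ‖fourierBasis.repr F k‖ₑ ^ 2 := by
  have h1 : HasSum (fun i => ‖fourierBasis.repr F i‖ ^ 2) (‖fourierBasis.repr F‖ ^ 2) := by
    apply_mod_cast lp.hasSum_norm ?_ (fourierBasis.repr F)
    simp
  rw [LinearIsometryEquiv.norm_map] at h1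
  have h2 := ENNReal.ofReal_tsum_of_nonneg (fun k => by positivity) h1.summable
  rw [h1.tsum_eq] at h2
  simpa only [ENNReal.ofReal_pow (norm_nonneg _), ofReal_norm] using h2

/-- Parseval's identity. -/
lemma enorm_sq_eq_sql2 (f : L2 L) : ‖f‖ₑ ^ 2 = sql2 (coeff f) := by
  rw [← enorm_cx, enorm_sq_eq_tsum]
  unfold sql2
  simp only [coeff_eq_repr]

lemma enorm_eq_sql2 (f : L2 L) : ‖f‖ₑ = sql2 (coeff f) ^ (1 / 2 : ℝ) := by
  rw [← enorm_sq_eq_sql2, sq_rpow_half]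

lemma sql2_coeff_lt_top (f : L2 L) : sql2 (coeff f) < ⊤ := by
  rw [← enorm_sq_eq_sql2]
  exact ENNReal.pow_lt_top enorm_lt_top

lemma eq_of_coeff_eq {f g : L2 L} (h : ∀ k, coeff f k = coeff g k) : f = g := by
  rw [← sub_eq_zero]
  have h1 := enorm_sq_eq_sql2 (f - g)
  have h2 : sql2 (coeff (f - g)) = 0 := by
    unfold sql2
    simp [coeff_sub, h]
  rw [h2] at h1
  simpa using h1

lemma coeff_zero_eq_mean (f : L2 L) : coeff f 0 = mean f := by
  unfold coeff fourierCoeff mean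
  simp only [neg_zero, fourier_zero, one_smul]
  exact integral_ofReal

lemma abs_mean_le (f : L2 L) : ‖mean f‖ₑ ≤ ‖f‖ₑ := by
  have h1 : ‖mean f‖ₑ = ‖coeff f 0‖ₑ := by
    rw [coeff_zero_eq_mean, ← ofReal_norm, ← ofReal_norm, Complex.norm_real]
  have h2 : ‖coeff f 0‖ₑ ^ 2 ≤ ‖f‖ₑ ^ 2 := by
    rw [enorm_sq_eq_sql2]
    exact ENNReal.le_tsum (f := fun k => ‖coeff f k‖ₑ ^ 2) 0
  rw [h1]
  exact le_of_sq_le h2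

lemma mean_sub (f g : L2 L) : mean (f - g) = mean f - mean g := by
  have h := coeff_sub f g 0
  simp only [coeff_zero_eq_mean] at h
  exact_mod_cast h

/-- A square summable sequence with the symmetry of the coefficients of real functions is the
sequence of Fourier coefficients of a real square integrable function. -/
lemma exists_coeff_eq {c : ℤ → ℂ} (hc : sql2 c < ⊤)
    (hsymm : ∀ k, c (-k) = (starRingEnd ℂ) (c k)) : ∃ f : L2 L, ∀ k, coeff f k = c k := by
  have hmem : Memℓp c 2 := by
    apply memℓp_gen
    have h1 : Summable fun k => ‖c k‖₊ ^ 2 := by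
      apply ENNReal.tsum_coe_ne_top_iff_summable.1
      unfold sql2 at hc
      simpa [enorm_eq_nnnorm] using hc.ne
    have h2 := NNReal.summable_coe.2 h1
    simpa using h2
  set F : Lp ℂ 2 haarL := fourierBasis.repr.symm ⟨c, hmem⟩
  have hF : ∀ k, fourierCoeff F k = c k := by
    intro k
    rw [← fourierBasis_repr]
    simp only [F, LinearIsometryEquiv.apply_symm_apply]
  refine ⟨Complex.reCLM.compLp F, fun k => ?_⟩
  have hI : Integrable F haarL := (Lp.memLp F).integrable one_le_two
  have h1 : ∀ k, Integrable (fun x => fourier k x • F x) haarL := fun k => hI.fourier_smul k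
  have h2 : coeff (Complex.reCLM.compLp F) k = fourierCoeff (fun x => ((F x).re : ℂ)) k := by
    refine congrFun (fourierCoeff_congr_ae ?_) k
    filter_upwards [Complex.reCLM.coeFn_compLp F] with x hx
    rw [hx]
    rfl
  have h3 : fourierCoeff (fun x => ((F x).re : ℂ)) k =
      (1 / 2) * (fourierCoeff F k + (starRingEnd ℂ) (fourierCoeff F (-k))) := by
    unfold fourierCoeff
    rw [← integral_conj, ← integral_add (h1 _) ?_, ← integral_const_mul]
    · congr 1
      ext x
      simp only [smul_eq_mul, map_mul]
      rw [← fourier_neg, neg_neg, Complex.re_eq_add_conj]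
      ring
    · exact (h1 (-(-k))).norm.mono' (Complex.continuous_conj.comp_aestronglyMeasurable (h1 _).1)
        (Eventually.of_forall fun x => by rw [RCLike.norm_conj])
  rw [h2, h3, hF, hF, hsymm, Complex.conj_conj]
  ring

/-- The Fourier coefficient of a product. -/
def prodCoeff (f g : L2 L) (k : ℤ) : ℂ :=
  fourierCoeff (fun x : AddCircle L => ((f x * g x : ℝ) : ℂ)) k

lemma integrable_mul_L2 (f g : L2 L) : Integrable (fun x => f x * g x) haarL :=
  (Lp.memLp f).integrable_mul (Lp.memLp g)

/-- Parseval's identity for the inner product of e_k·g with f. It makes the convolution series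
converge for all square integrable factors, although their product is only integrable. -/
lemma hasSum_prodCoeff (f g : L2 L) (k : ℤ) :
    HasSum (fun k₁ => coeff f k₁ * coeff g (k - k₁)) (prodCoeff f g k) := by
  have hmem : MemLp (fun x : AddCircle L => fourier k x * ((g x : ℝ) : ℂ)) 2 haarL := by
    refine MemLp.of_le (Lp.memLp g) ?_ (Eventually.of_forall fun x => ?_)
    · exact ((fourier k).continuous.aestronglyMeasurable).mul
        (Complex.continuous_ofReal.comp_aestronglyMeasurable (Lp.aestronglyMeasurable g))
    · rw [norm_mul, Complex.norm_real]
      have : ‖fourier k x‖ = 1 := by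
        rw [fourier_apply]
        exact Circle.norm_coe _
      rw [this, one_mul]
  set h := hmem.toLp
  have hh := hmem.coeFn_toLp
  have hs := fourierBasis.hasSum_inner_mul_inner h (cx f)
  have e1 : inner ℂ h (cx f) = prodCoeff f g k := by
    rw [L2.inner_def]
    unfold prodCoeff fourierCoeff
    refine integral_congr_ae ?_
    filter_upwards [hh, coeFn_cx f] with x h1 h2
    rw [h1, h2, RCLike.inner_apply', map_mul, ← fourier_neg, Complex.conj_ofReal, smul_eq_mul]
    push_cast
    ring
  have e2 : ∀ k₁, inner ℂ h (fourierBasis k₁) = coeff g (k - k₁) := by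
    intro k₁
    rw [L2.inner_def, coe_fourierBasis]
    unfold coeff fourierCoeff
    refine integral_congr_ae ?_
    filter_upwards [hh, coeFn_fourierLp 2 k₁] with x h1 h2
    rw [h1, h2, RCLike.inner_apply', map_mul, ← fourier_neg, Complex.conj_ofReal, smul_eq_mul,
      show -(k - k₁) = -k + k₁ by ring, fourier_add]
    ring
  have e3 : ∀ k₁, inner ℂ (fourierBasis k₁) (cx f) = coeff f k₁ := by
    intro k₁
    rw [← HilbertBasis.repr_apply_apply, coeff_eq_repr]
  rw [e1] at hs
  refine hs.congr_fun ?_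
  intro k₁
  rw [e2, e3, mul_comm]

lemma enorm_prodCoeff_le (f g : L2 L) (k : ℤ) : ‖prodCoeff f g k‖ₑ ≤ ‖f‖ₑ * ‖g‖ₑ := by
  rw [← (hasSum_prodCoeff f g k).tsum_eq]
  refine enorm_tsum_le_tsum_enorm.trans ?_
  simp only [enorm_mul]
  refine le_of_sq_le ?_
  rw [mul_pow, enorm_sq_eq_sql2, enorm_sq_eq_sql2]
  exact tsum_conv_sq_le (fun k => ‖coeff f k‖ₑ) (fun k => ‖coeff g k‖ₑ) k

lemma prodCoeff_sub_left (f f' g : L2 L) (k : ℤ) :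
    prodCoeff (f - f') g k = prodCoeff f g k - prodCoeff f' g k := by
  have h := (hasSum_prodCoeff f g k).sub (hasSum_prodCoeff f' g k)
  refine (hasSum_prodCoeff (f - f') g k).unique (h.congr_fun fun k₁ => ?_)
  rw [coeff_sub]
  ring

lemma prodCoeff_sub_right (f g g' : L2 L) (k : ℤ) :
    prodCoeff f (g - g') k = prodCoeff f g k - prodCoeff f g' k := by
  have h := (hasSum_prodCoeff f g k).sub (hasSum_prodCoeff f g' k)
  refine (hasSum_prodCoeff f (g - g') k).unique (h.congr_fun fun k₁ => ?_)
  rw [coeff_sub]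
  ring

lemma norm_prodCoeff_le (f g : L2 L) (k : ℤ) : ‖prodCoeff f g k‖ ≤ ‖f‖ * ‖g‖ := by
  have h := enorm_prodCoeff_le f g k
  rw [← ofReal_norm, ← ofReal_norm, ← ofReal_norm, ← ENNReal.ofReal_mul (norm_nonneg _)] at h
  exact (ENNReal.ofReal_le_ofReal_iff (by positivity)).1 h

lemma norm_coeff_le (f : L2 L) (k : ℤ) : ‖coeff f k‖ ≤ ‖f‖ := by
  have h : ‖coeff f k‖ₑ ^ 2 ≤ ‖f‖ₑ ^ 2 := by
    rw [enorm_sq_eq_sql2]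
    exact ENNReal.le_tsum (f := fun k => ‖coeff f k‖ₑ ^ 2) k
  have h' := le_of_sq_le h
  rw [← ofReal_norm, ← ofReal_norm] at h'
  exact (ENNReal.ofReal_le_ofReal_iff (norm_nonneg _)).1 h'

lemma continuous_coeff (k : ℤ) : Continuous fun f : L2 L => coeff f k := by
  rw [continuous_iff_continuousAt]
  intro f
  rw [ContinuousAt, tendsto_iff_norm_sub_tendsto_zero]
  have h : Tendsto (fun g : L2 L => ‖g - f‖) (𝓝 f) (𝓝 0) :=
    tendsto_iff_norm_sub_tendsto_zero.1 tendsto_id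
  refine squeeze_zero (fun _ => norm_nonneg _) (fun g => ?_) h
  rw [← coeff_sub]
  exact norm_coeff_le _ _

lemma continuous_prodCoeff (k : ℤ) : Continuous fun x : L2 L × L2 L => prodCoeff x.1 x.2 k := by
  rw [continuous_iff_continuousAt]
  intro x
  rw [ContinuousAt, tendsto_iff_norm_sub_tendsto_zero]
  have h : Tendsto (fun y : L2 L × L2 L => ‖y.1 - x.1‖ * ‖y.2‖ + ‖x.1‖ * ‖y.2 - x.2‖) (𝓝 x)
      (𝓝 (‖x.1 - x.1‖ * ‖x.2‖ + ‖x.1‖ * ‖x.2 - x.2‖)) :=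
    Continuous.tendsto (by fun_prop) x
  simp only [sub_self, norm_zero, zero_mul, mul_zero, add_zero] at h
  refine squeeze_zero (fun _ => norm_nonneg _) (fun y => ?_) h
  have e : prodCoeff y.1 y.2 k - prodCoeff x.1 x.2 k =
      prodCoeff (y.1 - x.1) y.2 k + prodCoeff x.1 (y.2 - x.2) k := by
    rw [prodCoeff_sub_left, prodCoeff_sub_right]
    ring
  rw [e]
  exact (norm_add_le _ _).trans (add_le_add (norm_prodCoeff_le _ _ _) (norm_prodCoeff_le _ _ _))

end Circle

/-! ### The weak formulation in terms of Fourier coefficients -/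

section Weak

variable {L : ℝ}

lemma fourier_coe_eq_ee (k : ℤ) (x : ℝ) : fourier k (x : AddCircle L) = ee (freq L k * x) := by
  rw [fourier_coe_apply]
  unfold ee freq
  congr 1
  push_cast
  ring

/-- Smooth periodic functions on the real line. -/
structure IsTest (L : ℝ) (φ : ℝ → ℂ) : Prop where
  smooth : ContDiff ℝ ((⊤ : ℕ∞) : WithTop ℕ∞) φ
  periodic : Function.Periodic φ L

lemma IsTest.deriv {φ : ℝ → ℂ} (h : IsTest L φ) : IsTest L (deriv φ) where
  smooth := h.smooth.deriv'
  periodic := fun x => by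
    have := deriv_comp_add_const φ L x
    rw [← this]
    congr 1
    ext y
    exact h.periodic y

lemma deriv_ee (k : ℤ) : deriv (fun x : ℝ => ee (-(freq L k * x))) =
    fun x => -(Complex.I * freq L k) * ee (-(freq L k * x)) := by
  ext x
  have := hasDerivAt_ee_mul (-freq L k) x
  simp only [neg_mul] at this
  rw [this.deriv]
  push_cast
  ring

lemma iteratedDeriv_three_ee (k : ℤ) : iteratedDeriv 3 (fun x : ℝ => ee (-(freq L k * x))) =
    fun x => Complex.I * freq L k ^ 3 * ee (-(freq L k * x)) := by
  rw [iteratedDeriv_succ, iteratedDeriv_succ, iteratedDeriv_one, deriv_ee]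
  have h : ∀ c : ℂ, deriv (fun x : ℝ => c * ee (-(freq L k * x))) =
      fun x => c * (-(Complex.I * freq L k) * ee (-(freq L k * x))) := by
    intro c
    ext x
    rw [deriv_const_mul_field, deriv_ee]
  rw [h]
  simp only [← mul_assoc]
  rw [h]
  ext x
  linear_combination (-(Complex.I * freq L k ^ 3 * ee (-(freq L k * x)))) * Complex.I_sq

/-- The Fourier coefficient of a periodic function on the real line. -/
def testCoeff (L : ℝ) (φ : ℝ → ℂ) (k : ℤ) : ℂ :=
  (1 / L : ℝ) * ∫ x in (0 : ℝ)..L, ee (-(freq L k * x)) * φ x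

lemma IsTest.testCoeff_deriv {φ : ℝ → ℂ} (h : IsTest L φ) (k : ℤ) :
    testCoeff L (_root_.deriv φ) k = Complex.I * freq L k * testCoeff L φ k := by
  have hd : Differentiable ℝ φ := h.smooth.differentiable (by simp)
  have hd' : Continuous (_root_.deriv φ) := h.deriv.smooth.continuous
  have he : ∀ x : ℝ, HasDerivAt (fun x : ℝ => ee (-(freq L k * x)))
      (-(Complex.I * freq L k) * ee (-(freq L k * x))) x := by
    intro x
    have := hasDerivAt_ee_mul (-freq L k) x
    simp only [neg_mul] at this
    refine this.congr_deriv ?_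
    push_cast
    ring
  have hbd : ee (-(freq L k * L)) = 1 := by
    have h1 := fourier_coe_eq_ee (L := L) (-k) L
    rw [freq_neg, neg_mul] at h1
    rw [← h1, AddCircle.coe_period]
    exact fourier_eval_zero (-k)
  have hp := intervalIntegral.integral_mul_deriv_eq_deriv_mul (a := 0) (b := L)
    (fun x _ => he x) (fun x _ => (hd x).hasDerivAt)
    (Continuous.intervalIntegrable (by fun_prop) _ _) (hd'.intervalIntegrable _ _)
  have h0 : φ L = φ 0 := by
    have := h.periodic 0
    rwa [zero_add] at this
  rw [hbd, h0] at hp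
  unfold testCoeff
  rw [hp]
  simp only [mul_zero, neg_zero, ee_zero, mul_assoc, neg_mul]
  rw [intervalIntegral.integral_neg, intervalIntegral.integral_const_mul,
    intervalIntegral.integral_const_mul]
  ring

/-- The exponentials as test functions. -/
lemma isTest_ee (k : ℤ) : IsTest L fun x => ee (-(freq L k * x)) where
  smooth := by
    have h : ContDiff ℝ ((⊤ : ℕ∞) : WithTop ℕ∞) fun x : ℝ => ((-(freq L k * x) : ℝ) : ℂ) :=
      Complex.ofRealCLM.contDiff.comp (contDiff_const.mul contDiff_id).neg
    exact (contDiff_const.mul h).cexp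
  periodic := fun x => by
    have h1 := fourier_coe_eq_ee (L := L) (-k) (x + L)
    have h2 := fourier_coe_eq_ee (L := L) (-k) x
    simp only [freq_neg, neg_mul] at h1 h2
    simp only
    rw [← h1, ← h2, AddCircle.coe_add_period]

variable [hL : Fact (0 < L)]

local notation "haarL" => (AddCircle.haarAddCircle : Measure (AddCircle L))

lemma integral_interval_eq (F : AddCircle L → ℂ) :
    ∫ x in (0 : ℝ)..L, F (x : AddCircle L) = L * ∫ x, F x ∂haarL := by
  have h := AddCircle.intervalIntegral_preimage L 0 F
  rw [zero_add] at h
  rw [h, AddCircle.volume_eq_smul_haarAddCircle, integral_smul_measure,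
    ENNReal.toReal_ofReal hL.out.le, Complex.real_smul]

lemma norm_testCoeff_le (φ : ℝ → ℂ) :
    ∃ M : ℝ, ∀ k, ‖testCoeff L φ k‖ ≤ M := by
  refine ⟨‖((1 / L : ℝ) : ℂ)‖ * ∫ x in (0 : ℝ)..L, ‖φ x‖, fun k => ?_⟩
  unfold testCoeff
  rw [norm_mul]
  gcongr
  refine (intervalIntegral.norm_integral_le_integral_norm hL.out.le).trans (le_of_eq ?_)
  simp

/-- Two integrations by parts give decay of order k⁻². -/
lemma IsTest.summable_testCoeff {φ : ℝ → ℂ} (h : IsTest L φ) :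
    Summable fun k => ‖testCoeff L φ k‖ := by
  obtain ⟨M, hM⟩ := norm_testCoeff_le (L := L) (_root_.deriv (_root_.deriv φ))
  have hs : Summable fun k : ℤ => M / (2 * Real.pi / L) ^ 2 * (1 / (k : ℝ) ^ 2) :=
    (Real.summable_one_div_int_pow.2 one_lt_two).mul_left _
  refine Summable.of_norm_bounded_eventually hs ?_
  rw [eventually_cofinite]
  refine (finite_singleton (0 : ℤ)).subset fun k hk => ?_
  by_contra hk0
  apply hk
  have hk0' : (k : ℝ) ≠ 0 := by exact_mod_cast hk0
  have h1 := hM k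
  rw [h.deriv.testCoeff_deriv, h.testCoeff_deriv] at h1
  simp only [norm_mul, Complex.norm_I, one_mul, Complex.norm_real, Real.norm_eq_abs] at h1
  have hpos : 0 < |freq L k| ^ 2 := by
    have : freq L k ≠ 0 := by
      unfold freq
      have := hL.out.ne'
      have := Real.pi_pos.ne'
      positivity
    positivity
  have e : M / (2 * Real.pi / L) ^ 2 * (1 / (k : ℝ) ^ 2) = M / |freq L k| ^ 2 := by
    rw [sq_abs]
    unfold freq
    have := hL.out.ne'
    have := Real.pi_pos.ne'
    field_simp
  rw [norm_norm, e, le_div_iff₀ hpos]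
  calc _ = |freq L k| * (|freq L k| * ‖testCoeff L φ k‖) := by ring
    _ ≤ M := h1

lemma IsTest.hasSum {φ : ℝ → ℂ} (h : IsTest L φ) (x : ℝ) :
    HasSum (fun k => testCoeff L φ k * ee (freq L k * x)) (φ x) := by
  have hc : Continuous (h.periodic.lift) := continuous_coinduced_dom.2 h.smooth.continuous
  let Φ : C(AddCircle L, ℂ) := ⟨h.periodic.lift, hc⟩
  have hcoeff : ∀ k, fourierCoeff Φ k = testCoeff L φ k := by
    intro k
    rw [fourierCoeff_eq_intervalIntegral _ _ 0, zero_add, testCoeff, Complex.real_smul]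
    congr 2
    ext x
    rw [fourier_coe_eq_ee, freq_neg, neg_mul]
    rfl
  have hs : Summable (fourierCoeff Φ) := by
    refine Summable.of_norm ?_
    simp only [hcoeff]
    exact h.summable_testCoeff
  have := has_pointwise_sum_fourier_series_of_summable hs (x : AddCircle L)
  simp only [hcoeff, smul_eq_mul, fourier_coe_eq_ee] at this
  exact this

lemma IsTest.hasSum_integral {φ : ℝ → ℂ} (h : IsTest L φ) {f : AddCircle L → ℝ}
    (hf : Integrable f haarL) :
    HasSum (fun k => testCoeff L φ k * (L * fourierCoeff (fun x => (f x : ℂ)) (-k)))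
      (∫ x in (0 : ℝ)..L, f (x : AddCircle L) • φ x) := by
  let Φ : AddCircle L → ℂ := h.periodic.lift
  have e1 : ∫ x in (0 : ℝ)..L, f (x : AddCircle L) • φ x = L * ∫ x, f x • Φ x ∂haarL :=
    integral_interval_eq fun x => f x • Φ x
  have hΦ : ∀ x, HasSum (fun k => testCoeff L φ k * fourier k x) (Φ x) := by
    intro x
    induction x using QuotientAddGroup.induction_on with
    | H x =>
      have := h.hasSum x
      simp only [← fourier_coe_eq_ee] at this
      exact this
  have hfc : Integrable (fun x => (f x : ℂ)) haarL := hf.ofReal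
  have hInt : ∀ k, Integrable (fun x => testCoeff L φ k * (fourier k x • (f x : ℂ))) haarL :=
    fun k => (hfc.fourier_smul k).const_mul _
  have hs := hasSum_integral_of_summable_integral_norm (μ := haarL)
    (F := fun k x => testCoeff L φ k * (fourier k x • (f x : ℂ))) hInt (by
      have : ∀ k, ∫ x, ‖testCoeff L φ k * (fourier k x • (f x : ℂ))‖ ∂haarL =
          ‖testCoeff L φ k‖ * ∫ x, ‖(f x : ℂ)‖ ∂haarL := by
        intro k
        rw [← integral_const_mul]
        congr 1
        ext x
        have : ‖fourier k x‖ = 1 := by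
          rw [fourier_apply]
          exact Circle.norm_coe _
        rw [norm_mul, norm_smul, this, one_mul]
      simp_rw [this]
      exact h.summable_testCoeff.mul_right _)
  have e2 : ∀ x, ∑' k, testCoeff L φ k * (fourier k x • (f x : ℂ)) = f x • Φ x := by
    intro x
    rw [← (hΦ x).tsum_eq, Complex.real_smul, ← tsum_mul_left]
    refine tsum_congr fun k => ?_
    rw [smul_eq_mul]
    ring
  simp_rw [e2] at hs
  rw [e1]
  refine (hs.mul_left (L : ℂ)).congr_fun fun k => ?_
  rw [integral_const_mul]
  unfold fourierCoeff
  rw [neg_neg]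
  ring

lemma integral_smul_ee (f : AddCircle L → ℝ) (k : ℤ) :
    ∫ x in (0 : ℝ)..L, f (x : AddCircle L) • ee (-(freq L k * x)) =
      L * fourierCoeff (fun x => (f x : ℂ)) k := by
  rw [fourierCoeff, ← integral_interval_eq]
  congr 1
  ext x
  rw [fourier_coe_eq_ee, freq_neg, neg_mul, Complex.real_smul, smul_eq_mul, mul_comm]

end Weak

/-! ### Equivalence of the weak formulation and the system for the Fourier coefficients -/

section Weak

variable {L : ℝ} [hL : Fact (0 < L)]

local notation "haarL" => (AddCircle.haarAddCircle : Measure (AddCircle L))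

lemma IsTest.integrable_smul {φ : ℝ → ℂ} (h : IsTest L φ) {f : AddCircle L → ℝ}
    (hf : Integrable f haarL) : Integrable (fun x => f x • h.periodic.lift x) haarL := by
  have hc : Continuous (h.periodic.lift) := continuous_coinduced_dom.2 h.smooth.continuous
  let Φ : C(AddCircle L, ℂ) := ⟨h.periodic.lift, hc⟩
  have hfc : Integrable (fun x => (f x : ℂ)) haarL := hf.ofReal
  have := Integrable.bdd_mul (c := ‖Φ‖) hfc (f := Φ) hc.aestronglyMeasurable
    (Eventually.of_forall fun x => Φ.norm_coe_le_norm x)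
  refine this.congr (Eventually.of_forall fun x => ?_)
  simp only [Complex.real_smul]
  rw [mul_comm]
  rfl

lemma IsTest.integral_add {φ ψ : ℝ → ℂ} (hφ : IsTest L φ) (hψ : IsTest L ψ)
    {f g : AddCircle L → ℝ} (hf : Integrable f haarL) (hg : Integrable g haarL) :
    ∫ x in (0 : ℝ)..L, (f (x : AddCircle L) • φ x + g (x : AddCircle L) • ψ x) =
      (∫ x in (0 : ℝ)..L, f (x : AddCircle L) • φ x) +
        ∫ x in (0 : ℝ)..L, g (x : AddCircle L) • ψ x := by
  have e1 := integral_interval_eq (L := L) fun x => f x • hφ.periodic.lift x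
  have e2 := integral_interval_eq (L := L) fun x => g x • hψ.periodic.lift x
  have e3 := integral_interval_eq (L := L)
    fun x => f x • hφ.periodic.lift x + g x • hψ.periodic.lift x
  rw [MeasureTheory.integral_add (hφ.integrable_smul hf) (hψ.integrable_smul hg), mul_add,
    ← e1, ← e2] at e3
  exact e3

/-- The system in terms of Fourier coefficients. -/
structure FourierSol (T : ℝ) (u v : ℝ → L2 L) : Prop where
  eq_u : ∀ k, ∀ t ∈ Icc 0 T, coeff (u t) k = coeff (u 0) k + ∫ r in (0 : ℝ)..t,
    (Complex.I * freq L k ^ 3 * coeff (u r) k - Complex.I * freq L k * prodCoeff (u r) (v r) k)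
  eq_v : ∀ k, ∀ t ∈ Icc 0 T, coeff (v t) k = coeff (v 0) k + ∫ r in (0 : ℝ)..t,
    -(Complex.I / 2 * freq L k) * prodCoeff (u r) (u r) k

variable {s T : ℝ} {u₀ v₀ : L2 L} {u v : ℝ → L2 L}

lemma mul_left_cancel_integral {a b : ℂ} {f : ℝ → ℂ} {t : ℝ}
    (h : L * a = L * b + ∫ r in (0 : ℝ)..t, L * f r) : a = b + ∫ r in (0 : ℝ)..t, f r := by
  rw [intervalIntegral.integral_const_mul, ← mul_add] at h
  exact mul_left_cancel₀ (by exact_mod_cast hL.out.ne') h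

/-- Test with e^{-iξx}: its first derivative yields -iξ and its third derivative yields iξ³. -/
lemma IsSolution.fourierSol (h : IsSolution s T u₀ v₀ u v) : FourierSol T u v where
  eq_u k t ht := by
    rw [h.init_u]
    apply mul_left_cancel_integral (L := L)
    have h1 := h.eq_u _ (isTest_ee k).smooth (isTest_ee k).periodic t ht
    rw [integral_smul_ee, integral_smul_ee] at h1
    refine h1.trans ?_
    congr 1
    congr 1
    ext r
    have hd := (isTest_ee (L := L) k).deriv
    have hd3 := hd.deriv.deriv
    have e3 : iteratedDeriv 3 (fun x : ℝ => ee (-(freq L k * x))) =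
        deriv (deriv (deriv fun x : ℝ => ee (-(freq L k * x)))) := by
      rw [iteratedDeriv_succ, iteratedDeriv_succ, iteratedDeriv_one]
    rw [← e3] at hd3
    have h2 := hd.integral_add hd3 (integrable_mul_L2 (u r) (v r)) (integrable_L2 (u r))
    refine h2.trans ?_
    rw [deriv_ee, iteratedDeriv_three_ee]
    have e : ∀ (a : ℝ) (c z : ℂ), a • (c * z) = c * (a • z) := fun a c z =>
      (mul_smul_comm a c z).symm
    simp_rw [e]
    rw [intervalIntegral.integral_const_mul, intervalIntegral.integral_const_mul,
      integral_smul_ee (fun x => u r x * v r x), integral_smul_ee]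
    unfold prodCoeff coeff
    ring
  eq_v k t ht := by
    rw [h.init_v]
    apply mul_left_cancel_integral (L := L)
    have h1 := h.eq_v _ (isTest_ee k).smooth (isTest_ee k).periodic t ht
    rw [integral_smul_ee, integral_smul_ee] at h1
    refine h1.trans ?_
    congr 1
    congr 1
    ext r
    rw [deriv_ee]
    have e : ∀ x : ℝ, (u r (x : AddCircle L) ^ 2 / 2) •
        (-(Complex.I * freq L k) * ee (-(freq L k * x))) =
        -(Complex.I / 2 * freq L k) *
          ((u r (x : AddCircle L) * u r (x : AddCircle L)) • ee (-(freq L k * x))) := by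
      intro x
      rw [Complex.real_smul, Complex.real_smul]
      push_cast
      ring
    simp_rw [e]
    rw [intervalIntegral.integral_const_mul, integral_smul_ee (fun x => u r x * u r x)]
    unfold prodCoeff
    ring

lemma hasSum_intervalIntegral {t : ℝ} (ht : 0 ≤ t) {F : ℤ → ℝ → ℂ} {G : ℝ → ℂ} {b : ℤ → ℝ}
    (hF : ∀ k, ContinuousOn (F k) (Icc 0 t)) (hb : ∀ k, ∀ r ∈ Icc 0 t, ‖F k r‖ ≤ b k)
    (hs : Summable b) (hG : ∀ r ∈ Icc 0 t, HasSum (fun k => F k r) (G r)) :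
    HasSum (fun k => ∫ r in (0 : ℝ)..t, F k r) (∫ r in (0 : ℝ)..t, G r) := by
  have hsub : uIoc 0 t ⊆ Icc 0 t := by
    rw [uIoc_of_le ht]
    exact Ioc_subset_Icc_self
  refine intervalIntegral.hasSum_integral_of_dominated_convergence (fun k _ => b k) ?_ ?_ ?_ ?_ ?_
  · intro k
    exact ((hF k).mono hsub).aestronglyMeasurable measurableSet_uIoc
  · intro k
    exact Eventually.of_forall fun r hr => hb k r (hsub hr)
  · exact Eventually.of_forall fun r hr => hs
  · simp
  · exact Eventually.of_forall fun r hr => hG r (hsub hr)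

/-- Expand the test function in its Fourier series and sum the coefficient equations. The rapid
decay of its coefficients dominates the derivatives, so sum and time integral may be exchanged. -/
lemma FourierSol.weak_u (h : FourierSol T u v) (hu : ContinuousOn u (Icc 0 T))
    (hv : ContinuousOn v (Icc 0 T)) {φ : ℝ → ℂ} (hφ : IsTest L φ) {t : ℝ} (ht : t ∈ Icc 0 T) :
    ∫ x in (0 : ℝ)..L, u t (x : AddCircle L) • φ x =
      (∫ x in (0 : ℝ)..L, u 0 (x : AddCircle L) • φ x) +
        ∫ r in (0 : ℝ)..t, ∫ x in (0 : ℝ)..L,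
          ((u r (x : AddCircle L) * v r (x : AddCircle L)) • deriv φ x
            + u r (x : AddCircle L) • iteratedDeriv 3 φ x) := by
  have hsub : Icc 0 t ⊆ Icc 0 T := Icc_subset_Icc_right ht.2
  have hu' := hu.mono hsub
  have hv' := hv.mono hsub
  have hd := hφ.deriv
  have hd3 := hd.deriv.deriv
  have e3 : iteratedDeriv 3 φ = deriv (deriv (deriv φ)) := by
    rw [iteratedDeriv_succ, iteratedDeriv_succ, iteratedDeriv_one]
  set F : ℤ → ℝ → ℂ := fun k r => testCoeff L φ k * (L *
    (Complex.I * freq L (-k) ^ 3 * coeff (u r) (-k) -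
      Complex.I * freq L (-k) * prodCoeff (u r) (v r) (-k)))
  have hpc : ∀ k, ContinuousOn (fun r => prodCoeff (u r) (v r) k) (Icc 0 t) := fun k =>
    (continuous_prodCoeff k).comp_continuousOn (hu'.prodMk hv')
  have hcc : ∀ k, ContinuousOn (fun r => coeff (u r) k) (Icc 0 t) := fun k =>
    (continuous_coeff k).comp_continuousOn hu'
  have hF : ∀ k, ContinuousOn (F k) (Icc 0 t) := by
    intro k
    have h1 := hpc (-k)
    have h2 := hcc (-k)
    fun_prop
  obtain ⟨M, hM⟩ := isCompact_Icc.exists_bound_of_continuousOn hu'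
  obtain ⟨M', hM'⟩ := isCompact_Icc.exists_bound_of_continuousOn hv'
  -- The powers of the frequency are handed to the test function as derivatives, whose coefficients
  -- are still summable.
  have hFe : ∀ k r, F k r = testCoeff L (deriv φ) k * (L * prodCoeff (u r) (v r) (-k)) +
      testCoeff L (deriv (deriv (deriv φ))) k * (L * coeff (u r) (-k)) := by
    intro k r
    simp only [F]
    rw [hd.deriv.testCoeff_deriv, hd.testCoeff_deriv, hφ.testCoeff_deriv, freq_neg]
    push_cast
    linear_combination (-(Complex.I * freq L k ^ 3 * testCoeff L φ k * L * coeff (u r) (-k))) *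
      Complex.I_sq
  have hG : ∀ r ∈ Icc 0 t, HasSum (fun k => F k r) (∫ x in (0 : ℝ)..L,
          ((u r (x : AddCircle L) * v r (x : AddCircle L)) • deriv φ x
            + u r (x : AddCircle L) • iteratedDeriv 3 φ x)) := by
    intro r hr
    rw [e3, hd.integral_add hd3 (integrable_mul_L2 (u r) (v r)) (integrable_L2 (u r))]
    have h1 := hd.hasSum_integral (integrable_mul_L2 (u r) (v r))
    have h2 := hd3.hasSum_integral (integrable_L2 (u r))
    exact (h1.add h2).congr_fun fun k => hFe k r
  have hb : ∀ k, ∀ r ∈ Icc 0 t, ‖F k r‖ ≤ ‖testCoeff L (deriv φ) k‖ * (L * (M * M')) +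
      ‖testCoeff L (deriv (deriv (deriv φ))) k‖ * (L * M) := by
    intro k r hr
    have hLp := hL.out
    have hM0 := (norm_nonneg _).trans (hM r hr)
    rw [hFe]
    refine (norm_add_le _ _).trans ?_
    simp only [norm_mul, Complex.norm_real, Real.norm_of_nonneg hLp.le]
    gcongr
    · refine (norm_prodCoeff_le _ _ _).trans ?_
      gcongr
      · exact hM r hr
      · exact hM' r hr
    · exact (norm_coeff_le _ _).trans (hM r hr)
  have hsum := hasSum_intervalIntegral ht.1 hF hb
    ((hd.summable_testCoeff.mul_right _).add (hd3.summable_testCoeff.mul_right _)) hG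
  have h1 := hφ.hasSum_integral (integrable_L2 (u t))
  have h0 := hφ.hasSum_integral (integrable_L2 (u 0))
  refine h1.unique ((h0.add hsum).congr_fun fun k => ?_)
  simp only [F]
  rw [intervalIntegral.integral_const_mul, intervalIntegral.integral_const_mul, ← mul_add,
    ← mul_add]
  congr 2
  exact h.eq_u (-k) t ht

lemma FourierSol.weak_v (h : FourierSol T u v) (hu : ContinuousOn u (Icc 0 T))
    {φ : ℝ → ℂ} (hφ : IsTest L φ) {t : ℝ} (ht : t ∈ Icc 0 T) :
    ∫ x in (0 : ℝ)..L, v t (x : AddCircle L) • φ x =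
      (∫ x in (0 : ℝ)..L, v 0 (x : AddCircle L) • φ x) +
        ∫ r in (0 : ℝ)..t, ∫ x in (0 : ℝ)..L,
          (u r (x : AddCircle L) ^ 2 / 2) • deriv φ x := by
  have hsub : Icc 0 t ⊆ Icc 0 T := Icc_subset_Icc_right ht.2
  have hu' := hu.mono hsub
  have hd := hφ.deriv
  set F : ℤ → ℝ → ℂ := fun k r => testCoeff L φ k * (L *
    (-(Complex.I / 2 * freq L (-k)) * prodCoeff (u r) (u r) (-k)))
  have hpc : ∀ k, ContinuousOn (fun r => prodCoeff (u r) (u r) k) (Icc 0 t) := fun k =>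
    (continuous_prodCoeff k).comp_continuousOn (hu'.prodMk hu')
  have hF : ∀ k, ContinuousOn (F k) (Icc 0 t) := by
    intro k
    have h1 := hpc (-k)
    fun_prop
  obtain ⟨M, hM⟩ := isCompact_Icc.exists_bound_of_continuousOn hu'
  have hFe : ∀ k r, F k r =
      1 / 2 * (testCoeff L (deriv φ) k * (L * prodCoeff (u r) (u r) (-k))) := by
    intro k r
    simp only [F]
    rw [hφ.testCoeff_deriv, freq_neg]
    push_cast
    ring
  have hG : ∀ r ∈ Icc 0 t, HasSum (fun k => F k r) (∫ x in (0 : ℝ)..L,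
          (u r (x : AddCircle L) ^ 2 / 2) • deriv φ x) := by
    intro r hr
    have h1 := (hd.hasSum_integral (integrable_mul_L2 (u r) (u r))).mul_left (1 / 2 : ℂ)
    rw [← intervalIntegral.integral_const_mul] at h1
    have e : ∀ x : ℝ, (u r (x : AddCircle L) ^ 2 / 2) • deriv φ x =
        1 / 2 * ((u r (x : AddCircle L) * u r (x : AddCircle L)) • deriv φ x) := by
      intro x
      rw [Complex.real_smul, Complex.real_smul]
      push_cast
      ring
    simp_rw [e]
    exact h1.congr_fun fun k => hFe k r
  have hb : ∀ k, ∀ r ∈ Icc 0 t, ‖F k r‖ ≤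
      1 / 2 * (‖testCoeff L (deriv φ) k‖ * (L * (M * M))) := by
    intro k r hr
    have hLp := hL.out
    have hM0 := (norm_nonneg _).trans (hM r hr)
    rw [hFe]
    simp only [norm_mul, Complex.norm_real, Real.norm_of_nonneg hLp.le]
    have : ‖(1 / 2 : ℂ)‖ = 1 / 2 := by norm_num
    rw [this]
    gcongr
    refine (norm_prodCoeff_le _ _ _).trans ?_
    gcongr <;> exact hM r hr
  have hsum := hasSum_intervalIntegral ht.1 hF hb
    ((hd.summable_testCoeff.mul_right _).mul_left _) hG
  have h1 := hφ.hasSum_integral (integrable_L2 (v t))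
  have h0 := hφ.hasSum_integral (integrable_L2 (v 0))
  refine h1.unique ((h0.add hsum).congr_fun fun k => ?_)
  simp only [F]
  rw [intervalIntegral.integral_const_mul, intervalIntegral.integral_const_mul, ← mul_add,
    ← mul_add]
  congr 2
  exact h.eq_v (-k) t ht

lemma enorm_le_sobNorm (hs : 0 ≤ s) (f : L2 L) : ‖f‖ₑ ≤ sobNorm s f := by
  rw [enorm_eq_sql2]
  unfold sobNorm sql2
  gcongr with k
  exact le_mul_of_one_le_left' (one_le_jb (freq L k) hs)

lemma SobContinuousOn.continuousOn (hs : 0 ≤ s) {I : Set ℝ} (h : SobContinuousOn s u I) :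
    ContinuousOn u I := by
  intro t ht
  rw [ContinuousWithinAt, EMetric.tendsto_nhds]
  intro ε hε
  filter_upwards [(h t ht).2.eventually (gt_mem_nhds hε)] with r hr
  rw [edist_eq_enorm_sub]
  exact (enorm_le_sobNorm hs _).trans_lt hr

lemma FourierSol.isSolution (hs : 0 ≤ s) (h : FourierSol T u v)
    (hu : SobContinuousOn s u (Icc 0 T)) (hv : ContinuousOn v (Icc 0 T)) (h0 : u 0 = u₀)
    (h0' : v 0 = v₀) : IsSolution s T u₀ v₀ u v where
  cont_u := hu
  cont_v := hv
  init_u := h0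
  init_v := h0'
  eq_u φ h1 h2 t ht := by
    rw [← h0]
    exact h.weak_u (hu.continuousOn hs) hv ⟨h1, h2⟩ ht
  eq_v φ h1 h2 t ht := by
    rw [← h0']
    exact h.weak_v (hu.continuousOn hs) ⟨h1, h2⟩ ht

end Weak

/-! ### The spaces `Y` and `ZS` -/

section Rep

variable {L : ℝ} {s : ℝ} {w : ℤ → ℝ}

lemma enorm_weight (s : ℝ) (k : ℤ) :
    ‖((bracket (freq L k) ^ s : ℝ) : ℂ)‖ₑ = jb (freq L k) s := by
  rw [← ofReal_norm, Complex.norm_real,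
    Real.norm_of_nonneg (Real.rpow_nonneg (bracket_pos _).le _), jb]

lemma weight_ne_zero (s : ℝ) (k : ℤ) : ((bracket (freq L k) ^ s : ℝ) : ℂ) ≠ 0 := by
  exact_mod_cast (Real.rpow_pos_of_pos (bracket_pos _) _).ne'

lemma lintegral_comp_add (f : ℝ → ℝ≥0∞) (c : ℝ) : ∫⁻ x, f (x + c) = ∫⁻ x, f x :=
  lintegral_add_right_eq_self f c

/-- Translating τ by w(k) turns the weight ⟨τ - w(k)⟩ into ⟨τ⟩. In this way spaces with different
dispersion relations are carried to the single space `ZS`. -/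
lemma bourgainNorm_eq {a : ℤ → ℝ → ℂ} :
    bourgainNorm L w s (1 / 2) a = (∑' k : ℤ, ∫⁻ τ : ℝ,
      jb τ 1 * ‖((bracket (freq L k) ^ s : ℝ) : ℂ) * a k (τ + w k)‖ₑ ^ 2) ^ (1 / 2 : ℝ) := by
  unfold bourgainNorm
  congr 1
  refine tsum_congr fun k => ?_
  rw [← lintegral_comp_add _ (w k)]
  congr 1
  ext τ
  rw [add_sub_cancel_right, ENNReal.ofReal_mul (Real.rpow_nonneg (bracket_pos _).le _), enorm_mul,
    enorm_weight]
  change (jb (freq L k) s * jb τ (1 / 2) * _) ^ 2 = _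
  rw [mul_pow, mul_pow, mul_pow, jb_pow_two τ]
  norm_num
  ring

lemma sobL1Norm_eq {a : ℤ → ℝ → ℂ} : sobL1Norm L s a = (∑' k : ℤ, (∫⁻ τ : ℝ,
      ‖((bracket (freq L k) ^ s : ℝ) : ℂ) * a k (τ + w k)‖ₑ) ^ 2) ^ (1 / 2 : ℝ) := by
  unfold sobL1Norm
  congr 1
  refine tsum_congr fun k => ?_
  rw [← lintegral_comp_add _ (w k)]
  simp only [enorm_mul, enorm_weight]
  rfl

variable [hL : Fact (0 < L)] {I : Set ℝ} {u v : ℝ → L2 L}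

/-- The weighted Fourier coefficients. -/
def wc (s : ℝ) (f : L2 L) (k : ℤ) : ℂ := ((bracket (freq L k) ^ s : ℝ) : ℂ) * coeff f k

lemma sobNorm_eq (s : ℝ) (f : L2 L) : sobNorm s f = sql2 (wc s f) ^ (1 / 2 : ℝ) := by
  unfold sobNorm sql2 wc
  simp only [enorm_mul, enorm_weight]
  rfl

lemma wc_sub (s : ℝ) (f g : L2 L) : wc s (f - g) = wc s f - wc s g := by
  ext k
  simp only [wc, coeff_sub, Pi.sub_apply]
  ring

lemma wc_zero (f : L2 L) : wc 0 f = coeff f := by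
  ext k
  simp [wc]

lemma sobNorm_zero (f : L2 L) : sobNorm 0 f = ‖f‖ₑ := by
  rw [sobNorm_eq, wc_zero, enorm_eq_sql2]

/-- `p` is the transform of an extension of the weighted Fourier coefficients of `u`, from which
the oscillation with frequencies `w` has been removed. -/
def IsRep (s : ℝ) (w : ℤ → ℝ) (I : Set ℝ) (u : ℝ → L2 L) (p : ZS) : Prop :=
  ∀ t ∈ I, ∀ k, tp p.1 k t = ee (-(w k * t)) * wc s (u t) k

lemma IsRep.wc_eq {p : ZS} (h : IsRep s w I u p) {t : ℝ} (ht : t ∈ I) (k : ℤ) :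
    wc s (u t) k = ee (w k * t) * tp p.1 k t := by
  rw [h t ht k, ← mul_assoc, mul_comm (ee _), ee_neg_mul_ee, one_mul]

lemma sql2_ee_mul_tp_le (w : ℤ → ℝ) (p : ZS) (t : ℝ) :
    sql2 (fun k => ee (w k * t) * tp p.1 k t) ≤ sqX1 p.1 := by
  refine le_trans (le_of_eq ?_) (tsum_enorm_tp_sq_le p.1 t)
  unfold sql2
  simp [enorm_mul]

/-- Every mode is continuous in time and dominated by its L¹ norm in τ, and these norms are square
summable. Continuity in H^s thus comes from the ℓ²L¹ component alone. -/
lemma tendsto_sql2_tp (w : ℤ → ℝ) (p : ZS) (t : ℝ) :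
    Tendsto (fun r => sql2 ((fun k => ee (w k * r) * tp p.1 k r) -
      fun k => ee (w k * t) * tp p.1 k t)) (𝓝 t) (𝓝 0) := by
  refine tendsto_tsum_of_dominated (G := fun k => (2 * ∫⁻ σ, ‖p.1 k σ‖ₑ) ^ 2) ?_ ?_ ?_
  · refine Eventually.of_forall fun r k => ?_
    gcongr
    simp only [Pi.sub_apply]
    refine enorm_sub_le.trans ?_
    rw [enorm_mul, enorm_mul, enorm_ee, enorm_ee, one_mul, one_mul, two_mul]
    exact add_le_add (enorm_tp_le _ _ _) (enorm_tp_le _ _ _)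
  · simp_rw [mul_pow]
    rw [ENNReal.tsum_mul_left]
    exact ENNReal.mul_lt_top (by norm_num) p.sqX1_lt_top
  · intro k
    have hc : Continuous fun r => ee (w k * r) * tp p.1 k r := by
      have := continuous_tp p k
      fun_prop
    have h1 := (hc.tendsto t).sub_const (ee (w k * t) * tp p.1 k t)
    rw [sub_self] at h1
    have h2 := ENNReal.Tendsto.pow (n := 2) h1.enorm
    simpa using h2

lemma IsRep.sobContinuousOn {p : ZS} (h : IsRep s w I u p) : SobContinuousOn s u I := by
  intro t ht
  have e : ∀ t ∈ I, wc s (u t) = fun k => ee (w k * t) * tp p.1 k t := fun t ht =>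
    funext fun k => h.wc_eq ht k
  constructor
  · rw [sobNorm_eq, rpow_half_lt_top, e t ht]
    exact (sql2_ee_mul_tp_le w p t).trans_lt p.sqX1_lt_top
  · have h1 := ((tendsto_sql2_tp w p t).ennrpow_const (1 / 2 : ℝ)).mono_left
      (nhdsWithin_le_nhds (s := I))
    rw [ENNReal.zero_rpow_of_pos (by norm_num)] at h1
    refine h1.congr' ?_
    filter_upwards [self_mem_nhdsWithin] with r hr
    rw [sobNorm_eq, wc_sub, e r hr, e t ht]

lemma Represents.exists_isRep {a : ℤ → ℝ → ℂ} (h : Represents I u a)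
    (h2 : bourgainNorm L w s (1 / 2) a < ⊤) (h1 : sobL1Norm L s a < ⊤) :
    ∃ p : ZS, IsRep s w I u p := by
  obtain ⟨hm, hrep⟩ := h
  set a' : ℤ → ℝ → ℂ := fun k => (hm k).mk
  have ha' : ∀ k, Measurable (a' k) := fun k => (hm k).stronglyMeasurable_mk.measurable
  have hae : ∀ k, a k =ᵐ[volume] a' k := fun k => (hm k).ae_eq_mk
  have hae' : ∀ k, ∀ᵐ τ, a k (τ + w k) = a' k (τ + w k) := fun k =>
    (quasiMeasurePreserving_add_right volume (w k)).ae (hae k)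
  rw [bourgainNorm_eq, rpow_half_lt_top] at h2
  rw [sobL1Norm_eq (w := w), rpow_half_lt_top] at h1
  refine ⟨⟨fun k σ => ((bracket (freq L k) ^ s : ℝ) : ℂ) * a' k (σ + w k), fun k => ?_, ?_⟩, ?_⟩
  · have := ha' k
    fun_prop
  · rw [zn_lt_top_iff]
    constructor
    · refine lt_of_eq_of_lt ?_ h2
      refine tsum_congr fun k => lintegral_congr_ae ?_
      filter_upwards [hae' k] with τ hτ
      rw [hτ]
    · refine lt_of_eq_of_lt ?_ h1
      refine tsum_congr fun k => ?_
      congr 1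
      refine lintegral_congr_ae ?_
      filter_upwards [hae' k] with τ hτ
      rw [hτ]
  · intro t ht k
    unfold tp wc
    rw [hrep t ht k]
    rw [← integral_add_right_eq_self (fun τ : ℝ => Complex.exp (Complex.I * τ * t) * a k τ) (w k),
      ← integral_const_mul, ← integral_const_mul]
    refine integral_congr_ae ?_
    filter_upwards [hae' k] with τ hτ
    rw [exp_eq_ee, hτ, show (τ + w k) * t = w k * t + τ * t by ring, ee_add]
    linear_combination (-(((bracket (freq L k) ^ s : ℝ) : ℂ) * a' k (τ + w k) * ee (τ * t))) *
      ee_neg_mul_ee (w k * t)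

lemma IsRep.exists_represents {p : ZS} (h : IsRep s w I u p) :
    ∃ a, Represents I u a ∧ bourgainNorm L w s (1 / 2) a < ⊤ ∧ sobL1Norm L s a < ⊤ := by
  set a : ℤ → ℝ → ℂ := fun k τ => ((bracket (freq L k) ^ s : ℝ) : ℂ)⁻¹ * p.1 k (τ - w k)
  have ha : ∀ k τ, ((bracket (freq L k) ^ s : ℝ) : ℂ) * a k (τ + w k) = p.1 k τ := by
    intro k τ
    simp only [a]
    rw [add_sub_cancel_right, mul_inv_cancel_left₀ (weight_ne_zero s k)]
  refine ⟨a, ⟨fun k => ?_, fun t ht k => ?_⟩, ?_, ?_⟩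
  · have := p.meas k
    exact Measurable.aestronglyMeasurable (by fun_prop)
  · have h1 := h.wc_eq ht k
    have h2 : coeff (u t) k = ((bracket (freq L k) ^ s : ℝ) : ℂ)⁻¹ * wc s (u t) k := by
      rw [wc, inv_mul_cancel_left₀ (weight_ne_zero s k)]
    rw [h2, h1, tp, ← integral_add_right_eq_self
      (fun τ : ℝ => Complex.exp (Complex.I * τ * t) * a k τ) (w k), ← integral_const_mul,
      ← integral_const_mul]
    congr 1
    ext τ
    simp only [a]
    rw [exp_eq_ee, add_sub_cancel_right, show (τ + w k) * t = w k * t + τ * t by ring, ee_add]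
    ring
  · rw [bourgainNorm_eq, rpow_half_lt_top]
    simp only [ha]
    exact (zn_lt_top_iff.1 p.lt_top).1
  · rw [sobL1Norm_eq (w := w), rpow_half_lt_top]
    simp only [ha]
    exact p.sqX1_lt_top

lemma YNorm_lt_top_iff {g : ℝ} : YNorm s g I u v < ⊤ ↔
    (∃ p, IsRep s (dispersion L g) I u p) ∧ ∃ q, IsRep 0 (fun _ => 0) I v q := by
  unfold YNorm
  simp only [iInf_lt_iff, exists_prop]
  constructor
  · rintro ⟨a, b, ha, hb, h⟩
    simp only [ENNReal.add_lt_top] at h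
    exact ⟨ha.exists_isRep h.1.1.1 h.1.1.2, hb.exists_isRep h.1.2 h.2⟩
  · rintro ⟨⟨p, hp⟩, q, hq⟩
    obtain ⟨a, ha, ha2, ha1⟩ := hp.exists_represents
    obtain ⟨b, hb, hb2, hb1⟩ := hq.exists_represents
    refine ⟨a, b, ha, hb, ?_⟩
    simp only [ENNReal.add_lt_top]
    exact ⟨⟨⟨ha2, ha1⟩, hb2⟩, hb1⟩

lemma Represents.sobNorm_le {a : ℤ → ℝ → ℂ} (h : Represents I u a) {t : ℝ} (ht : t ∈ I) :
    sobNorm s (u t) ≤ sobL1Norm L s a := by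
  unfold sobNorm sobL1Norm
  gcongr with k
  rw [h.2 t ht k, lintegral_const_mul' _ _ ENNReal.ofReal_ne_top]
  gcongr
  refine (enorm_integral_le_lintegral_enorm _).trans (le_of_eq ?_)
  simp [enorm_mul, exp_eq_ee]

lemma sobNorm_add_enorm_le_YNorm {g : ℝ} {t : ℝ} (ht : t ∈ I) :
    sobNorm s (u t) + ‖v t‖ₑ ≤ YNorm s g I u v := by
  unfold YNorm
  refine le_iInf fun a => le_iInf fun b => le_iInf fun ha => le_iInf fun hb => ?_
  rw [← sobNorm_zero]
  refine add_le_add ((ha.sobNorm_le ht).trans ?_) (hb.sobNorm_le ht)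
  exact le_add_right le_add_self

/-- The embedding of `Y` into continuous functions. -/
lemma embedding_Y {g : ℝ} (h : YNorm s g I u v < ⊤) :
    SobContinuousOn s u I ∧ ContinuousOn v I := by
  obtain ⟨⟨p, hp⟩, q, hq⟩ := YNorm_lt_top_iff.1 h
  exact ⟨hp.sobContinuousOn, hq.sobContinuousOn.continuousOn le_rfl⟩

end Rep

/-! ### The Duhamel formula -/

/-- The integrating factor e^{iβt}, applied to an integral equation: differentiate inside the
interval and integrate back, with continuity up to the end points. -/
lemma integral_twist {y h : ℝ → ℂ} (α β : ℝ) (hy : ContinuousOn y (Icc 0 1))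
    (hh : ContinuousOn h (Icc 0 1))
    (heq : ∀ t ∈ Icc (0 : ℝ) 1, y t = y 0 + ∫ r in (0 : ℝ)..t, (Complex.I * α * y r + h r))
    {t : ℝ} (ht : t ∈ Icc (0 : ℝ) 1) :
    ee (β * t) * y t = y 0 + ∫ r in (0 : ℝ)..t,
      ee (β * r) * (Complex.I * (α + β) * y r + h r) := by
  set f : ℝ → ℂ := fun r => Complex.I * α * y r + h r
  have hf : ContinuousOn f (Icc 0 1) := by fun_prop
  have hsub : Icc 0 t ⊆ Icc (0 : ℝ) 1 := Icc_subset_Icc_right ht.2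
  have hderiv : ∀ x ∈ Ioo 0 t, HasDerivAt (fun r => ee (β * r) * y r)
      (ee (β * x) * (Complex.I * (α + β) * y x + h x)) x := by
    intro x hx
    have hx' : x ∈ Ioo (0 : ℝ) 1 := ⟨hx.1, hx.2.trans_le ht.2⟩
    have hnhds : Icc (0 : ℝ) 1 ∈ 𝓝 x := Icc_mem_nhds hx'.1 hx'.2
    have h1 : HasDerivAt (fun t => ∫ r in (0 : ℝ)..t, f r) (f x) x := by
      refine intervalIntegral.integral_hasDerivAt_right ?_ ?_ (hf.continuousAt hnhds)
      · refine ContinuousOn.intervalIntegrable ?_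
        rw [uIcc_of_le hx'.1.le]
        exact hf.mono (Icc_subset_Icc_right hx'.2.le)
      · exact (hf.mono Ioo_subset_Icc_self).stronglyMeasurableAtFilter isOpen_Ioo x hx'
    have h2 : HasDerivAt y (f x) x := by
      refine (h1.const_add (y 0)).congr_of_eventuallyEq ?_
      filter_upwards [hnhds] with r hr
      exact heq r hr
    refine ((hasDerivAt_ee_mul β x).mul h2).congr_deriv ?_
    simp only [f]
    ring
  have hy' := hy.mono hsub
  have hh' := hh.mono hsub
  have := intervalIntegral.integral_eq_sub_of_hasDerivAt_of_le ht.1 (by fun_prop) hderiv (by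
    refine ContinuousOn.intervalIntegrable ?_
    rw [uIcc_of_le ht.1]
    fun_prop)
  rw [this]
  simp

/-! ### Passage between the coefficient system and the Duhamel formula on a rescaled window -/

section Window

variable {L : ℝ} [hL : Fact (0 < L)] {s T g δ t₀ : ℝ} {u v : ℝ → L2 L} {p q : ZS}

/-- `p` and `q` represent `u` and `v` on the time interval `[t₀, t₀ + δ]`, rescaled to `[0, 1]`. -/
structure Window (s g δ t₀ : ℝ) (u v : ℝ → L2 L) (p q : ZS) : Prop where
  fst : ∀ r ∈ Icc (0 : ℝ) 1, ∀ k, tp p.1 k r =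
    ee (-(δ * dispersion L g k * r)) * wc s (u (t₀ + δ * r)) k
  snd : ∀ r ∈ Icc (0 : ℝ) 1, ∀ k, tp q.1 k r = coeff (v (t₀ + δ * r)) k

lemma Window.tsum_fst (h : Window s g δ t₀ u v p q)
    (hg : ∀ r ∈ Icc (0 : ℝ) 1, coeff (v (t₀ + δ * r)) 0 = g) (k : ℤ) {r : ℝ}
    (hr : r ∈ Icc (0 : ℝ) 1) :
    ∑' k₁, mul₁ L s δ k k₁ * ee (-ph₁ L δ g k k₁ * r) * (tp p.1 k₁ r * tp q.1 (k - k₁) r) =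
      ((bracket (freq L k) ^ s : ℝ) : ℂ) * ee (-(δ * dispersion L g k * r)) *
        (-(Complex.I * (δ * freq L k)) * (prodCoeff (u (t₀ + δ * r)) (v (t₀ + δ * r)) k -
          g * coeff (u (t₀ + δ * r)) k)) := by
  set f := u (t₀ + δ * r)
  set f' := v (t₀ + δ * r)
  -- Removing the term k₁ = k from the convolution subtracts g times the coefficient of u; this
  -- corresponds to the zero entry of `mul₁`.
  have h1 := (hasSum_prodCoeff f f' k).sub (hasSum_ite_eq k (coeff f k * coeff f' 0))
  rw [hg r hr, mul_comm _ (g : ℂ)] at h1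
  have h2 := h1.mul_left (((bracket (freq L k) ^ s : ℝ) : ℂ) *
    ee (-(δ * dispersion L g k * r)) * -(Complex.I * (δ * freq L k)))
  rw [← mul_assoc, ← h2.tsum_eq]
  refine tsum_congr fun k₁ => ?_
  rw [h.fst r hr, h.snd r hr]
  unfold mul₁
  split_ifs with hk
  · subst hk
    have h0 := hg r hr
    simp only [zero_mul, sub_self]
    rw [h0]
    ring
  · have e : ee (-ph₁ L δ g k k₁ * r) * ee (-(δ * dispersion L g k₁ * r)) =
        ee (-(δ * dispersion L g k * r)) := by
      rw [← ee_add]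
      congr 1
      unfold ph₁
      rw [dispersion_eq, dispersion_eq]
      ring
    have e2 : bracket (freq L k₁) ^ (-s) * bracket (freq L k₁) ^ s = 1 := by
      rw [← Real.rpow_add (bracket_pos _), neg_add_cancel, Real.rpow_zero]
    have e2' : ((bracket (freq L k₁) ^ (-s) : ℝ) : ℂ) * ((bracket (freq L k₁) ^ s : ℝ) : ℂ) = 1 := by
      exact_mod_cast e2
    rw [← e]
    unfold wc
    push_cast at e2' ⊢
    linear_combination (-Complex.I * δ * freq L k * ((bracket (freq L k) ^ s : ℝ) : ℂ) *
      ee (-ph₁ L δ g k k₁ * r) * ee (-(δ * dispersion L g k₁ * r)) * coeff f k₁ *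
      coeff f' (k - k₁)) * e2'

lemma Window.tsum_snd (h : Window s g δ t₀ u v p q) (k : ℤ) {r : ℝ} (hr : r ∈ Icc (0 : ℝ) 1) :
    ∑' k₁, mul₂ L s δ k k₁ * ee (-ph₂ L δ g k k₁ * r) * (tp p.1 k₁ r * tp p.1 (k - k₁) r) =
      δ * (-(Complex.I / 2 * freq L k) * prodCoeff (u (t₀ + δ * r)) (u (t₀ + δ * r)) k) := by
  set f := u (t₀ + δ * r)
  rw [← mul_assoc, ← ((hasSum_prodCoeff f f k).mul_left _).tsum_eq]
  refine tsum_congr fun k₁ => ?_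
  rw [h.fst r hr, h.fst r hr]
  have e : ee (-ph₂ L δ g k k₁ * r) * ee (-(δ * dispersion L g k₁ * r)) *
      ee (-(δ * dispersion L g (k - k₁) * r)) = 1 := by
    rw [← ee_add, ← ee_add, ← ee_zero]
    congr 1
    unfold ph₂
    rw [dispersion_eq, dispersion_eq]
    ring
  have e2 : ∀ k₁, ((bracket (freq L k₁) ^ (-s) : ℝ) : ℂ) *
      ((bracket (freq L k₁) ^ s : ℝ) : ℂ) = 1 := by
    intro k₁
    have e2 : bracket (freq L k₁) ^ (-s) * bracket (freq L k₁) ^ s = 1 := by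
      rw [← Real.rpow_add (bracket_pos _), neg_add_cancel, Real.rpow_zero]
    exact_mod_cast e2
  unfold mul₂ wc
  push_cast
  calc _ = δ * (-(Complex.I / 2 * freq L k)) * coeff f k₁ * coeff f (k - k₁) *
        (ee (-ph₂ L δ g k k₁ * r) * ee (-(δ * dispersion L g k₁ * r)) *
          ee (-(δ * dispersion L g (k - k₁) * r))) *
        (((bracket (freq L k₁) ^ (-s) : ℝ) : ℂ) * ((bracket (freq L k₁) ^ s : ℝ) : ℂ)) *
        (((bracket (freq L (k - k₁)) ^ (-s) : ℝ) : ℂ) *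
          ((bracket (freq L (k - k₁)) ^ s : ℝ) : ℂ))  := by ring
    _ = _ := by
      rw [e, e2, e2]
      ring

lemma integral_window {c : ℂ} {f : ℝ → ℂ} {Y : ℝ → ℂ} (hf : ContinuousOn f (Icc 0 T))
    (h : ∀ t ∈ Icc 0 T, Y t = c + ∫ r in (0 : ℝ)..t, f r) (h0 : 0 ≤ t₀) (hδ : 0 ≤ δ)
    (hT : t₀ + δ ≤ T) {t : ℝ} (ht : t ∈ Icc (0 : ℝ) 1) :
    Y (t₀ + δ * t) = Y t₀ + ∫ r in (0 : ℝ)..t, δ * f (t₀ + δ * r) := by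
  have h1 : 0 ≤ δ * t := mul_nonneg hδ ht.1
  have h2 : δ * t ≤ δ := mul_le_of_le_one_right hδ ht.2
  rw [h _ ⟨by linarith, by linarith⟩, h t₀ ⟨h0, by linarith⟩, intervalIntegral.integral_const_mul,
    ← Complex.real_smul, intervalIntegral.smul_integral_comp_add_mul, mul_zero, add_zero, add_assoc,
    intervalIntegral.integral_add_adjacent_intervals]
  · refine ContinuousOn.intervalIntegrable (hf.mono ?_)
    rw [uIcc_of_le h0]
    exact Icc_subset_Icc_right (by linarith)
  · refine ContinuousOn.intervalIntegrable (hf.mono ?_)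
    rw [uIcc_of_le (by linarith)]
    exact Icc_subset_Icc h0 (by linarith)

lemma mapsTo_window (h0 : 0 ≤ t₀) (hδ : 0 ≤ δ) (hT : t₀ + δ ≤ T) :
    MapsTo (fun r => t₀ + δ * r) (Icc (0 : ℝ) 1) (Icc 0 T) := by
  intro r hr
  have h1 : 0 ≤ δ * r := mul_nonneg hδ hr.1
  have h2 : δ * r ≤ δ := mul_le_of_le_one_right hδ hr.2
  exact ⟨by linarith, by linarith⟩

/-- Conservation of the mean of v: the nonlinear term is a derivative, and its symbol vanishes at k
= 0. -/
lemma FourierSol.coeff_zero (hF : FourierSol T u v) {t : ℝ} (ht : t ∈ Icc 0 T) :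
    coeff (v t) 0 = coeff (v 0) 0 := by
  have := hF.eq_v 0 t ht
  simpa using this

/-- Regroup iξ³û - iξ(uv)^ as iΩû - iξ((uv)^ - gû), then rotate by e^{-iδΩt}. The linear term
cancels, and the rest is the integrand of the bilinear operator. -/
lemma Window.duhamel_fst (h : Window s g δ t₀ u v p q) (hF : FourierSol T u v)
    (hu : ContinuousOn u (Icc 0 T)) (hv : ContinuousOn v (Icc 0 T)) (hg : coeff (v 0) 0 = g)
    (h0 : 0 ≤ t₀) (hδ : 0 ≤ δ) (hT : t₀ + δ ≤ T)
    (hm : ∀ k, ∃ M : ℝ, ∀ k₁, ‖mul₁ L s δ k k₁‖ ≤ M) (k : ℤ) {t : ℝ} (ht : t ∈ Icc (0 : ℝ) 1) :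
    tp p.1 k t = tp p.1 k 0 + tp (bilin (mul₁ L s δ) (ph₁ L δ g) p.1 q.1) k t := by
  have hmaps := mapsTo_window h0 hδ hT
  have hg' : ∀ r ∈ Icc (0 : ℝ) 1, coeff (v (t₀ + δ * r)) 0 = g := fun r hr => by
    rw [hF.coeff_zero (hmaps hr), hg]
  have hcu : ContinuousOn (fun r => u (t₀ + δ * r)) (Icc 0 1) :=
    hu.comp (by fun_prop) hmaps
  have hcv : ContinuousOn (fun r => v (t₀ + δ * r)) (Icc 0 1) :=
    hv.comp (by fun_prop) hmaps
  have hY : ContinuousOn (fun r => coeff (u (t₀ + δ * r)) k) (Icc 0 1) :=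
    (continuous_coeff k).comp_continuousOn hcu
  have hQ : ContinuousOn (fun r => prodCoeff (u (t₀ + δ * r)) (v (t₀ + δ * r)) k) (Icc 0 1) :=
    (continuous_prodCoeff k).comp_continuousOn (hcu.prodMk hcv)
  have hc1 : ContinuousOn (fun r => coeff (u r) k) (Icc 0 T) :=
    (continuous_coeff k).comp_continuousOn hu
  have hc2 : ContinuousOn (fun r => prodCoeff (u r) (v r) k) (Icc 0 T) :=
    (continuous_prodCoeff k).comp_continuousOn (hu.prodMk hv)
  have heq : ∀ t ∈ Icc (0 : ℝ) 1, coeff (u (t₀ + δ * t)) k = coeff (u (t₀ + δ * 0)) k +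
      ∫ r in (0 : ℝ)..t, (Complex.I * (δ * dispersion L g k : ℝ) * coeff (u (t₀ + δ * r)) k +
        -(Complex.I * (δ * freq L k)) * (prodCoeff (u (t₀ + δ * r)) (v (t₀ + δ * r)) k -
          g * coeff (u (t₀ + δ * r)) k)) := by
    intro t ht
    have := integral_window (Y := fun t => coeff (u t) k) (by fun_prop) (hF.eq_u k) h0 hδ hT ht
    rw [mul_zero, add_zero]
    refine this.trans ?_
    congr 2
    ext r
    unfold dispersion
    push_cast
    ring
  have htw := integral_twist (δ * dispersion L g k) (-(δ * dispersion L g k)) hY (by fun_prop)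
    heq ht
  rw [tp_bilin hm p q k ht]
  have hsum : ∫ r in (0 : ℝ)..t, ∑' k₁, mul₁ L s δ k k₁ * ee (-ph₁ L δ g k k₁ * r) *
      (tp p.1 k₁ r * tp q.1 (k - k₁) r) = ∫ r in (0 : ℝ)..t, ((bracket (freq L k) ^ s : ℝ) : ℂ) *
        (ee (-(δ * dispersion L g k) * r) * (Complex.I *
          ((δ * dispersion L g k : ℝ) + (-(δ * dispersion L g k) : ℝ)) *
            coeff (u (t₀ + δ * r)) k +
          -(Complex.I * (δ * freq L k)) * (prodCoeff (u (t₀ + δ * r)) (v (t₀ + δ * r)) k -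
          g * coeff (u (t₀ + δ * r)) k))) := by
    refine intervalIntegral.integral_congr fun r hr => ?_
    rw [uIcc_of_le ht.1] at hr
    rw [h.tsum_fst hg' k ⟨hr.1, hr.2.trans ht.2⟩, neg_mul]
    push_cast
    ring_nf
  rw [hsum, intervalIntegral.integral_const_mul, h.fst t ht, h.fst 0 ⟨le_rfl, zero_le_one⟩]
  unfold wc
  rw [neg_mul] at htw
  simp only [mul_zero, neg_zero, ee_zero, add_zero] at htw ⊢
  linear_combination ((bracket (freq L k) ^ s : ℝ) : ℂ) * htw

lemma Window.duhamel_snd (h : Window s g δ t₀ u v p q) (hF : FourierSol T u v)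
    (hu : ContinuousOn u (Icc 0 T)) (h0 : 0 ≤ t₀) (hδ : 0 ≤ δ) (hT : t₀ + δ ≤ T)
    (hm : ∀ k, ∃ M : ℝ, ∀ k₁, ‖mul₂ L s δ k k₁‖ ≤ M) (k : ℤ) {t : ℝ} (ht : t ∈ Icc (0 : ℝ) 1) :
    tp q.1 k t = tp q.1 k 0 + tp (bilin (mul₂ L s δ) (ph₂ L δ g) p.1 p.1) k t := by
  have hc2 : ContinuousOn (fun r => prodCoeff (u r) (u r) k) (Icc 0 T) :=
    (continuous_prodCoeff k).comp_continuousOn (hu.prodMk hu)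
  have := integral_window (Y := fun t => coeff (v t) k) (by fun_prop) (hF.eq_v k) h0 hδ hT ht
  rw [tp_bilin hm p p k ht, h.snd t ht, h.snd 0 ⟨le_rfl, zero_le_one⟩, mul_zero, add_zero]
  refine this.trans ?_
  congr 1
  refine intervalIntegral.integral_congr fun r hr => ?_
  rw [uIcc_of_le ht.1] at hr
  rw [h.tsum_snd k ⟨hr.1, hr.2.trans ht.2⟩]

lemma integral_unscale {f : ℝ → ℂ} {Y : ℝ → ℂ} (hT : 0 < T)
    (h : ∀ t ∈ Icc (0 : ℝ) 1, Y (0 + T * t) = Y 0 + ∫ r in (0 : ℝ)..t, T * f (0 + T * r)) {t : ℝ}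
    (ht : t ∈ Icc 0 T) : Y t = Y 0 + ∫ r in (0 : ℝ)..t, f r := by
  have h1 := h (t / T) ⟨div_nonneg ht.1 hT.le, (div_le_one hT).2 ht.2⟩
  rw [intervalIntegral.integral_const_mul, ← Complex.real_smul,
    intervalIntegral.smul_integral_comp_add_mul, mul_div_cancel₀ _ hT.ne', mul_zero, zero_add,
    zero_add] at h1
  exact h1

lemma Window.fourierSol (h : Window s g T 0 u v p q) (hT : 0 < T)
    (hu : ContinuousOn u (Icc 0 T)) (hv : ContinuousOn v (Icc 0 T))
    (hg : ∀ r ∈ Icc (0 : ℝ) 1, coeff (v (0 + T * r)) 0 = g)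
    (hm₁ : ∀ k, ∃ M : ℝ, ∀ k₁, ‖mul₁ L s T k k₁‖ ≤ M)
    (hm₂ : ∀ k, ∃ M : ℝ, ∀ k₁, ‖mul₂ L s T k k₁‖ ≤ M)
    (h₁ : ∀ k, ∀ t ∈ Icc (0 : ℝ) 1,
      tp p.1 k t = tp p.1 k 0 + tp (bilin (mul₁ L s T) (ph₁ L T g) p.1 q.1) k t)
    (h₂ : ∀ k, ∀ t ∈ Icc (0 : ℝ) 1,
      tp q.1 k t = tp q.1 k 0 + tp (bilin (mul₂ L s T) (ph₂ L T g) p.1 p.1) k t) :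
    FourierSol T u v := by
  have h01 : (0 : ℝ) ∈ Icc (0 : ℝ) 1 := ⟨le_rfl, zero_le_one⟩
  have hmaps := mapsTo_window (T := T) le_rfl hT.le (zero_add T).le
  have hcu : ContinuousOn (fun r => u (0 + T * r)) (Icc 0 1) := hu.comp (by fun_prop) hmaps
  have hcv : ContinuousOn (fun r => v (0 + T * r)) (Icc 0 1) := hv.comp (by fun_prop) hmaps
  constructor
  · intro k t ht
    refine integral_unscale (Y := fun t => coeff (u t) k) hT (fun t ht => ?_) ht
    have hY : ContinuousOn (fun r => coeff (u (0 + T * r)) k) (Icc 0 1) :=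
      (continuous_coeff k).comp_continuousOn hcu
    have hQ : ContinuousOn (fun r => prodCoeff (u (0 + T * r)) (v (0 + T * r)) k) (Icc 0 1) :=
      (continuous_prodCoeff k).comp_continuousOn (hcu.prodMk hcv)
    have heq : ∀ t ∈ Icc (0 : ℝ) 1,
        ee (-(T * dispersion L g k) * t) * coeff (u (0 + T * t)) k =
        ee (-(T * dispersion L g k) * 0) * coeff (u (0 + T * 0)) k + ∫ r in (0 : ℝ)..t,
          (Complex.I * (0 : ℝ) * (ee (-(T * dispersion L g k) * r) * coeff (u (0 + T * r)) k) +
          ee (-(T * dispersion L g k) * r) * (-(Complex.I * (T * freq L k)) *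
            (prodCoeff (u (0 + T * r)) (v (0 + T * r)) k - g * coeff (u (0 + T * r)) k))) := by
      intro t ht
      have h3 := h₁ k t ht
      rw [tp_bilin hm₁ p q k ht, h.fst t ht, h.fst 0 h01] at h3
      have hsum : ∫ r in (0 : ℝ)..t, ∑' k₁, mul₁ L s T k k₁ * ee (-ph₁ L T g k k₁ * r) *
          (tp p.1 k₁ r * tp q.1 (k - k₁) r) =
          ∫ r in (0 : ℝ)..t, ((bracket (freq L k) ^ s : ℝ) : ℂ) *
          (Complex.I * (0 : ℝ) * (ee (-(T * dispersion L g k) * r) * coeff (u (0 + T * r)) k) +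
          ee (-(T * dispersion L g k) * r) * (-(Complex.I * (T * freq L k)) *
            (prodCoeff (u (0 + T * r)) (v (0 + T * r)) k - g * coeff (u (0 + T * r)) k))) := by
        refine intervalIntegral.integral_congr fun r hr => ?_
        rw [uIcc_of_le ht.1] at hr
        rw [h.tsum_fst hg k ⟨hr.1, hr.2.trans ht.2⟩, neg_mul]
        push_cast
        ring_nf
      rw [hsum, intervalIntegral.integral_const_mul] at h3
      unfold wc at h3
      rw [neg_mul, neg_mul]
      refine mul_left_cancel₀ (weight_ne_zero (L := L) s k) ?_
      linear_combination h3
    -- Undo the rotation: the rotated coefficient satisfies an equation without linear term, and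
    -- twisting back with α = 0 restores it.
    have htw := integral_twist (h := fun r => ee (-(T * dispersion L g k) * r) *
      (-(Complex.I * (T * freq L k)) *
        (prodCoeff (u (0 + T * r)) (v (0 + T * r)) k - g * coeff (u (0 + T * r)) k))) 0
      (T * dispersion L g k) (by fun_prop) (by fun_prop) heq ht
    have hcancel : ∀ r, ee (T * dispersion L g k * r) * ee (-(T * dispersion L g k) * r) = 1 := by
      intro r
      rw [neg_mul, mul_comm, ee_neg_mul_ee]
    rw [← mul_assoc, hcancel, one_mul] at htw
    refine htw.trans ?_
    simp only [mul_zero, ee_zero, one_mul, add_zero]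
    congr 2
    ext r
    have := hcancel r
    unfold dispersion at this ⊢
    push_cast
    linear_combination (Complex.I * T * (freq L k ^ 3 - g * freq L k) * coeff (u (0 + T * r)) k -
      Complex.I * T * freq L k * (prodCoeff (u (0 + T * r)) (v (0 + T * r)) k -
        g * coeff (u (0 + T * r)) k)) * this
  · intro k t ht
    refine integral_unscale (Y := fun t => coeff (v t) k) hT (fun t ht => ?_) ht
    have h3 := h₂ k t ht
    rw [tp_bilin hm₂ p p k ht, h.snd t ht, h.snd 0 h01, mul_zero, add_zero] at h3
    refine h3.trans ?_
    congr 1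
    refine intervalIntegral.integral_congr fun r hr => ?_
    rw [uIcc_of_le ht.1] at hr
    rw [h.tsum_snd k ⟨hr.1, hr.2.trans ht.2⟩]

end Window

/-! ### Uniqueness -/

/-- Multiplication by phases in the space `ZS`. -/
def ZS.phase (θ : ℤ → ℝ) (p : ZS) : ZS where
  val := fun k σ => ee (θ k) * p.1 k σ
  meas := fun k => by
    have := p.meas k
    fun_prop
  lt_top := lt_of_le_of_lt (zn_le_of_enorm_le fun k σ => by simp [enorm_mul]) p.lt_top

lemma ZS.norm_phase_le (θ : ℤ → ℝ) (p : ZS) : ‖p.phase θ‖ ≤ ‖p‖ := by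
  rw [ZS.norm_def, ZS.norm_def]
  exact ENNReal.toReal_mono p.lt_top.ne
    (zn_le_of_enorm_le fun k σ => by simp [ZS.phase, enorm_mul])

lemma tp_phase (θ : ℤ → ℝ) (p : ZS) (k : ℤ) (t : ℝ) :
    tp (p.phase θ).1 k t = ee (θ k) * tp p.1 k t := by
  unfold tp
  rw [← integral_const_mul]
  congr 1
  ext σ
  simp only [ZS.phase]
  ring

lemma norm_tp_le (p : ZS) (k : ℤ) (t : ℝ) : ‖tp p.1 k t‖ ≤ ‖p‖ := by
  have h1 : ‖tp p.1 k t‖ₑ ^ 2 ≤ zn p.1 ^ 2 :=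
    ((ENNReal.le_tsum (f := fun k => ‖tp p.1 k t‖ₑ ^ 2) k).trans (tsum_enorm_tp_sq_le p.1 t)).trans
      (sqX1_le_zn_sq p.1)
  have h2 := le_of_sq_le h1
  rw [ZS.zn_eq, ← ofReal_norm] at h2
  exact (ENNReal.ofReal_le_ofReal_iff (norm_nonneg _)).1 h2

lemma tp_bilin_congr {m : ℤ → ℤ → ℂ} {φ : ℤ → ℤ → ℝ} (hm : ∀ k, ∃ M : ℝ, ∀ k₁, ‖m k k₁‖ ≤ M)
    {p q p' q' : ZS} (hp : ∀ k, ∀ r ∈ Icc (0 : ℝ) 1, tp p.1 k r = tp p'.1 k r)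
    (hq : ∀ k, ∀ r ∈ Icc (0 : ℝ) 1, tp q.1 k r = tp q'.1 k r) (k : ℤ) {t : ℝ}
    (ht : t ∈ Icc (0 : ℝ) 1) :
    tp (bilin m φ p.1 q.1) k t = tp (bilin m φ p'.1 q'.1) k t := by
  rw [tp_bilin hm p q k ht, tp_bilin hm p' q' k ht]
  refine intervalIntegral.integral_congr fun r hr => ?_
  rw [uIcc_of_le ht.1] at hr
  have hr' : r ∈ Icc (0 : ℝ) 1 := ⟨hr.1, hr.2.trans ht.2⟩
  refine tsum_congr fun k₁ => ?_
  rw [hp k₁ r hr', hq (k - k₁) r hr']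

section Uniqueness

variable {m₁ m₂ : ℤ → ℤ → ℂ} {φ₁ φ₂ : ℤ → ℤ → ℝ} {S : ℝ}

lemma tp_bilin_diff {m : ℤ → ℤ → ℂ} {φ : ℤ → ℤ → ℝ} (hS : 0 ≤ S)
    (h : Admissible m φ (ENNReal.ofReal S)) {p q p' q' d e : ZS}
    (hd : ∀ k, ∀ r ∈ Icc (0 : ℝ) 1, tp d.1 k r = tp p.1 k r - tp p'.1 k r)
    (he : ∀ k, ∀ r ∈ Icc (0 : ℝ) 1, tp e.1 k r = tp q.1 k r - tp q'.1 k r) (k : ℤ) {t : ℝ}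
    (ht : t ∈ Icc (0 : ℝ) 1) :
    tp (ZS.bilin m φ d q + ZS.bilin m φ p' e).1 k t =
      tp (bilin m φ p.1 q.1) k t - tp (bilin m φ p'.1 q'.1) k t := by
  have h1 : tp (ZS.bilin m φ d q).1 k t = tp (ZS.bilin m φ (p - p') q).1 k t := by
    rw [ZS.coe_bilin hS h, ZS.coe_bilin hS h]
    refine tp_bilin_congr h.bdd (fun k r hr => ?_) (fun _ _ _ => rfl) k ht
    rw [hd k r hr, tp_sub]
  have h2 : tp (ZS.bilin m φ p' e).1 k t = tp (ZS.bilin m φ p' (q - q')).1 k t := by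
    rw [ZS.coe_bilin hS h, ZS.coe_bilin hS h]
    refine tp_bilin_congr h.bdd (fun _ _ _ => rfl) (fun k r hr => ?_) k ht
    rw [he k r hr, tp_sub]
  rw [tp_add, h1, h2, ZS.bilin_sub_left hS h, ZS.bilin_sub_right hS h, tp_sub, tp_sub,
    ZS.coe_bilin hS h, ZS.coe_bilin hS h, ZS.coe_bilin hS h]
  ring

/-- Two solutions of the Duhamel formula with the same initial values agree. -/
lemma tp_eq_of_duhamel (hS : 0 ≤ S) (h₁ : Admissible m₁ φ₁ (ENNReal.ofReal S))
    (h₂ : Admissible m₂ φ₂ (ENNReal.ofReal S)) {z z' : ZS × ZS} {M : ℝ} (hz : ‖z‖ ≤ M)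
    (hz' : ‖z'‖ ≤ M) (hM : 4 * (bilinNorm S * M) ≤ 1)
    (e₁ : ∀ k, ∀ t ∈ Icc (0 : ℝ) 1,
      tp z.1.1 k t = tp z.1.1 k 0 + tp (bilin m₁ φ₁ z.1.1 z.2.1) k t)
    (e₂ : ∀ k, ∀ t ∈ Icc (0 : ℝ) 1,
      tp z.2.1 k t = tp z.2.1 k 0 + tp (bilin m₂ φ₂ z.1.1 z.1.1) k t)
    (e₁' : ∀ k, ∀ t ∈ Icc (0 : ℝ) 1,
      tp z'.1.1 k t = tp z'.1.1 k 0 + tp (bilin m₁ φ₁ z'.1.1 z'.2.1) k t)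
    (e₂' : ∀ k, ∀ t ∈ Icc (0 : ℝ) 1,
      tp z'.2.1 k t = tp z'.2.1 k 0 + tp (bilin m₂ φ₂ z'.1.1 z'.1.1) k t)
    (i₁ : ∀ k, tp z.1.1 k 0 = tp z'.1.1 k 0) (i₂ : ∀ k, tp z.2.1 k 0 = tp z'.2.1 k 0)
    (k : ℤ) {t : ℝ} (ht : t ∈ Icc (0 : ℝ) 1) :
    tp z.1.1 k t = tp z'.1.1 k t ∧ tp z.2.1 k t = tp z'.2.1 k t := by
  have hκ := bilinNorm_nonneg hS
  have hB := bddBiadditive_sysB hS h₁ h₂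
  -- The formulas hold only at times in [0, 1], not as identities in `ZS`. So the difference is
  -- represented there by extensions X of ever smaller norm: inserting X into the difference of the
  -- quadratic terms gives another extension of the same difference with half the norm. Values on
  -- [0, 1] are bounded by the norm of any extension.
  have key : ∀ n : ℕ, ∃ X : ZS × ZS, ‖X‖ ≤ (1 / 2) ^ n * ‖z - z'‖ ∧
      (∀ k, ∀ r ∈ Icc (0 : ℝ) 1, tp X.1.1 k r = tp z.1.1 k r - tp z'.1.1 k r) ∧
      ∀ k, ∀ r ∈ Icc (0 : ℝ) 1, tp X.2.1 k r = tp z.2.1 k r - tp z'.2.1 k r := by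
    intro n
    induction n with
    | zero =>
      refine ⟨z - z', by simp, fun k r _ => tp_sub _ _ k r, fun k r _ => tp_sub _ _ k r⟩
    | succ n ih =>
      obtain ⟨X, hX, hX₁, hX₂⟩ := ih
      refine ⟨sysB m₁ m₂ φ₁ φ₂ X z + sysB m₁ m₂ φ₁ φ₂ z' X, ?_, fun k r hr => ?_, fun k r hr => ?_⟩
      · calc _ ≤ _ := norm_add_le _ _
          _ ≤ bilinNorm S * (‖X‖ * ‖z‖) + bilinNorm S * (‖z'‖ * ‖X‖) :=
              add_le_add (hB.bound _ _) (hB.bound _ _)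
          _ ≤ bilinNorm S * (‖X‖ * M) + bilinNorm S * (M * ‖X‖) := by gcongr
          _ = 2 * (bilinNorm S * M) * ‖X‖ := by ring
          _ ≤ 1 / 2 * ‖X‖ := by gcongr; linarith
          _ ≤ 1 / 2 * ((1 / 2) ^ n * ‖z - z'‖) := by gcongr
          _ = _ := by ring
      · refine (tp_bilin_diff hS h₁ hX₁ hX₂ k hr).trans ?_
        rw [e₁ k r hr, e₁' k r hr, i₁]
        ring
      · refine (tp_bilin_diff hS h₂ hX₁ hX₁ k hr).trans ?_
        rw [e₂ k r hr, e₂' k r hr, i₂]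
        ring
  have hlim : Tendsto (fun n : ℕ => (1 / 2 : ℝ) ^ n * ‖z - z'‖) atTop (𝓝 0) := by
    have := (tendsto_pow_atTop_nhds_zero_of_lt_one (r := (1 / 2 : ℝ)) (by norm_num)
      (by norm_num)).mul_const ‖z - z'‖
    rwa [zero_mul] at this
  constructor
  · rw [← sub_eq_zero, ← norm_le_zero_iff]
    refine ge_of_tendsto hlim (Eventually.of_forall fun n => ?_)
    obtain ⟨X, hX, hX₁, hX₂⟩ := key n
    rw [← hX₁ k t ht]
    exact (norm_tp_le _ _ _).trans ((norm_fst_le X).trans hX)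
  · rw [← sub_eq_zero, ← norm_le_zero_iff]
    refine ge_of_tendsto hlim (Eventually.of_forall fun n => ?_)
    obtain ⟨X, hX, hX₁, hX₂⟩ := key n
    rw [← hX₂ k t ht]
    exact (norm_tp_le _ _ _).trans ((norm_snd_le X).trans hX)

end Uniqueness

lemma exists_small_bilinNorm {K : ℝ} (A : ℝ) :
    ∃ T₀ : ℝ, 0 < T₀ ∧ T₀ ≤ 1 ∧ ∀ T, 0 < T → T ≤ T₀ →
      A * bilinNorm (K * T ^ (2 / 5 : ℝ)) ≤ 1 := by
  have hc : ContinuousAt (fun T : ℝ => A * bilinNorm (K * T ^ (2 / 5 : ℝ))) 0 := by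
    unfold bilinNorm
    have h1 : ContinuousAt (fun T : ℝ => T ^ (2 / 5 : ℝ)) 0 :=
      Real.continuousAt_rpow_const _ _ (Or.inr (by norm_num))
    have h2 : ContinuousAt (fun T : ℝ => (bilinC.toReal * (K * T ^ (2 / 5 : ℝ))) ^ (1 / 2 : ℝ)) 0 :=
      ContinuousAt.rpow_const (by fun_prop) (Or.inr (by norm_num))
    fun_prop
  have h0 : A * bilinNorm (K * (0 : ℝ) ^ (2 / 5 : ℝ)) < 1 := by
    unfold bilinNorm
    rw [Real.zero_rpow (by norm_num), mul_zero, mul_zero, Real.zero_rpow (by norm_num)]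
    norm_num
  obtain ⟨ε, hε, h⟩ := Metric.eventually_nhds_iff.1 (hc.eventually (gt_mem_nhds h0))
  refine ⟨min (ε / 2) 1, by positivity, min_le_right _ _, fun T hT hT' => (h ?_).le⟩
  rw [Real.dist_eq, sub_zero, abs_of_pos hT]
  exact (hT'.trans (min_le_left _ _)).trans_lt (by linarith)

/-! ### Uniqueness in Y by induction over short time windows -/

section UniqueSol

variable {L : ℝ} [hL : Fact (0 < L)] {s T g : ℝ} {u v u' v' : ℝ → L2 L}

/-- In the window the oscillation is removed relative to time t₀ instead of 0. The phase factor
e^{iΩt₀} makes up for this without changing the modulus. -/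
lemma IsRep.window {P Q : ZS} (hP : IsRep s (dispersion L g) (Icc 0 T) u P)
    (hQ : IsRep 0 (fun _ => 0) (Icc 0 T) v Q) {δ t₀ : ℝ} (h0 : 0 ≤ t₀) (hδ : 0 < δ)
    (hT : t₀ + δ ≤ T) :
    Window s g δ t₀ u v ((P.loc hδ t₀).phase fun k => dispersion L g k * t₀) (Q.loc hδ t₀) where
  fst r hr k := by
    rw [tp_phase, tp_loc hδ t₀ P k hr, hP _ (mapsTo_window h0 hδ.le hT hr), ← mul_assoc, ← ee_add]
    congr 2
    ring
  snd r hr k := by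
    rw [tp_loc hδ t₀ Q k hr, hQ _ (mapsTo_window h0 hδ.le hT hr), wc_zero]
    simp

lemma eq_of_wc_eq {f f' : L2 L} (h : ∀ k, wc s f k = wc s f' k) : f = f' := by
  refine eq_of_coeff_eq fun k => ?_
  exact mul_left_cancel₀ (weight_ne_zero (L := L) s k) (h k)

/-- Solutions in `Y` are unique. -/
lemma solution_unique (hs₀ : 0 ≤ s) (hs₁ : s ≤ 1 / 2) (hT : 0 < T) (hT1 : T ≤ 1)
    (hF : FourierSol T u v) (hF' : FourierSol T u' v') (hu0 : u 0 = u' 0) (hv0 : v 0 = v' 0)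
    (hg : coeff (v 0) 0 = g) (hY : YNorm s g (Icc 0 T) u v < ⊤)
    (hY' : YNorm s g (Icc 0 T) u' v' < ⊤) :
    EqOn u u' (Icc 0 T) ∧ EqOn v v' (Icc 0 T) := by
  obtain ⟨hcu, hcv⟩ := embedding_Y hY
  obtain ⟨hcu', hcv'⟩ := embedding_Y hY'
  replace hcu := hcu.continuousOn hs₀
  replace hcu' := hcu'.continuousOn hs₀
  obtain ⟨⟨P, hP⟩, Q, hQ⟩ := YNorm_lt_top_iff.1 hY
  obtain ⟨⟨P', hP'⟩, Q', hQ'⟩ := YNorm_lt_top_iff.1 hY'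
  obtain ⟨K, hK, hadm⟩ := exists_admissible hL.out hs₀ hs₁ (abs_nonneg g)
  set C := 2 * (locC ^ (1 / 2 : ℝ)).toReal
  have hC : 0 ≤ C := by positivity
  -- A common bound for the localizations of both solutions to all windows. The step size T₀ is
  -- chosen after it, so no smallness of the solutions is assumed.
  set M := C * (‖P‖ + ‖Q‖ + ‖P'‖ + ‖Q'‖)
  have hM : 0 ≤ M := by positivity
  obtain ⟨T₀, hT₀, -, hsmall⟩ := exists_small_bilinNorm (K := K) (4 * M)
  have hPM : ‖P‖ ≤ ‖P‖ + ‖Q‖ + ‖P'‖ + ‖Q'‖ := by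
    linarith [norm_nonneg Q, norm_nonneg P', norm_nonneg Q']
  have hQM : ‖Q‖ ≤ ‖P‖ + ‖Q‖ + ‖P'‖ + ‖Q'‖ := by
    linarith [norm_nonneg P, norm_nonneg P', norm_nonneg Q']
  have hPM' : ‖P'‖ ≤ ‖P‖ + ‖Q‖ + ‖P'‖ + ‖Q'‖ := by
    linarith [norm_nonneg Q, norm_nonneg P, norm_nonneg Q']
  have hQM' : ‖Q'‖ ≤ ‖P‖ + ‖Q‖ + ‖P'‖ + ‖Q'‖ := by
    linarith [norm_nonneg Q, norm_nonneg P', norm_nonneg P]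
  have h01 : (0 : ℝ) ∈ Icc (0 : ℝ) 1 := ⟨le_rfl, zero_le_one⟩
  have step : ∀ δ t₀ : ℝ, 0 < δ → δ ≤ T₀ → 0 ≤ t₀ → t₀ + δ ≤ T → u t₀ = u' t₀ → v t₀ = v' t₀ →
      ∀ t ∈ Icc t₀ (t₀ + δ), u t = u' t ∧ v t = v' t := by
    intro δ t₀ hδ hδ₀ h0 hδT hu hv t ht
    have hδ1 : δ ≤ 1 := by linarith
    have W := hP.window hQ h0 hδ hδT
    have W' := hP'.window hQ' h0 hδ hδT
    set θ : ℤ → ℝ := fun k => dispersion L g k * t₀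
    obtain ⟨h₁, h₂⟩ := hadm δ g hδ hδ1 le_rfl
    have hS : 0 ≤ K * δ ^ (2 / 5 : ℝ) := by positivity
    have hbound : ∀ (P Q : ZS) (A : ℝ), ‖P‖ ≤ A → ‖Q‖ ≤ A →
        ‖(((P.loc hδ t₀).phase θ, Q.loc hδ t₀) : ZS × ZS)‖ ≤ C * A := by
      intro P Q A hPA hQA
      refine norm_prod_le_iff.2 ⟨?_, ?_⟩
      · refine (ZS.norm_phase_le _ _).trans ((ZS.norm_loc_le hδ t₀ P).trans ?_)
        gcongr
      · refine (ZS.norm_loc_le hδ t₀ Q).trans ?_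
        gcongr
    have hr : (t - t₀) / δ ∈ Icc (0 : ℝ) 1 :=
      ⟨div_nonneg (by linarith [ht.1]) hδ.le, (div_le_one hδ).2 (by linarith [ht.2])⟩
    have hreq : t₀ + δ * ((t - t₀) / δ) = t := by
      rw [mul_div_cancel₀ _ hδ.ne']
      ring
    have hg' : coeff (v' 0) 0 = g := by rw [← hv0, hg]
    have heq := fun k => tp_eq_of_duhamel hS h₁ h₂
      (z := ((P.loc hδ t₀).phase θ, Q.loc hδ t₀))
      (z' := ((P'.loc hδ t₀).phase θ, Q'.loc hδ t₀)) (M := M)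
      (hbound P Q _ hPM hQM) (hbound P' Q' _ hPM' hQM')
      (by linarith [hsmall δ hδ hδ₀])
      (fun k t ht => W.duhamel_fst hF hcu hcv hg h0 hδ.le hδT h₁.bdd k ht)
      (fun k t ht => W.duhamel_snd hF hcu h0 hδ.le hδT h₂.bdd k ht)
      (fun k t ht => W'.duhamel_fst hF' hcu' hcv' hg' h0 hδ.le hδT h₁.bdd k ht)
      (fun k t ht => W'.duhamel_snd hF' hcu' h0 hδ.le hδT h₂.bdd k ht)
      (fun k => by
        rw [W.fst 0 h01, W'.fst 0 h01, mul_zero, mul_zero, add_zero, hu])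
      (fun k => by
        rw [W.snd 0 h01, W'.snd 0 h01, mul_zero, add_zero, hv]) k hr
    constructor
    · refine eq_of_wc_eq (s := s) fun k => ?_
      have h3 := (heq k).1
      rw [W.fst _ hr, W'.fst _ hr, hreq] at h3
      refine mul_left_cancel₀ ?_ h3
      rw [← norm_ne_zero_iff, norm_ee]
      exact one_ne_zero
    · refine eq_of_coeff_eq fun k => ?_
      have h3 := (heq k).2
      rwa [W.snd _ hr, W'.snd _ hr, hreq] at h3
  -- Equal windows of length T/N ≤ T₀ cover [0, T]; agreement is passed on from each window to the
  -- next.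
  obtain ⟨N, hN⟩ := exists_nat_ge (T / T₀)
  have hN0 : (0 : ℝ) < N := lt_of_lt_of_le (by positivity) hN
  set δ := T / N
  have hδ : 0 < δ := by positivity
  have hδ₀ : δ ≤ T₀ := by
    rw [div_le_iff₀ hN0]
    rw [div_le_iff₀ hT₀] at hN
    linarith
  have hNδ : N * δ = T := mul_div_cancel₀ T hN0.ne'
  have main : ∀ n : ℕ, n ≤ N → ∀ t ∈ Icc 0 (n * δ), u t = u' t ∧ v t = v' t := by
    intro n
    induction n with
    | zero =>
      intro _ t ht
      have : t = 0 := by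
        have := ht.2
        simp only [Nat.cast_zero, zero_mul] at this
        exact le_antisymm this ht.1
      rw [this]
      exact ⟨hu0, hv0⟩
    | succ n ih =>
      intro hn t ht
      have ih' := ih (by omega)
      rcases le_total t (n * δ) with h | h
      · exact ih' t ⟨ht.1, h⟩
      · have hnδ : (0 : ℝ) ≤ n * δ := by positivity
        have h3 := ih' (n * δ) ⟨hnδ, le_rfl⟩
        have h4 : (n : ℝ) * δ + δ ≤ T := by
          rw [← hNδ]
          have : ((n : ℝ) + 1) ≤ N := by exact_mod_cast hn
          nlinarith
        refine step δ (n * δ) hδ hδ₀ hnδ h4 h3.1 h3.2 t ⟨h, ?_⟩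
        have := ht.2
        push_cast at this
        linarith
  have := main N le_rfl
  rw [hNδ] at this
  exact ⟨fun t ht => (this t ht).1, fun t ht => (this t ht).2⟩

end UniqueSol

/-! ### Existence -/

lemma ZS.refl_sub (p q : ZS) : (p - q).refl = p.refl - q.refl := by
  ext k σ
  simp [ZS.refl, DSW.refl]

lemma ZS.refl_add (p q : ZS) : (p + q).refl = p.refl + q.refl := by
  ext k σ
  simp [ZS.refl, DSW.refl]

lemma ZS.refl_lin {c : ℤ → ℂ} (hc : sql2 c < ⊤) (h : ∀ k, c (-k) = (starRingEnd ℂ) (c k)) :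
    (ZS.lin c).refl = ZS.lin c := by
  ext k σ
  simp only [ZS.refl, ZS.coe_lin hc, DSW.refl, linP]
  rw [map_mul, h, Complex.conj_conj, isCutoff.refl, Complex.conj_conj]

lemma ZS.refl_bilin {m : ℤ → ℤ → ℂ} {φ : ℤ → ℤ → ℝ} {S : ℝ} (hS : 0 ≤ S)
    (h : Admissible m φ (ENNReal.ofReal S))
    (hm : ∀ k k₁, m (-k) (-k₁) = (starRingEnd ℂ) (m k k₁))
    (hφ : ∀ k k₁, φ (-k) (-k₁) = -φ k k₁) (p q : ZS) :
    (ZS.bilin m φ p q).refl = ZS.bilin m φ p.refl q.refl := by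
  ext1
  rw [ZS.coe_bilin hS h]
  simp only [ZS.refl, ZS.coe_bilin hS h]
  rw [bilin_refl hm hφ]

lemma mul₁_refl (L s T : ℝ) (k k₁ : ℤ) :
    mul₁ L s T (-k) (-k₁) = (starRingEnd ℂ) (mul₁ L s T k k₁) := by
  unfold mul₁
  simp only [neg_inj, freq_neg, bracket_neg]
  split_ifs
  · simp
  · simp only [map_mul, map_neg, Complex.conj_I, Complex.conj_ofReal]
    push_cast
    ring

lemma mul₂_refl (L s T : ℝ) (k k₁ : ℤ) :
    mul₂ L s T (-k) (-k₁) = (starRingEnd ℂ) (mul₂ L s T k k₁) := by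
  unfold mul₂
  rw [show -k - -k₁ = -(k - k₁) by ring]
  simp only [freq_neg, bracket_neg, map_mul, map_neg, map_div₀, Complex.conj_I, Complex.conj_ofReal,
    map_ofNat]
  push_cast
  ring

lemma ph₁_refl (L T g : ℝ) (k k₁ : ℤ) : ph₁ L T g (-k) (-k₁) = -ph₁ L T g k k₁ := by
  unfold ph₁
  rw [freq_neg, freq_neg, Om_neg, Om_neg]
  ring

lemma ph₂_refl (L T g : ℝ) (k k₁ : ℤ) : ph₂ L T g (-k) (-k₁) = -ph₂ L T g k k₁ := by
  unfold ph₂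
  rw [show -k - -k₁ = -(k - k₁) by ring, freq_neg, freq_neg, Om_neg, Om_neg]
  ring

/-- The quadratic part of the Duhamel formula for the system on the time interval `[0, T]`. -/
def dswB (L s T g : ℝ) : ZS × ZS → ZS × ZS → ZS × ZS :=
  sysB (mul₁ L s T) (mul₂ L s T) (ph₁ L T g) (ph₂ L T g)

/-- The reflected pair solves the same equation, since data, multipliers and phases have the
symmetry of real functions, and it has the same norm. Uniqueness in the ball identifies the two. -/
lemma sub_refl_eq_zero {L s T g ρ S : ℝ} {c₁ c₂ : ℤ → ℂ} (hS : 0 ≤ S)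
    (h₁ : Admissible (mul₁ L s T) (ph₁ L T g) (ENNReal.ofReal S))
    (h₂ : Admissible (mul₂ L s T) (ph₂ L T g) (ENNReal.ofReal S))
    (hρ : 4 * (bilinNorm S * ρ) ≤ 1) (hc₁ : sql2 c₁ < ⊤) (hc₂ : sql2 c₂ < ⊤)
    (hc₁' : ∀ k, c₁ (-k) = (starRingEnd ℂ) (c₁ k)) (hc₂' : ∀ k, c₂ (-k) = (starRingEnd ℂ) (c₂ k))
    {z : ZS × ZS} (hz : ‖z‖ ≤ ρ)
    (heq : ‖z - ((ZS.lin c₁, ZS.lin c₂) + dswB L s T g z z)‖ = 0) :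
    ‖z.1 - z.1.refl‖ = 0 ∧ ‖z.2 - z.2.refl‖ = 0 := by
  have hrz : ‖((z.1.refl, z.2.refl) : ZS × ZS)‖ = ‖z‖ := by
    rw [Prod.norm_def, Prod.norm_def, ZS.norm_refl, ZS.norm_refl]
  have heq' : ‖((z.1.refl, z.2.refl) : ZS × ZS) - ((ZS.lin c₁, ZS.lin c₂) +
      dswB L s T g (z.1.refl, z.2.refl) (z.1.refl, z.2.refl))‖ = 0 := by
    rw [← heq, Prod.norm_def, Prod.norm_def]
    simp only [dswB, sysB, Prod.fst_sub, Prod.fst_add, Prod.snd_sub, Prod.snd_add]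
    congr 1
    · conv_rhs => rw [← ZS.norm_refl, ZS.refl_sub, ZS.refl_add, ZS.refl_lin hc₁ hc₁',
        ZS.refl_bilin hS h₁ (mul₁_refl L s T) (ph₁_refl L T g)]
    · conv_rhs => rw [← ZS.norm_refl, ZS.refl_sub, ZS.refl_add, ZS.refl_lin hc₂ hc₂',
        ZS.refl_bilin hS h₂ (mul₂_refl L s T) (ph₂_refl L T g)]
  have hB : BddBiadditive (dswB L s T g) (bilinNorm S) := bddBiadditive_sysB hS h₁ h₂
  have h := hB.norm_sub_le_of_eq_add (bilinNorm_nonneg hS) hρ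
    (hrz.trans_le hz) hz heq' heq
  simp only [sub_self, norm_zero, add_zero, mul_zero] at h
  have h3 : ‖z - (z.1.refl, z.2.refl)‖ = 0 := le_antisymm h (norm_nonneg _)
  exact ⟨le_antisymm ((norm_fst_le _).trans h3.le) (norm_nonneg _),
    le_antisymm ((norm_snd_le _).trans h3.le) (norm_nonneg _)⟩

section Existence

variable {L : ℝ} [hL : Fact (0 < L)] {s T : ℝ}

/-- The linear part of the Duhamel formula for the system. -/
def dswLin (s : ℝ) (u₀ v₀ : L2 L) : ZS × ZS := (ZS.lin (wc s u₀), ZS.lin (coeff v₀))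

/-- The pair `z` solves the Duhamel formula with initial data `(u₀, v₀)` and represents `(u, v)`. -/
structure DuhamelSol (s T ρ : ℝ) (u₀ v₀ : L2 L) (z : ZS × ZS) (u v : ℝ → L2 L) : Prop where
  norm_le : ‖z‖ ≤ ρ
  eq : ‖z - (dswLin s u₀ v₀ + dswB L s T (mean v₀) z z)‖ = 0
  fst : ∀ t k, wc s (u t) k = ee (dispersion L (mean v₀) k * t) * tp z.1.1 k (t / T)
  snd : ∀ t k, coeff (v t) k = tp z.2.1 k (t / T)

lemma sql2_wc_lt_top {f : L2 L} (h : sobNorm s f < ⊤) : sql2 (wc s f) < ⊤ := by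
  rwa [sobNorm_eq, rpow_half_lt_top] at h

lemma wc_neg (f : L2 L) (k : ℤ) : wc s f (-k) = (starRingEnd ℂ) (wc s f k) := by
  unfold wc
  rw [freq_neg, bracket_neg, coeff_neg_eq_conj, map_mul, Complex.conj_ofReal]

lemma norm_dswLin_le {u₀ v₀ : L2 L} {R : ℝ≥0} (h : sobNorm s u₀ + ‖v₀‖ₑ ≤ R) :
    ‖dswLin s u₀ v₀‖ ≤ linC.toReal * R := by
  have h1 : sobNorm s u₀ ≤ R := le_self_add.trans h
  have h2 : ‖v₀‖ₑ ≤ R := le_add_self.trans h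
  refine norm_prod_le_iff.2 ⟨?_, ?_⟩
  · simp only [dswLin]
    rw [ZS.norm_lin (sql2_wc_lt_top (h1.trans_lt ENNReal.coe_lt_top)), ← sobNorm_eq]
    gcongr
    exact ENNReal.toReal_mono ENNReal.coe_ne_top h1
  · simp only [dswLin]
    rw [ZS.norm_lin (sql2_coeff_lt_top v₀), ← enorm_eq_sql2]
    gcongr
    exact ENNReal.toReal_mono ENNReal.coe_ne_top h2

lemma norm_dswLin_sub_le {u₀ v₀ w₀ z₀ : L2 L} (hu : sobNorm s u₀ < ⊤) (hw : sobNorm s w₀ < ⊤)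
    {d : ℝ≥0} (h : sobNorm s (w₀ - u₀) + ‖z₀ - v₀‖ₑ ≤ d) :
    ‖dswLin s w₀ z₀ - dswLin s u₀ v₀‖ ≤ linC.toReal * d := by
  have e : dswLin s w₀ z₀ - dswLin s u₀ v₀ = dswLin s (w₀ - u₀) (z₀ - v₀) := by
    ext1
    · simp only [dswLin, Prod.fst_sub]
      rw [ZS.lin_sub (sql2_wc_lt_top hw) (sql2_wc_lt_top hu), wc_sub]
    · simp only [dswLin, Prod.snd_sub]
      rw [ZS.lin_sub (sql2_coeff_lt_top z₀) (sql2_coeff_lt_top v₀)]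
      congr 1
      ext k
      simp [coeff_sub]
  rw [e]
  exact norm_dswLin_le h

/-- After the fixed point is found in `ZS`, its conjugation symmetry is what allows the coefficients
at every time to be realized by real-valued functions. -/
lemma exists_duhamelSol {ρ S : ℝ} {R : ℝ≥0} (hs₀ : 0 ≤ s) (hS : 0 ≤ S) {u₀ v₀ : L2 L}
    (h₁ : Admissible (mul₁ L s T) (ph₁ L T (mean v₀)) (ENNReal.ofReal S))
    (h₂ : Admissible (mul₂ L s T) (ph₂ L T (mean v₀)) (ENNReal.ofReal S))
    (hρ : 4 * (bilinNorm S * ρ) ≤ 1) (hR : linC.toReal * R ≤ ρ / 2)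
    (h : sobNorm s u₀ + ‖v₀‖ₑ ≤ R) : ∃ z u v, DuhamelSol s T ρ u₀ v₀ z u v := by
  have hc₁ := sql2_wc_lt_top ((le_self_add.trans h).trans_lt ENNReal.coe_lt_top)
  have hc₂ := sql2_coeff_lt_top v₀
  obtain ⟨z, hz, heq⟩ := (bddBiadditive_sysB hS h₁ h₂).exists_eq_add (bilinNorm_nonneg hS) hρ
    ((norm_dswLin_le h).trans hR)
  obtain ⟨hr₁, hr₂⟩ := sub_refl_eq_zero hS h₁ h₂ hρ hc₁ hc₂ (wc_neg u₀) (coeff_neg_eq_conj v₀) hz heq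
  have hconj : ∀ p : ZS, ‖p - p.refl‖ = 0 → ∀ k t, tp p.1 (-k) t = (starRingEnd ℂ) (tp p.1 k t) := by
    intro p hp k t
    have h3 := tp_eq_of_norm_sub_eq_zero hp (-k) t
    rw [h3]
    simp only [ZS.refl]
    rw [tp_refl, neg_neg]
  have hu : ∀ t, ∃ f : L2 L, ∀ k, coeff f k = ((bracket (freq L k) ^ (-s) : ℝ) : ℂ) *
      (ee (dispersion L (mean v₀) k * t) * tp z.1.1 k (t / T)) := by
    intro t
    refine exists_coeff_eq ?_ fun k => ?_
    · refine lt_of_le_of_lt ?_ z.1.sqX1_lt_top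
      refine le_trans ?_ (tsum_enorm_tp_sq_le z.1.1 (t / T))
      unfold sql2
      gcongr with k
      rw [enorm_mul, enorm_mul, enorm_ee, one_mul, enorm_weight]
      exact mul_le_of_le_one_left' (jb_le_one _ (by linarith))
    · have e : dispersion L (mean v₀) (-k) = -dispersion L (mean v₀) k := by
        rw [dispersion_eq, dispersion_eq, freq_neg, Om_neg]
      rw [freq_neg, bracket_neg, e, hconj _ hr₁, map_mul, map_mul, conj_ee, Complex.conj_ofReal,
        neg_mul]
  have hv : ∀ t, ∃ f : L2 L, ∀ k, coeff f k = tp z.2.1 k (t / T) := by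
    intro t
    refine exists_coeff_eq ?_ fun k => hconj _ hr₂ k _
    exact (tsum_enorm_tp_sq_le z.2.1 (t / T)).trans_lt z.2.sqX1_lt_top
  choose u hu using hu
  choose v hv using hv
  refine ⟨z, u, v, hz, heq, fun t k => ?_, hv⟩
  have e2 : bracket (freq L k) ^ s * bracket (freq L k) ^ (-s) = 1 := by
    rw [← Real.rpow_add (bracket_pos _), add_neg_cancel, Real.rpow_zero]
  rw [wc, hu, ← mul_assoc, ← Complex.ofReal_mul, e2, Complex.ofReal_one, one_mul]

variable {ρ S : ℝ} {u₀ v₀ : L2 L} {z : ZS × ZS} {u v : ℝ → L2 L}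

lemma DuhamelSol.window (h : DuhamelSol s T ρ u₀ v₀ z u v) (hT : 0 < T) :
    Window s (mean v₀) T 0 u v z.1 z.2 where
  fst r _ k := by
    rw [h.fst, zero_add, mul_div_cancel_left₀ _ hT.ne', ← mul_assoc]
    rw [show dispersion L (mean v₀) k * (T * r) = T * dispersion L (mean v₀) k * r by ring,
      ee_neg_mul_ee, one_mul]
  snd r _ k := by
    rw [h.snd, zero_add, mul_div_cancel_left₀ _ hT.ne']

/-- Dilating z back to the original time scale gives an extension to all times. It represents u and
v everywhere, so any set I is allowed. -/
lemma DuhamelSol.YNorm_lt_top (h : DuhamelSol s T ρ u₀ v₀ z u v) (hT : 0 < T) (hT1 : T ≤ 1)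
    (I : Set ℝ) : YNorm s (mean v₀) I u v < ⊤ := by
  refine YNorm_lt_top_iff.2 ⟨⟨z.1.dil hT hT1, fun t _ k => ?_⟩, z.2.dil hT hT1, fun t _ k => ?_⟩
  · rw [tp_dil, h.fst, ← mul_assoc, ee_neg_mul_ee, one_mul]
  · rw [tp_dil, wc_zero, h.snd]
    simp

lemma DuhamelSol.tp_fst (h : DuhamelSol s T ρ u₀ v₀ z u v) (hS : 0 ≤ S)
    (h₁ : Admissible (mul₁ L s T) (ph₁ L T (mean v₀)) (ENNReal.ofReal S)) (hu : sobNorm s u₀ < ⊤)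
    (k : ℤ) {t : ℝ} (ht : t ∈ Icc (0 : ℝ) 1) :
    tp z.1.1 k t = wc s u₀ k + tp (bilin (mul₁ L s T) (ph₁ L T (mean v₀)) z.1.1 z.2.1) k t := by
  have h1 : ‖z.1 - (dswLin s u₀ v₀ + dswB L s T (mean v₀) z z).1‖ = 0 :=
    le_antisymm ((norm_fst_le (z - _)).trans h.eq.le) (norm_nonneg _)
  rw [tp_eq_of_norm_sub_eq_zero h1, Prod.fst_add, tp_add]
  simp only [dswLin, dswB, sysB]
  rw [tp_lin (sql2_wc_lt_top hu) k ht, ZS.coe_bilin hS h₁]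

lemma DuhamelSol.tp_snd (h : DuhamelSol s T ρ u₀ v₀ z u v) (hS : 0 ≤ S)
    (h₂ : Admissible (mul₂ L s T) (ph₂ L T (mean v₀)) (ENNReal.ofReal S))
    (k : ℤ) {t : ℝ} (ht : t ∈ Icc (0 : ℝ) 1) :
    tp z.2.1 k t = coeff v₀ k + tp (bilin (mul₂ L s T) (ph₂ L T (mean v₀)) z.1.1 z.1.1) k t := by
  have h1 : ‖z.2 - (dswLin s u₀ v₀ + dswB L s T (mean v₀) z z).2‖ = 0 :=
    le_antisymm ((norm_snd_le (z - _)).trans h.eq.le) (norm_nonneg _)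
  rw [tp_eq_of_norm_sub_eq_zero h1, Prod.snd_add, tp_add]
  simp only [dswLin, dswB, sysB]
  rw [tp_lin (sql2_coeff_lt_top v₀) k ht, ZS.coe_bilin hS h₂]

lemma DuhamelSol.isSolution (h : DuhamelSol s T ρ u₀ v₀ z u v) (hT : 0 < T) (hT1 : T ≤ 1)
    (hs₀ : 0 ≤ s) (hS : 0 ≤ S)
    (h₁ : Admissible (mul₁ L s T) (ph₁ L T (mean v₀)) (ENNReal.ofReal S))
    (h₂ : Admissible (mul₂ L s T) (ph₂ L T (mean v₀)) (ENNReal.ofReal S))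
    (hu₀ : sobNorm s u₀ < ⊤) : IsSolution s T u₀ v₀ u v := by
  have h01 : (0 : ℝ) ∈ Icc (0 : ℝ) 1 := ⟨le_rfl, zero_le_one⟩
  have hzero : ∀ {m φ} (_ : Admissible m φ (ENNReal.ofReal S)) (p q : ZS) (k : ℤ),
      tp (bilin m φ p.1 q.1) k 0 = 0 := by
    intro m φ hm p q k
    rw [tp_bilin hm.bdd p q k h01, intervalIntegral.integral_same]
  have i₁ : ∀ k, tp z.1.1 k 0 = wc s u₀ k := fun k => by
    rw [h.tp_fst hS h₁ hu₀ k h01, hzero h₁, add_zero]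
  have i₂ : ∀ k, tp z.2.1 k 0 = coeff v₀ k := fun k => by
    rw [h.tp_snd hS h₂ k h01, hzero h₂, add_zero]
  obtain ⟨hcu, hcv⟩ := embedding_Y (h.YNorm_lt_top hT hT1 (Icc 0 T))
  -- The fixed point problem was set up with the initial mean as drift. It corresponds to the
  -- original system only because the mean is conserved by the fixed point: `mul₂` vanishes at k =
  -- 0.
  have hg : ∀ r ∈ Icc (0 : ℝ) 1, coeff (v (0 + T * r)) 0 = mean v₀ := by
    intro r hr
    rw [← (h.window hT).snd r hr, h.tp_snd hS h₂ 0 hr, tp_bilin h₂.bdd z.1 z.1 0 hr,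
      coeff_zero_eq_mean]
    simp [mul₂]
  have hF := (h.window hT).fourierSol hT (hcu.continuousOn hs₀) hcv hg h₁.bdd h₂.bdd
    (fun k t ht => by rw [i₁, h.tp_fst hS h₁ hu₀ k ht])
    (fun k t ht => by rw [i₂, h.tp_snd hS h₂ k ht])
  refine hF.isSolution hs₀ hcu hcv ?_ ?_
  · refine eq_of_wc_eq (s := s) fun k => ?_
    rw [h.fst, zero_div, i₁]
    simp
  · refine eq_of_coeff_eq fun k => ?_
    rw [h.snd, zero_div, i₂]

end Existence

/-! ### Continuous dependence on the data -/

lemma norm_ee_sub_le (x y : ℝ) : ‖ee x - ee y‖ ≤ min 2 |x - y| := by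
  refine le_min ?_ ?_
  · refine (norm_sub_le _ _).trans ?_
    rw [norm_ee, norm_ee]
    norm_num
  · have h : ee x - ee y = ee y * (Complex.exp (Complex.I * ((x - y : ℝ) : ℂ)) - 1) := by
      unfold ee
      rw [mul_sub, ← Complex.exp_add, mul_one]
      congr 2
      push_cast
      ring
    rw [h, norm_mul, norm_ee, one_mul]
    exact Real.norm_exp_I_mul_ofReal_sub_one_le

lemma sql2_rpow_le_add {c : ℤ → ℂ} {F G : ℤ → ℝ≥0∞} (h : ∀ k, ‖c k‖ₑ ≤ F k + G k) :
    sql2 c ^ (1 / 2 : ℝ) ≤ (∑' k, F k ^ 2) ^ (1 / 2 : ℝ) + (∑' k, G k ^ 2) ^ (1 / 2 : ℝ) := by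
  have h1 := l2n_add_le (μ := (Measure.count : Measure ℤ)) (measurable_of_countable F)
    (measurable_of_countable G)
  simp only [l2n, lintegral_count] at h1
  refine le_trans ?_ h1
  unfold sql2
  exact ENNReal.rpow_le_rpow (ENNReal.tsum_le_tsum fun k => pow_le_pow_left' (h k) 2) (by norm_num)

lemma rpow_half_tsum_tp_le (p : ZS) (t : ℝ) :
    (∑' k, ‖tp p.1 k t‖ₑ ^ 2) ^ (1 / 2 : ℝ) ≤ ENNReal.ofReal ‖p‖ := by
  rw [rpow_half_le_iff, ← ZS.zn_eq]
  exact (tsum_enorm_tp_sq_le p.1 t).trans (sqX1_le_zn_sq p.1)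

/-- A bound for the square of the distance between the free evolutions of `p` with the drifts `g`
and `g'`. -/
def driftGap (L T g g' : ℝ) (p : ℤ → ℝ → ℂ) : ℝ≥0∞ :=
  ∑' k, (ENNReal.ofReal (min 2 (|g' - g| * (|freq L k| * T))) * ∫⁻ σ, ‖p k σ‖ₑ) ^ 2

/-- Every mode tends to zero, but not uniformly in k; the bound 2 supplies the majorant for
dominated convergence. -/
lemma tendsto_driftGap (L T g : ℝ) (p : ZS) :
    Tendsto (fun g' => driftGap L T g g' p.1) (𝓝 g) (𝓝 0) := by
  refine tendsto_tsum_of_dominated (G := fun k => (ENNReal.ofReal 2 * ∫⁻ σ, ‖p.1 k σ‖ₑ) ^ 2) ?_ ?_ ?_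
  · refine Eventually.of_forall fun g' k => pow_le_pow_left' ?_ 2
    exact mul_le_mul_left (ENNReal.ofReal_le_ofReal (min_le_left _ _)) _
  · simp_rw [mul_pow]
    rw [ENNReal.tsum_mul_left]
    exact ENNReal.mul_lt_top (by simp) p.sqX1_lt_top
  · intro k
    have hc : Continuous fun g' : ℝ => min 2 (|g' - g| * (|freq L k| * T)) := by fun_prop
    have h1 := ENNReal.tendsto_ofReal (hc.tendsto g)
    have h2 := ENNReal.Tendsto.mul_const (b := ∫⁻ σ, ‖p.1 k σ‖ₑ) h1
      (Or.inr (lintegral_enorm_lt_top p.sqX1_lt_top k).ne)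
    have h3 := ENNReal.Tendsto.pow (n := 2) h2
    simpa using h3

lemma tendsto_dswB {L s T S R g : ℝ} (hS : 0 ≤ S)
    (hadm : ∀ g : ℝ, |g| ≤ R → Admissible (mul₁ L s T) (ph₁ L T g) (ENNReal.ofReal S) ∧
      Admissible (mul₂ L s T) (ph₂ L T g) (ENNReal.ofReal S)) (hg : |g| ≤ R) (z : ZS × ZS) :
    Tendsto (fun g' => ‖dswB L s T g' z z - dswB L s T g z z‖) (𝓝[{g' | |g'| ≤ R}] g) (𝓝 0) := by
  have hev : ∀ᶠ g' in 𝓝[{g' : ℝ | |g'| ≤ R}] g, |g'| ≤ R := self_mem_nhdsWithin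
  have h1 := ZS.tendsto_bilin (l := 𝓝[{g' : ℝ | |g'| ≤ R}] g) (φ := fun g' => ph₁ L T g') hS
    (hev.mono fun g' h => (hadm g' h).1) (hadm g hg).1 z.1 z.2 fun k k₁ => by
      refine (Continuous.tendsto ?_ g).mono_left nhdsWithin_le_nhds
      unfold ph₁ Om
      fun_prop
  have h2 := ZS.tendsto_bilin (l := 𝓝[{g' : ℝ | |g'| ≤ R}] g) (φ := fun g' => ph₂ L T g') hS
    (hev.mono fun g' h => (hadm g' h).2) (hadm g hg).2 z.1 z.1 fun k k₁ => by
      refine (Continuous.tendsto ?_ g).mono_left nhdsWithin_le_nhds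
      unfold ph₂ Om
      fun_prop
  have h3 := h1.max h2
  rw [max_self] at h3
  exact h3

section Continuity

variable {L : ℝ} [hL : Fact (0 < L)] {s T ρ S : ℝ} {u₀ v₀ w₀ z₀ : L2 L} {z z' : ZS × ZS}
  {u v u' v' : ℝ → L2 L}

lemma DuhamelSol.enorm_sub_le (h : DuhamelSol s T ρ u₀ v₀ z u v)
    (h' : DuhamelSol s T ρ w₀ z₀ z' u' v') (t : ℝ) :
    ‖v' t - v t‖ₑ ≤ ENNReal.ofReal ‖z' - z‖ := by
  have e : ∀ k, coeff (v' t - v t) k = tp (z'.2 - z.2).1 k (t / T) := fun k => by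
    rw [coeff_sub, h.snd, h'.snd, tp_sub]
  rw [enorm_eq_sql2]
  unfold sql2
  simp_rw [e]
  exact (rpow_half_tsum_tp_le _ _).trans (ENNReal.ofReal_le_ofReal (norm_snd_le (z' - z)))

/-- The difference of the two oscillations is made to fall on the fixed z and not on z'. The second
term then tends to zero as the means approach each other. -/
lemma DuhamelSol.sobNorm_sub_le (h : DuhamelSol s T ρ u₀ v₀ z u v)
    (h' : DuhamelSol s T ρ w₀ z₀ z' u' v') {t : ℝ} (ht : t ∈ Icc 0 T) :
    sobNorm s (u' t - u t) ≤ ENNReal.ofReal ‖z' - z‖ +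
      driftGap L T (mean v₀) (mean z₀) z.1.1 ^ (1 / 2 : ℝ) := by
  rw [sobNorm_eq]
  refine (sql2_rpow_le_add (F := fun k => ‖tp (z'.1 - z.1).1 k (t / T)‖ₑ)
    (G := fun k => ENNReal.ofReal (min 2 (|mean z₀ - mean v₀| * (|freq L k| * T))) *
      ∫⁻ σ, ‖z.1.1 k σ‖ₑ) fun k => ?_).trans (add_le_add ?_ le_rfl)
  · have e : wc s (u' t - u t) k = ee (dispersion L (mean z₀) k * t) * tp (z'.1 - z.1).1 k (t / T) +
        (ee (dispersion L (mean z₀) k * t) - ee (dispersion L (mean v₀) k * t)) *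
          tp z.1.1 k (t / T) := by
      rw [wc_sub, Pi.sub_apply, h.fst, h'.fst, tp_sub]
      ring
    rw [e]
    refine (enorm_add_le _ _).trans (add_le_add ?_ ?_)
    · rw [enorm_mul, enorm_ee, one_mul]
    · rw [enorm_mul]
      refine mul_le_mul' ?_ (enorm_tp_le _ _ _)
      rw [← ofReal_norm]
      refine ENNReal.ofReal_le_ofReal ((norm_ee_sub_le _ _).trans (min_le_min le_rfl ?_))
      have e2 : dispersion L (mean z₀) k * t - dispersion L (mean v₀) k * t =
          -((mean z₀ - mean v₀) * (freq L k * t)) := by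
        unfold dispersion
        ring
      rw [e2, abs_neg, abs_mul, abs_mul, abs_of_nonneg ht.1]
      gcongr
      exact ht.2
  · exact (rpow_half_tsum_tp_le _ _).trans (ENNReal.ofReal_le_ofReal (norm_fst_le (z' - z)))

lemma DuhamelSol.norm_sub_le (h : DuhamelSol s T ρ u₀ v₀ z u v)
    (h' : DuhamelSol s T ρ w₀ z₀ z' u' v') (hS : 0 ≤ S)
    (h₁ : Admissible (mul₁ L s T) (ph₁ L T (mean z₀)) (ENNReal.ofReal S))
    (h₂ : Admissible (mul₂ L s T) (ph₂ L T (mean z₀)) (ENNReal.ofReal S))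
    (hρ : 4 * (bilinNorm S * ρ) ≤ 1) :
    ‖z' - z‖ ≤ 2 * (‖dswLin s w₀ z₀ - dswLin s u₀ v₀‖ +
      ‖dswB L s T (mean z₀) z z - dswB L s T (mean v₀) z z‖) := by
  have hB : BddBiadditive (dswB L s T (mean z₀)) (bilinNorm S) := bddBiadditive_sysB hS h₁ h₂
  exact hB.norm_sub_le_of_eq_add (bilinNorm_nonneg hS) hρ h.norm_le h'.norm_le h.eq h'.eq

lemma abs_mean_le_of_enorm_le {f : L2 L} {d : ℝ≥0} (h : ‖f‖ₑ ≤ d) : |mean f| ≤ d := by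
  have h1 := (abs_mean_le f).trans h
  rw [← ofReal_norm, Real.norm_eq_abs] at h1
  rw [← ENNReal.ofReal_coe_nnreal] at h1
  exact (ENNReal.ofReal_le_ofReal_iff d.2).1 h1

/-- Closeness of the data forces closeness of the means. This controls the change of the bilinear
operator at z and the gap between the free evolutions; stability of the fixed point then bounds z' -
z. -/
lemma DuhamelSol.exists_delta {R : ℝ≥0} (h : DuhamelSol s T ρ u₀ v₀ z u v) (hS : 0 ≤ S)
    (hadm : ∀ g : ℝ, |g| ≤ R → Admissible (mul₁ L s T) (ph₁ L T g) (ENNReal.ofReal S) ∧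
      Admissible (mul₂ L s T) (ph₂ L T g) (ENNReal.ofReal S))
    (hρ : 4 * (bilinNorm S * ρ) ≤ 1) (hdata : sobNorm s u₀ + ‖v₀‖ₑ ≤ R) {ε : ℝ≥0∞} (hε : 0 < ε) :
    ∃ δ : ℝ≥0∞, 0 < δ ∧ ∀ w₀ z₀ : L2 L, ∀ z' u' v', DuhamelSol s T ρ w₀ z₀ z' u' v' →
      sobNorm s w₀ + ‖z₀‖ₑ ≤ R → sobNorm s (w₀ - u₀) + ‖z₀ - v₀‖ₑ < δ →
      ∀ t ∈ Icc 0 T, sobNorm s (u' t - u t) + ‖v' t - v t‖ₑ < ε := by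
  obtain ⟨e, he, heε⟩ := ENNReal.lt_iff_exists_nnreal_btwn.1 hε
  have he0 : (0 : ℝ) < e := by exact_mod_cast he
  have hg : |mean v₀| ≤ R := abs_mean_le_of_enorm_le (le_add_self.trans hdata)
  have hu₀ : sobNorm s u₀ < ⊤ := (le_self_add.trans hdata).trans_lt ENNReal.coe_lt_top
  have hd := (tendsto_driftGap L T (mean v₀) z.1).mono_left
    (nhdsWithin_le_nhds (s := {g' : ℝ | |g'| ≤ R}))
  have hd2 := hd.ennrpow_const (1 / 2 : ℝ)
  rw [ENNReal.zero_rpow_of_pos (by norm_num)] at hd2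
  have hev := (hd2.eventually (Iio_mem_nhds (show 0 < ENNReal.ofReal (e / 4) by simpa using he0))).and
    ((tendsto_dswB hS hadm hg z).eventually (Iio_mem_nhds (show 0 < (e : ℝ) / 16 by positivity)))
  obtain ⟨η, hη, hball⟩ := Metric.mem_nhdsWithin_iff.1 hev
  have hC : 0 ≤ linC.toReal := ENNReal.toReal_nonneg
  -- The linear and the bilinear error are at most e/16 each, so z' - z has norm at most 2(e/16 +
  -- e/16) = e/4, and three terms of size e/4 add up to less than e. The summand 1 keeps the
  -- denominator positive.
  refine ⟨ENNReal.ofReal (min η (e / (16 * (linC.toReal + 1)))),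
    by rw [ENNReal.ofReal_pos]; positivity, fun w₀ z₀ z' u' v' h' hdata' hlt t ht => ?_⟩
  have hw₀ : sobNorm s w₀ < ⊤ := (le_self_add.trans hdata').trans_lt ENNReal.coe_lt_top
  obtain ⟨d, hd, hdδ⟩ := ENNReal.lt_iff_exists_nnreal_btwn.1 hlt
  rw [← ENNReal.ofReal_coe_nnreal, ENNReal.ofReal_lt_ofReal_iff (by positivity), lt_min_iff] at hdδ
  have hg' : |mean z₀| ≤ R := abs_mean_le_of_enorm_le (le_add_self.trans hdata')
  have hgg : |mean z₀ - mean v₀| ≤ d := by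
    rw [← mean_sub]
    exact abs_mean_le_of_enorm_le (le_add_self.trans hd.le)
  obtain ⟨hb1, hb2⟩ := hball (show mean z₀ ∈ Metric.ball (mean v₀) η ∩ {g' : ℝ | |g'| ≤ R} from
    ⟨by rw [Metric.mem_ball, Real.dist_eq]; exact hgg.trans_lt hdδ.1, hg'⟩)
  have h1 := h.norm_sub_le h' hS (hadm _ hg').1 (hadm _ hg').2 hρ
  have h2 := norm_dswLin_sub_le hu₀ hw₀ hd.le
  have h3 : linC.toReal * d ≤ e / 16 := by
    have h4 := hdδ.2
    rw [lt_div_iff₀ (by positivity)] at h4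
    nlinarith [d.2]
  have h5 : ‖z' - z‖ ≤ e / 4 := by linarith
  calc sobNorm s (u' t - u t) + ‖v' t - v t‖ₑ
      ≤ (ENNReal.ofReal ‖z' - z‖ + driftGap L T (mean v₀) (mean z₀) z.1.1 ^ (1 / 2 : ℝ)) +
        ENNReal.ofReal ‖z' - z‖ := add_le_add (h.sobNorm_sub_le h' ht) (h.enorm_sub_le h' t)
    _ ≤ (ENNReal.ofReal (e / 4) + ENNReal.ofReal (e / 4)) + ENNReal.ofReal (e / 4) :=
        add_le_add (add_le_add (ENNReal.ofReal_le_ofReal h5) hb1.le) (ENNReal.ofReal_le_ofReal h5)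
    _ ≤ e := by
        rw [← ENNReal.ofReal_add (by positivity) (by positivity),
          ← ENNReal.ofReal_add (by positivity) (by positivity), ← ENNReal.ofReal_coe_nnreal]
        exact ENNReal.ofReal_le_ofReal (by linarith)
    _ < ε := heε

end Continuity

end DSW

end

/-! ### The main theorem -/

open DSW

theorem theorem1p1 (L : ℝ) [Fact (0 < L)] (s : ℝ) (hs₀ : 0 ≤ s) (hs₁ : s ≤ 1 / 2) :
    -- the embedding of `Y` into `C⁰_t H^s × C⁰_t L²`
    (∃ C : ℝ≥0, ∀ (g : ℝ) (I : Set ℝ) (u v : ℝ → DSW.L2 L), DSW.YNorm s g I u v < ⊤ →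
      DSW.SobContinuousOn s u I ∧ ContinuousOn v I ∧
        ∀ t ∈ I, DSW.sobNorm s (u t) + ‖v t‖ₑ ≤ C * DSW.YNorm s g I u v) ∧
    -- local well-posedness, with a time that depends only on the size `R` of the data
    ∀ R : ℝ≥0, ∃ T : ℝ, 0 < T ∧ ∃ U V : DSW.L2 L → DSW.L2 L → ℝ → DSW.L2 L,
      (∀ u₀ v₀ : DSW.L2 L, DSW.sobNorm s u₀ + ‖v₀‖ₑ ≤ R →
        -- existence
        DSW.IsSolution s T u₀ v₀ (U u₀ v₀) (V u₀ v₀) ∧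
        DSW.YNorm s (DSW.mean v₀) (Icc 0 T) (U u₀ v₀) (V u₀ v₀) < ⊤ ∧
        -- uniqueness in `Y`
        ∀ u v : ℝ → DSW.L2 L, DSW.IsSolution s T u₀ v₀ u v →
          DSW.YNorm s (DSW.mean v₀) (Icc 0 T) u v < ⊤ →
          EqOn u (U u₀ v₀) (Icc 0 T) ∧ EqOn v (V u₀ v₀) (Icc 0 T)) ∧
      -- continuity of the solution map
      (∀ u₀ v₀ : DSW.L2 L, DSW.sobNorm s u₀ + ‖v₀‖ₑ ≤ R →
        ∀ ε : ℝ≥0∞, 0 < ε → ∃ δ : ℝ≥0∞, 0 < δ ∧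
          ∀ w₀ z₀ : DSW.L2 L, DSW.sobNorm s w₀ + ‖z₀‖ₑ ≤ R →
            DSW.sobNorm s (w₀ - u₀) + ‖z₀ - v₀‖ₑ < δ →
            ∀ t ∈ Icc 0 T,
              DSW.sobNorm s (U w₀ z₀ t - U u₀ v₀ t) + ‖V w₀ z₀ t - V u₀ v₀ t‖ₑ < ε) := by
  refine ⟨⟨1, fun g I u v hY => ?_⟩, fun R => ?_⟩
  · obtain ⟨h1, h2⟩ := embedding_Y hY
    refine ⟨h1, h2, fun t ht => ?_⟩
    rw [ENNReal.coe_one, one_mul]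
    exact sobNorm_add_enorm_le_YNorm ht
  obtain ⟨K, hK, hadm⟩ := exists_admissible (L := L) Fact.out hs₀ hs₁ R.2
  -- The radius is twice the bound of the linear part, as the contraction requires. The time T is
  -- then chosen from ρ and K, hence from R, L and s alone.
  set ρ : ℝ := 2 * (linC.toReal * R) with hρdef
  obtain ⟨T, hT, hT1, hsmall⟩ := exists_small_bilinNorm (K := K) (4 * ρ)
  have hρ : 4 * (bilinNorm (K * T ^ (2 / 5 : ℝ)) * ρ) ≤ 1 := by
    have := hsmall T hT le_rfl
    linarith
  set S : ℝ := K * T ^ (2 / 5 : ℝ) with hSdef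
  have hS : 0 ≤ S := by positivity
  have hadm' : ∀ g : ℝ, |g| ≤ R → Admissible (mul₁ L s T) (ph₁ L T g) (ENNReal.ofReal S) ∧
      Admissible (mul₂ L s T) (ph₂ L T g) (ENNReal.ofReal S) := fun g hg => hadm T g hT hT1 hg
  have hmean : ∀ u₀ v₀ : L2 L, sobNorm s u₀ + ‖v₀‖ₑ ≤ R → |mean v₀| ≤ R := fun u₀ v₀ h =>
    abs_mean_le_of_enorm_le (le_add_self.trans h)
  have hex : ∀ u₀ v₀ : L2 L, ∃ z u v, sobNorm s u₀ + ‖v₀‖ₑ ≤ R →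
      DuhamelSol s T ρ u₀ v₀ z u v := by
    intro u₀ v₀
    by_cases h : sobNorm s u₀ + ‖v₀‖ₑ ≤ R
    · obtain ⟨h₁, h₂⟩ := hadm' _ (hmean u₀ v₀ h)
      obtain ⟨z, u, v, hz⟩ := exists_duhamelSol hs₀ hS h₁ h₂ hρ (by linarith) h
      exact ⟨z, u, v, fun _ => hz⟩
    -- For data outside the ball the solution map takes an irrelevant value.
    · exact ⟨0, 0, 0, fun h' => absurd h' h⟩
  choose Z U V hsol using hex
  refine ⟨T, hT, U, V, fun u₀ v₀ h => ?_, fun u₀ v₀ h ε hε => ?_⟩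
  · obtain ⟨h₁, h₂⟩ := hadm' _ (hmean u₀ v₀ h)
    have hu₀ : sobNorm s u₀ < ⊤ := (le_self_add.trans h).trans_lt ENNReal.coe_lt_top
    have hsol₀ := (hsol u₀ v₀ h).isSolution hT hT1 hs₀ hS h₁ h₂ hu₀
    have hY₀ := (hsol u₀ v₀ h).YNorm_lt_top hT hT1 (Icc 0 T)
    refine ⟨hsol₀, hY₀, fun u v huv hY => ?_⟩
    refine solution_unique hs₀ hs₁ hT hT1 huv.fourierSol hsol₀.fourierSol
      (huv.init_u.trans hsol₀.init_u.symm) (huv.init_v.trans hsol₀.init_v.symm) ?_ hY hY₀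
    rw [huv.init_v, coeff_zero_eq_mean]
  · obtain ⟨δ, hδ, H⟩ := (hsol u₀ v₀ h).exists_delta hS hadm' hρ h hε
    exact ⟨δ, hδ, fun w₀ z₀ h' hlt => H w₀ z₀ _ _ _ (hsol w₀ z₀ h') h' hlt⟩
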